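/- Let $X$ and $B$ be compact complex manifolds and let $\pi: X\to B$ be a holomorphic submersion with connected fibres $X_b=\pi^{-1}(b)$ of complex dimension $m$. Let $\omega_B$ be a Kähler metric on $B$, and let $\omega_X$ be a relatively cscK metric on $X$: a closed real $(1,1)$-form whose restriction $\omega_b=\omega_X|_{X_b}$ to each fibre is a Kähler metric of constant scalar curvature. Notation. Let $\mathcal V=\ker d\pi$, and let $\mathcal H$ be the $\omega_X$-orthogonal complement of $\mathcal V$, so that $TX=\mathcal H\oplus\mathcal V$. For vector fields $w_1,w_2$ on $B$ with horizontal lifts $w_1^\#,w_2^\#$, let $F_{\mathcal H}(w_1,w_2)$ be the vertical part of $[w_1^\#,w_2^\#]$; it is fibrewise Hamiltonian. Let $\mu^*F_{\mathcal H}(w_1,w_2)$ be the function $f$ whose restriction to each fibre satisfies $df=\omega_b(F_{\mathcal H}(w_1,w_2),\cdot)$ and $\int_{X_b}f\,\omega_b^m=0$. Let $\Lambda_{\omega_B}$ be the contraction of horizontal two-forms with $\omega_B$. Let $\rho$ be the curvature of the Hermitian metric induced by $\omega_X$ on $-K_{X/B}=\Lambda^m\mathcal V$, that is, $\rho=-i\partial\bar\partial\log\det(g_{j\bar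 k})$ in holomorphic coordinates $(w,z)$ with $\pi(w,z)=w$, where $\omega_b=i\sum g_{j\bar k}\,dz^j\wedge d\bar z^k$; let $\rho_{\mathcal H}$ be its purely horizontal component. Let $\Delta_{\mathcal V}$ be the vertical Laplacian, $\Delta_{\mathcal V}f|_{X_b}=-\Lambda_{\omega_b}\,i\partial\bar\partial (f|_{X_b})$. Let $E_b$ be the space of real smooth functions $f$ on $X_b$ with $\bar\partial\nabla^{1,0}f=0$ and $\int_{X_b}f\,\omega_b^m=0$. Let $C^\infty_E(X)$ be the space of smooth real functions on $X$ whose restriction to every $X_b$ lies in $E_b$, and $C^\infty_R(X)$ the space of smooth real functions on $X$ whose restriction to every $X_b$ has integral zero and is $L^2(\omega_b^m)$-orthogonal to $E_b$. Write $p(\varphi)=\psi$ if $\varphi=\pi^*\varphi_B+\psi+\varphi_R$ with $\varphi_B\in C^\infty(B)$, $\psi\in C^\infty_E(X)$, $\varphi_R\in C^\infty_R(X)$; when $\dim E_b$ is independent of $b$, $p$ is the projection onto the second summand of $C^\infty(X)=\pi^*C^\infty(B)\oplus C^\infty_E(X)\oplus C^\infty_R(X)$. The relatively cscK metric $\omega_X$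 is called an optimal symplectic connection if $$p\big(\Delta_{\mathcal V}(\Lambda_{\omega_B}\mu^*F_{\mathcal H})+\Lambda_{\omega_B}\rho_{\mathcal H}\big)=0.$$ Proposition. Suppose that $\omega_X\in c_1(-K_{X/B})$, i.e. that $\omega_X$ and $\rho$ have the same class in $H^2(X,\mathbb R)$ (the factor $2\pi$ being absorbed into $c_1$); in particular all fibres are Fano manifolds. Then $\omega_X$ is an optimal symplectic connection if and only if $$p(\Lambda_{\omega_B}\mu^*F_{\mathcal H})=0.$$ -/

import Mathlib

open scoped Manifold ContDiff Matrix
open MeasureTheory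

namespace FibrationGeometry

noncomputable section

/-! ### Linear algebra of real two-forms on a complex vector space -/

section LinearAlgebra

variable {V : Type*} [AddCommGroup V] [Module ℂ V]

/-- For a real two-form `σ`, extended complex bilinearly, the number `-i σ(u^{1,0}, v^{0,1})` with
`u^{1,0} = (u - i J u) / 2` and `v^{0,1} = (v + i J v) / 2`. If `σ = i ∑ σ_{jk̄} dz^j ∧ dz̄^k`, then
the value on the coordinate vectors `e_j, e_k` is `σ_{jk̄}`. -/
def hermCoeff (σ : V → V → ℝ) (u v : V) : ℂ :=
  (((σ u (Complex.I • v) - σ (Complex.I • u) v : ℝ) : ℂ)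
    - Complex.I * ((σ u v + σ (Complex.I • u) (Complex.I • v) : ℝ) : ℂ)) / 4

/-- The matrix `(σ_{jk̄})` of (the (1,1)-part of) a real two-form in a family of vectors. -/
def hermMatrix {ι : Type*} (e : ι → V) (σ : V → V → ℝ) : Matrix ι ι ℂ :=
  Matrix.of fun j k => hermCoeff σ (e j) (e k)

/-- The contraction `Λ_θ σ = ∑ θ^{jk̄} σ_{jk̄}`, computed in a complex basis `e`
(it does not depend on `e`); in particular `Λ_θ θ` is the complex dimension. -/
def contraction {ι : Type*} [Fintype ι] [DecidableEq ι] (e : ι → V) (θ σ : V → V → ℝ) : ℝ :=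
  ((hermMatrix e θ)⁻¹ * hermMatrix e σ).trace.re

end LinearAlgebra

/-! ### Differential forms -/

/-- (Not necessarily smooth) real `k`-forms on a manifold `M` with model space `E`. The tangent
space of `M` at each point is `E`, via the preferred chart at that point. -/
abbrev Form (E M : Type*) [NormedAddCommGroup E] [NormedSpace ℝ E] (k : ℕ) : Type _ :=
  M → E [⋀^Fin k]→L[ℝ] ℝ

/-- The bilinear function of a two-form at a point. -/
def Form.at₂ {E M : Type*} [NormedAddCommGroup E] [NormedSpace ℝ E] (η : Form E M 2) (x : M)
    (u v : E) : ℝ :=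
  η x ![u, v]

section Forms

variable {E E' M M' : Type*} [NormedAddCommGroup E] [NormedSpace ℝ E]
  [NormedAddCommGroup E'] [NormedSpace ℝ E']
  [TopologicalSpace M] [ChartedSpace E M] [TopologicalSpace M'] [ChartedSpace E' M']

/-- The (real) differential of a map of manifolds at a point. -/
def tangentMapAt (f : M → M') (x : M) : E →L[ℝ] E' :=
  mfderiv 𝓘(ℝ, E) 𝓘(ℝ, E') f x

/-- Pullback of forms. -/
def Form.pull {k : ℕ} (f : M → M') (η : Form E' M' k) : Form E M k :=
  fun x => (η (f x)).compContinuousLinearMap (tangentMapAt (E := E) (E' := E') f x)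

/-- Smoothness, in charts. -/
def Form.IsSmooth {k : ℕ} (η : Form E M k) : Prop :=
  ∀ e ∈ atlas E M, ContDiffOn ℝ ∞ (Form.pull (E := E) (M := E) e.symm η) e.target

/-- `dη = ζ`, in charts. -/
def Form.HasExtDeriv {k : ℕ} (η : Form E M k) (ζ : Form E M (k + 1)) : Prop :=
  ∀ e ∈ atlas E M, ∀ z ∈ e.target,
    extDeriv (Form.pull (E := E) (M := E) e.symm η) z = Form.pull (E := E) (M := E) e.symm ζ z

/-- Smooth closed forms. -/
def Form.IsClosed {k : ℕ} (η : Form E M k) : Prop :=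
  η.IsSmooth ∧ η.HasExtDeriv 0

/-- Two smooth `(k+1)`-forms define the same de Rham class if their difference is `d` of a smooth
`k`-form. -/
def Form.Cohomologous {k : ℕ} (η ζ : Form E M (k + 1)) : Prop :=
  ∃ γ : Form E M k, γ.IsSmooth ∧ γ.HasExtDeriv (η - ζ)

end Forms

section Complex

variable {E : Type*} [NormedAddCommGroup E] [NormedSpace ℂ E]

/-- A real two-form is of type (1,1) if it is invariant under the complex structure. -/
def Form.IsOneOne {M : Type*} (η : Form E M 2) : Prop :=
  ∀ x u v, η.at₂ x (Complex.I • u) (Complex.I • v) = η.at₂ x u v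

/-- The complex structure as a real linear map. -/
def complexJ : E →L[ℝ] E :=
  (Complex.I • ContinuousLinearMap.id ℂ E).restrictScalars ℝ

/-- `d^c f = - df ∘ J` for a real function on a complex vector space. -/
def dc (f : E → ℝ) : Form E E 1 :=
  fun z => ContinuousAlternatingMap.ofSubsingleton ℝ E ℝ (0 : Fin 1)
    (-((fderiv ℝ f z).comp complexJ))

/-- `i ∂∂̄ f = (1/2) d d^c f` for a real function on a complex vector space. -/
def iddbar (f : E → ℝ) : Form E E 2 :=
  fun z => (1 / 2 : ℝ) • extDeriv (dc f) z

/-- A Kähler form on a complex manifold. -/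
structure IsKahlerForm {M : Type*} [TopologicalSpace M] [ChartedSpace E M] (η : Form E M 2) :
    Prop where
  closed : η.IsClosed
  oneOne : η.IsOneOne
  pos : ∀ x v, v ≠ 0 → 0 < η.at₂ x v (Complex.I • v)

end Complex

/-! ### Kähler geometry in holomorphic coordinates

Here `θ` is a two-form on (an open subset of) `ℂ^m`, `θ = i ∑ g_{jk̄} dz^j ∧ dz̄^k`. -/

section Local

variable {m : ℕ}

/-- The coordinate vectors of `ℂ^m`. -/
def stdVec (m : ℕ) (j : Fin m) : Fin m → ℂ := Pi.single j 1

/-- The matrix `(g_{jk̄})` of `θ` at a point. -/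
def metricMatrix (θ : Form (Fin m → ℂ) (Fin m → ℂ) 2) (z : Fin m → ℂ) : Matrix (Fin m) (Fin m) ℂ :=
  hermMatrix (stdVec m) (θ.at₂ z)

/-- The density of `θ^m = m! det(g) ∏ (i dz^j ∧ dz̄^j)` with respect to Lebesgue measure. -/
def volumeDensity (θ : Form (Fin m → ℂ) (Fin m → ℂ) 2) (z : Fin m → ℂ) : ℝ :=
  m.factorial * 2 ^ m * (metricMatrix θ z).det.re

/-- `Ric θ = - i ∂∂̄ log det g`. -/
def ricciForm (θ : Form (Fin m → ℂ) (Fin m → ℂ) 2) : Form (Fin m → ℂ) (Fin m → ℂ) 2 :=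
  iddbar fun z => -Real.log (metricMatrix θ z).det.re

/-- `S(θ) = Λ_θ Ric θ`. -/
def localScalarCurvature (θ : Form (Fin m → ℂ) (Fin m → ℂ) 2) (z : Fin m → ℂ) : ℝ :=
  contraction (stdVec m) (θ.at₂ z) ((ricciForm θ).at₂ z)

/-- The nonnegative `∂̄`-Laplacian `Δ f = - Λ_θ i ∂∂̄ f = - ∑ g^{jk̄} ∂_j ∂_k̄ f`. -/
def localLaplacian (θ : Form (Fin m → ℂ) (Fin m → ℂ) 2) (f : (Fin m → ℂ) → ℝ) (z : Fin m → ℂ) : ℝ :=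
  -contraction (stdVec m) (θ.at₂ z) ((iddbar f).at₂ z)

/-- `∂f / ∂z̄^k`. -/
def dbarCoeff (f : (Fin m → ℂ) → ℝ) (z : Fin m → ℂ) (k : Fin m) : ℂ :=
  ((fderiv ℝ f z (stdVec m k) : ℂ)
    + Complex.I * (fderiv ℝ f z (Complex.I • stdVec m k) : ℂ)) / 2

/-- The components `v^j` of the (1,0)-gradient `∇^{1,0} f = ∑ v^j ∂_j`, determined by
`∑_j g_{jk̄} v^j = ∂f / ∂z̄^k`. -/
def grad10 (θ : Form (Fin m → ℂ) (Fin m → ℂ) 2) (f : (Fin m → ℂ) → ℝ) (z : Fin m → ℂ) :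
    Fin m → ℂ :=
  ((metricMatrix θ z)ᵀ)⁻¹ *ᵥ dbarCoeff f z

end Local

/-! ### Holomorphic submersions -/

section Submersion

variable {EX EB X B : Type*}
  [NormedAddCommGroup EX] [NormedSpace ℂ EX] [NormedAddCommGroup EB] [NormedSpace ℂ EB]
  [TopologicalSpace X] [ChartedSpace EX X] [TopologicalSpace B] [ChartedSpace EB B]
  {m : ℕ} {π : X → B}

variable (EX EB m) in
/-- `π` is a holomorphic submersion with `m`-dimensional fibres: around each point there are
holomorphic charts in which `π` is the projection `EB × ℂ^m → EB`. -/
abbrev IsHolSubmersion (π : X → B) : Prop :=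
  Manifold.IsSubmersionOfComplement (Fin m → ℂ) 𝓘(ℂ, EX) 𝓘(ℂ, EB) ω π

variable (h : IsHolSubmersion EX EB m π)

/-- Holomorphic coordinates `(w, z)` on `X` around `x` in which `π` is `(w, z) ↦ w`. -/
def adaptedCoord (x : X) : X → EB × (Fin m → ℂ) :=
  fun y => (h x).equiv ((h x).domChart y)

/-- The inverse of the adapted coordinates around `x`. -/
def adaptedParam (x : X) : EB × (Fin m → ℂ) → X :=
  fun p => (h x).domChart.symm ((h x).equiv.symm p)

/-- The open set on which the adapted parametrization around `x` is defined. -/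
def adaptedDomain (x : X) : Set (EB × (Fin m → ℂ)) :=
  {p | (h x).equiv.symm p ∈ (h x).domChart.target}

/-- The parametrization `z ↦ (w₀, z)` of an open subset of the fibre of `π` through `x`. As `x`
runs through a fibre, the inverses of these maps form a holomorphic atlas of that fibre. -/
def fibreParam (x : X) : (Fin m → ℂ) → X :=
  fun z => adaptedParam h x ((adaptedCoord h x x).1, z)

/-- The open set on which `fibreParam h x` is defined. -/
def fibreDomain (x : X) : Set (Fin m → ℂ) :=
  {z | ((adaptedCoord h x x).1, z) ∈ adaptedDomain h x}

/-- The fibre coordinates of `x` itself. -/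
def fibrePoint (x : X) : Fin m → ℂ := (adaptedCoord h x x).2

/-- A function is smooth along the fibre over `b`. Only its values on that fibre matter. -/
def SmoothOnFibre (b : B) (f : X → ℝ) : Prop :=
  ∀ x, π x = b → ContDiffOn ℝ ∞ (f ∘ fibreParam h x) (fibreDomain h x)

variable (Ω : Form EX X 2)

/-- The restriction of `Ω` to the fibre through `x`, in the fibre coordinates around `x`. -/
def fibreForm (x : X) : Form (Fin m → ℂ) (Fin m → ℂ) 2 :=
  Form.pull (E := Fin m → ℂ) (E' := EX) (fibreParam h x) Ω

/-- The measure `ω_b^m` on the fibre over `b`, as a measure on `X` concentrated on the fibre. It is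
glued from its restrictions to the coordinate patches of the fibre, as their supremum. -/
def fibreMeasure [MeasurableSpace X] (b : B) : Measure X :=
  ⨆ x : {x : X // π x = b},
    (((volume : Measure (Fin m → ℂ)).restrict (fibreDomain h x.1)).withDensity
      fun z => ENNReal.ofReal (volumeDensity (fibreForm h Ω x.1) z)).map (fibreParam h x.1)

/-- The scalar curvature of `ω_b` at `x`, where `b = π x`. -/
def fibreScalarCurvature (x : X) : ℝ :=
  localScalarCurvature (fibreForm h Ω x) (fibrePoint h x)

/-- The vertical Laplacian `Δ_V`. -/
def verticalLaplacian (f : X → ℝ) (x : X) : ℝ :=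
  localLaplacian (fibreForm h Ω x) (f ∘ fibreParam h x) (fibrePoint h x)

/-- The curvature `ρ` of the Hermitian metric induced by `Ω` on `-K_{X/B} = Λ^m V`. In adapted
coordinates `(w, z)` it is `- i ∂∂̄ log det(Ω(∂_{z_j}, ∂_{z̄_k}) / i)`. -/
def relativeRicci : Form EX X 2 := fun x =>
  Form.pull (E := EX) (E' := EB × (Fin m → ℂ)) (adaptedCoord h x)
    (iddbar fun p => -Real.log (hermMatrix (fun j => ((0 : EB), stdVec m j))
      (Form.at₂ (Form.pull (E := EB × (Fin m → ℂ)) (E' := EX) (adaptedParam h x) Ω) p)).det.re) x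

/-! ### The connection and its curvature -/

variable (π) in
/-- `v` is a vertical tangent vector at `x`. -/
def IsVertical (x : X) (v : EX) : Prop :=
  tangentMapAt (E := EX) (E' := EB) π x v = 0

variable (π EB) in
/-- `u` is a horizontal tangent vector at `x`: it is `Ω`-orthogonal to the vertical space. -/
def IsHorizontal (x : X) (u : EX) : Prop :=
  ∀ v, IsVertical (EB := EB) π x v → Ω.at₂ x u v = 0

variable (π) in
/-- The horizontal lift to `x` of a tangent vector `w` of `B` at `π x`. -/
def horizontalLift (x : X) (w : EB) : EX :=
  Classical.epsilon fun u =>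
    tangentMapAt (E := EX) (E' := EB) π x u = w ∧ IsHorizontal EB π Ω x u

variable (π EB) in
/-- The vertical component of a tangent vector. -/
def verticalPart (x : X) (u : EX) : EX :=
  u - horizontalLift (EB := EB) π Ω x (tangentMapAt (E := EX) (E' := EB) π x u)

/-- The vector field on a neighbourhood of `b` in `B` with value `w` at `b` which is constant in
the preferred chart at `b`. -/
def coordinateField (b : B) (w : EB) (b' : B) : EB :=
  tangentMapAt (E := EB) (E' := EB) (M := EB) (chartAt EB b).symm (chartAt EB b b') w

variable (π) in
/-- The curvature `F_H` of the connection: the vertical part of the bracket of the horizontal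
lifts of two commuting vector fields extending `w₁`, `w₂ ∈ T_{π x} B`. -/
def connectionCurvature (x : X) (w₁ w₂ : EB) : EX :=
  verticalPart EB π Ω x
    (VectorField.mlieBracket 𝓘(ℝ, EX)
      (fun y => horizontalLift (EX := EX) π Ω y (coordinateField (π x) w₁ (π y)))
      (fun y => horizontalLift (EX := EX) π Ω y (coordinateField (π x) w₂ (π y))) x)

variable [MeasurableSpace X]

/-- `f` is the Hamiltonian of integral zero of the vector field `ξ` on the fibre over `b`:
`df = ω_b(ξ, ·)` and `∫ f ω_b^m = 0`. -/
def IsHamiltonian (b : B) (ξ : X → EX) (f : X → ℝ) : Prop :=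
  SmoothOnFibre h b f ∧
  (∀ x, π x = b → ∀ z ∈ fibreDomain h x, ∀ u : Fin m → ℂ,
    fderiv ℝ (f ∘ fibreParam h x) z u =
      Ω.at₂ (fibreParam h x z) (ξ (fibreParam h x z))
        (tangentMapAt (E := Fin m → ℂ) (E' := EX) (fibreParam h x) z u)) ∧
  ∫ y, f y ∂(fibreMeasure h Ω b) = 0

/-- The fibrewise co-moment map `μ^*`, on the fibre over `b`. Only the values of the resulting
function on that fibre are meaningful. -/
def comoment (b : B) (ξ : X → EX) : X → ℝ :=
  Classical.epsilon fun f => IsHamiltonian h Ω b ξ f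

/-- The two-form `μ^* F_H` on `B` with values in fibrewise Hamiltonian functions. -/
def comomentCurvature (x : X) (w₁ w₂ : EB) : ℝ :=
  comoment h Ω (π x) (fun y => connectionCurvature π Ω y w₁ w₂) x

/-- The function `Λ_{ω_B} μ^* F_H` on `X`. -/
def contractedComomentCurvature [FiniteDimensional ℂ EB] (ΩB : Form EB B 2) (x : X) : ℝ :=
  contraction (Module.finBasis ℂ EB) (ΩB.at₂ (π x)) (comomentCurvature h Ω x)

/-- The function `Λ_{ω_B} ρ_H` on `X`, where `ρ_H` is the purely horizontal component of `ρ`. -/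
def contractedHorizontalRicci [FiniteDimensional ℂ EB] (ΩB : Form EB B 2) (x : X) : ℝ :=
  contraction (Module.finBasis ℂ EB) (ΩB.at₂ (π x)) fun w₁ w₂ =>
    (relativeRicci h Ω).at₂ x (horizontalLift π Ω x w₁) (horizontalLift π Ω x w₂)

/-! ### Fibrewise holomorphy potentials and the projection `p` -/

/-- The space `E_b` of real holomorphy potentials (`∂̄ ∇^{1,0} f = 0`) of integral zero on the
fibre over `b`. -/
def IsFibrePotential (b : B) (f : X → ℝ) : Prop :=
  SmoothOnFibre h b f ∧
  (∀ x, π x = b →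
    DifferentiableOn ℂ (grad10 (fibreForm h Ω x) (f ∘ fibreParam h x)) (fibreDomain h x)) ∧
  ∫ y, f y ∂(fibreMeasure h Ω b) = 0

/-- The space `C^∞_E(X)`. -/
def MemCE (f : X → ℝ) : Prop :=
  ContMDiff 𝓘(ℝ, EX) 𝓘(ℝ, ℝ) ∞ f ∧ ∀ b, IsFibrePotential h Ω b f

/-- The space `C^∞_R(X)`: smooth functions whose restriction to each fibre has integral zero and is
`L²`-orthogonal to `E_b`. -/
def MemCR (f : X → ℝ) : Prop :=
  ContMDiff 𝓘(ℝ, EX) 𝓘(ℝ, ℝ) ∞ f ∧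
  ∀ b, ∫ y, f y ∂(fibreMeasure h Ω b) = 0 ∧
    ∀ g, IsFibrePotential h Ω b g → ∫ y, f y * g y ∂(fibreMeasure h Ω b) = 0

/-- `p(φ) = ψ`: in the decomposition `C^∞(X) = C^∞(B) ⊕ C^∞_E(X) ⊕ C^∞_R(X)`, the
`C^∞_E(X)`-component of `φ` is `ψ`. -/
def ProjE (φ ψ : X → ℝ) : Prop :=
  MemCE h Ω ψ ∧ ∃ (φB : B → ℝ) (φR : X → ℝ),
    ContMDiff 𝓘(ℝ, EB) 𝓘(ℝ, ℝ) ∞ φB ∧ MemCR h Ω φR ∧ ∀ x, φ x = φB (π x) + ψ x + φR x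

/-! ### The metrics in question -/

variable (π EB) in
/-- A relatively Kähler metric: a closed real (1,1)-form on `X` which is positive on the fibres. -/
structure IsRelativelyKahler : Prop where
  closed : Ω.IsClosed
  oneOne : Ω.IsOneOne
  pos : ∀ x v, IsVertical (EB := EB) π x v → v ≠ 0 → 0 < Ω.at₂ x v (Complex.I • v)

/-- A relatively cscK metric: the restriction to each fibre has constant scalar curvature. -/
structure IsRelativelyCscK : Prop where
  relKahler : IsRelativelyKahler EB π Ω
  cscK : ∀ b, ∃ c, ∀ x, π x = b → fibreScalarCurvature h Ω x = c

/-- Optimal symplectic connections: relatively cscK metrics with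
`p(Δ_V(Λ_{ω_B} μ^* F_H) + Λ_{ω_B} ρ_H) = 0`. -/
def IsOptimalSymplecticConnection [FiniteDimensional ℂ EB] (ΩB : Form EB B 2) : Prop :=
  IsRelativelyCscK h Ω ∧
  ProjE h Ω
    (fun x => verticalLaplacian h Ω (contractedComomentCurvature h Ω ΩB) x
      + contractedHorizontalRicci h Ω ΩB x) 0

/-- `Ω ∈ c₁(-K_{X/B})`, where this class is normalized so as to be represented by the curvature
`ρ` (without a factor `1 / 2π`). -/
def InRelativeAnticanonicalClass : Prop :=
  Form.Cohomologous (k := 1) (relativeRicci h Ω) Ω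

end Submersion

end

end FibrationGeometry

open FibrationGeometry

/-! Let η = ρ - Ω (`ricciDefect`), which is exact by assumption. The heart of the proof is that η is
purely horizontal, with components that are constant along the fibres. This is shown type by type.

Vertical part. On a fibre ρ restricts to Ric(ω_b), so constant scalar curvature makes η restrict to
a closed (1,1)-form of constant trace. Such a form is coclosed, hence L²-orthogonal to all exact
forms and in particular to itself. It therefore vanishes, and every fibre satisfies Ric(ω_b) = ω_b
(`fibreForm_ricciDefect`).

Mixed part. As η is closed, of type (1,1) and zero on pairs of vertical vectors, inserting the lift
of a base vector gives the real part of a closed holomorphic one-form on the fibre. By the Bochner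
formula with Ric = ω_b, its squared norm N satisfies ΔN ≤ -N for the nonnegative Laplacian. Since ΔN
has integral zero and N ≥ 0, N vanishes (`ricciDefect_eq_zero_of_isVertical`).

Horizontal part. Cartan's formula for dη = 0 on two lifts and a vertical vector now says that
η(w₁^#, w₂^#) is constant on connected fibres (`liftedForm_eq_of_closed`). The same formula for dΩ =
0 gives d(Ω(w₁^#, w₂^#)) = ω_b(F_H(w₁, w₂), ·) along the fibres, so μ^*F_H(w₁, w₂) is Ω(w₁^#, w₂^#)
minus its fibre mean (`isHamiltonian_liftedForm`, `comomentCurvature_eq`). Contracting with ω_B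
yields Λρ_H = Λμ^*F_H + π^*c for a function c on B (`exists_contractedHorizontalRicci_eq`).

Now put φ = Λμ^*F_H, which has mean zero on the fibres. Because Ric(ω_b) = ω_b, every mean-zero real
holomorphy potential g satisfies Δg = g (`IsFibrePotential.verticalLaplacian_eq`), and symmetry of
the Laplacian gives ∫(Δφ + φ)g = 2∫φg. Hence Δφ + φ is orthogonal to E_b exactly when φ is, and both
conditions of the theorem say that φ lies in C^∞_R(X) (`projE_zero_iff`,
`projE_laplacian_add_zero_iff`). Neither φ, chosen fibre by fibre, nor c is smooth by construction;
their smoothness is deduced from that of Λρ_H. -/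

namespace FibrationGeometry

open scoped ComplexOrder

noncomputable section

set_option linter.unusedSectionVars false

/-! ### Hermitian linear algebra of real two-forms on a complex vector space. -/

section LinearAlgebraLemmas

variable {V V' : Type*} [AddCommGroup V] [Module ℂ V] [AddCommGroup V'] [Module ℂ V']

/-- Real bilinear functions on a complex vector space. -/
structure IsRealBilin (σ : V → V → ℝ) : Prop where
  add_left : ∀ u u' v, σ (u + u') v = σ u v + σ u' v
  add_right : ∀ u v v', σ u (v + v') = σ u v + σ u v'
  smul_left : ∀ (r : ℝ) u v, σ ((r : ℂ) • u) v = r * σ u v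
  smul_right : ∀ (r : ℝ) u v, σ u ((r : ℂ) • v) = r * σ u v

lemma IsRealBilin.neg_left {σ : V → V → ℝ} (hσ : IsRealBilin σ) (u v : V) :
    σ (-u) v = -σ u v := by
  simpa using hσ.smul_left (-1) u v

lemma IsRealBilin.neg_right {σ : V → V → ℝ} (hσ : IsRealBilin σ) (u v : V) :
    σ u (-v) = -σ u v := by
  simpa using hσ.smul_right (-1) u v

lemma hermCoeff_add_left {σ : V → V → ℝ} (hσ : IsRealBilin σ) (u u' v : V) :
    hermCoeff σ (u + u') v = hermCoeff σ u v + hermCoeff σ u' v := by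
  simp only [hermCoeff, smul_add, hσ.add_left]
  push_cast
  ring

lemma hermCoeff_add_right {σ : V → V → ℝ} (hσ : IsRealBilin σ) (u v v' : V) :
    hermCoeff σ u (v + v') = hermCoeff σ u v + hermCoeff σ u v' := by
  simp only [hermCoeff, smul_add, hσ.add_right]
  push_cast
  ring

/-- Type (1,1) is not needed: `hermCoeff` evaluates the complexified form on the (1,0)-part of u and
the (0,1)-part of v, and these depend complex linearly on u and antilinearly on v. -/
lemma hermCoeff_smul_left {σ : V → V → ℝ} (hσ : IsRealBilin σ) (c : ℂ) (u v : V) :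
    hermCoeff σ (c • u) v = c * hermCoeff σ u v := by
  have hc : ∀ w : V, c • w = (c.re : ℂ) • w + (c.im : ℂ) • (Complex.I • w) := by
    intro w
    rw [smul_smul, ← add_smul, Complex.re_add_im]
  have hI : ∀ w : V, Complex.I • Complex.I • w = -w := by
    intro w
    rw [smul_smul, Complex.I_mul_I, neg_one_smul]
  have h1 : ∀ w, σ (c • u) w = c.re * σ u w + c.im * σ (Complex.I • u) w := by
    intro w
    rw [hc, hσ.add_left, hσ.smul_left, hσ.smul_left]
  have h2 : ∀ w, σ (Complex.I • c • u) w = c.re * σ (Complex.I • u) w - c.im * σ u w := by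
    intro w
    rw [smul_comm, hc, hσ.add_left, hσ.smul_left, hσ.smul_left, hI, hσ.neg_left]
    ring
  have hcc : c = (c.re : ℂ) + (c.im : ℂ) * Complex.I := (Complex.re_add_im c).symm
  simp only [hermCoeff, h1, h2]
  conv_rhs => rw [hcc]
  push_cast
  ring_nf
  simp only [Complex.I_sq]
  ring

lemma hermCoeff_smul_right {σ : V → V → ℝ} (hσ : IsRealBilin σ) (c : ℂ) (u v : V) :
    hermCoeff σ u (c • v) = star c * hermCoeff σ u v := by
  have hc : ∀ w : V, c • w = (c.re : ℂ) • w + (c.im : ℂ) • (Complex.I • w) := by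
    intro w
    rw [smul_smul, ← add_smul, Complex.re_add_im]
  have hI : ∀ w : V, Complex.I • Complex.I • w = -w := by
    intro w
    rw [smul_smul, Complex.I_mul_I, neg_one_smul]
  have h1 : ∀ w, σ w (c • v) = c.re * σ w v + c.im * σ w (Complex.I • v) := by
    intro w
    rw [hc, hσ.add_right, hσ.smul_right, hσ.smul_right]
  have h2 : ∀ w, σ w (Complex.I • c • v) = c.re * σ w (Complex.I • v) - c.im * σ w v := by
    intro w
    rw [smul_comm, hc, hσ.add_right, hσ.smul_right, hσ.smul_right, hI, hσ.neg_right]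
    ring
  have hcc : star c = (c.re : ℂ) - (c.im : ℂ) * Complex.I := by
    apply Complex.ext <;> simp
  simp only [hermCoeff, h1, h2, hcc]
  push_cast
  ring_nf
  simp only [Complex.I_sq]
  ring

lemma hermCoeff_sum_left {κ : Type*} {σ : V → V → ℝ} (hσ : IsRealBilin σ) (s : Finset κ)
    (f : κ → V) (v : V) : hermCoeff σ (∑ i ∈ s, f i) v = ∑ i ∈ s, hermCoeff σ (f i) v := by
  classical
  induction s using Finset.induction_on with
  | empty => simpa using hermCoeff_smul_left hσ 0 0 v
  | insert a s ha ih => rw [Finset.sum_insert ha, Finset.sum_insert ha, hermCoeff_add_left hσ, ih]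

lemma hermCoeff_sum_right {κ : Type*} {σ : V → V → ℝ} (hσ : IsRealBilin σ) (s : Finset κ)
    (f : κ → V) (u : V) : hermCoeff σ u (∑ i ∈ s, f i) = ∑ i ∈ s, hermCoeff σ u (f i) := by
  classical
  induction s using Finset.induction_on with
  | empty => simpa using hermCoeff_smul_right hσ 0 u 0
  | insert a s ha ih => rw [Finset.sum_insert ha, Finset.sum_insert ha, hermCoeff_add_right hσ, ih]

/-- Sesquilinearity turns a change of complex frame into a congruence. This is the source of the
coordinate independence of traces, norms and volume densities below. -/
lemma hermMatrix_change {ι : Type*} [Fintype ι] {σ : V → V → ℝ} (hσ : IsRealBilin σ)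
    (A : Matrix ι ι ℂ) (e : ι → V) :
    hermMatrix (fun j => ∑ k, A j k • e k) σ = A * hermMatrix e σ * Aᴴ := by
  ext j k
  simp only [hermMatrix, Matrix.of_apply, Matrix.mul_apply, Matrix.conjTranspose_apply,
    hermCoeff_sum_left hσ, hermCoeff_smul_left hσ, hermCoeff_sum_right hσ,
    hermCoeff_smul_right hσ, Finset.mul_sum, Finset.sum_mul]
  rw [Finset.sum_comm]
  refine Finset.sum_congr rfl fun a _ => Finset.sum_congr rfl fun b _ => ?_
  ring

/-- A complex linear change of frame. -/
lemma exists_matrix_of_linearMap {ι : Type*} [Fintype ι] (b : Module.Basis ι ℂ V)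
    (L : V →ₗ[ℂ] V) : ∃ A : Matrix ι ι ℂ, ∀ j, L (b j) = ∑ k, A j k • b k := by
  refine ⟨Matrix.of fun j k => b.repr (L (b j)) k, fun j => ?_⟩
  simp only [Matrix.of_apply]
  exact (b.sum_repr (L (b j))).symm

/-- Reversal of products holds for the nonsingular inverse even if G is degenerate, so only A has to
be invertible; cyclicity of the trace then cancels A. -/
lemma trace_change {ι : Type*} [Fintype ι] [DecidableEq ι] {A G S : Matrix ι ι ℂ}
    (hA : IsUnit A.det) :
    ((A * G * Aᴴ)⁻¹ * (A * S * Aᴴ)).trace = (G⁻¹ * S).trace := by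
  have hA' : IsUnit Aᴴ.det := by
    rw [Matrix.det_conjTranspose]; exact hA.star
  rw [Matrix.mul_inv_rev, Matrix.mul_inv_rev]
  calc (Aᴴ⁻¹ * (G⁻¹ * A⁻¹) * (A * S * Aᴴ)).trace
      = (Aᴴ⁻¹ * (G⁻¹ * (A⁻¹ * A) * S * Aᴴ)).trace := by simp only [Matrix.mul_assoc]
    _ = (G⁻¹ * S * (Aᴴ * Aᴴ⁻¹)).trace := by
        rw [Matrix.nonsing_inv_mul _ hA, Matrix.mul_one, Matrix.trace_mul_comm]
        simp only [Matrix.mul_assoc]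
    _ = _ := by rw [Matrix.mul_nonsing_inv _ hA', Matrix.mul_one]

lemma contraction_change {ι : Type*} [Fintype ι] [DecidableEq ι] {θ σ : V → V → ℝ}
    (hθ : IsRealBilin θ) (hσ : IsRealBilin σ) {A : Matrix ι ι ℂ} (hA : IsUnit A.det) (e : ι → V) :
    contraction (fun j => ∑ k, A j k • e k) θ σ = contraction e θ σ := by
  rw [contraction, contraction, hermMatrix_change hθ, hermMatrix_change hσ, trace_change hA]

/-- The squared norm of a two-form with respect to the metric `θ`. -/
def normSqForm {ι : Type*} [Fintype ι] [DecidableEq ι] (e : ι → V) (θ σ τ : V → V → ℝ) : ℝ :=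
  ((hermMatrix e θ)⁻¹ * hermMatrix e σ * (hermMatrix e θ)⁻¹ * hermMatrix e τ).trace.re

lemma trace_change₂ {ι : Type*} [Fintype ι] [DecidableEq ι] {A G S T : Matrix ι ι ℂ}
    (hA : IsUnit A.det) :
    ((A * G * Aᴴ)⁻¹ * (A * S * Aᴴ) * (A * G * Aᴴ)⁻¹ * (A * T * Aᴴ)).trace
      = (G⁻¹ * S * G⁻¹ * T).trace := by
  have hA' : IsUnit Aᴴ.det := by
    rw [Matrix.det_conjTranspose]; exact hA.star
  have hG : (A * G * Aᴴ)⁻¹ = Aᴴ⁻¹ * G⁻¹ * A⁻¹ := by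
    rw [Matrix.mul_inv_rev, Matrix.mul_inv_rev, Matrix.mul_assoc]
  rw [hG]
  calc (Aᴴ⁻¹ * G⁻¹ * A⁻¹ * (A * S * Aᴴ) * (Aᴴ⁻¹ * G⁻¹ * A⁻¹) * (A * T * Aᴴ)).trace
      = (Aᴴ⁻¹ * (G⁻¹ * (A⁻¹ * A) * S * (Aᴴ * Aᴴ⁻¹) * G⁻¹ * (A⁻¹ * A) * T * Aᴴ)).trace := by
        simp only [Matrix.mul_assoc]
    _ = _ := by
        rw [Matrix.nonsing_inv_mul _ hA, Matrix.mul_nonsing_inv _ hA', Matrix.trace_mul_comm]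
        simp only [Matrix.mul_assoc, Matrix.mul_one, Matrix.mul_nonsing_inv _ hA']

lemma normSqForm_change {ι : Type*} [Fintype ι] [DecidableEq ι] {θ σ τ : V → V → ℝ}
    (hθ : IsRealBilin θ) (hσ : IsRealBilin σ) (hτ : IsRealBilin τ) {A : Matrix ι ι ℂ}
    (hA : IsUnit A.det) (e : ι → V) :
    normSqForm (fun j => ∑ k, A j k • e k) θ σ τ = normSqForm e θ σ τ := by
  rw [normSqForm, normSqForm, hermMatrix_change hθ, hermMatrix_change hσ, hermMatrix_change hτ,
    trace_change₂ hA]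

lemma contraction_add {ι : Type*} [Fintype ι] [DecidableEq ι] (e : ι → V) (θ σ τ : V → V → ℝ) :
    contraction e θ (fun u v => σ u v + τ u v) = contraction e θ σ + contraction e θ τ := by
  have : hermMatrix e (fun u v => σ u v + τ u v) = hermMatrix e σ + hermMatrix e τ := by
    ext j k
    simp only [hermMatrix, hermCoeff, Matrix.of_apply, Matrix.add_apply]
    push_cast
    ring
  rw [contraction, this, Matrix.mul_add, Matrix.trace_add, Complex.add_re]
  rfl

lemma contraction_smul {ι : Type*} [Fintype ι] [DecidableEq ι] (e : ι → V) (c : ℝ)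
    (θ σ : V → V → ℝ) :
    contraction e θ (fun u v => c * σ u v) = c * contraction e θ σ := by
  have : hermMatrix e (fun u v => c * σ u v) = (c : ℂ) • hermMatrix e σ := by
    ext j k
    simp only [hermMatrix, hermCoeff, Matrix.of_apply, Matrix.smul_apply, smul_eq_mul]
    push_cast
    ring
  rw [contraction, this, Matrix.mul_smul, Matrix.trace_smul, smul_eq_mul, Complex.re_ofReal_mul]
  rfl

lemma contraction_sub {ι : Type*} [Fintype ι] [DecidableEq ι] (e : ι → V) (θ σ τ : V → V → ℝ) :
    contraction e θ (fun u v => σ u v - τ u v) = contraction e θ σ - contraction e θ τ := by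
  have := contraction_add e θ σ (fun u v => (-1) * τ u v)
  rw [contraction_smul] at this
  simpa [sub_eq_add_neg] using this

/-- For type (1,1) the four terms pair up. The imaginary part is then -σ(u, v)/2, which is how
vanishing coefficients are later converted back into the vanishing of a real form. -/
lemma hermCoeff_of_oneOne {σ : V → V → ℝ} (hσ : IsRealBilin σ)
    (h11 : ∀ u v, σ (Complex.I • u) (Complex.I • v) = σ u v) (u v : V) :
    hermCoeff σ u v = ((σ u (Complex.I • v) : ℂ) - Complex.I * (σ u v : ℂ)) / 2 := by
  have h1 : σ (Complex.I • u) v = -σ u (Complex.I • v) := by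
    rw [← h11 u (Complex.I • v), smul_smul, Complex.I_mul_I, neg_one_smul, hσ.neg_right, neg_neg]
  simp only [hermCoeff, h1, h11]
  push_cast
  ring

lemma hermMatrix_isHermitian {ι : Type*} {σ : V → V → ℝ}
    (hanti : ∀ u v, σ v u = -σ u v) (e : ι → V) : (hermMatrix e σ).IsHermitian := by
  ext j k
  simp only [hermMatrix, hermCoeff, Matrix.conjTranspose_apply, Matrix.of_apply, star_div₀,
    star_sub, star_mul', Complex.star_def, Complex.conj_ofReal, Complex.conj_I]
  rw [hanti (e k) (Complex.I • e j), hanti (Complex.I • e k) (e j), hanti (e j) (e k),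
    hanti (Complex.I • e j) (Complex.I • e k)]
  simp only [map_ofNat]
  push_cast
  simp only [hanti (Complex.I • e j) (e k), hanti (e j) (Complex.I • e k)]
  push_cast
  ring

lemma hermCoeff_self {σ : V → V → ℝ} (hσ : IsRealBilin σ)
    (h11 : ∀ u v, σ (Complex.I • u) (Complex.I • v) = σ u v)
    (hanti : ∀ u v, σ v u = -σ u v) (u : V) :
    hermCoeff σ u u = ((σ u (Complex.I • u) / 2 : ℝ) : ℂ) := by
  have : σ u u = 0 := by linarith [hanti u u]
  rw [hermCoeff_of_oneOne hσ h11, this]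
  push_cast
  ring

lemma hermMatrix_posDef {ι : Type*} [Fintype ι] {σ : V → V → ℝ} (hσ : IsRealBilin σ)
    (h11 : ∀ u v, σ (Complex.I • u) (Complex.I • v) = σ u v)
    (hanti : ∀ u v, σ v u = -σ u v) {e : ι → V} (he : LinearIndependent ℂ e)
    (hpos : ∀ v ∈ Submodule.span ℂ (Set.range e), v ≠ 0 → 0 < σ v (Complex.I • v)) :
    (hermMatrix e σ).PosDef := by
  refine Matrix.PosDef.of_dotProduct_mulVec_pos (hermMatrix_isHermitian hanti e) fun x hx => ?_
  -- The coefficients are conjugated because `hermCoeff` is linear in its first slot, whereas the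
  -- quadratic form of a hermitian matrix is antilinear there.
  set v : V := ∑ j, star (x j) • e j with hv
  have h1 : star x ⬝ᵥ (hermMatrix e σ *ᵥ x) = hermCoeff σ v v := by
    rw [hv, hermCoeff_sum_left hσ]
    simp only [hermCoeff_sum_right hσ, hermCoeff_smul_left hσ, hermCoeff_smul_right hσ,
      dotProduct, Matrix.mulVec, hermMatrix, Matrix.of_apply, Pi.star_apply, star_star]
    refine Finset.sum_congr rfl fun j _ => ?_
    rw [Finset.mul_sum]
    refine Finset.sum_congr rfl fun k _ => by ring
  have hv0 : v ≠ 0 := by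
    intro h0
    apply hx
    funext j
    have := Fintype.linearIndependent_iff.1 he (fun j => star (x j)) (by rw [← hv, h0]) j
    simpa using this
  have hvs : v ∈ Submodule.span ℂ (Set.range e) :=
    Submodule.sum_mem _ fun j _ => Submodule.smul_mem _ _ (Submodule.subset_span ⟨j, rfl⟩)
  rw [h1, hermCoeff_self hσ h11 hanti]
  have := hpos v hvs hv0
  exact_mod_cast half_pos this

open scoped MatrixOrder in
lemma exists_eq_conjTranspose_mul_self {ι : Type*} [Fintype ι] [DecidableEq ι] {H : Matrix ι ι ℂ}
    (hH : H.PosDef) : ∃ C : Matrix ι ι ℂ, IsUnit C.det ∧ H = Cᴴ * C := by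
  obtain ⟨C, hC⟩ := CStarAlgebra.nonneg_iff_eq_star_mul_self.mp hH.posSemidef.nonneg
  refine ⟨C, ?_, hC⟩
  have h := (Matrix.isUnit_iff_isUnit_det H).1 hH.isUnit
  rw [hC, Matrix.det_mul] at h
  exact isUnit_of_mul_isUnit_right h

/-- A hermitian matrix of zero norm vanishes. -/
lemma trace_norm_nonneg {ι : Type*} [Fintype ι] [DecidableEq ι] {H S : Matrix ι ι ℂ}
    (hH : H.PosDef) (hS : S.IsHermitian) :
    0 ≤ (H * S * H * S).trace.re ∧ ((H * S * H * S).trace.re = 0 → S = 0) := by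
  obtain ⟨C, hdet, hC⟩ := exists_eq_conjTranspose_mul_self hH
  -- With H = C^*C, cyclicity identifies tr(HSHS) with tr(T^*T), the sum of the |T_ij|².
  set T := C * S * Cᴴ with hT
  have hTH : Tᴴ = T := by
    rw [hT, Matrix.conjTranspose_mul, Matrix.conjTranspose_mul, Matrix.conjTranspose_conjTranspose,
      hS.eq, Matrix.mul_assoc]
  have htr : (H * S * H * S).trace = (Tᴴ * T).trace := by
    rw [hTH, hC, hT]
    calc (Cᴴ * C * S * (Cᴴ * C) * S).trace = (Cᴴ * (C * S * Cᴴ * C * S)).trace := by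
          simp only [Matrix.mul_assoc]
      _ = _ := by rw [Matrix.trace_mul_comm]; simp only [Matrix.mul_assoc]
  have hre : (Tᴴ * T).trace.re = ∑ i, ∑ j, Complex.normSq (T j i) := by
    simp only [Matrix.trace, Matrix.diag, Matrix.mul_apply, Matrix.conjTranspose_apply,
      Complex.re_sum]
    refine Finset.sum_congr rfl fun i _ => Finset.sum_congr rfl fun j _ => ?_
    rw [Complex.star_def, ← Complex.normSq_eq_conj_mul_self, Complex.ofReal_re]
  rw [htr, hre]
  refine ⟨Finset.sum_nonneg fun i _ => Finset.sum_nonneg fun j _ => Complex.normSq_nonneg _,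
    fun h0 => ?_⟩
  have hT0 : T = 0 := by
    ext j i
    have h1 := (Finset.sum_eq_zero_iff_of_nonneg
      (fun i _ => Finset.sum_nonneg fun j _ => Complex.normSq_nonneg _)).1 h0 i (Finset.mem_univ _)
    have h2 := (Finset.sum_eq_zero_iff_of_nonneg
      (fun j _ => Complex.normSq_nonneg _)).1 h1 j (Finset.mem_univ _)
    simpa using h2
  have hdet' : IsUnit Cᴴ.det := by rw [Matrix.det_conjTranspose]; exact hdet.star
  calc S = C⁻¹ * (C * S * Cᴴ) * Cᴴ⁻¹ := by
        rw [Matrix.mul_assoc C, ← Matrix.mul_assoc, Matrix.nonsing_inv_mul _ hdet, Matrix.one_mul,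
          Matrix.mul_assoc, Matrix.mul_nonsing_inv _ hdet', Matrix.mul_one]
    _ = 0 := by rw [← hT, hT0]; simp

/-- Writing H = C^*C and Hᵀ = D^*D, the trace is the squared Hilbert–Schmidt norm of D T C^*. It
supplies the sign of the Hessian term in the Bochner formula. -/
lemma trace_symm_nonneg {ι : Type*} [Fintype ι] [DecidableEq ι] {H T : Matrix ι ι ℂ}
    (hH : H.PosDef) : 0 ≤ (H * Tᴴ * Hᵀ * T).trace.re := by
  obtain ⟨C, -, hC⟩ := exists_eq_conjTranspose_mul_self hH
  obtain ⟨D, -, hD⟩ := exists_eq_conjTranspose_mul_self hH.transpose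
  set M := D * T * Cᴴ with hM
  have htr : (H * Tᴴ * Hᵀ * T).trace = (Mᴴ * M).trace := by
    rw [hD, hC, hM, Matrix.conjTranspose_mul, Matrix.conjTranspose_mul,
      Matrix.conjTranspose_conjTranspose]
    calc (Cᴴ * C * Tᴴ * (Dᴴ * D) * T).trace = (Cᴴ * (C * Tᴴ * Dᴴ * D * T)).trace := by
          simp only [Matrix.mul_assoc]
      _ = _ := by rw [Matrix.trace_mul_comm]; simp only [Matrix.mul_assoc]
  rw [htr]
  simp only [Matrix.trace, Matrix.diag, Matrix.mul_apply, Matrix.conjTranspose_apply,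
    Complex.re_sum]
  refine Finset.sum_nonneg fun i _ => Finset.sum_nonneg fun j _ => ?_
  rw [Complex.star_def, ← Complex.normSq_eq_conj_mul_self, Complex.ofReal_re]
  exact Complex.normSq_nonneg _

end LinearAlgebraLemmas

/-! ### Wirtinger calculus for functions and matrices on ℂ^m. -/

section Wirtinger

variable {m : ℕ}

/-- The Wirtinger derivative `(∂_{x_l} + s ∂_{y_l}) / 2`: it is `∂/∂z^l` for `s = -i` and
`∂/∂z̄^l` for `s = i`. -/
def wirt (s : ℂ) (l : Fin m) (F : (Fin m → ℂ) → ℂ) (z : Fin m → ℂ) : ℂ :=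
  (fderiv ℝ F z (stdVec m l) + s * fderiv ℝ F z (Complex.I • stdVec m l)) / 2

/-- The entrywise Wirtinger derivative of a matrix valued function. -/
def wirtM (s : ℂ) (l : Fin m) (M : (Fin m → ℂ) → Matrix (Fin m) (Fin m) ℂ) (z : Fin m → ℂ) :
    Matrix (Fin m) (Fin m) ℂ :=
  Matrix.of fun i j => wirt s l (fun y => M y i j) z

variable {s t : ℂ} {l k : Fin m} {F F' : (Fin m → ℂ) → ℂ} {z : Fin m → ℂ} {O : Set (Fin m → ℂ)}

lemma wirt_congr (h : F =ᶠ[nhds z] F') : wirt s l F z = wirt s l F' z := by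
  rw [wirt, wirt, h.fderiv_eq]

lemma wirt_congr_of_eqOn (hO : IsOpen O) (hz : z ∈ O) (h : Set.EqOn F F' O) :
    wirt s l F z = wirt s l F' z :=
  wirt_congr (Filter.eventuallyEq_of_mem (hO.mem_nhds hz) h)

lemma wirt_add (hF : DifferentiableAt ℝ F z) (hF' : DifferentiableAt ℝ F' z) :
    wirt s l (fun y => F y + F' y) z = wirt s l F z + wirt s l F' z := by
  rw [wirt, wirt, wirt, fderiv_fun_add hF hF']
  simp only [_root_.add_apply]
  ring

lemma wirt_mul (hF : DifferentiableAt ℝ F z) (hF' : DifferentiableAt ℝ F' z) :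
    wirt s l (fun y => F y * F' y) z = wirt s l F z * F' z + F z * wirt s l F' z := by
  rw [wirt, wirt, wirt, fderiv_fun_mul hF hF']
  simp only [_root_.add_apply, _root_.smul_apply, smul_eq_mul]
  ring

lemma wirt_const (c : ℂ) : wirt s l (fun _ : Fin m → ℂ => c) z = 0 := by
  simp [wirt]

lemma wirt_const_mul (c : ℂ) (hF : DifferentiableAt ℝ F z) :
    wirt s l (fun y => c * F y) z = c * wirt s l F z := by
  rw [wirt_mul (differentiableAt_const c) hF, wirt_const]
  ring

lemma wirt_neg : wirt s l (fun y => -F y) z = -wirt s l F z := by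
  rw [wirt, wirt, fderiv_fun_neg]
  simp only [_root_.neg_apply]
  ring

lemma wirt_sub (hF : DifferentiableAt ℝ F z) (hF' : DifferentiableAt ℝ F' z) :
    wirt s l (fun y => F y - F' y) z = wirt s l F z - wirt s l F' z := by
  rw [wirt, wirt, wirt, fderiv_fun_sub hF hF']
  simp only [_root_.sub_apply]
  ring

lemma wirt_sum {κ : Type*} (u : Finset κ) {f : κ → (Fin m → ℂ) → ℂ}
    (hf : ∀ i ∈ u, DifferentiableAt ℝ (f i) z) :
    wirt s l (fun y => ∑ i ∈ u, f i y) z = ∑ i ∈ u, wirt s l (f i) z := by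
  rw [wirt, fderiv_fun_sum hf]
  simp only [_root_.sum_apply, wirt]
  rw [Finset.mul_sum, ← Finset.sum_add_distrib, Finset.sum_div]

lemma wirt_conj (hF : DifferentiableAt ℝ F z) :
    wirt s l (fun y => star (F y)) z = star (wirt (star s) l F z) := by
  have h : fderiv ℝ (fun y => star (F y)) z
      = (Complex.conjCLE : ℂ →L[ℝ] ℂ).comp (fderiv ℝ F z) :=
    ((Complex.conjCLE : ℂ →L[ℝ] ℂ).hasFDerivAt.comp z hF.hasFDerivAt).fderiv
  rw [wirt, wirt, h]
  simp

lemma wirt_holomorphic (hF : DifferentiableAt ℂ F z) : wirt Complex.I l F z = 0 := by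
  rw [wirt, hF.fderiv_restrictScalars ℝ]
  simp only [ContinuousLinearMap.coe_restrictScalars', map_smul, smul_eq_mul]
  rw [← mul_assoc, Complex.I_mul_I]
  ring

lemma ContDiffOn.wirt (hO : IsOpen O) (hF : ContDiffOn ℝ ∞ F O) :
    ContDiffOn ℝ ∞ (fun z => wirt s l F z) O := by
  have h : ContDiffOn ℝ ∞ (fderiv ℝ F) O := hF.fderiv_of_isOpen hO (by simp)
  unfold FibrationGeometry.wirt
  exact ((h.clm_apply contDiffOn_const).add
    (contDiffOn_const.mul (h.clm_apply contDiffOn_const))).div_const 2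

lemma ContDiffOn.differentiableAt_of_isOpen {E G : Type*} [NormedAddCommGroup E] [NormedSpace ℝ E]
    [NormedAddCommGroup G] [NormedSpace ℝ G] {F : E → G} {O : Set E} {z : E}
    (hF : ContDiffOn ℝ ∞ F O) (hO : IsOpen O) (hz : z ∈ O) : DifferentiableAt ℝ F z :=
  (hF.contDiffAt (hO.mem_nhds hz)).differentiableAt (by simp)

lemma wirt_comm (hO : IsOpen O) (hF : ContDiffOn ℝ ∞ F O) (hz : z ∈ O) :
    wirt s l (fun y => wirt t k F y) z = wirt t k (fun y => wirt s l F y) z := by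
  have h : ContDiffOn ℝ ∞ (fderiv ℝ F) O := hF.fderiv_of_isOpen hO (by simp)
  have hd := ContDiffOn.differentiableAt_of_isOpen h hO hz
  have hsymm : IsSymmSndFDerivAt ℝ F z :=
    (hF.contDiffAt (hO.mem_nhds hz)).isSymmSndFDerivAt
      (by rw [minSmoothness_of_isRCLikeNormedField]; exact WithTop.coe_le_coe.2 (le_top : (2 : ℕ∞) ≤ ⊤))
  have key : ∀ (t : ℂ) (k : Fin m) (u : Fin m → ℂ), fderiv ℝ (fun y => wirt t k F y) z u
      = (fderiv ℝ (fderiv ℝ F) z u (stdVec m k)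
        + t * fderiv ℝ (fderiv ℝ F) z u (Complex.I • stdVec m k)) / 2 := by
    intro t k u
    have e1 : ∀ v, HasFDerivAt (fun y => fderiv ℝ F y v)
        ((ContinuousLinearMap.apply ℝ ℂ v).comp (fderiv ℝ (fderiv ℝ F) z)) z := fun v =>
      (ContinuousLinearMap.apply ℝ ℂ v).hasFDerivAt.comp z hd.hasFDerivAt
    have e2 : HasFDerivAt (fun y => wirt t k F y) _ z :=
      ((e1 (stdVec m k)).add ((e1 (Complex.I • stdVec m k)).const_mul t)).mul_const (2⁻¹ : ℂ)
    rw [e2.fderiv]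
    simp
    ring
  rw [FibrationGeometry.wirt, FibrationGeometry.wirt, key, key, key, key]
  rw [hsymm.eq (stdVec m l) (stdVec m k), hsymm.eq (Complex.I • stdVec m l) (stdVec m k),
    hsymm.eq (stdVec m l) (Complex.I • stdVec m k),
    hsymm.eq (Complex.I • stdVec m l) (Complex.I • stdVec m k)]
  ring

lemma stdVec_sum (u : Fin m → ℂ) : u = ∑ j, u j • stdVec m j := by
  funext i
  simp [stdVec, Finset.sum_apply, Pi.single_apply]

/-- A real function whose `∂̄`-derivatives vanish at a point has zero derivative there. -/
lemma fderiv_eq_zero_of_wirt {f : (Fin m → ℂ) → ℝ} (hf : DifferentiableAt ℝ f z)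
    (h : ∀ k, wirt Complex.I k (fun y => (f y : ℂ)) z = 0) : fderiv ℝ f z = 0 := by
  have hc : fderiv ℝ (fun y => (f y : ℂ)) z = Complex.ofRealCLM.comp (fderiv ℝ f z) :=
    (Complex.ofRealCLM.hasFDerivAt.comp z hf.hasFDerivAt).fderiv
  have h1 : ∀ k, fderiv ℝ f z (stdVec m k) = 0 ∧ fderiv ℝ f z (Complex.I • stdVec m k) = 0 := by
    intro k
    have := h k
    rw [wirt, hc] at this
    have h2 : ((fderiv ℝ f z (stdVec m k) : ℂ)
      + Complex.I * (fderiv ℝ f z (Complex.I • stdVec m k) : ℂ)) = 0 := by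
      simpa using this
    constructor
    · simpa using congrArg Complex.re h2
    · simpa using congrArg Complex.im h2
  ext u
  rw [stdVec_sum u, map_sum, _root_.zero_apply]
  refine Finset.sum_eq_zero fun j _ => ?_
  have : u j • stdVec m j
      = (u j).re • stdVec m j + (u j).im • (Complex.I • stdVec m j) := by
    conv_lhs => rw [← Complex.re_add_im (u j)]
    rw [add_smul, ← smul_smul]
    rfl
  rw [this, map_add, map_smul, map_smul, (h1 j).1, (h1 j).2]
  simp

variable {M N : (Fin m → ℂ) → Matrix (Fin m) (Fin m) ℂ}

lemma wirtM_mul (hM : ∀ i j, DifferentiableAt ℝ (fun y => M y i j) z)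
    (hN : ∀ i j, DifferentiableAt ℝ (fun y => N y i j) z) :
    wirtM s l (fun y => M y * N y) z = wirtM s l M z * N z + M z * wirtM s l N z := by
  ext i j
  simp only [wirtM, Matrix.of_apply, Matrix.mul_apply, Matrix.add_apply]
  rw [wirt_sum _ fun a _ => (hM i a).fun_mul (hN a j), ← Finset.sum_add_distrib]
  exact Finset.sum_congr rfl fun a _ => wirt_mul (hM i a) (hN a j)

lemma wirt_trace (hM : ∀ i j, DifferentiableAt ℝ (fun y => M y i j) z) :
    wirt s l (fun y => (M y).trace) z = (wirtM s l M z).trace := by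
  simp only [Matrix.trace, Matrix.diag, wirtM, Matrix.of_apply]
  exact wirt_sum _ fun i _ => hM i i

lemma wirt_prod {κ : Type*} [DecidableEq κ] (u : Finset κ) {f : κ → (Fin m → ℂ) → ℂ}
    (hf : ∀ i ∈ u, DifferentiableAt ℝ (f i) z) :
    wirt s l (fun y => ∏ i ∈ u, f i y) z
      = ∑ i ∈ u, (∏ j ∈ u.erase i, f j z) * wirt s l (f i) z := by
  have h := HasFDerivAt.finsetProd (u := u) (fun i hi => (hf i hi).hasFDerivAt)
  rw [wirt, h.fderiv]
  simp only [_root_.sum_apply, _root_.smul_apply, smul_eq_mul, wirt]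
  rw [Finset.mul_sum, ← Finset.sum_add_distrib, Finset.sum_div]
  exact Finset.sum_congr rfl fun i _ => by ring

/-- Jacobi's formula. -/
lemma wirt_det (hM : ∀ i j, DifferentiableAt ℝ (fun y => M y i j) z) :
    wirt s l (fun y => (M y).det) z = ((M z).adjugate * wirtM s l M z).trace := by
  have hp : ∀ σ : Equiv.Perm (Fin m), DifferentiableAt ℝ (fun y => ∏ i, M y (σ i) i) z := fun σ =>
    (HasFDerivAt.finsetProd fun i _ => (hM (σ i) i).hasFDerivAt).differentiableAt
  -- The Leibniz expansion differentiates one column at a time; by Cramer's rule each determinant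
  -- with a replaced column is a diagonal entry of the adjugate times the derivative.
  have h1 : wirt s l (fun y => (M y).det) z
      = ∑ i, (Matrix.updateCol (M z) i fun a => wirtM s l M z a i).det := by
    simp only [Matrix.det_apply']
    rw [wirt_sum]
    · rw [Finset.sum_comm]
      refine Finset.sum_congr rfl fun σ _ => ?_
      rw [wirt_const_mul _ (hp σ),
        wirt_prod _ fun i _ => hM _ _, Finset.mul_sum]
      refine Finset.sum_congr rfl fun i _ => ?_
      rw [← Finset.mul_prod_erase Finset.univ _ (Finset.mem_univ i)]
      rw [Matrix.updateCol_self, mul_comm (wirtM s l M z (σ i) i)]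
      congr 2
      refine Finset.prod_congr rfl fun j hj => ?_
      rw [Matrix.updateCol_ne (Finset.ne_of_mem_erase hj)]
    · intro σ _
      exact (hp σ).const_mul _
  rw [h1]
  simp only [Matrix.trace, Matrix.diag]
  refine Finset.sum_congr rfl fun i _ => ?_
  rw [← Matrix.cramer_apply, Matrix.cramer_eq_adjugate_mulVec]
  rfl

lemma wirt_det_of_isUnit (hM : ∀ i j, DifferentiableAt ℝ (fun y => M y i j) z)
    (hdet : IsUnit (M z).det) :
    wirt s l (fun y => (M y).det) z = (M z).det * ((M z)⁻¹ * wirtM s l M z).trace := by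
  rw [wirt_det hM, Matrix.inv_def, Matrix.smul_mul, Matrix.trace_smul, smul_eq_mul, ← mul_assoc,
    Ring.mul_inverse_cancel _ hdet, one_mul]

lemma contDiffOn_det {E : Type*} [NormedAddCommGroup E] [NormedSpace ℝ E] {O : Set E}
    {ι : Type*} [Fintype ι] [DecidableEq ι] {M : E → Matrix ι ι ℂ}
    (hM : ∀ i j, ContDiffOn ℝ ∞ (fun y => M y i j) O) :
    ContDiffOn ℝ ∞ (fun y => (M y).det) O := by
  simp only [Matrix.det_apply']
  exact ContDiffOn.sum fun σ _ => contDiffOn_const.mul (contDiffOn_prod fun i _ => hM _ _)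

lemma contDiffOn_inv {E : Type*} [NormedAddCommGroup E] [NormedSpace ℝ E] {O : Set E}
    {ι : Type*} [Fintype ι] [DecidableEq ι] {M : E → Matrix ι ι ℂ}
    (hM : ∀ i j, ContDiffOn ℝ ∞ (fun y => M y i j) O)
    (hdet : ∀ y ∈ O, (M y).det ≠ 0) (i j : ι) :
    ContDiffOn ℝ ∞ (fun y => (M y)⁻¹ i j) O := by
  have h : ∀ y, (M y)⁻¹ i j
      = ((M y).det)⁻¹ * (Matrix.updateRow (M y) j (Pi.single i 1)).det := by
    intro y
    rw [Matrix.inv_def, Matrix.smul_apply, Ring.inverse_eq_inv', Matrix.adjugate_apply, smul_eq_mul]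
  simp only [h]
  refine ((contDiffOn_det hM).inv hdet).mul (contDiffOn_det fun a b => ?_)
  by_cases ha : a = j
  · subst ha
    simp only [Matrix.updateRow_self]
    exact contDiffOn_const
  · simp only [Matrix.updateRow_ne ha]
    exact hM a b

lemma wirtM_inv (hO : IsOpen O) (hM : ∀ i j, ContDiffOn ℝ ∞ (fun y => M y i j) O)
    (hdet : ∀ y ∈ O, (M y).det ≠ 0) (hz : z ∈ O) :
    wirtM s l (fun y => (M y)⁻¹) z = -((M z)⁻¹ * wirtM s l M z * (M z)⁻¹) := by
  have hd := fun i j => ContDiffOn.differentiableAt_of_isOpen (hM i j) hO hz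
  have hd' := fun i j => ContDiffOn.differentiableAt_of_isOpen (contDiffOn_inv hM hdet i j) hO hz
  have h1 : wirtM s l (fun y => (M y)⁻¹ * M y) z = 0 := by
    ext i j
    simp only [wirtM, Matrix.of_apply, Matrix.zero_apply]
    rw [wirt_congr_of_eqOn hO hz (F' := fun _ => (1 : Matrix (Fin m) (Fin m) ℂ) i j), wirt_const]
    intro y hy
    simp only
    rw [Matrix.nonsing_inv_mul _ (isUnit_iff_ne_zero.2 (hdet y hy))]
  rw [wirtM_mul hd' hd] at h1
  have h2 : wirtM s l (fun y => (M y)⁻¹) z * M z = -((M z)⁻¹ * wirtM s l M z) :=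
    eq_neg_of_add_eq_zero_left h1
  have hu : IsUnit (M z).det := isUnit_iff_ne_zero.2 (hdet z hz)
  calc wirtM s l (fun y => (M y)⁻¹) z
      = wirtM s l (fun y => (M y)⁻¹) z * M z * (M z)⁻¹ := by
        rw [Matrix.mul_assoc, Matrix.mul_nonsing_inv _ hu, Matrix.mul_one]
    _ = _ := by rw [h2, Matrix.neg_mul]

end Wirtinger

/-! ### Pointwise formulas for forms of low degree and their exterior derivatives. -/

section FormLemmas

lemma Form.at₂_antisymm {E M : Type*} [NormedAddCommGroup E] [NormedSpace ℝ E] (η : Form E M 2)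
    (x : M) (u v : E) : η.at₂ x v u = -η.at₂ x u v := by
  have h := (η x).map_swap ![u, v] (show (0 : Fin 2) ≠ 1 by decide)
  refine Eq.trans ?_ h
  refine congrArg (η x) ?_
  funext i
  fin_cases i <;> rfl

lemma Form.at₂_add_left {E M : Type*} [NormedAddCommGroup E] [NormedSpace ℝ E] (η : Form E M 2)
    (x : M) (u u' v : E) : η.at₂ x (u + u') v = η.at₂ x u v + η.at₂ x u' v :=
  (η x).toContinuousMultilinearMap.cons_add ![v] u u'

lemma Form.at₂_smul_left {E M : Type*} [NormedAddCommGroup E] [NormedSpace ℝ E] (η : Form E M 2)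
    (x : M) (r : ℝ) (u v : E) : η.at₂ x (r • u) v = r * η.at₂ x u v :=
  (η x).toContinuousMultilinearMap.cons_smul ![v] r u

lemma Form.at₂_add_right {E M : Type*} [NormedAddCommGroup E] [NormedSpace ℝ E] (η : Form E M 2)
    (x : M) (u v v' : E) : η.at₂ x u (v + v') = η.at₂ x u v + η.at₂ x u v' := by
  rw [η.at₂_antisymm x (v + v'), η.at₂_antisymm x v, η.at₂_antisymm x v', η.at₂_add_left]
  ring

lemma Form.at₂_smul_right {E M : Type*} [NormedAddCommGroup E] [NormedSpace ℝ E] (η : Form E M 2)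
    (x : M) (r : ℝ) (u v : E) : η.at₂ x u (r • v) = r * η.at₂ x u v := by
  rw [η.at₂_antisymm x (r • v), η.at₂_antisymm x v, η.at₂_smul_left]
  ring

lemma Form.isRealBilin {E M : Type*} [NormedAddCommGroup E] [NormedSpace ℂ E] (η : Form E M 2)
    (x : M) : IsRealBilin (η.at₂ x) where
  add_left := η.at₂_add_left x
  add_right := η.at₂_add_right x
  smul_left r u v := η.at₂_smul_left x r u v
  smul_right r u v := η.at₂_smul_right x r u v

variable {E : Type*} [NormedAddCommGroup E] [NormedSpace ℝ E]

lemma extDeriv_one_apply {γ : Form E E 1} {z : E} (h : DifferentiableAt ℝ γ z) (u v : E) :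
    Form.at₂ (fun y => extDeriv γ y) z u v
      = fderiv ℝ (fun y => γ y ![v]) z u - fderiv ℝ (fun y => γ y ![u]) z v := by
  rw [Form.at₂, extDeriv_apply h]
  have h0 : (0 : Fin 2).removeNth ![u, v] = ![v] := by
    funext i; fin_cases i; rfl
  have h1 : (1 : Fin 2).removeNth ![u, v] = ![u] := by
    funext i; fin_cases i; rfl
  rw [Fin.sum_univ_two, h0, h1]
  simp [sub_eq_add_neg]

lemma extDeriv_two_apply {σ : Form E E 2} {z : E} (h : DifferentiableAt ℝ σ z) (a b c : E) :
    extDeriv σ z ![a, b, c]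
      = fderiv ℝ (fun y => σ.at₂ y b c) z a - fderiv ℝ (fun y => σ.at₂ y a c) z b
        + fderiv ℝ (fun y => σ.at₂ y a b) z c := by
  rw [extDeriv_apply h]
  have h0 : (0 : Fin 3).removeNth ![a, b, c] = ![b, c] := by
    funext i; fin_cases i <;> rfl
  have h1 : (1 : Fin 3).removeNth ![a, b, c] = ![a, c] := by
    funext i; fin_cases i <;> rfl
  have h2 : (2 : Fin 3).removeNth ![a, b, c] = ![a, b] := by
    funext i; fin_cases i <;> rfl
  rw [Fin.sum_univ_three, h0, h1, h2]
  simp [Form.at₂, sub_eq_add_neg]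

lemma contDiffOn_form_apply {k : ℕ} {σ : Form E E k} {O : Set E} (h : ContDiffOn ℝ ∞ σ O)
    (v : Fin k → E) : ContDiffOn ℝ ∞ (fun y => σ y v) O :=
  (ContinuousAlternatingMap.apply ℝ E ℝ v).contDiff.comp_contDiffOn h

end FormLemmas

/-! ### Closed (1,1)-forms and Kähler forms on open subsets of ℂ^m. -/

section LocalKahler

variable {m : ℕ} {O : Set (Fin m → ℂ)} {z : Fin m → ℂ}

/-- A smooth closed `(1,1)`-form on an open subset of `ℂ^m`. -/
structure IsClosedOneOneOn (σ : Form (Fin m → ℂ) (Fin m → ℂ) 2) (O : Set (Fin m → ℂ)) : Prop where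
  smooth : ContDiffOn ℝ ∞ σ O
  closed : ∀ z ∈ O, extDeriv σ z = 0
  oneOne : ∀ z ∈ O, ∀ u v, σ.at₂ z (Complex.I • u) (Complex.I • v) = σ.at₂ z u v

/-- A Kähler form on an open subset of `ℂ^m`. -/
structure IsKahlerOn (θ : Form (Fin m → ℂ) (Fin m → ℂ) 2) (O : Set (Fin m → ℂ)) : Prop
    extends IsClosedOneOneOn θ O where
  isOpen : IsOpen O
  pos : ∀ z ∈ O, ∀ v, v ≠ 0 → 0 < θ.at₂ z v (Complex.I • v)

variable {σ θ : Form (Fin m → ℂ) (Fin m → ℂ) 2}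

lemma contDiffOn_hermCoeff {E : Type*} [NormedAddCommGroup E] [NormedSpace ℂ E] {σ : Form E E 2}
    {O : Set E} (h : ContDiffOn ℝ ∞ σ O) (u v : E) :
    ContDiffOn ℝ ∞ (fun y => hermCoeff (σ.at₂ y) u v) O := by
  have h1 : ∀ u v, ContDiffOn ℝ ∞ (fun y => ((σ.at₂ y u v : ℝ) : ℂ)) O := fun u v =>
    Complex.ofRealCLM.contDiff.comp_contDiffOn (contDiffOn_form_apply h _)
  simp only [hermCoeff]
  push_cast
  exact (((h1 _ _).sub (h1 _ _)).sub (contDiffOn_const.mul ((h1 _ _).add (h1 _ _)))).div_const 4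

lemma contDiffOn_metricMatrix (h : ContDiffOn ℝ ∞ σ O) (i j : Fin m) :
    ContDiffOn ℝ ∞ (fun y => metricMatrix σ y i j) O :=
  contDiffOn_hermCoeff h _ _

lemma fderiv_ofReal {E : Type*} [NormedAddCommGroup E] [NormedSpace ℝ E] {f : E → ℝ} {z : E}
    (hf : DifferentiableAt ℝ f z) (u : E) :
    fderiv ℝ (fun y => ((f y : ℝ) : ℂ)) z u = (fderiv ℝ f z u : ℂ) := by
  have h : HasFDerivAt (fun y => ((f y : ℝ) : ℂ)) (Complex.ofRealCLM.comp (fderiv ℝ f z)) z :=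
    Complex.ofRealCLM.hasFDerivAt.comp z hf.hasFDerivAt
  rw [h.fderiv]
  rfl

/-- The Kähler identity `∂_l σ_{jk̄} = ∂_j σ_{lk̄}`. -/
lemma IsClosedOneOneOn.symm (h : IsClosedOneOneOn σ O) (hO : IsOpen O) (hz : z ∈ O)
    (l j k : Fin m) :
    wirtM (-Complex.I) l (metricMatrix σ) z j k = wirtM (-Complex.I) j (metricMatrix σ) z l k := by
  have hd : ∀ a b, DifferentiableAt ℝ (fun y => σ.at₂ y a b) z := fun a b =>
    ContDiffOn.differentiableAt_of_isOpen (contDiffOn_form_apply h.smooth _) hO hz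
  have hc : ∀ a b, DifferentiableAt ℝ (fun y => ((σ.at₂ y a b : ℝ) : ℂ)) z := fun a b =>
    Complex.ofRealCLM.differentiableAt.comp z (hd a b)
  have hcl : ∀ a b c, fderiv ℝ (fun y => σ.at₂ y b c) z a - fderiv ℝ (fun y => σ.at₂ y a c) z b
        + fderiv ℝ (fun y => σ.at₂ y a b) z c = 0 := by
    intro a b c
    rw [← extDeriv_two_apply (ContDiffOn.differentiableAt_of_isOpen h.smooth hO hz), h.closed z hz]
    rfl
  have hev : ∀ {f g : (Fin m → ℂ) → ℝ}, (∀ y ∈ O, f y = g y) → fderiv ℝ f z = fderiv ℝ g z :=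
    fun hfg => (Filter.eventuallyEq_of_mem (hO.mem_nhds hz) hfg).fderiv_eq
  have h11 : ∀ a b, fderiv ℝ (fun y => σ.at₂ y (Complex.I • a) (Complex.I • b)) z
      = fderiv ℝ (fun y => σ.at₂ y a b) z := fun a b => hev fun y hy => h.oneOne y hy a b
  have hI1 : ∀ y ∈ O, ∀ a b, σ.at₂ y (Complex.I • a) b = -σ.at₂ y a (Complex.I • b) := by
    intro y hy a b
    rw [← h.oneOne y hy a (Complex.I • b), smul_smul, Complex.I_mul_I, neg_one_smul,
      (σ.isRealBilin y).neg_right, neg_neg]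
  have hI1' : ∀ a b, fderiv ℝ (fun y => σ.at₂ y (Complex.I • a) b) z
      = -fderiv ℝ (fun y => σ.at₂ y a (Complex.I • b)) z := by
    intro a b
    rw [hev (hI1 · · a b), fderiv_fun_neg]
  have hsw : ∀ a b, fderiv ℝ (fun y => σ.at₂ y b a) z = -fderiv ℝ (fun y => σ.at₂ y a b) z := by
    intro a b
    rw [hev (fun y _ => σ.at₂_antisymm y a b), fderiv_fun_neg]
  have hG : ∀ j k, Set.EqOn (fun y => metricMatrix σ y j k)
      (fun y => ((σ.at₂ y (stdVec m j) (Complex.I • stdVec m k) : ℝ) : ℂ) * 2⁻¹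
        + (-Complex.I * 2⁻¹) * ((σ.at₂ y (stdVec m j) (stdVec m k) : ℝ) : ℂ)) O := by
    intro j k y hy
    simp only [metricMatrix, hermMatrix, Matrix.of_apply]
    rw [hermCoeff_of_oneOne (σ.isRealBilin y) (h.oneOne y hy)]
    ring
  have hw : ∀ l j k, wirtM (-Complex.I) l (metricMatrix σ) z j k
      = ((fderiv ℝ (fun y => σ.at₂ y (stdVec m j) (Complex.I • stdVec m k)) z (stdVec m l) : ℂ)
        - Complex.I * (fderiv ℝ (fun y => σ.at₂ y (stdVec m j) (stdVec m k)) z (stdVec m l) : ℂ)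
        - Complex.I * (fderiv ℝ (fun y => σ.at₂ y (stdVec m j) (Complex.I • stdVec m k)) z
            (Complex.I • stdVec m l) : ℂ)
        - (fderiv ℝ (fun y => σ.at₂ y (stdVec m j) (stdVec m k)) z
            (Complex.I • stdVec m l) : ℂ)) / 4 := by
    intro l j k
    rw [wirtM, Matrix.of_apply, wirt_congr_of_eqOn hO hz (hG j k),
      wirt_add ((hc _ _).mul_const _) ((hc _ _).const_mul _), wirt_const_mul _ (hc _ _),
      wirt_mul (hc _ _) (differentiableAt_const _), wirt_const]
    simp only [wirt, fderiv_ofReal (hd _ _)]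
    linear_combination (fderiv ℝ (fun y => σ.at₂ y (stdVec m j) (stdVec m k)) z
            (Complex.I • stdVec m l) : ℂ) / 4 * Complex.I_mul_I
  rw [hw, hw]
  set a := stdVec m l
  set b := stdVec m j
  set c := stdVec m k
  set i := Complex.I
  -- The identity is the (2,1)-part of dσ = 0. Expanded over ℝ and reduced by invariance under the
  -- complex structure, it is a combination of closedness on four real triples.
  have c3 := hcl (i • a) b (i • c)
  have c4 := hcl (i • b) a (i • c)
  have c5 := hcl (i • a) b c
  have c6 := hcl (i • b) a c
  rw [h11] at c3 c4
  rw [hI1' a b] at c3 c5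
  rw [hI1' b a, hsw (i • a) b, hI1' a b] at c4 c6
  rw [hI1' a c] at c5
  rw [hI1' b c] at c6
  have c3' := congrArg (fun r : ℝ => (r : ℂ)) c3
  have c4' := congrArg (fun r : ℝ => (r : ℂ)) c4
  have c5' := congrArg (fun r : ℝ => (r : ℂ)) c5
  have c6' := congrArg (fun r : ℝ => (r : ℂ)) c6
  simp only [_root_.neg_apply] at c3' c4' c5' c6'
  push_cast at c3' c4' c5' c6'
  linear_combination -i / 4 * c3' + i / 4 * c4' - c5' / 4 + c6' / 4

end LocalKahler

/-! ### The operator i∂∂̄ and its naturality under holomorphic maps. -/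

section Iddbar

variable {E E' : Type*} [NormedAddCommGroup E] [NormedSpace ℂ E]
  [NormedAddCommGroup E'] [NormedSpace ℂ E']

lemma two_le_infty : (2 : WithTop ℕ∞) ≤ ∞ := WithTop.coe_le_coe.2 (le_top : (2 : ℕ∞) ≤ ⊤)

lemma differentiableAt_fderiv {G : Type*} [NormedAddCommGroup G] [NormedSpace ℝ G] {f : E → G}
    {z : E} (hf : ContDiffAt ℝ 2 f z) : DifferentiableAt ℝ (fderiv ℝ f) z :=
  (hf.fderiv_right (m := 1) (by norm_num)).differentiableAt (by norm_num)

lemma iddbar_apply {f : E → ℝ} {z : E} (hf : ContDiffAt ℝ 2 f z) (u v : E) :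
    (iddbar f).at₂ z u v = (fderiv ℝ (fderiv ℝ f) z v (Complex.I • u)
      - fderiv ℝ (fderiv ℝ f) z u (Complex.I • v)) / 2 := by
  have hd := differentiableAt_fderiv hf
  have hdc : DifferentiableAt ℝ (dc f) z := by
    have h1 : DifferentiableAt ℝ (fun y => -((fderiv ℝ f y).comp (complexJ : E →L[ℝ] E))) z :=
      (hd.clm_comp (differentiableAt_const _)).neg
    exact (ContinuousAlternatingMap.ofSubsingletonLIE (𝕜 := ℝ) (E := E) (F := ℝ)
      (0 : Fin 1)).toContinuousLinearEquiv.differentiableAt.comp z h1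
  have h2 : ∀ v w : E, fderiv ℝ (fun y => dc f y ![v]) z w
      = -fderiv ℝ (fderiv ℝ f) z w (Complex.I • v) := by
    intro v w
    have h3 : HasFDerivAt (fun y => -(fderiv ℝ f y (Complex.I • v)))
        (-((ContinuousLinearMap.apply ℝ ℝ (Complex.I • v)).comp (fderiv ℝ (fderiv ℝ f) z))) z :=
      ((ContinuousLinearMap.apply ℝ ℝ (Complex.I • v)).hasFDerivAt.comp z hd.hasFDerivAt).neg
    have h4 : (fun y => dc f y ![v]) = fun y => -(fderiv ℝ f y (Complex.I • v)) := by
      funext y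
      simp [dc, complexJ]
    rw [h4, h3.fderiv]
    simp
  have h5 := extDeriv_one_apply hdc u v
  rw [h2, h2] at h5
  have h6 : (iddbar f).at₂ z u v = (1 / 2) * Form.at₂ (fun y => extDeriv (dc f) y) z u v := rfl
  rw [h6, h5]
  ring

lemma iddbar_oneOne {f : E → ℝ} {z : E} (hf : ContDiffAt ℝ 2 f z) (u v : E) :
    (iddbar f).at₂ z (Complex.I • u) (Complex.I • v) = (iddbar f).at₂ z u v := by
  have hs : IsSymmSndFDerivAt ℝ f z :=
    hf.isSymmSndFDerivAt (by rw [minSmoothness_of_isRCLikeNormedField])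
  rw [iddbar_apply hf, iddbar_apply hf, smul_smul, smul_smul, Complex.I_mul_I, neg_one_smul,
    neg_one_smul, map_neg, map_neg, hs.eq (Complex.I • v) u, hs.eq (Complex.I • u) v]
  ring

/-- `i∂∂̄` commutes with pullback by holomorphic maps. -/
lemma iddbar_comp {f : E' → ℝ} {τ : E → E'} {z : E} (hf : ContDiffAt ℝ 2 f (τ z))
    (hτ : ContDiffAt ℂ 2 τ z) (u v : E) :
    (iddbar (f ∘ τ)).at₂ z u v
      = (iddbar f).at₂ (τ z) (fderiv ℝ τ z u) (fderiv ℝ τ z v) := by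
  have hτR : ContDiffAt ℝ 2 τ z := hτ.restrict_scalars ℝ
  have hτd : ∀ᶠ y in nhds z, DifferentiableAt ℂ τ y := by
    filter_upwards [hτ.eventually (by simp)] with y hy
    exact hy.differentiableAt (by norm_num)
  have hlin : ∀ y, DifferentiableAt ℂ τ y → ∀ w : E,
      fderiv ℝ τ y (Complex.I • w) = Complex.I • fderiv ℝ τ y w := by
    intro y hy w
    rw [hy.fderiv_restrictScalars ℝ]
    simp
  have hfd : ∀ᶠ y in nhds z, DifferentiableAt ℝ f (τ y) := by
    have := hf.eventually (by simp)
    filter_upwards [hτR.continuousAt.eventually this] with y hy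
    exact hy.differentiableAt (by norm_num)
  have hd1 : fderiv ℝ (f ∘ τ) =ᶠ[nhds z] fun y => (fderiv ℝ f (τ y)).comp (fderiv ℝ τ y) := by
    filter_upwards [hτd, hfd] with y hy1 hy2
    exact fderiv_comp y hy2 (hy1.restrictScalars ℝ)
  have hdf := differentiableAt_fderiv hf
  have hdτ := differentiableAt_fderiv hτR
  have hτ1 : DifferentiableAt ℝ τ z := hτR.differentiableAt (by norm_num)
  -- Besides the pulled back Hessian, the chain rule produces Df applied to D²τ. Holomorphy makes
  -- D²τ complex bilinear, so this extra term is the same for (v, iu) and (u, iv) and cancels in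
  -- i∂∂̄.
  have hd2 : ∀ a b, fderiv ℝ (fderiv ℝ (f ∘ τ)) z a b
      = fderiv ℝ (fderiv ℝ f) (τ z) (fderiv ℝ τ z a) (fderiv ℝ τ z b)
        + fderiv ℝ f (τ z) (fderiv ℝ (fderiv ℝ τ) z a b) := by
    intro a b
    rw [hd1.fderiv_eq]
    have hc : HasFDerivAt (fun y => fderiv ℝ f (τ y))
        ((fderiv ℝ (fderiv ℝ f) (τ z)).comp (fderiv ℝ τ z)) z :=
      hdf.hasFDerivAt.comp z hτ1.hasFDerivAt
    rw [(hc.clm_comp hdτ.hasFDerivAt).fderiv]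
    simp [add_comm]
  have hs : IsSymmSndFDerivAt ℝ τ z :=
    hτR.isSymmSndFDerivAt (by rw [minSmoothness_of_isRCLikeNormedField])
  have hI : ∀ a b, fderiv ℝ (fderiv ℝ τ) z a (Complex.I • b)
      = Complex.I • fderiv ℝ (fderiv ℝ τ) z a b := by
    intro a b
    have h1 : HasFDerivAt (fun y => fderiv ℝ τ y (Complex.I • b))
        ((ContinuousLinearMap.apply ℝ E' (Complex.I • b)).comp (fderiv ℝ (fderiv ℝ τ) z)) z :=
      (ContinuousLinearMap.apply ℝ E' (Complex.I • b)).hasFDerivAt.comp z hdτ.hasFDerivAt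
    have h2 : HasFDerivAt (fun y => Complex.I • fderiv ℝ τ y b)
        (Complex.I • ((ContinuousLinearMap.apply ℝ E' b).comp (fderiv ℝ (fderiv ℝ τ) z))) z :=
      ((ContinuousLinearMap.apply ℝ E' b).hasFDerivAt.comp z hdτ.hasFDerivAt).const_smul Complex.I
    have h3 : (fun y => fderiv ℝ τ y (Complex.I • b)) =ᶠ[nhds z]
        fun y => Complex.I • fderiv ℝ τ y b := by
      filter_upwards [hτd] with y hy
      exact hlin y hy b
    have h4 := h3.fderiv_eq (𝕜 := ℝ)
    rw [h1.fderiv, h2.fderiv] at h4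
    exact congrArg (fun L : E →L[ℝ] E' => L a) h4
  have hzl := hlin z hτd.self_of_nhds
  have hcomp : ContDiffAt ℝ 2 (f ∘ τ) z := hf.comp z hτR
  rw [iddbar_apply hcomp, iddbar_apply hf, hd2, hd2, hI, hI, hzl, hzl, hs.eq v u]
  ring

end Iddbar

/-! ### Hermitian coefficients of i∂∂̄f and of exact two-forms. -/

section LocalKahler

variable {m : ℕ} {O K : Set (Fin m → ℂ)} {z : Fin m → ℂ}
  {σ θ : Form (Fin m → ℂ) (Fin m → ℂ) 2}

lemma wirt_ofReal {f : (Fin m → ℂ) → ℝ} (hf : DifferentiableAt ℝ f z) (s : ℂ) (k : Fin m) :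
    wirt s k (fun y => (f y : ℂ)) z = ((fderiv ℝ f z (stdVec m k) : ℂ)
      + s * (fderiv ℝ f z (Complex.I • stdVec m k) : ℂ)) / 2 := by
  rw [wirt, fderiv_ofReal hf, fderiv_ofReal hf]

lemma contDiffOn_ofReal {E : Type*} [NormedAddCommGroup E] [NormedSpace ℝ E] {f : E → ℝ}
    {O : Set E} (hf : ContDiffOn ℝ ∞ f O) : ContDiffOn ℝ ∞ (fun y => (f y : ℂ)) O :=
  Complex.ofRealCLM.contDiff.comp_contDiffOn hf

lemma hermCoeff_iddbar {f : (Fin m → ℂ) → ℝ} (hO : IsOpen O) (hf : ContDiffOn ℝ ∞ f O) (hz : z ∈ O)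
    (j k : Fin m) :
    hermCoeff ((iddbar f).at₂ z) (stdVec m j) (stdVec m k)
      = wirt (-Complex.I) j (fun y => wirt Complex.I k (fun x => (f x : ℂ)) y) z := by
  have hf2 : ContDiffAt ℝ 2 f z := (hf.contDiffAt (hO.mem_nhds hz)).of_le two_le_infty
  have hs : IsSymmSndFDerivAt ℝ f z :=
    hf2.isSymmSndFDerivAt (by rw [minSmoothness_of_isRCLikeNormedField])
  have hd := differentiableAt_fderiv hf2
  have hda : ∀ v, DifferentiableAt ℝ (fun y => fderiv ℝ f y v) z := fun v =>
    hd.clm_apply (differentiableAt_const v)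
  have hdv : ∀ v w, fderiv ℝ (fun y => fderiv ℝ f y v) z w = fderiv ℝ (fderiv ℝ f) z w v := by
    intro v w
    have h3 : HasFDerivAt (fun y => fderiv ℝ f y v)
        ((ContinuousLinearMap.apply ℝ ℝ v).comp (fderiv ℝ (fderiv ℝ f) z)) z :=
      (ContinuousLinearMap.apply ℝ ℝ v).hasFDerivAt.comp z hd.hasFDerivAt
    rw [h3.fderiv]
    rfl
  have hdc : ∀ v, DifferentiableAt ℝ (fun y => ((fderiv ℝ f y v : ℝ) : ℂ)) z := fun v =>
    Complex.ofRealCLM.differentiableAt.comp z (hda v)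
  have h1 : Set.EqOn (fun y => wirt Complex.I k (fun x => (f x : ℂ)) y)
      (fun y => 2⁻¹ * ((fderiv ℝ f y (stdVec m k) : ℝ) : ℂ)
        + (Complex.I * 2⁻¹) * ((fderiv ℝ f y (Complex.I • stdVec m k) : ℝ) : ℂ)) O := by
    intro y hy
    simp only
    rw [wirt_ofReal (ContDiffOn.differentiableAt_of_isOpen hf hO hy)]
    ring
  rw [wirt_congr_of_eqOn hO hz h1, wirt_add ((hdc _).const_mul _) ((hdc _).const_mul _),
    wirt_const_mul _ (hdc _), wirt_const_mul _ (hdc _), wirt_ofReal (hda _), wirt_ofReal (hda _),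
    hdv, hdv, hdv, hdv, hermCoeff]
  simp only [iddbar_apply hf2, smul_smul, Complex.I_mul_I, neg_one_smul, map_neg]
  rw [hs.eq (Complex.I • stdVec m k) (Complex.I • stdVec m j), hs.eq (stdVec m k) (stdVec m j),
    hs.eq (stdVec m k) (Complex.I • stdVec m j), hs.eq (Complex.I • stdVec m k) (stdVec m j)]
  push_cast
  linear_combination (-((fderiv ℝ (fderiv ℝ f) z (Complex.I • stdVec m j)
    (Complex.I • stdVec m k) : ℝ) : ℂ) / 4) * (-1) * Complex.I_mul_I

/-- The `(0,1)`-coefficients of a real one-form. -/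
def coeff01 (γ : Form (Fin m → ℂ) (Fin m → ℂ) 1) (k : Fin m) (y : Fin m → ℂ) : ℂ :=
  ((γ y ![stdVec m k] : ℂ) + Complex.I * (γ y ![Complex.I • stdVec m k] : ℂ)) / 2

lemma contDiffOn_coeff01 {γ : Form (Fin m → ℂ) (Fin m → ℂ) 1} (hγ : ContDiffOn ℝ ∞ γ O)
    (k : Fin m) : ContDiffOn ℝ ∞ (coeff01 γ k) O := by
  have h1 : ∀ v, ContDiffOn ℝ ∞ (fun y => ((γ y ![v] : ℝ) : ℂ)) O := fun v =>
    contDiffOn_ofReal (contDiffOn_form_apply hγ _)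
  exact ((h1 _).add (contDiffOn_const.mul (h1 _))).div_const 2

/-- The (1,1)-part of dγ is ∂γ^{0,1} plus its conjugate, since γ is real. The factor -i is the
normalization of `hermCoeff`, and transposing the indices of the conjugate term produces the minus
sign. -/
lemma hermCoeff_extDeriv {γ : Form (Fin m → ℂ) (Fin m → ℂ) 1} (hO : IsOpen O)
    (hγ : ContDiffOn ℝ ∞ γ O) (hz : z ∈ O) (j k : Fin m) :
    hermCoeff (Form.at₂ (fun y => extDeriv γ y) z) (stdVec m j) (stdVec m k)
      = -Complex.I * (wirt (-Complex.I) j (coeff01 γ k) z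
        - star (wirt (-Complex.I) k (coeff01 γ j) z)) := by
  have hd := ContDiffOn.differentiableAt_of_isOpen hγ hO hz
  have hdv : ∀ v, DifferentiableAt ℝ (fun y => γ y ![v]) z := fun v =>
    ContDiffOn.differentiableAt_of_isOpen (contDiffOn_form_apply hγ _) hO hz
  have hdc : ∀ v, DifferentiableAt ℝ (fun y => ((γ y ![v] : ℝ) : ℂ)) z := fun v =>
    Complex.ofRealCLM.differentiableAt.comp z (hdv v)
  have hw : ∀ j k, wirt (-Complex.I) j (coeff01 γ k) z
      = (wirt (-Complex.I) j (fun y => ((γ y ![stdVec m k] : ℝ) : ℂ)) z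
        + Complex.I * wirt (-Complex.I) j
          (fun y => ((γ y ![Complex.I • stdVec m k] : ℝ) : ℂ)) z) / 2 := by
    intro j k
    have : coeff01 γ k = fun y => 2⁻¹ * ((γ y ![stdVec m k] : ℝ) : ℂ)
        + (Complex.I * 2⁻¹) * ((γ y ![Complex.I • stdVec m k] : ℝ) : ℂ) := by
      funext y
      rw [coeff01]
      ring
    rw [this, wirt_add ((hdc _).const_mul _) ((hdc _).const_mul _), wirt_const_mul _ (hdc _),
      wirt_const_mul _ (hdc _)]
    ring
  rw [hw, hw]
  simp only [wirt_ofReal (hdv _), hermCoeff, extDeriv_one_apply hd, star_add, star_mul', star_div₀,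
    Complex.star_def, Complex.conj_ofReal, Complex.conj_I, map_neg, map_ofNat]
  push_cast
  ring_nf
  simp only [Complex.I_sq, Complex.I_pow_three]
  ring

end LocalKahler

/-! ### Divergences, the Ricci potential and the Laplacian of a local Kähler metric. -/

section LocalKahlerIdentities

variable {m : ℕ} {O K : Set (Fin m → ℂ)} {z : Fin m → ℂ}
  {σ θ : Form (Fin m → ℂ) (Fin m → ℂ) 2}

lemma linearIndependent_stdVec : LinearIndependent ℂ (stdVec m) := by
  have := (Pi.basisFun ℂ (Fin m)).linearIndependent
  convert this using 1
  funext j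
  simp [stdVec]

lemma IsKahlerOn.posDef (h : IsKahlerOn θ O) (hz : z ∈ O) : (metricMatrix θ z).PosDef :=
  hermMatrix_posDef (θ.isRealBilin z) (h.oneOne z hz) (θ.at₂_antisymm z) linearIndependent_stdVec
    fun v _ hv => h.pos z hz v hv

lemma IsKahlerOn.det_ne_zero (h : IsKahlerOn θ O) (hz : z ∈ O) : (metricMatrix θ z).det ≠ 0 :=
  (h.posDef hz).det_pos.ne'

lemma IsKahlerOn.isUnit_det (h : IsKahlerOn θ O) (hz : z ∈ O) : IsUnit (metricMatrix θ z).det :=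
  isUnit_iff_ne_zero.2 (h.det_ne_zero hz)

lemma IsKahlerOn.det_re_pos (h : IsKahlerOn θ O) (hz : z ∈ O) :
    0 < (metricMatrix θ z).det.re :=
  (Complex.lt_def.1 (h.posDef hz).det_pos).1

lemma IsKahlerOn.det_im (h : IsKahlerOn θ O) (hz : z ∈ O) : (metricMatrix θ z).det.im = 0 :=
  (Complex.lt_def.1 (h.posDef hz).det_pos).2.symm

lemma IsKahlerOn.det_eq (h : IsKahlerOn θ O) (hz : z ∈ O) :
    (metricMatrix θ z).det = ((metricMatrix θ z).det.re : ℂ) := by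
  apply Complex.ext <;> simp [h.det_im hz]

lemma IsKahlerOn.contDiffOn_matrix (h : IsKahlerOn θ O) (i j : Fin m) :
    ContDiffOn ℝ ∞ (fun y => metricMatrix θ y i j) O :=
  contDiffOn_metricMatrix h.smooth i j

lemma IsKahlerOn.contDiffOn_inv (h : IsKahlerOn θ O) (i j : Fin m) :
    ContDiffOn ℝ ∞ (fun y => (metricMatrix θ y)⁻¹ i j) O :=
  FibrationGeometry.contDiffOn_inv h.contDiffOn_matrix (fun _ hy => h.det_ne_zero hy) i j

/-- Raising the index of a `(0,1)`-form with the metric. -/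
def raise (θ : Form (Fin m → ℂ) (Fin m → ℂ) 2) (c : Fin m → (Fin m → ℂ) → ℂ) (l : Fin m)
    (y : Fin m → ℂ) : ℂ :=
  ∑ k, (metricMatrix θ y)⁻¹ k l * c k y

variable {c : Fin m → (Fin m → ℂ) → ℂ}

lemma IsKahlerOn.contDiffOn_raise (h : IsKahlerOn θ O) (hc : ∀ k, ContDiffOn ℝ ∞ (c k) O)
    (l : Fin m) : ContDiffOn ℝ ∞ (raise θ c l) O :=
  ContDiffOn.sum fun k _ => (h.contDiffOn_inv k l).mul (hc k)

lemma IsKahlerOn.lower_raise (h : IsKahlerOn θ O) (hz : z ∈ O) (k : Fin m) :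
    ∑ j, metricMatrix θ z j k * raise θ c j z = c k z := by
  simp only [raise, Finset.mul_sum]
  rw [Finset.sum_comm]
  have h1 : ∀ a, ∑ j, metricMatrix θ z j k * ((metricMatrix θ z)⁻¹ a j * c a z)
      = (1 : Matrix (Fin m) (Fin m) ℂ) a k * c a z := by
    intro a
    rw [← Matrix.nonsing_inv_mul _ (h.isUnit_det hz), Matrix.mul_apply, Finset.sum_mul]
    exact Finset.sum_congr rfl fun j _ => by ring
  simp only [h1, Matrix.one_apply, ite_mul, one_mul, zero_mul, Finset.sum_ite_eq',
    Finset.mem_univ, if_true]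

lemma IsKahlerOn.raise_lower (h : IsKahlerOn θ O) (hz : z ∈ O) (v : Fin m → ℂ) (l : Fin m) :
    ∑ k, (metricMatrix θ z)⁻¹ k l * ∑ j, metricMatrix θ z j k * v j = v l := by
  simp only [Finset.mul_sum]
  rw [Finset.sum_comm]
  have h1 : ∀ j, ∑ k, (metricMatrix θ z)⁻¹ k l * (metricMatrix θ z j k * v j)
      = (1 : Matrix (Fin m) (Fin m) ℂ) j l * v j := by
    intro j
    rw [← Matrix.mul_nonsing_inv _ (h.isUnit_det hz), Matrix.mul_apply, Finset.sum_mul]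
    exact Finset.sum_congr rfl fun j _ => by ring
  simp only [h1, Matrix.one_apply, ite_mul, one_mul, zero_mul, Finset.sum_ite_eq',
    Finset.mem_univ, if_true]

/-- `g^{lk̄} ∂_l c_k̄` is the divergence of the vector field obtained by raising the index. -/
lemma IsKahlerOn.trace_wirt_eq_div (h : IsKahlerOn θ O) (hc : ∀ k, ContDiffOn ℝ ∞ (c k) O)
    (hz : z ∈ O) :
    ∑ k, ∑ l, (metricMatrix θ z)⁻¹ k l * wirt (-Complex.I) l (c k) z
      = ∑ l, wirt (-Complex.I) l (raise θ c l) z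
        + ∑ l, raise θ c l z *
          ((metricMatrix θ z)⁻¹ * wirtM (-Complex.I) l (metricMatrix θ) z).trace := by
  have hG := fun i j => ContDiffOn.differentiableAt_of_isOpen (h.contDiffOn_matrix i j) h.isOpen hz
  have hv := fun l => ContDiffOn.differentiableAt_of_isOpen (h.contDiffOn_raise hc l) h.isOpen hz
  -- Differentiate c_k = g_{jk̄} v^j. The Kähler identity exchanges ∂_l g_{jk̄} for ∂_j g_{lk̄}, so
  -- that after contraction the second term becomes v^j tr(g⁻¹ ∂_j g).
  have h1 : ∀ k l, wirt (-Complex.I) l (c k) z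
      = ∑ j, metricMatrix θ z j k * wirt (-Complex.I) l (raise θ c j) z
        + ∑ j, wirtM (-Complex.I) j (metricMatrix θ) z l k * raise θ c j z := by
    intro k l
    rw [wirt_congr_of_eqOn h.isOpen hz (F' := fun y => ∑ j, metricMatrix θ y j k * raise θ c j y)
      fun y hy => (h.lower_raise hy k).symm, wirt_sum _ fun j _ => (hG j k).fun_mul (hv j),
      ← Finset.sum_add_distrib]
    refine Finset.sum_congr rfl fun j _ => ?_
    rw [wirt_mul (hG j k) (hv j), h.toIsClosedOneOneOn.symm h.isOpen hz j l k, add_comm]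
    rfl
  simp only [h1, mul_add, Finset.sum_add_distrib]
  congr 1
  · rw [Finset.sum_comm]
    exact Finset.sum_congr rfl fun l _ =>
      h.raise_lower hz (fun j => wirt (-Complex.I) l (raise θ c j) z) l
  · simp only [Finset.mul_sum, Matrix.trace, Matrix.diag, Matrix.mul_apply]
    rw [show (∑ k, ∑ l, ∑ j, (metricMatrix θ z)⁻¹ k l
        * (wirtM (-Complex.I) j (metricMatrix θ) z l k * raise θ c j z))
      = ∑ k, ∑ j, ∑ l, (metricMatrix θ z)⁻¹ k l
        * (wirtM (-Complex.I) j (metricMatrix θ) z l k * raise θ c j z) from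
        Finset.sum_congr rfl fun k _ => Finset.sum_comm, Finset.sum_comm]
    refine Finset.sum_congr rfl fun j _ => Finset.sum_congr rfl fun k _ =>
      Finset.sum_congr rfl fun l _ => by ring

/-- By Jacobi's formula the correction term in `trace_wirt_eq_div` is v^l ∂_l log det g.
Multiplication by det g therefore produces a Euclidean divergence, and Stokes' theorem for Lebesgue
measure becomes applicable. -/
lemma IsKahlerOn.div_det_raise (h : IsKahlerOn θ O) (hc : ∀ k, ContDiffOn ℝ ∞ (c k) O)
    (hz : z ∈ O) :
    ∑ l, wirt (-Complex.I) l (fun y => (metricMatrix θ y).det * raise θ c l y) z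
      = (metricMatrix θ z).det *
        ∑ k, ∑ l, (metricMatrix θ z)⁻¹ k l * wirt (-Complex.I) l (c k) z := by
  have hG := fun i j => ContDiffOn.differentiableAt_of_isOpen (h.contDiffOn_matrix i j) h.isOpen hz
  have hv := fun l => ContDiffOn.differentiableAt_of_isOpen (h.contDiffOn_raise hc l) h.isOpen hz
  have hdet : DifferentiableAt ℝ (fun y => (metricMatrix θ y).det) z :=
    ContDiffOn.differentiableAt_of_isOpen (contDiffOn_det h.contDiffOn_matrix) h.isOpen hz
  rw [h.trace_wirt_eq_div hc hz, mul_add, Finset.mul_sum, Finset.mul_sum,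
    ← Finset.sum_add_distrib]
  refine Finset.sum_congr rfl fun l _ => ?_
  rw [wirt_mul hdet (hv l), wirt_det_of_isUnit hG (h.isUnit_det hz)]
  ring

/-- The Kähler potential `-log det g` of the Ricci form. -/
def ricciPotential (θ : Form (Fin m → ℂ) (Fin m → ℂ) 2) (y : Fin m → ℂ) : ℝ :=
  -Real.log (metricMatrix θ y).det.re

lemma IsKahlerOn.contDiffOn_ricciPotential (h : IsKahlerOn θ O) :
    ContDiffOn ℝ ∞ (ricciPotential θ) O := by
  have h1 : ContDiffOn ℝ ∞ (fun y => (metricMatrix θ y).det.re) O :=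
    Complex.reCLM.contDiff.comp_contDiffOn (contDiffOn_det h.contDiffOn_matrix)
  exact (h1.log fun y hy => (h.det_re_pos hy).ne').neg

lemma IsKahlerOn.wirt_ricciPotential (h : IsKahlerOn θ O) (hz : z ∈ O) (s : ℂ) (l : Fin m) :
    wirt s l (fun y => (ricciPotential θ y : ℂ)) z
      = -((metricMatrix θ z)⁻¹ * wirtM s l (metricMatrix θ) z).trace := by
  have hG := fun i j => ContDiffOn.differentiableAt_of_isOpen (h.contDiffOn_matrix i j) h.isOpen hz
  have hdet : ContDiffOn ℝ ∞ (fun y => (metricMatrix θ y).det.re) O :=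
    Complex.reCLM.contDiff.comp_contDiffOn (contDiffOn_det h.contDiffOn_matrix)
  have hd := ContDiffOn.differentiableAt_of_isOpen hdet h.isOpen hz
  have hpos := h.det_re_pos hz
  have h1 : wirt s l (fun y => (metricMatrix θ y).det) z
      = wirt s l (fun y => (((metricMatrix θ y).det.re : ℝ) : ℂ)) z :=
    wirt_congr_of_eqOn h.isOpen hz fun y hy => h.det_eq hy
  rw [wirt_det_of_isUnit hG (h.isUnit_det hz), wirt_ofReal hd] at h1
  have h2 : fderiv ℝ (ricciPotential θ) z
      = -((metricMatrix θ z).det.re⁻¹ • fderiv ℝ (fun y => (metricMatrix θ y).det.re) z) := by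
    have := (hd.hasFDerivAt.log hpos.ne').neg
    exact this.fderiv
  rw [wirt_ofReal (ContDiffOn.differentiableAt_of_isOpen h.contDiffOn_ricciPotential h.isOpen hz),
    h2]
  have hne : (metricMatrix θ z).det ≠ 0 := h.det_ne_zero hz
  have h3 : ((metricMatrix θ z)⁻¹ * wirtM s l (metricMatrix θ) z).trace
      = (metricMatrix θ z).det⁻¹ * ((metricMatrix θ z).det
        * ((metricMatrix θ z)⁻¹ * wirtM s l (metricMatrix θ) z).trace) := by
    rw [← mul_assoc, inv_mul_cancel₀ hne, one_mul]
  rw [h3, h1]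
  conv_rhs => rw [h.det_eq hz]
  simp only [_root_.neg_apply, _root_.smul_apply, smul_eq_mul]
  push_cast
  ring

/-- Taking real parts in `contraction` loses nothing when both matrices are hermitian, so complex
identities can be used throughout. -/
lemma trace_mul_re {ι : Type*} [Fintype ι] {H S : Matrix ι ι ℂ} (hH : H.IsHermitian)
    (hS : S.IsHermitian) : (H * S).trace = ((H * S).trace.re : ℂ) := by
  have : star (H * S).trace = (H * S).trace := by
    rw [← Matrix.trace_conjTranspose, Matrix.conjTranspose_mul, hH.eq, hS.eq, Matrix.trace_mul_comm]
  exact (Complex.conj_eq_iff_re.1 this).symm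

lemma trace_mul_eq_sum {ι : Type*} [Fintype ι] (H S : Matrix ι ι ℂ) :
    (H * S).trace = ∑ k, ∑ l, H k l * S l k := by
  simp [Matrix.trace, Matrix.mul_apply]

lemma dbarCoeff_eq {f : (Fin m → ℂ) → ℝ} (hf : DifferentiableAt ℝ f z) (k : Fin m) :
    dbarCoeff f z k = wirt Complex.I k (fun y => (f y : ℂ)) z := by
  rw [wirt_ofReal hf]
  rfl

lemma grad10_eq {f : (Fin m → ℂ) → ℝ} (hf : DifferentiableAt ℝ f z) (l : Fin m) :
    grad10 θ f z l = raise θ (fun k y => wirt Complex.I k (fun x => (f x : ℂ)) y) l z := by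
  simp only [grad10, raise, Matrix.mulVec, dotProduct, ← Matrix.transpose_nonsing_inv,
    Matrix.transpose_apply, dbarCoeff_eq hf]

/-- The Laplacian as a complex trace. -/
lemma IsKahlerOn.localLaplacian_eq (h : IsKahlerOn θ O) {f : (Fin m → ℂ) → ℝ}
    (hf : ContDiffOn ℝ ∞ f O) (hz : z ∈ O) :
    (localLaplacian θ f z : ℂ) = -∑ k, ∑ l, (metricMatrix θ z)⁻¹ k l
      * wirt (-Complex.I) l (fun y => wirt Complex.I k (fun x => (f x : ℂ)) y) z := by
  have h1 : (localLaplacian θ f z : ℂ) = -((((metricMatrix θ z)⁻¹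
      * hermMatrix (stdVec m) ((iddbar f).at₂ z)).trace.re : ℝ) : ℂ) := by
    rw [localLaplacian, contraction]
    push_cast
    rfl
  rw [h1, ← trace_mul_re (h.posDef hz).isHermitian.inv
    (hermMatrix_isHermitian ((iddbar f).at₂_antisymm z) _), trace_mul_eq_sum]
  congr 1
  refine Finset.sum_congr rfl fun k _ => Finset.sum_congr rfl fun l _ => ?_
  rw [← hermCoeff_iddbar h.isOpen hf hz]
  rfl

lemma IsKahlerOn.contDiffOn_localLaplacian (h : IsKahlerOn θ O) {f : (Fin m → ℂ) → ℝ}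
    (hf : ContDiffOn ℝ ∞ f O) : ContDiffOn ℝ ∞ (localLaplacian θ f) O := by
  have h1 : ContDiffOn ℝ ∞ (fun z => -∑ k, ∑ l, (metricMatrix θ z)⁻¹ k l
      * wirt (-Complex.I) l (fun y => wirt Complex.I k (fun x => (f x : ℂ)) y) z) O :=
    (ContDiffOn.sum fun k _ => ContDiffOn.sum fun l _ => (h.contDiffOn_inv k l).mul
      (ContDiffOn.wirt h.isOpen (ContDiffOn.wirt h.isOpen (contDiffOn_ofReal hf)))).neg
  refine (Complex.reCLM.contDiff.comp_contDiffOn h1).congr fun z hz => ?_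
  rw [Function.comp_apply, ← h.localLaplacian_eq hf hz]
  rfl

/-- This is the form in which the Einstein condition is used: -log det g is then a Kähler potential
of θ, to second order at the point. -/
lemma IsKahlerOn.wirt_wirt_ricciPotential (h : IsKahlerOn θ O) (hz : z ∈ O)
    (hric : ∀ u v, (ricciForm θ).at₂ z u v = θ.at₂ z u v) (l k : Fin m) :
    wirt Complex.I k (fun y => wirt (-Complex.I) l (fun x => (ricciPotential θ x : ℂ)) y) z
      = metricMatrix θ z l k := by
  rw [wirt_comm h.isOpen (contDiffOn_ofReal h.contDiffOn_ricciPotential) hz,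
    ← hermCoeff_iddbar h.isOpen h.contDiffOn_ricciPotential hz]
  have : (iddbar (ricciPotential θ)).at₂ z = θ.at₂ z := by
    funext u v
    exact hric u v
  rw [this]
  rfl

/-- On a Kähler–Einstein manifold `Ric = ω`, a real holomorphy potential `f` satisfies
`d (Δ f) = d f`. -/
lemma IsKahlerOn.fderiv_localLaplacian (h : IsKahlerOn θ O) {f : (Fin m → ℂ) → ℝ}
    (hf : ContDiffOn ℝ ∞ f O) (hol : DifferentiableOn ℂ (grad10 θ f) O) (hz : z ∈ O)
    (hric : ∀ u v, (ricciForm θ).at₂ z u v = θ.at₂ z u v) :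
    fderiv ℝ (localLaplacian θ f) z = fderiv ℝ f z := by
  have hL := ContDiffOn.differentiableAt_of_isOpen (h.contDiffOn_localLaplacian hf) h.isOpen hz
  have hfd := ContDiffOn.differentiableAt_of_isOpen hf h.isOpen hz
  set c : Fin m → (Fin m → ℂ) → ℂ := fun k y => wirt Complex.I k (fun x => (f x : ℂ)) y with hc
  have hcs : ∀ k, ContDiffOn ℝ ∞ (c k) O := fun k =>
    ContDiffOn.wirt h.isOpen (contDiffOn_ofReal hf)
  have hvs := h.contDiffOn_raise hcs
  set p : (Fin m → ℂ) → ℂ := fun y => (ricciPotential θ y : ℂ) with hp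
  have hps : ContDiffOn ℝ ∞ p O := contDiffOn_ofReal h.contDiffOn_ricciPotential
  -- With p = -log det g, Δf is minus the divergence of the gradient v, corrected by v^l ∂_l p.
  -- Since v is holomorphic, ∂̄_k of this leaves only v^l ∂̄_k ∂_l p, which by the Einstein
  -- condition is g_{lk̄} v^l = ∂̄_k f.
  have hLeq : Set.EqOn (fun y => (localLaplacian θ f y : ℂ))
      (fun y => -(∑ l, wirt (-Complex.I) l (raise θ c l) y
        - ∑ l, raise θ c l y * wirt (-Complex.I) l p y)) O := by
    intro y hy
    simp only
    rw [h.localLaplacian_eq hf hy, h.trace_wirt_eq_div hcs hy]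
    simp only [hp, h.wirt_ricciPotential hy, mul_neg, Finset.sum_neg_distrib]
    ring
  have hvhol : ∀ l k, ∀ y ∈ O, wirt Complex.I k (raise θ c l) y = 0 := by
    intro l k y hy
    have h1 : Set.EqOn (raise θ c l) (fun y => grad10 θ f y l) O := fun y hy =>
      (grad10_eq (ContDiffOn.differentiableAt_of_isOpen hf h.isOpen hy) l).symm
    rw [wirt_congr_of_eqOn h.isOpen hy h1]
    apply wirt_holomorphic
    exact differentiableAt_pi.1 (hol.differentiableAt (h.isOpen.mem_nhds hy)) l
  have hd1 : ∀ l, DifferentiableAt ℝ (fun y => wirt (-Complex.I) l (raise θ c l) y) z := fun l =>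
    ContDiffOn.differentiableAt_of_isOpen (ContDiffOn.wirt h.isOpen (hvs l)) h.isOpen hz
  have hd2 : ∀ l, DifferentiableAt ℝ (raise θ c l) z := fun l =>
    ContDiffOn.differentiableAt_of_isOpen (hvs l) h.isOpen hz
  have hd3 : ∀ l, DifferentiableAt ℝ (fun y => wirt (-Complex.I) l p y) z := fun l =>
    ContDiffOn.differentiableAt_of_isOpen (ContDiffOn.wirt h.isOpen hps) h.isOpen hz
  have hkey : ∀ k, wirt Complex.I k (fun y => (localLaplacian θ f y : ℂ)) z = c k z := by
    intro k
    rw [wirt_congr_of_eqOn h.isOpen hz hLeq, wirt_neg,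
      wirt_sub (DifferentiableAt.fun_sum fun l _ => hd1 l)
        (DifferentiableAt.fun_sum fun l _ => (hd2 l).fun_mul (hd3 l)),
      wirt_sum _ fun l _ => hd1 l, wirt_sum _ fun l _ => (hd2 l).fun_mul (hd3 l)]
    have e1 : ∀ l, wirt Complex.I k (fun y => wirt (-Complex.I) l (raise θ c l) y) z = 0 := by
      intro l
      rw [wirt_comm h.isOpen (hvs l) hz,
        wirt_congr_of_eqOn h.isOpen hz (F' := fun _ => 0) (hvhol l k), wirt_const]
    have e2 : ∀ l, wirt Complex.I k (fun y => raise θ c l y * wirt (-Complex.I) l p y) z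
        = metricMatrix θ z l k * raise θ c l z := by
      intro l
      rw [wirt_mul (hd2 l) (hd3 l), hvhol l k z hz, h.wirt_wirt_ricciPotential hz hric]
      ring
    simp only [e1, e2, Finset.sum_const_zero, h.lower_raise hz]
    ring
  have hsub : fderiv ℝ (fun y => localLaplacian θ f y - f y) z = 0 := by
    apply fderiv_eq_zero_of_wirt (hL.fun_sub hfd)
    intro k
    have hcL : DifferentiableAt ℝ (fun y => (localLaplacian θ f y : ℂ)) z :=
      Complex.ofRealCLM.differentiableAt.comp z hL
    have hcf : DifferentiableAt ℝ (fun y => (f y : ℂ)) z :=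
      Complex.ofRealCLM.differentiableAt.comp z hfd
    have : (fun y => ((localLaplacian θ f y - f y : ℝ) : ℂ))
        = fun y => (localLaplacian θ f y : ℂ) - (f y : ℂ) := by
      funext y
      push_cast
      rfl
    rw [this, wirt_sub hcL hcf, hkey k, sub_self]
  rw [fderiv_fun_sub hL hfd] at hsub
  exact sub_eq_zero.1 hsub

end LocalKahlerIdentities

/-! ### The Bochner inequality for holomorphic one-forms when Ric = ω. -/

section Bochner

variable {m : ℕ} {O : Set (Fin m → ℂ)} {z : Fin m → ℂ} {θ : Form (Fin m → ℂ) (Fin m → ℂ) 2}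

lemma contDiffOn_star {E : Type*} [NormedAddCommGroup E] [NormedSpace ℝ E] {F : E → ℂ}
    {O : Set E} (hF : ContDiffOn ℝ ∞ F O) : ContDiffOn ℝ ∞ (fun y => star (F y)) O :=
  (Complex.conjCLE : ℂ →L[ℝ] ℂ).contDiff.comp_contDiffOn hF

lemma IsKahlerOn.star_matrix (h : IsKahlerOn θ O) (hz : z ∈ O) (j k : Fin m) :
    star (metricMatrix θ z j k) = metricMatrix θ z k j :=
  (h.posDef hz).isHermitian.apply k j

/-- The antiholomorphic Kähler identity `∂_k̄ g_{jl̄} = ∂_l̄ g_{jk̄}`. -/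
lemma IsKahlerOn.symm_bar (h : IsKahlerOn θ O) (hz : z ∈ O) (j k l : Fin m) :
    wirt Complex.I k (fun y => metricMatrix θ y j l) z
      = wirt Complex.I l (fun y => metricMatrix θ y j k) z := by
  have h1 : ∀ k l, wirt Complex.I k (fun y => metricMatrix θ y j l) z
      = star (wirtM (-Complex.I) k (metricMatrix θ) z l j) := by
    intro k l
    rw [wirtM, Matrix.of_apply, ← wirt_congr_of_eqOn h.isOpen hz (F := fun y =>
      star (metricMatrix θ y l j)) fun y hy => h.star_matrix hy l j,
      wirt_conj (ContDiffOn.differentiableAt_of_isOpen (h.contDiffOn_matrix l j) h.isOpen hz)]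
    simp
  rw [h1, h1, h.toIsClosedOneOneOn.symm h.isOpen hz k l j]

set_option maxHeartbeats 1600000 in
/-- The Bochner inequality for holomorphic one-forms on a Kähler–Einstein manifold with
`Ric = ω`. -/
lemma IsKahlerOn.bochner (h : IsKahlerOn θ O) {β : Fin m → (Fin m → ℂ) → ℂ}
    (hβ : ∀ k, ContDiffOn ℝ ∞ (β k) O) (hol : ∀ j k, ∀ y ∈ O, wirt Complex.I k (β j) y = 0)
    (hcl : ∀ j k, ∀ y ∈ O, wirt (-Complex.I) k (β j) y = wirt (-Complex.I) j (β k) y) (hz : z ∈ O)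
    (hric : ∀ u v, (ricciForm θ).at₂ z u v = θ.at₂ z u v) :
    (∑ j, β j z * raise θ (fun k y => star (β k y)) j z).re ≤
      (∑ k, ∑ l, (metricMatrix θ z)⁻¹ k l * wirt (-Complex.I) l (fun y => wirt Complex.I k
        (fun x => ∑ j, β j x * raise θ (fun k y => star (β k y)) j x) y) z).re := by
  have hO := h.isOpen
  have hβd : ∀ k, ∀ y ∈ O, DifferentiableAt ℝ (β k) y := fun k y hy =>
    ContDiffOn.differentiableAt_of_isOpen (hβ k) hO hy
  have hbs : ∀ k, ContDiffOn ℝ ∞ (fun y => star (β k y)) O := fun k => contDiffOn_star (hβ k)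
  set v : Fin m → (Fin m → ℂ) → ℂ := raise θ (fun k y => star (β k y)) with hv
  have hvs : ∀ j, ContDiffOn ℝ ∞ (v j) O := h.contDiffOn_raise hbs
  have hvd : ∀ k, ∀ y ∈ O, DifferentiableAt ℝ (v k) y := fun k y hy =>
    ContDiffOn.differentiableAt_of_isOpen (hvs k) hO hy
  have hGd : ∀ i j, ∀ y ∈ O, DifferentiableAt ℝ (fun y => metricMatrix θ y i j) y :=
    fun i j y hy => ContDiffOn.differentiableAt_of_isOpen (h.contDiffOn_matrix i j) hO hy
  set τ : Fin m → Fin m → (Fin m → ℂ) → ℂ := fun j k y => wirt Complex.I k (v j) y with hτ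
  have hτs : ∀ j k, ContDiffOn ℝ ∞ (τ j k) O := fun j k => ContDiffOn.wirt hO (hvs j)
  have hτd : ∀ j k, ∀ y ∈ O, DifferentiableAt ℝ (τ j k) y := fun j k y hy =>
    ContDiffOn.differentiableAt_of_isOpen (hτs j k) hO hy
  have hlow : ∀ k, ∀ y ∈ O, ∑ j, metricMatrix θ y j k * v j y = star (β k y) := fun k y hy =>
    h.lower_raise hy k
  -- T is ∂̄v with its index lowered, that is, the conjugate of the covariant derivative of β. It is
  -- symmetric because ∂β = 0 and the Christoffel term is symmetric by the Kähler identity.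
  set T : (Fin m → ℂ) → Matrix (Fin m) (Fin m) ℂ :=
    fun y => Matrix.of fun a k => ∑ j, metricMatrix θ y j a * τ j k y with hT
  have hTeq : ∀ a k, ∀ y ∈ O, T y a k = star (wirt (-Complex.I) k (β a) y)
      - ∑ j, wirt Complex.I k (fun x => metricMatrix θ x j a) y * v j y := by
    intro a k y hy
    have h1 : wirt Complex.I k (fun x => ∑ j, metricMatrix θ x j a * v j x) y
        = wirt Complex.I k (fun x => star (β a x)) y :=
      wirt_congr_of_eqOn hO hy (hlow a)
    rw [wirt_sum _ fun j _ => (hGd j a y hy).fun_mul (hvd j y hy), wirt_conj (hβd a y hy)] at h1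
    simp only [fun j => wirt_mul (s := Complex.I) (l := k) (hGd j a y hy) (hvd j y hy),
      Finset.sum_add_distrib] at h1
    have h2 : star Complex.I = -Complex.I := by simp
    rw [h2] at h1
    simp only [hT, Matrix.of_apply]
    linear_combination h1
  have hTsymm : ∀ a k, ∀ y ∈ O, T y a k = T y k a := by
    intro a k y hy
    rw [hTeq a k y hy, hTeq k a y hy, hcl a k y hy]
    simp only [fun j => h.symm_bar hy j k a]
  set N : (Fin m → ℂ) → ℂ := fun x => ∑ j, β j x * v j x with hN
  have hNs : ContDiffOn ℝ ∞ N O := ContDiffOn.sum fun j _ => (hβ j).mul (hvs j)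
  set c : Fin m → (Fin m → ℂ) → ℂ := fun k y => wirt Complex.I k N y with hc
  have hcs : ∀ k, ContDiffOn ℝ ∞ (c k) O := fun k => ContDiffOn.wirt hO hNs
  -- As β is holomorphic, ∂̄_k differentiates only v in N = β_j v^j. The symmetry of T then moves k
  -- to the slot where the metric can raise it.
  have hceq : ∀ k, ∀ y ∈ O, c k y = ∑ j, metricMatrix θ y j k * ∑ i, star (v i y) * τ j i y := by
    intro k y hy
    have h1 : c k y = ∑ j, β j y * τ j k y := by
      simp only [hc, hN]
      rw [wirt_sum _ fun j _ => (hβd j y hy).fun_mul (hvd j y hy)]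
      refine Finset.sum_congr rfl fun j _ => ?_
      rw [wirt_mul (hβd j y hy) (hvd j y hy), hol j k y hy, zero_mul, zero_add]
    have h2 : ∀ j, β j y = ∑ i, metricMatrix θ y j i * star (v i y) := by
      intro j
      rw [← star_star (β j y), ← hlow j y hy, star_sum]
      refine Finset.sum_congr rfl fun i _ => ?_
      rw [star_mul', h.star_matrix hy]
    have h3 : c k y = ∑ i, star (v i y) * T y i k := by
      rw [h1]
      simp only [h2, hT, Matrix.of_apply, Finset.sum_mul, Finset.mul_sum]
      rw [Finset.sum_comm]
      exact Finset.sum_congr rfl fun i _ => Finset.sum_congr rfl fun j _ => by ring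
    rw [h3]
    simp only [fun i => hTsymm i k y hy]
    simp only [hT, Matrix.of_apply, Finset.mul_sum]
    rw [Finset.sum_comm]
    exact Finset.sum_congr rfl fun i _ => Finset.sum_congr rfl fun j _ => by ring
  have hW : ∀ l, Set.EqOn (raise θ c l) (fun y => ∑ i, star (v i y) * τ l i y) O := by
    intro l y hy
    simp only [raise, hceq _ y hy]
    exact h.raise_lower hy (fun j => ∑ i, star (v i y) * τ j i y) l
  set p : (Fin m → ℂ) → ℂ := fun y => (ricciPotential θ y : ℂ) with hp
  have hps : ContDiffOn ℝ ∞ p O := contDiffOn_ofReal h.contDiffOn_ricciPotential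
  have hpd : ∀ l, DifferentiableAt ℝ (fun y => wirt (-Complex.I) l p y) z := fun l =>
    ContDiffOn.differentiableAt_of_isOpen (ContDiffOn.wirt hO hps) hO hz
  -- The conjugates of the β_k are antiholomorphic, so the trace in `trace_wirt_eq_div` is zero and
  -- v has vanishing weighted divergence.
  have hdivv : Set.EqOn (fun y => ∑ l, wirt (-Complex.I) l (v l) y)
      (fun y => ∑ l, v l y * wirt (-Complex.I) l p y) O := by
    intro y hy
    have h1 := h.trace_wirt_eq_div hbs hy
    have h2 : ∀ k l, wirt (-Complex.I) l (fun y => star (β k y)) y = 0 := by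
      intro k l
      rw [wirt_conj (hβd k y hy)]
      have : star (-Complex.I) = Complex.I := by simp
      rw [this, hol k l y hy, star_zero]
    simp only [h2, mul_zero, Finset.sum_const_zero] at h1
    simp only [hp, h.wirt_ricciPotential hy, mul_neg, Finset.sum_neg_distrib]
    exact eq_neg_of_add_eq_zero_left h1.symm
  have hvw : ∀ l, ContDiffOn ℝ ∞ (fun y => wirt (-Complex.I) l (v l) y) O := fun l =>
    ContDiffOn.wirt hO (hvs l)
  -- Apply ∂̄_i to the preceding identity. The Einstein condition turns v^l ∂̄_i ∂_l p into g_{lī}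
  -- v^l, the conjugate of β_i; this is the curvature term of the Bochner formula.
  have hddiv : ∀ i, ∑ l, wirt (-Complex.I) l (τ l i) z
      = ∑ l, τ l i z * wirt (-Complex.I) l p z + star (β i z) := by
    intro i
    have h1 := wirt_congr_of_eqOn (s := Complex.I) (l := i) hO hz hdivv
    rw [wirt_sum _ fun l _ => ContDiffOn.differentiableAt_of_isOpen (hvw l) hO hz,
      wirt_sum _ fun l _ => (hvd l z hz).fun_mul (hpd l)] at h1
    simp only [fun l => wirt_mul (s := Complex.I) (l := i) (hvd l z hz) (hpd l),
      Finset.sum_add_distrib, fun l => wirt_comm (s := Complex.I) (l := i) (t := -Complex.I) (k := l)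
      hO (hvs l) hz] at h1
    simp only [hp, h.wirt_wirt_ricciPotential hz hric] at h1
    rw [show ∑ l, wirt (-Complex.I) l (τ l i) z = _ from h1, ← hlow i z hz]
    congr 1
    exact Finset.sum_congr rfl fun l _ => mul_comm _ _
  have hsv : ∀ i, DifferentiableAt ℝ (fun y => star (v i y)) z := fun i =>
    ContDiffOn.differentiableAt_of_isOpen (contDiffOn_star (hvs i)) hO hz
  have hdivW : ∑ l, wirt (-Complex.I) l (raise θ c l) z
      = ∑ l, ∑ i, star (τ i l z) * τ l i z
        + ∑ i, star (v i z) * ∑ l, wirt (-Complex.I) l (τ l i) z := by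
    have h1 : ∀ l, wirt (-Complex.I) l (raise θ c l) z
        = ∑ i, star (τ i l z) * τ l i z + ∑ i, star (v i z) * wirt (-Complex.I) l (τ l i) z := by
      intro l
      rw [wirt_congr_of_eqOn hO hz (hW l), wirt_sum _ fun i _ => (hsv i).fun_mul (hτd l i z hz),
        ← Finset.sum_add_distrib]
      refine Finset.sum_congr rfl fun i _ => ?_
      rw [wirt_mul (hsv i) (hτd l i z hz), wirt_conj (hvd i z hz)]
      have : star (-Complex.I) = Complex.I := by simp
      rw [this]
    simp only [h1, Finset.sum_add_distrib, Finset.mul_sum]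
    congr 1
    rw [Finset.sum_comm]
  -- In the weighted divergence of the gradient of N the first derivatives of p cancel. What remains
  -- is the Hessian term and a curvature term equal to the conjugate of N.
  have hmain : ∑ k, ∑ l, (metricMatrix θ z)⁻¹ k l * wirt (-Complex.I) l (c k) z
      = ∑ l, ∑ i, star (τ i l z) * τ l i z + star (N z) := by
    rw [h.trace_wirt_eq_div hcs hz, hdivW]
    have h1 : ∀ l, ((metricMatrix θ z)⁻¹ * wirtM (-Complex.I) l (metricMatrix θ) z).trace
        = -wirt (-Complex.I) l p z := by
      intro l
      rw [h.wirt_ricciPotential hz, neg_neg]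
    simp only [h1, hddiv, hW _ hz, mul_add, Finset.sum_add_distrib]
    have h2 : ∑ i, star (v i z) * star (β i z) = star (N z) := by
      simp only [hN, star_sum, star_mul']
      exact Finset.sum_congr rfl fun i _ => mul_comm _ _
    have h3 : ∑ l, (∑ i, star (v i z) * τ l i z) * -wirt (-Complex.I) l p z
        = -∑ i, star (v i z) * ∑ l, τ l i z * wirt (-Complex.I) l p z := by
      simp only [Finset.mul_sum, Finset.sum_mul]
      rw [Finset.sum_comm, ← Finset.sum_neg_distrib]
      refine Finset.sum_congr rfl fun i _ => ?_
      rw [← Finset.sum_neg_distrib]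
      exact Finset.sum_congr rfl fun l _ => by ring
    rw [h2, h3]
    ring
  have hτT : ∀ j k, τ j k z = ((metricMatrix θ z)⁻¹ᵀ * T z) j k := by
    intro j k
    rw [← h.raise_lower hz (fun j => τ j k z) j, Matrix.mul_apply]
    rfl
  have hH := (h.posDef hz).inv
  have hτT' : ∀ i l, star (τ i l z) = ((metricMatrix θ z)⁻¹ * (T z)ᴴ) i l := by
    intro i l
    rw [hτT, Matrix.mul_apply, Matrix.mul_apply, star_sum]
    refine Finset.sum_congr rfl fun a _ => ?_
    rw [star_mul', Matrix.transpose_apply, Matrix.conjTranspose_apply, hTsymm a l z hz,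
      hH.isHermitian.apply i a]
  -- The factors in the Hessian term carry transposed indices, so it is not visibly a sum of
  -- squares; the symmetry of T brings it to the shape of `trace_symm_nonneg`.
  have hnn : 0 ≤ (∑ l, ∑ i, star (τ i l z) * τ l i z).re := by
    have := trace_symm_nonneg (T := T z) hH
    rw [Matrix.mul_assoc ((metricMatrix θ z)⁻¹ * (T z)ᴴ), trace_mul_eq_sum] at this
    rw [Finset.sum_comm]
    simp only [hτT']
    simp only [hτT]
    exact this
  change (N z).re ≤ (∑ k, ∑ l, (metricMatrix θ z)⁻¹ k l * wirt (-Complex.I) l (c k) z).re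
  rw [hmain, Complex.add_re]
  have : (star (N z)).re = (N z).re := by simp
  linarith

end Bochner

/-! ### Integration by parts on open subsets of ℂ^m. -/

section Stokes

variable {m : ℕ} {O K : Set (Fin m → ℂ)} {z : Fin m → ℂ} {θ σ : Form (Fin m → ℂ) (Fin m → ℂ) 2}

/-- Extension by zero: off O the function vanishes on the open complement of K, so smoothness is a
local question on two open sets that cover the space. -/
lemma contDiff_indicator_of_vanish {E G : Type*} [NormedAddCommGroup E] [NormedSpace ℝ E]
    [NormedAddCommGroup G] [NormedSpace ℝ G] {O K : Set E} (hO : IsOpen O) (hK : IsCompact K)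
    (hKO : K ⊆ O) {F : E → G} (hF : ContDiffOn ℝ ∞ F O) (hv : ∀ y ∈ O, y ∉ K → F y = 0) :
    ContDiff ℝ ∞ (O.indicator F) := by
  rw [contDiff_iff_contDiffAt]
  intro y
  by_cases hy : y ∈ O
  · refine (hF.contDiffAt (hO.mem_nhds hy)).congr_of_eventuallyEq ?_
    filter_upwards [hO.mem_nhds hy] with x hx
    exact Set.indicator_of_mem hx F
  · have hyK : y ∈ Kᶜ := fun h => hy (hKO h)
    refine (contDiffAt_const (c := (0 : G))).congr_of_eventuallyEq ?_
    filter_upwards [hK.isClosed.isOpen_compl.mem_nhds hyK] with x hx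
    by_cases hxO : x ∈ O
    · rw [Set.indicator_of_mem hxO, hv x hxO hx]
    · exact Set.indicator_of_notMem hxO F

/-- Integration by parts against the constant function 1. -/
lemma integral_fderiv_eq_zero {F : (Fin m → ℂ) → ℂ} (hF : ContDiff ℝ ∞ F)
    (hc : HasCompactSupport F) (v : Fin m → ℂ) : ∫ y, fderiv ℝ F y v = 0 := by
  have hd : Continuous (fun y => fderiv ℝ F y v) :=
    (hF.continuous_fderiv (by simp)).clm_apply continuous_const
  have hcd : HasCompactSupport (fun y => fderiv ℝ F y v) := hc.fderiv_apply ℝ v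
  have h := integral_mul_fderiv_eq_neg_fderiv_mul_of_integrable (μ := (volume : Measure (Fin m → ℂ)))
    (f := fun _ => (1 : ℂ)) (g := F) (v := v) (by simp)
    (by simpa using hd.integrable_of_hasCompactSupport hcd)
    (by simpa using hF.continuous.integrable_of_hasCompactSupport hc)
    (fun _ _ => differentiableAt_const _) (fun x _ => hF.differentiable (by simp) x)
  simpa using h

lemma integrableOn_of_vanish {G : Type*} [NormedAddCommGroup G] [NormedSpace ℝ G]
    (hO : IsOpen O) (hK : IsCompact K)
    (hKO : K ⊆ O) {F : (Fin m → ℂ) → G} (hF : ContDiffOn ℝ ∞ F O)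
    (hv : ∀ y ∈ O, y ∉ K → F y = 0) : IntegrableOn F O := by
  rw [← integrable_indicator_iff hO.measurableSet]
  have hs := contDiff_indicator_of_vanish hO hK hKO hF hv
  refine hs.continuous.integrable_of_hasCompactSupport (HasCompactSupport.intro hK fun y hy => ?_)
  by_cases hyO : y ∈ O
  · rw [Set.indicator_of_mem hyO, hv y hyO hy]
  · exact Set.indicator_of_notMem hyO F

lemma integral_wirt_eq_zero (hO : IsOpen O) (hK : IsCompact K) (hKO : K ⊆ O)
    {F : (Fin m → ℂ) → ℂ} (hF : ContDiffOn ℝ ∞ F O) (hv : ∀ y ∈ O, y ∉ K → F y = 0) (s : ℂ)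
    (l : Fin m) : ∫ y in O, wirt s l F y = 0 := by
  set F' := O.indicator F with hF'
  have hs : ContDiff ℝ ∞ F' := contDiff_indicator_of_vanish hO hK hKO hF hv
  have hc : HasCompactSupport F' := HasCompactSupport.intro hK fun y hy => by
    by_cases hyO : y ∈ O
    · rw [hF', Set.indicator_of_mem hyO, hv y hyO hy]
    · exact Set.indicator_of_notMem hyO F
  have h1 : ∫ y in O, wirt s l F y = ∫ y, wirt s l F' y := by
    rw [← integral_indicator hO.measurableSet]
    congr 1
    funext y
    by_cases hy : y ∈ O
    · rw [Set.indicator_of_mem hy]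
      exact wirt_congr_of_eqOn hO hy fun x hx => (Set.indicator_of_mem hx F).symm
    · rw [Set.indicator_of_notMem hy]
      have hyK : y ∈ Kᶜ := fun h => hy (hKO h)
      rw [wirt_congr_of_eqOn hK.isClosed.isOpen_compl hyK (F' := fun _ => 0), wirt_const]
      intro x hx
      by_cases hxO : x ∈ O
      · simp only [hF']
        rw [Set.indicator_of_mem hxO, hv x hxO hx]
      · exact Set.indicator_of_notMem hxO F
  rw [h1]
  have hi : ∀ v, Integrable (fun y => fderiv ℝ F' y v) := fun v =>
    ((hs.continuous_fderiv (by simp)).clm_apply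
      continuous_const).integrable_of_hasCompactSupport (hc.fderiv_apply ℝ v)
  simp only [wirt]
  rw [integral_div, integral_add (hi _) ((hi _).const_mul s), integral_const_mul,
    integral_fderiv_eq_zero hs hc, integral_fderiv_eq_zero hs hc]
  simp

/-- A version of Stokes' theorem: the divergence of a compactly supported vector field has
integral zero. -/
lemma integral_div_eq_zero (hO : IsOpen O) (hK : IsCompact K) (hKO : K ⊆ O)
    {F : Fin m → (Fin m → ℂ) → ℂ} (hF : ∀ j, ContDiffOn ℝ ∞ (F j) O)
    (hv : ∀ j, ∀ y ∈ O, y ∉ K → F j y = 0) (s : ℂ) :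
    ∫ y in O, ∑ j, wirt s j (F j) y = 0 := by
  rw [integral_finsetSum]
  · exact Finset.sum_eq_zero fun j _ => integral_wirt_eq_zero hO hK hKO (hF j) (hv j) s j
  · intro j _
    refine integrableOn_of_vanish hO hK hKO (ContDiffOn.wirt hO (hF j)) fun y hy hyK => ?_
    rw [wirt_congr_of_eqOn (hO.inter hK.isClosed.isOpen_compl) ⟨hy, hyK⟩ (F' := fun _ => 0)
      fun x hx => hv j x hx.1 hx.2, wirt_const]

/-- If `Q` is hermitian and divergence free, then the pairing of `Q` with an exact form is a
divergence. -/
lemma pairing_extDeriv {γ : Form (Fin m → ℂ) (Fin m → ℂ) 1} (hO : IsOpen O)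
    (hγ : ContDiffOn ℝ ∞ γ O) {Q : (Fin m → ℂ) → Matrix (Fin m) (Fin m) ℂ}
    (hQ : ∀ k j, ContDiffOn ℝ ∞ (fun y => Q y k j) O) (hz : z ∈ O) (hQH : (Q z).IsHermitian)
    (hdiv : ∀ k, ∑ j, wirt (-Complex.I) j (fun y => Q y k j) z = 0) :
    (Q z * hermMatrix (stdVec m) (Form.at₂ (fun y => extDeriv γ y) z)).trace.re
      = 2 * (∑ j, wirt (-Complex.I) j (fun y => ∑ k, Q y k j * coeff01 γ k y) z).im := by
  have hQd := fun k j => ContDiffOn.differentiableAt_of_isOpen (hQ k j) hO hz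
  have had := fun k => ContDiffOn.differentiableAt_of_isOpen (contDiffOn_coeff01 hγ k) hO hz
  set t : ℂ := ∑ k, ∑ j, Q z k j * wirt (-Complex.I) j (coeff01 γ k) z with ht
  have h1 : ∑ j, wirt (-Complex.I) j (fun y => ∑ k, Q y k j * coeff01 γ k y) z = t := by
    have : ∀ j, wirt (-Complex.I) j (fun y => ∑ k, Q y k j * coeff01 γ k y) z
        = ∑ k, wirt (-Complex.I) j (fun y => Q y k j) z * coeff01 γ k z
          + ∑ k, Q z k j * wirt (-Complex.I) j (coeff01 γ k) z := by
      intro j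
      rw [wirt_sum _ fun k _ => (hQd k j).fun_mul (had k), ← Finset.sum_add_distrib]
      exact Finset.sum_congr rfl fun k _ => wirt_mul (hQd k j) (had k)
    simp only [this, Finset.sum_add_distrib]
    rw [Finset.sum_comm]
    simp only [← Finset.sum_mul, hdiv, zero_mul, Finset.sum_const_zero, zero_add]
    rw [Finset.sum_comm]
  have h2 : (Q z * hermMatrix (stdVec m) (Form.at₂ (fun y => extDeriv γ y) z)).trace
      = -Complex.I * (t - star t) := by
    rw [trace_mul_eq_sum]
    have h3 : star t = ∑ k, ∑ j, Q z k j * star (wirt (-Complex.I) k (coeff01 γ j) z) := by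
      simp only [ht, star_sum, star_mul']
      rw [Finset.sum_comm]
      refine Finset.sum_congr rfl fun k _ => Finset.sum_congr rfl fun j _ => ?_
      rw [hQH.apply k j]
    rw [h3, ht, ← Finset.sum_sub_distrib, Finset.mul_sum]
    refine Finset.sum_congr rfl fun k _ => ?_
    rw [← Finset.sum_sub_distrib, Finset.mul_sum]
    refine Finset.sum_congr rfl fun j _ => ?_
    simp only [hermMatrix, Matrix.of_apply]
    rw [hermCoeff_extDeriv hO hγ hz]
    ring
  rw [h1, h2]
  simp
  ring

/-- Stokes' theorem for the pairing of an exact form with compact support and a hermitian divergence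
free matrix. -/
lemma integral_pairing_extDeriv {γ : Form (Fin m → ℂ) (Fin m → ℂ) 1} (hO : IsOpen O)
    (hK : IsCompact K) (hKO : K ⊆ O) (hγ : ContDiffOn ℝ ∞ γ O) (hv : ∀ y ∈ O, y ∉ K → γ y = 0)
    {Q : (Fin m → ℂ) → Matrix (Fin m) (Fin m) ℂ} (hQ : ∀ k j, ContDiffOn ℝ ∞ (fun y => Q y k j) O)
    (hQH : ∀ y ∈ O, (Q y).IsHermitian)
    (hdiv : ∀ y ∈ O, ∀ k, ∑ j, wirt (-Complex.I) j (fun y => Q y k j) y = 0) :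
    ∫ y in O, (Q y * hermMatrix (stdVec m) (Form.at₂ (fun y => extDeriv γ y) y)).trace.re = 0 := by
  rw [setIntegral_congr_fun hO.measurableSet fun y hy =>
    pairing_extDeriv hO hγ hQ hy (hQH y hy) (hdiv y hy), integral_const_mul]
  set F : Fin m → (Fin m → ℂ) → ℂ := fun j y => ∑ k, Q y k j * coeff01 γ k y with hF
  have hFs : ∀ j, ContDiffOn ℝ ∞ (F j) O := fun j =>
    ContDiffOn.sum fun k _ => (hQ k j).mul (contDiffOn_coeff01 hγ k)
  have hFv : ∀ j, ∀ y ∈ O, y ∉ K → F j y = 0 := by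
    intro j y hy hyK
    simp [hF, coeff01, hv y hy hyK]
  have h1 := integral_div_eq_zero hO hK hKO hFs hFv (-Complex.I)
  have hInt : IntegrableOn (fun y => ∑ j, wirt (-Complex.I) j (F j) y) O := by
    refine integrableOn_of_vanish hO hK hKO
      (ContDiffOn.sum fun j _ => ContDiffOn.wirt hO (hFs j)) fun y hy hyK => ?_
    refine Finset.sum_eq_zero fun j _ => ?_
    rw [wirt_congr_of_eqOn (hO.inter hK.isClosed.isOpen_compl) ⟨hy, hyK⟩ (F' := fun _ => 0)
      fun x hx => hFv j x hx.1 hx.2, wirt_const]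
  have h2 := integral_im hInt
  rw [h1] at h2
  simp only [RCLike.im_to_complex] at h2
  rw [h2]
  simp

lemma IsKahlerOn.volumeDensity_mul_re (h : IsKahlerOn θ O) (hz : z ∈ O) (t : ℂ) :
    t.re * volumeDensity θ z = m.factorial * 2 ^ m * ((metricMatrix θ z).det * t).re := by
  rw [volumeDensity, Complex.mul_re, h.det_im hz]
  ring

lemma IsKahlerOn.raise_row (k j : Fin m) (y : Fin m → ℂ)
    (S : (Fin m → ℂ) → Matrix (Fin m) (Fin m) ℂ) :
    raise θ (fun a y => S y k a) j y = (S y * (metricMatrix θ y)⁻¹) k j := by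
  rw [raise, Matrix.mul_apply]
  exact Finset.sum_congr rfl fun a _ => mul_comm _ _

/-- `∫ ⟨dγ, σ⟩ θ^m = 0` for a closed `(1,1)`-form `σ` of constant trace. -/
lemma IsKahlerOn.integral_normSqForm_extDeriv (h : IsKahlerOn θ O) (hσ : IsClosedOneOneOn σ O)
    {t : ℝ} (htr : ∀ y ∈ O, contraction (stdVec m) (θ.at₂ y) (σ.at₂ y) = t)
    {γ : Form (Fin m → ℂ) (Fin m → ℂ) 1} (hK : IsCompact K) (hKO : K ⊆ O)
    (hγ : ContDiffOn ℝ ∞ γ O) (hv : ∀ y ∈ O, y ∉ K → γ y = 0) :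
    ∫ y in O, normSqForm (stdVec m) (θ.at₂ y) (σ.at₂ y) (Form.at₂ (fun y => extDeriv γ y) y)
      * volumeDensity θ y = 0 := by
  have hO := h.isOpen
  set S : (Fin m → ℂ) → Matrix (Fin m) (Fin m) ℂ :=
    fun y => (metricMatrix θ y)⁻¹ * metricMatrix σ y with hS
  have hσs := contDiffOn_metricMatrix hσ.smooth
  have hSs : ∀ k a, ContDiffOn ℝ ∞ (fun y => S y k a) O := fun k a => by
    simp only [hS, Matrix.mul_apply]
    exact ContDiffOn.sum fun i _ => (h.contDiffOn_inv k i).mul (hσs i a)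
  have hSHs : ∀ k a, ContDiffOn ℝ ∞ (fun y => (S y * (metricMatrix θ y)⁻¹) k a) O := fun k a => by
    simp only [Matrix.mul_apply (M := S _)]
    exact ContDiffOn.sum fun i _ => (hSs k i).mul (h.contDiffOn_inv i a)
  have hσH : ∀ y, (metricMatrix σ y).IsHermitian := fun y =>
    hermMatrix_isHermitian (σ.at₂_antisymm y) _
  have htrS : ∀ y ∈ O, (S y).trace = t := by
    intro y hy
    have := trace_mul_re (h.posDef hy).isHermitian.inv (hσH y)
    rw [hS]
    simp only
    rw [this]
    exact congrArg _ (htr y hy)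
  -- Pairing dγ with Q = det(g) g⁻¹σg⁻¹ under Lebesgue measure gives, up to the constant m! 2^m, the
  -- inner product with σ under θ^m. It remains to see that the rows of Q are divergence free, that
  -- is, that σ is coclosed.
  set Q : (Fin m → ℂ) → Matrix (Fin m) (Fin m) ℂ :=
    fun y => (metricMatrix θ y).det • (S y * (metricMatrix θ y)⁻¹) with hQ
  have hdiv : ∀ y ∈ O, ∀ k, ∑ j, wirt (-Complex.I) j (fun y => Q y k j) y = 0 := by
    intro y hy k
    have hid := fun i j => ContDiffOn.differentiableAt_of_isOpen (h.contDiffOn_inv i j) hO hy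
    have hσd := fun i j => ContDiffOn.differentiableAt_of_isOpen (hσs i j) hO hy
    have h1 := h.div_det_raise (fun a => hSs k a) hy
    simp only [IsKahlerOn.raise_row] at h1
    have h0 : ∑ j, wirt (-Complex.I) j (fun y => Q y k j) y = _ := h1
    rw [h0]
    set H := (metricMatrix θ y)⁻¹ with hH
    set A : Fin m → Matrix (Fin m) (Fin m) ℂ :=
      fun l => wirtM (-Complex.I) l (metricMatrix θ) y with hA
    set B : Fin m → Matrix (Fin m) (Fin m) ℂ :=
      fun l => wirtM (-Complex.I) l (metricMatrix σ) y with hB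
    have hdS : ∀ l, wirtM (-Complex.I) l S y = H * (B l - A l * S y) := by
      intro l
      rw [hS, wirtM_mul hid hσd, wirtM_inv hO h.contDiffOn_matrix (fun _ h' => h.det_ne_zero h') hy]
      simp only [hH, hA, hB, Matrix.mul_sub, Matrix.neg_mul, Matrix.mul_assoc]
      abel
    have htr0 : ∀ p, (H * (B p - A p * S y)).trace = 0 := by
      intro p
      rw [← hdS, ← wirt_trace fun i j => ContDiffOn.differentiableAt_of_isOpen (hSs i j) hO hy,
        wirt_congr_of_eqOn hO hy (F' := fun _ => (t : ℂ)) htrS, wirt_const]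
    have h2 : ∀ a l, wirt (-Complex.I) l (fun y => S y k a) y
        = ∑ p, H k p * (B p l a - ∑ q, A p l q * S y q a) := by
      intro a l
      have : wirt (-Complex.I) l (fun y => S y k a) y = wirtM (-Complex.I) l S y k a := rfl
      rw [this, hdS, Matrix.mul_apply]
      refine Finset.sum_congr rfl fun p _ => ?_
      rw [Matrix.sub_apply, Matrix.mul_apply]
      simp only [hA, hB, hσ.symm hO hy l p, h.toIsClosedOneOneOn.symm hO hy l p]
    -- The Kähler identities for θ and for σ have exchanged the differentiation index l with p. The
    -- divergence of row k becomes g⁻¹_{kp} ∂_p tr(g⁻¹σ), which vanishes because the trace is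
    -- constant.
    have h3 : ∑ a, ∑ l, H a l * wirt (-Complex.I) l (fun y => S y k a) y
        = ∑ p, H k p * (H * (B p - A p * S y)).trace := by
      simp only [h2, trace_mul_eq_sum, Finset.mul_sum, Matrix.sub_apply, Matrix.mul_apply]
      rw [show (∑ a, ∑ l, ∑ p, H a l * (H k p * (B p l a - ∑ q, A p l q * S y q a)))
        = ∑ a, ∑ p, ∑ l, H a l * (H k p * (B p l a - ∑ q, A p l q * S y q a)) from
          Finset.sum_congr rfl fun a _ => Finset.sum_comm, Finset.sum_comm]
      exact Finset.sum_congr rfl fun p _ => Finset.sum_congr rfl fun a _ =>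
        Finset.sum_congr rfl fun l _ => by ring
    rw [h3]
    simp [htr0]
  have key := integral_pairing_extDeriv h.isOpen hK hKO hγ hv (Q := Q)
    (fun k j => (contDiffOn_det h.contDiffOn_matrix).mul (hSHs k j))
    (fun y hy => by
      rw [hQ, Matrix.IsHermitian, Matrix.conjTranspose_smul]
      simp only [hS]
      rw [Matrix.conjTranspose_mul, Matrix.conjTranspose_mul, (h.posDef hy).isHermitian.inv.eq,
        (hσH y).eq, Matrix.mul_assoc]
      congr 1
      rw [h.det_eq hy]
      simp)
    hdiv
  rw [setIntegral_congr_fun h.isOpen.measurableSet (g := fun y => (m.factorial * 2 ^ m : ℝ) *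
    (Q y * hermMatrix (stdVec m) (Form.at₂ (fun y => extDeriv γ y) y)).trace.re),
    integral_const_mul, key, mul_zero]
  intro y hy
  simp only
  rw [normSqForm, h.volumeDensity_mul_re hy, hQ, Matrix.smul_mul, Matrix.trace_smul, smul_eq_mul]
  rfl

/-- The Laplacian is symmetric. -/
lemma IsKahlerOn.integral_laplacian_symm (h : IsKahlerOn θ O) {u g : (Fin m → ℂ) → ℝ}
    (hu : ContDiffOn ℝ ∞ u O) (hg : ContDiffOn ℝ ∞ g O) (hK : IsCompact K) (hKO : K ⊆ O)
    (hv : ∀ y ∈ O, y ∉ K → u y = 0) :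
    ∫ y in O, (u y * localLaplacian θ g y - g y * localLaplacian θ u y) * volumeDensity θ y
      = 0 := by
  have hO := h.isOpen
  have huc := contDiffOn_ofReal hu
  have hgc := contDiffOn_ofReal hg
  -- This is Green's one-form g ∂̄u - u ∂̄g. It vanishes off K because u does, so g needs no support
  -- condition.
  set c : Fin m → (Fin m → ℂ) → ℂ := fun k y =>
    (g y : ℂ) * wirt Complex.I k (fun x => (u x : ℂ)) y
      - (u y : ℂ) * wirt Complex.I k (fun x => (g x : ℂ)) y with hc
  have hus : ∀ s k, ContDiffOn ℝ ∞ (fun y => wirt s k (fun x => (u x : ℂ)) y) O := fun s k =>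
    ContDiffOn.wirt hO huc
  have hgs : ∀ s k, ContDiffOn ℝ ∞ (fun y => wirt s k (fun x => (g x : ℂ)) y) O := fun s k =>
    ContDiffOn.wirt hO hgc
  have hcs : ∀ k, ContDiffOn ℝ ∞ (c k) O := fun k =>
    (hgc.mul (hus Complex.I k)).sub (huc.mul (hgs Complex.I k))
  set F : Fin m → (Fin m → ℂ) → ℂ := fun l y => (metricMatrix θ y).det * raise θ c l y with hF
  have hFs : ∀ l, ContDiffOn ℝ ∞ (F l) O := fun l =>
    (contDiffOn_det h.contDiffOn_matrix).mul (h.contDiffOn_raise hcs l)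
  have hFv : ∀ j, ∀ y ∈ O, y ∉ K → F j y = 0 := by
    intro j y hy hyK
    have h1 : ∀ k, c k y = 0 := by
      intro k
      simp only [hc]
      rw [wirt_congr_of_eqOn (hO.inter hK.isClosed.isOpen_compl) ⟨hy, hyK⟩ (F' := fun _ => 0)
        fun x hx => by simp [hv x hx.1 hx.2], wirt_const, hv y hy hyK]
      simp
    simp [hF, raise, h1]
  have h1 := integral_div_eq_zero hO hK hKO hFs hFv (-Complex.I)
  have hInt : IntegrableOn (fun y => ∑ j, wirt (-Complex.I) j (F j) y) O := by
    refine integrableOn_of_vanish hO hK hKO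
      (ContDiffOn.sum fun j _ => ContDiffOn.wirt hO (hFs j)) fun y hy hyK => ?_
    refine Finset.sum_eq_zero fun j _ => ?_
    rw [wirt_congr_of_eqOn (hO.inter hK.isClosed.isOpen_compl) ⟨hy, hyK⟩ (F' := fun _ => 0)
      fun x hx => hFv j x hx.1 hx.2, wirt_const]
  have h2 := integral_re hInt
  rw [h1] at h2
  simp only [RCLike.re_to_complex, Complex.zero_re] at h2
  rw [setIntegral_congr_fun hO.measurableSet (g := fun y => (m.factorial * 2 ^ m : ℝ) *
    (∑ j, wirt (-Complex.I) j (F j) y).re), integral_const_mul, h2, mul_zero]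
  intro y hy
  have hd : ∀ {f : (Fin m → ℂ) → ℂ}, ContDiffOn ℝ ∞ f O → DifferentiableAt ℝ f y := fun hf =>
    ContDiffOn.differentiableAt_of_isOpen hf hO hy
  simp only [hF]
  rw [h.div_det_raise hcs hy, ← h.volumeDensity_mul_re hy]
  congr 1
  set H := (metricMatrix θ y)⁻¹ with hH
  have hHH : H.IsHermitian := (h.posDef hy).isHermitian.inv
  have e1 : ∀ k l, wirt (-Complex.I) l (c k) y
      = (g y : ℂ) * wirt (-Complex.I) l (fun y => wirt Complex.I k (fun x => (u x : ℂ)) y) y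
        - (u y : ℂ) * wirt (-Complex.I) l (fun y => wirt Complex.I k (fun x => (g x : ℂ)) y) y
        + (wirt (-Complex.I) l (fun x => (g x : ℂ)) y * wirt Complex.I k (fun x => (u x : ℂ)) y
          - wirt (-Complex.I) l (fun x => (u x : ℂ)) y * wirt Complex.I k (fun x => (g x : ℂ)) y)
      := by
    intro k l
    simp only [hc]
    rw [wirt_sub ((hd hgc).fun_mul (hd (hus _ k))) ((hd huc).fun_mul (hd (hgs _ k))),
      wirt_mul (hd hgc) (hd (hus _ k)), wirt_mul (hd huc) (hd (hgs _ k))]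
    ring
  have hstar : ∀ {f : (Fin m → ℂ) → ℝ}, ContDiffOn ℝ ∞ f O → ∀ l,
      star (wirt (-Complex.I) l (fun x => (f x : ℂ)) y) = wirt Complex.I l (fun x => (f x : ℂ)) y
      := by
    intro f hf l
    have hfd := ContDiffOn.differentiableAt_of_isOpen hf hO hy
    rw [wirt_ofReal hfd, wirt_ofReal hfd]
    simp
  set X : ℂ := ∑ k, ∑ l, H k l * (wirt (-Complex.I) l (fun x => (g x : ℂ)) y
    * wirt Complex.I k (fun x => (u x : ℂ)) y) with hX
  have hXs : star X = ∑ k, ∑ l, H k l * (wirt (-Complex.I) l (fun x => (u x : ℂ)) y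
    * wirt Complex.I k (fun x => (g x : ℂ)) y) := by
    simp only [hX, star_sum, star_mul']
    rw [Finset.sum_comm]
    refine Finset.sum_congr rfl fun k _ => Finset.sum_congr rfl fun l _ => ?_
    rw [hHH.apply k l, hstar hg, ← hstar hu, star_star]
    ring
  -- The products of first derivatives are X and its conjugate, because g⁻¹ is hermitian. Their
  -- difference is imaginary and disappears on taking real parts.
  have e2 : ∑ k, ∑ l, H k l * wirt (-Complex.I) l (c k) y
      = ((u y * localLaplacian θ g y - g y * localLaplacian θ u y : ℝ) : ℂ) + (X - star X) := by
    push_cast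
    rw [h.localLaplacian_eq hu hy, h.localLaplacian_eq hg hy, hXs, hX]
    simp only [e1, mul_add, mul_sub, Finset.sum_add_distrib, Finset.sum_sub_distrib, ← hH,
      mul_neg, Finset.mul_sum, mul_left_comm _ ((g y : ℝ) : ℂ), mul_left_comm _ ((u y : ℝ) : ℂ)]
    ring
  rw [e2]
  simp

end Stokes

/-! ### The real smooth structure underlying a complex manifold. -/

section RealStructure

variable {E E' M M' : Type*} [NormedAddCommGroup E] [NormedSpace ℂ E]
  [NormedAddCommGroup E'] [NormedSpace ℂ E']
  [TopologicalSpace M] [ChartedSpace E M] [TopologicalSpace M'] [ChartedSpace E' M']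

lemma contDiffGroupoid_complex_le_real :
    contDiffGroupoid ω 𝓘(ℂ, E) ≤ contDiffGroupoid ∞ 𝓘(ℝ, E) := by
  rw [contDiffGroupoid, contDiffGroupoid]
  apply groupoid_of_pregroupoid_le
  intro f s hfs
  exact (ContDiffOn.restrict_scalars ℝ hfs).of_le le_top

lemma isManifold_real [IsManifold 𝓘(ℂ, E) ω M] : IsManifold 𝓘(ℝ, E) ∞ M where
  compatible {_ _} he he' := contDiffGroupoid_complex_le_real
    (HasGroupoid.compatible (G := contDiffGroupoid ω 𝓘(ℂ, E)) he he')

lemma maximalAtlas_complex_le_real {e : OpenPartialHomeomorph M E}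
    (he : e ∈ IsManifold.maximalAtlas 𝓘(ℂ, E) ω M) :
    e ∈ IsManifold.maximalAtlas 𝓘(ℝ, E) ∞ M := fun e' he' =>
  ⟨contDiffGroupoid_complex_le_real (he e' he').1, contDiffGroupoid_complex_le_real (he e' he').2⟩

lemma ContMDiffAt.real {f : M → M'} {x : M} (hf : ContMDiffAt 𝓘(ℂ, E) 𝓘(ℂ, E') ω f x) :
    ContMDiffAt 𝓘(ℝ, E) 𝓘(ℝ, E') ∞ f x := by
  rw [contMDiffAt_iff] at hf ⊢
  exact ⟨hf.1, (ContDiffWithinAt.restrict_scalars ℝ hf.2).of_le le_top⟩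

lemma ContMDiffOn.real {f : M → M'} {s : Set M} (hf : ContMDiffOn 𝓘(ℂ, E) 𝓘(ℂ, E') ω f s)
    (hs : IsOpen s) : ContMDiffOn 𝓘(ℝ, E) 𝓘(ℝ, E') ∞ f s := fun _ hx =>
  (ContMDiffAt.real (hf.contMDiffAt (hs.mem_nhds hx))).contMDiffWithinAt

/-- The differential is taken over ℝ. Its complex linearity is recovered from holomorphy in charts,
where the real derivative is the restriction of scalars of the complex one. -/
lemma tangentMapAt_smul {f : M → M'} {x : M} (hf : ContMDiffAt 𝓘(ℂ, E) 𝓘(ℂ, E') ω f x)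
    (c : ℂ) (v : E) :
    tangentMapAt (E := E) (E' := E') f x (c • v)
      = c • tangentMapAt (E := E) (E' := E') f x v := by
  have hR : MDifferentiableAt 𝓘(ℝ, E) 𝓘(ℝ, E') f x := (ContMDiffAt.real hf).mdifferentiableAt (by simp)
  have h2 := (contMDiffAt_iff.1 hf).2
  have h3 : DifferentiableAt ℂ (writtenInExtChartAt 𝓘(ℂ, E) 𝓘(ℂ, E') x f)
      (extChartAt 𝓘(ℂ, E) x x) := by
    have := h2.differentiableWithinAt (by simp)
    rw [modelWithCornersSelf_coe, Set.range_id, differentiableWithinAt_univ] at this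
    exact this
  have h4 : tangentMapAt (E := E) (E' := E') f x
      = fderiv ℝ (writtenInExtChartAt 𝓘(ℂ, E) 𝓘(ℂ, E') x f) (extChartAt 𝓘(ℂ, E) x x) := by
    refine hR.mfderiv.trans ?_
    change fderivWithin ℝ (writtenInExtChartAt 𝓘(ℂ, E) 𝓘(ℂ, E') x f) (Set.range id)
      (extChartAt 𝓘(ℂ, E) x x) = _
    rw [Set.range_id, fderivWithin_univ]
  rw [h4, h3.fderiv_restrictScalars ℝ]
  simp

end RealStructure

/-! ### Pullback of forms: functoriality, smoothness, exterior derivative. -/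

section Pullback

variable {E E' E'' M M' M'' : Type*} [NormedAddCommGroup E] [NormedSpace ℝ E]
  [NormedAddCommGroup E'] [NormedSpace ℝ E'] [NormedAddCommGroup E''] [NormedSpace ℝ E'']
  [TopologicalSpace M] [ChartedSpace E M] [TopologicalSpace M'] [ChartedSpace E' M']
  [TopologicalSpace M''] [ChartedSpace E'' M'']

lemma tangentMapAt_comp {g : M' → M''} {f : M → M'} {x : M}
    (hg : MDifferentiableAt 𝓘(ℝ, E') 𝓘(ℝ, E'') g (f x))
    (hf : MDifferentiableAt 𝓘(ℝ, E) 𝓘(ℝ, E') f x) :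
    tangentMapAt (E := E) (E' := E'') (g ∘ f) x
      = (tangentMapAt (E := E') (E' := E'') g (f x)).comp
        (tangentMapAt (E := E) (E' := E') f x) :=
  mfderiv_comp x hg hf

lemma tangentMapAt_congr {f g : M → M'} {x : M} (h : f =ᶠ[nhds x] g) :
    tangentMapAt (E := E) (E' := E') f x = tangentMapAt (E := E) (E' := E') g x :=
  h.mfderiv_eq

lemma tangentMapAt_eq_fderiv (f : E → E') (x : E) :
    tangentMapAt (E := E) (E' := E') f x = fderiv ℝ f x :=
  mfderiv_eq_fderiv

lemma Form.pull_at₂ {f : M → M'} (η : Form E' M' 2) (x : M) (u v : E) :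
    (Form.pull (E := E) (E' := E') f η).at₂ x u v
      = η.at₂ (f x) (tangentMapAt (E := E) (E' := E') f x u)
        (tangentMapAt (E := E) (E' := E') f x v) := by
  rw [Form.at₂, Form.at₂, Form.pull, ContinuousAlternatingMap.compContinuousLinearMap_apply]
  congr 1
  funext i
  fin_cases i <;> rfl

lemma Form.pull_comp {k : ℕ} {g : M' → M''} {f : M → M'} {x : M} (η : Form E'' M'' k)
    (hg : MDifferentiableAt 𝓘(ℝ, E') 𝓘(ℝ, E'') g (f x))
    (hf : MDifferentiableAt 𝓘(ℝ, E) 𝓘(ℝ, E') f x) :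
    Form.pull (E := E) (E' := E'') (g ∘ f) η x
      = Form.pull (E := E) (E' := E') f (Form.pull (E := E') (E' := E'') g η) x := by
  rw [Form.pull, Form.pull, tangentMapAt_comp hg hf]
  rfl

lemma Form.pull_congr {k : ℕ} {f g : M → M'} {x : M} (η : Form E' M' k) (h : f =ᶠ[nhds x] g) :
    Form.pull (E := E) (E' := E') f η x = Form.pull (E := E) (E' := E') g η x := by
  rw [Form.pull, Form.pull, tangentMapAt_congr h, h.self_of_nhds]

/-- On multilinear maps composition is analytic. Alternating maps embed there, and finite
dimensionality of E gives a continuous left inverse of the embedding, through which smoothness is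
transported back. -/
lemma contDiffOn_compContinuousLinearMap {E₀ : Type*} [NormedAddCommGroup E₀] [NormedSpace ℝ E₀]
    [FiniteDimensional ℝ E] {k : ℕ} {O : Set E₀} {σ : E₀ → E' [⋀^Fin k]→L[ℝ] ℝ}
    {L : E₀ → E →L[ℝ] E'} (hσ : ContDiffOn ℝ ∞ σ O) (hL : ContDiffOn ℝ ∞ L O) :
    ContDiffOn ℝ ∞ (fun p => (σ p).compContinuousLinearMap (L p)) O := by
  have hfin : FiniteDimensional ℝ (ContinuousMultilinearMap ℝ (fun _ : Fin k => E) ℝ) :=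
    Module.Finite.of_injective
      (ContinuousMultilinearMap.toMultilinearMapLinear :
        ContinuousMultilinearMap ℝ (fun _ : Fin k => E) ℝ →ₗ[ℝ] _)
      ContinuousMultilinearMap.toMultilinearMap_injective
  set T := (ContinuousAlternatingMap.toContinuousMultilinearMapLI
    (𝕜 := ℝ) (E := E) (F := ℝ) (ι := Fin k)) with hT
  obtain ⟨g, hg⟩ := T.toLinearMap.exists_leftInverse_of_injective
    (LinearMap.ker_eq_bot.2 T.injective)
  have h1 : ContDiffOn ℝ ∞ (fun p => ((σ p).toContinuousMultilinearMap).compContinuousLinearMap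
      (fun _ : Fin k => L p)) O := by
    have h2 : ContDiff ℝ ∞ (fun p : (Fin k → E →L[ℝ] E') ×
        (ContinuousMultilinearMap ℝ (fun _ : Fin k => E') ℝ) => p.2.compContinuousLinearMap p.1) :=
      contDiff_iff_contDiffAt.2 fun q =>
        (ContinuousMultilinearMap.analyticAt_uncurry_compContinuousLinearMap (𝕜 := ℝ)
          (Fm := fun _ : Fin k => E) (Em := fun _ : Fin k => E') (G := ℝ) (q := q)).contDiffAt
    have h3 : ContDiffOn ℝ ∞ (fun p => ((σ p).toContinuousMultilinearMap)) O :=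
      (ContinuousAlternatingMap.toContinuousMultilinearMapCLM (E := E') (F := ℝ) (ι := Fin k)
        ℝ (𝕜 := ℝ)).contDiff.comp_contDiffOn hσ
    exact h2.comp_contDiffOn ((contDiffOn_pi.2 fun _ => hL).prodMk h3)
  refine ((LinearMap.toContinuousLinearMap g).contDiff.comp_contDiffOn h1).congr fun p _ => ?_
  have := congrArg (fun f => f ((σ p).compContinuousLinearMap (L p))) hg
  exact this.symm

variable [IsManifold 𝓘(ℝ, E') ∞ M']

/-- Smoothness and d are defined through charts of the atlas only. Near p a pullback along f is
rewritten as the pullback of a chart expression along a smooth map of vector spaces, where the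
calculus of `extDeriv` applies. -/
lemma Form.pull_eventually {k : ℕ} {f : E → M'} {D : Set E} (hD : IsOpen D)
    (hf : ContMDiffOn 𝓘(ℝ, E) 𝓘(ℝ, E') ∞ f D) (η : Form E' M' k) {p : E} (hp : p ∈ D) :
    ∃ D' ⊆ D, IsOpen D' ∧ p ∈ D' ∧ ContDiffOn ℝ ∞ (chartAt E' (f p) ∘ f) D' ∧
      (∀ q ∈ D', (chartAt E' (f p) ∘ f) q ∈ (chartAt E' (f p)).target) ∧
      ∀ q ∈ D', Form.pull (E := E) (E' := E') f η q
        = (Form.pull (E := E') (E' := E') (chartAt E' (f p)).symm η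
          ((chartAt E' (f p) ∘ f) q)).compContinuousLinearMap
            (fderiv ℝ (chartAt E' (f p) ∘ f) q) := by
  set e := chartAt E' (f p) with he
  have heA : e ∈ IsManifold.maximalAtlas 𝓘(ℝ, E') ∞ M' := IsManifold.chart_mem_maximalAtlas _
  have hD' : IsOpen (D ∩ f ⁻¹' e.source) := hf.continuousOn.isOpen_inter_preimage hD e.open_source
  have hcf : ContMDiffOn 𝓘(ℝ, E) 𝓘(ℝ, E') ∞ (e ∘ f) (D ∩ f ⁻¹' e.source) :=
    (contMDiffOn_of_mem_maximalAtlas heA).comp (hf.mono Set.inter_subset_left) fun q hq => hq.2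
  refine ⟨D ∩ f ⁻¹' e.source, Set.inter_subset_left, hD', ⟨hp, mem_chart_source E' (f p)⟩,
    hcf.contDiffOn, fun q hq => e.map_source hq.2, fun q hq => ?_⟩
  have h1 : f =ᶠ[nhds q] e.symm ∘ (e ∘ f) := by
    filter_upwards [hD'.mem_nhds hq] with r hr
    exact (e.left_inv hr.2).symm
  have h2 : MDifferentiableAt 𝓘(ℝ, E') 𝓘(ℝ, E') e.symm ((e ∘ f) q) :=
    ((contMDiffOn_symm_of_mem_maximalAtlas heA).contMDiffAt
      (e.open_target.mem_nhds (e.map_source hq.2))).mdifferentiableAt (by simp)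
  have h3 : MDifferentiableAt 𝓘(ℝ, E) 𝓘(ℝ, E') (e ∘ f) q :=
    (hcf.contMDiffAt (hD'.mem_nhds hq)).mdifferentiableAt (by simp)
  rw [Form.pull_congr η h1, Form.pull_comp η h2 h3, Form.pull, tangentMapAt_eq_fderiv]

lemma Form.contDiffOn_pull [FiniteDimensional ℝ E] {k : ℕ} {f : E → M'} {D : Set E}
    (hD : IsOpen D) (hf : ContMDiffOn 𝓘(ℝ, E) 𝓘(ℝ, E') ∞ f D) {η : Form E' M' k}
    (hη : η.IsSmooth) : ContDiffOn ℝ ∞ (Form.pull (E := E) (E' := E') f η) D := by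
  intro p hp
  obtain ⟨D', -, hD'o, hpD', hτ, hm, hq⟩ := Form.pull_eventually hD hf η hp
  have h1 := contDiffOn_compContinuousLinearMap
    ((hη _ (chart_mem_atlas E' (f p))).comp hτ hm) (hτ.fderiv_of_isOpen hD'o (by simp))
  exact ((h1.congr hq).contDiffAt (hD'o.mem_nhds hpD')).contDiffWithinAt

lemma Form.extDeriv_pull {k : ℕ} {f : E → M'} {D : Set E}
    (hD : IsOpen D) (hf : ContMDiffOn 𝓘(ℝ, E) 𝓘(ℝ, E') ∞ f D) {η : Form E' M' k}
    {ζ : Form E' M' (k + 1)} (hη : η.IsSmooth) (hζ : η.HasExtDeriv ζ) {p : E} (hp : p ∈ D) :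
    extDeriv (Form.pull (E := E) (E' := E') f η) p = Form.pull (E := E) (E' := E') f ζ p := by
  obtain ⟨D', hD'D, hD'o, hpD', hτ, hm, hq⟩ := Form.pull_eventually hD hf η hp
  obtain ⟨D'', -, -, hpD'', -, -, hq'⟩ := Form.pull_eventually hD hf ζ hp
  have hea := chart_mem_atlas E' (f p)
  have h1 : DifferentiableAt ℝ (Form.pull (E := E') (E' := E') (chartAt E' (f p)).symm η)
      ((chartAt E' (f p) ∘ f) p) :=
    ContDiffOn.differentiableAt_of_isOpen (hη _ hea) (chartAt E' (f p)).open_target (hm p hpD')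
  rw [(Filter.eventuallyEq_of_mem (hD'o.mem_nhds hpD') hq).extDeriv_eq,
    extDeriv_pullback h1 ((hτ.contDiffAt (hD'o.mem_nhds hpD')).of_le two_le_infty)
      (by rw [minSmoothness_of_isRCLikeNormedField]), hζ _ hea _ (hm p hpD'), hq' p hpD'']

end Pullback

/-! ### Coordinates in which the submersion is a projection. -/

section AdaptedCharts

variable {EX EB X B : Type*}
  [NormedAddCommGroup EX] [NormedSpace ℂ EX] [NormedAddCommGroup EB] [NormedSpace ℂ EB]
  [TopologicalSpace X] [ChartedSpace EX X] [TopologicalSpace B] [ChartedSpace EB B]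
  {m : ℕ} {π : X → B} (h : IsHolSubmersion EX EB m π)

/-- The open set on which the adapted coordinates around `x` are defined. -/
def adaptedSource (x : X) : Set X := (h x).domChart.source

lemma isOpen_adaptedSource (x : X) : IsOpen (adaptedSource h x) := (h x).domChart.open_source

lemma mem_adaptedSource (x : X) : x ∈ adaptedSource h x := (h x).mem_domChart_source

lemma isOpen_adaptedDomain (x : X) : IsOpen (adaptedDomain h x) :=
  (h x).domChart.open_target.preimage (h x).equiv.symm.continuous

variable {h} in
lemma adaptedCoord_mem {x y : X} (hy : y ∈ adaptedSource h x) :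
    adaptedCoord h x y ∈ adaptedDomain h x := by
  simp only [adaptedDomain, adaptedCoord, Set.mem_ofPred_eq, ContinuousLinearEquiv.symm_apply_apply]
  exact (h x).domChart.map_source hy

variable {h} in
lemma adaptedParam_mem {x : X} {p : EB × (Fin m → ℂ)} (hp : p ∈ adaptedDomain h x) :
    adaptedParam h x p ∈ adaptedSource h x :=
  (h x).domChart.map_target hp

variable {h} in
lemma adaptedCoord_adaptedParam {x : X} {p : EB × (Fin m → ℂ)} (hp : p ∈ adaptedDomain h x) :
    adaptedCoord h x (adaptedParam h x p) = p := by
  simp only [adaptedCoord, adaptedParam]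
  rw [(h x).domChart.right_inv hp, ContinuousLinearEquiv.apply_symm_apply]

variable {h} in
lemma adaptedParam_adaptedCoord {x y : X} (hy : y ∈ adaptedSource h x) :
    adaptedParam h x (adaptedCoord h x y) = y := by
  simp only [adaptedCoord, adaptedParam, ContinuousLinearEquiv.symm_apply_apply]
  exact (h x).domChart.left_inv hy

variable {h} in
lemma proj_mem_codChart {x y : X} (hy : y ∈ adaptedSource h x) : π y ∈ (h x).codChart.source :=
  (h x).source_subset_preimage_source hy

variable {h} in
lemma adaptedCoord_fst {x y : X} (hy : y ∈ adaptedSource h x) :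
    (adaptedCoord h x y).1 = (h x).codChart (π y) := by
  have h1 := (h x).writtenInCharts 
    (show (h x).domChart y ∈ ((h x).domChart.extend 𝓘(ℂ, EX)).target by
      simpa using (h x).domChart.map_source hy)
  simp only [Function.comp_apply, OpenPartialHomeomorph.extend_coe,
    OpenPartialHomeomorph.extend_coe_symm, modelWithCornersSelf_coe, modelWithCornersSelf_coe_symm,
    id_eq] at h1
  rw [(h x).domChart.left_inv hy] at h1
  exact h1.symm

variable {h} in
lemma proj_eq_codChart_symm {x y : X} (hy : y ∈ adaptedSource h x) :
    π y = (h x).codChart.symm (adaptedCoord h x y).1 := by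
  rw [adaptedCoord_fst hy, (h x).codChart.left_inv (proj_mem_codChart hy)]

variable {h} in
lemma proj_adaptedParam {x : X} {p : EB × (Fin m → ℂ)} (hp : p ∈ adaptedDomain h x) :
    π (adaptedParam h x p) = (h x).codChart.symm p.1 := by
  rw [proj_eq_codChart_symm (adaptedParam_mem hp), adaptedCoord_adaptedParam hp]

variable {h} in
lemma fst_mem_codChart_target {x : X} {p : EB × (Fin m → ℂ)} (hp : p ∈ adaptedDomain h x) :
    p.1 ∈ (h x).codChart.target := by
  have h1 := adaptedCoord_fst (adaptedParam_mem hp)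
  rw [adaptedCoord_adaptedParam hp] at h1
  rw [h1]
  exact (h x).codChart.map_source (proj_mem_codChart (adaptedParam_mem hp))

lemma contMDiffOn_adaptedParam (x : X) :
    ContMDiffOn 𝓘(ℂ, EB × (Fin m → ℂ)) 𝓘(ℂ, EX) ω (adaptedParam h x) (adaptedDomain h x) :=
  (contMDiffOn_symm_of_mem_maximalAtlas (h x).domChart_mem_maximalAtlas).comp
    (h x).equiv.symm.contDiff.contMDiff.contMDiffOn fun _ hp => hp

lemma contMDiffOn_adaptedCoord (x : X) :
    ContMDiffOn 𝓘(ℂ, EX) 𝓘(ℂ, EB × (Fin m → ℂ)) ω (adaptedCoord h x) (adaptedSource h x) :=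
  (h x).equiv.contDiff.contMDiff.comp_contMDiffOn
    (contMDiffOn_of_mem_maximalAtlas (h x).domChart_mem_maximalAtlas)

variable {h} in
lemma contMDiffAt_adaptedParam {x : X} {p : EB × (Fin m → ℂ)} (hp : p ∈ adaptedDomain h x) :
    ContMDiffAt 𝓘(ℂ, EB × (Fin m → ℂ)) 𝓘(ℂ, EX) ω (adaptedParam h x) p :=
  (contMDiffOn_adaptedParam h x).contMDiffAt ((isOpen_adaptedDomain h x).mem_nhds hp)

variable {h} in
lemma contMDiffAt_adaptedCoord {x y : X} (hy : y ∈ adaptedSource h x) :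
    ContMDiffAt 𝓘(ℂ, EX) 𝓘(ℂ, EB × (Fin m → ℂ)) ω (adaptedCoord h x) y :=
  (contMDiffOn_adaptedCoord h x).contMDiffAt ((isOpen_adaptedSource h x).mem_nhds hy)

variable {h} in
lemma mdifferentiableAt_adaptedParam {x : X} {p : EB × (Fin m → ℂ)} (hp : p ∈ adaptedDomain h x) :
    MDifferentiableAt 𝓘(ℝ, EB × (Fin m → ℂ)) 𝓘(ℝ, EX) (adaptedParam h x) p :=
  (ContMDiffAt.real (contMDiffAt_adaptedParam hp)).mdifferentiableAt (by simp)

variable {h} in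
lemma mdifferentiableAt_adaptedCoord {x y : X} (hy : y ∈ adaptedSource h x) :
    MDifferentiableAt 𝓘(ℝ, EX) 𝓘(ℝ, EB × (Fin m → ℂ)) (adaptedCoord h x) y :=
  (ContMDiffAt.real (contMDiffAt_adaptedCoord hy)).mdifferentiableAt (by simp)

/-- The differential of the adapted parametrization. -/
def paramDeriv (x : X) (p : EB × (Fin m → ℂ)) : EB × (Fin m → ℂ) →L[ℝ] EX :=
  tangentMapAt (E := EB × (Fin m → ℂ)) (E' := EX) (adaptedParam h x) p

/-- The differential of the adapted coordinates. -/
def coordDeriv (x y : X) : EX →L[ℝ] EB × (Fin m → ℂ) :=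
  tangentMapAt (E := EX) (E' := EB × (Fin m → ℂ)) (adaptedCoord h x) y

variable {h}

lemma coordDeriv_paramDeriv {x : X} {p : EB × (Fin m → ℂ)} (hp : p ∈ adaptedDomain h x)
    (v : EB × (Fin m → ℂ)) :
    coordDeriv h x (adaptedParam h x p) (paramDeriv h x p v) = v := by
  have h1 := tangentMapAt_comp (mdifferentiableAt_adaptedCoord (adaptedParam_mem hp))
    (mdifferentiableAt_adaptedParam hp)
  have h2 : adaptedCoord h x ∘ adaptedParam h x =ᶠ[nhds p] id := by
    filter_upwards [(isOpen_adaptedDomain h x).mem_nhds hp] with q hq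
    exact adaptedCoord_adaptedParam hq
  rw [tangentMapAt_congr h2, tangentMapAt_eq_fderiv, fderiv_id] at h1
  exact (congrArg (fun L => L v) h1).symm

lemma paramDeriv_coordDeriv {x y : X} (hy : y ∈ adaptedSource h x) (v : EX) :
    paramDeriv h x (adaptedCoord h x y) (coordDeriv h x y v) = v := by
  have h1 := tangentMapAt_comp (mdifferentiableAt_adaptedParam (adaptedCoord_mem hy))
    (mdifferentiableAt_adaptedCoord hy)
  have h2 : adaptedParam h x ∘ adaptedCoord h x =ᶠ[nhds y] id := by
    filter_upwards [(isOpen_adaptedSource h x).mem_nhds hy] with q hq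
    exact adaptedParam_adaptedCoord hq
  have h3 : tangentMapAt (E := EX) (E' := EX) (id : X → X) y = ContinuousLinearMap.id ℝ EX :=
    mfderiv_id
  rw [tangentMapAt_congr h2, h3] at h1
  exact (congrArg (fun L => L v) h1).symm

lemma paramDeriv_smul {x : X} {p : EB × (Fin m → ℂ)} (hp : p ∈ adaptedDomain h x) (c : ℂ)
    (v : EB × (Fin m → ℂ)) : paramDeriv h x p (c • v) = c • paramDeriv h x p v :=
  tangentMapAt_smul (contMDiffAt_adaptedParam hp) c v

lemma coordDeriv_smul {x y : X} (hy : y ∈ adaptedSource h x) (c : ℂ) (v : EX) :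
    coordDeriv h x y (c • v) = c • coordDeriv h x y v :=
  tangentMapAt_smul (contMDiffAt_adaptedCoord hy) c v

lemma mdifferentiableAt_proj [IsManifold 𝓘(ℂ, EX) ω X] [IsManifold 𝓘(ℂ, EB) ω B]
    (h : IsHolSubmersion EX EB m π) (x : X) : MDifferentiableAt 𝓘(ℝ, EX) 𝓘(ℝ, EB) π x :=
  (ContMDiffAt.real (h x).contMDiffAt).mdifferentiableAt (by simp)

variable [IsManifold 𝓘(ℂ, EX) ω X] [IsManifold 𝓘(ℂ, EB) ω B]

/-- In adapted coordinates, `dπ` is the projection, up to the isomorphism given by the base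
chart. -/
lemma tangentMapAt_proj_paramDeriv {x : X} {p : EB × (Fin m → ℂ)} (hp : p ∈ adaptedDomain h x)
    (v : EB × (Fin m → ℂ)) :
    tangentMapAt (E := EX) (E' := EB) π (adaptedParam h x p) (paramDeriv h x p v)
      = tangentMapAt (E := EB) (E' := EB) (h x).codChart.symm p.1 v.1 := by
  have h1 := tangentMapAt_comp (mdifferentiableAt_proj h (adaptedParam h x p))
    (mdifferentiableAt_adaptedParam hp)
  have h2 : π ∘ adaptedParam h x =ᶠ[nhds p] (h x).codChart.symm ∘ Prod.fst := by
    filter_upwards [(isOpen_adaptedDomain h x).mem_nhds hp] with q hq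
    exact proj_adaptedParam hq
  have h3 : MDifferentiableAt 𝓘(ℝ, EB) 𝓘(ℝ, EB) (h x).codChart.symm p.1 :=
    (ContMDiffAt.real ((contMDiffOn_symm_of_mem_maximalAtlas
      (h x).codChart_mem_maximalAtlas).contMDiffAt
        ((h x).codChart.open_target.mem_nhds (fst_mem_codChart_target hp)))).mdifferentiableAt
      (by simp)
  have h4 : MDifferentiableAt 𝓘(ℝ, EB × (Fin m → ℂ)) 𝓘(ℝ, EB)
      (Prod.fst : EB × (Fin m → ℂ) → EB) p := by
    rw [mdifferentiableAt_iff_differentiableAt]; exact differentiableAt_fst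
  rw [tangentMapAt_congr h2, tangentMapAt_comp (f := (Prod.fst : EB × (Fin m → ℂ) → EB)) h3 h4,
    tangentMapAt_eq_fderiv, fderiv_fst] at h1
  exact (congrArg (fun L => L v) h1).symm

lemma tangentMapAt_codChart_symm_injective {x : X} {w : EB} (hw : w ∈ (h x).codChart.target) :
    Function.Injective (tangentMapAt (E := EB) (E' := EB) (h x).codChart.symm w) := by
  have h3 : MDifferentiableAt 𝓘(ℝ, EB) 𝓘(ℝ, EB) (h x).codChart.symm w :=
    (ContMDiffAt.real ((contMDiffOn_symm_of_mem_maximalAtlas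
      (h x).codChart_mem_maximalAtlas).contMDiffAt
        ((h x).codChart.open_target.mem_nhds hw))).mdifferentiableAt (by simp)
  have h4 : MDifferentiableAt 𝓘(ℝ, EB) 𝓘(ℝ, EB) (h x).codChart ((h x).codChart.symm w) :=
    (ContMDiffAt.real ((contMDiffOn_of_mem_maximalAtlas
      (h x).codChart_mem_maximalAtlas).contMDiffAt
        ((h x).codChart.open_source.mem_nhds
          ((h x).codChart.map_target hw)))).mdifferentiableAt (by simp)
  have h1 := tangentMapAt_comp h4 h3
  have h2 : (h x).codChart ∘ (h x).codChart.symm =ᶠ[nhds w] id := by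
    filter_upwards [(h x).codChart.open_target.mem_nhds hw] with q hq
    exact (h x).codChart.right_inv hq
  rw [tangentMapAt_congr h2, tangentMapAt_eq_fderiv, fderiv_id] at h1
  intro u v huv
  have hu := congrArg (fun L => L u) h1
  have hv := congrArg (fun L => L v) h1
  simp only [ContinuousLinearMap.coe_comp, Function.comp_apply, ContinuousLinearMap.coe_id',
    id_eq] at hu hv
  rw [hu, huv, ← hv]

lemma isVertical_paramDeriv_iff {x : X} {p : EB × (Fin m → ℂ)} (hp : p ∈ adaptedDomain h x)
    (v : EB × (Fin m → ℂ)) :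
    IsVertical (EB := EB) π (adaptedParam h x p) (paramDeriv h x p v) ↔ v.1 = 0 := by
  rw [IsVertical, tangentMapAt_proj_paramDeriv hp]
  constructor
  · intro h1
    apply tangentMapAt_codChart_symm_injective (fst_mem_codChart_target hp)
    rw [h1, map_zero]
  · intro h1
    rw [h1, map_zero]

end AdaptedCharts

/-! ### Fibre pieces in adapted coordinates and forms restricted to them. -/

section Slices

variable {EX EB X B : Type*}
  [NormedAddCommGroup EX] [NormedSpace ℂ EX] [NormedAddCommGroup EB] [NormedSpace ℂ EB]
  [TopologicalSpace X] [ChartedSpace EX X] [TopologicalSpace B] [ChartedSpace EB B]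
  {m : ℕ} {π : X → B} (h : IsHolSubmersion EX EB m π)

/-- The part of a fibre of `π` in the adapted coordinates around `x` on which these have first
component `w`. -/
def slice (x : X) (w : EB) : (Fin m → ℂ) → X := fun z => adaptedParam h x (w, z)

/-- The domain of `slice`. -/
def sliceDomain (x : X) (w : EB) : Set (Fin m → ℂ) := {z | (w, z) ∈ adaptedDomain h x}

/-- The restriction of `Ω` to a slice. -/
def sliceForm (Ω : Form EX X 2) (x : X) (w : EB) : Form (Fin m → ℂ) (Fin m → ℂ) 2 :=
  Form.pull (E := Fin m → ℂ) (E' := EX) (slice h x w) Ω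

/-- The first component of the coordinates of `x`. -/
def basePoint (x : X) : EB := (adaptedCoord h x x).1

lemma fibreParam_eq_slice (x : X) : fibreParam h x = slice h x (basePoint h x) := rfl

lemma fibreForm_eq_sliceForm (Ω : Form EX X 2) (x : X) :
    fibreForm h Ω x = sliceForm h Ω x (basePoint h x) := rfl

lemma isOpen_sliceDomain (x : X) (w : EB) : IsOpen (sliceDomain h x w) :=
  (isOpen_adaptedDomain h x).preimage (by fun_prop)

lemma isOpen_fibreDomain (x : X) : IsOpen (fibreDomain h x) := isOpen_sliceDomain h x _

lemma fibrePoint_mem (x : X) : fibrePoint h x ∈ fibreDomain h x :=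
  adaptedCoord_mem (mem_adaptedSource h x)

lemma fibreParam_fibrePoint (x : X) : fibreParam h x (fibrePoint h x) = x :=
  adaptedParam_adaptedCoord (mem_adaptedSource h x)

variable {h}

lemma proj_slice {x : X} {w : EB} {z : Fin m → ℂ} (hz : z ∈ sliceDomain h x w) :
    π (slice h x w z) = (h x).codChart.symm w :=
  proj_adaptedParam hz

lemma codChart_symm_basePoint (x : X) : (h x).codChart.symm (basePoint h x) = π x :=
  (proj_eq_codChart_symm (mem_adaptedSource h x)).symm

lemma proj_fibreParam {x : X} {z : Fin m → ℂ} (hz : z ∈ fibreDomain h x) :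
    π (fibreParam h x z) = π x :=
  (proj_slice hz).trans (codChart_symm_basePoint x)

lemma contMDiffOn_slice (x : X) (w : EB) :
    ContMDiffOn 𝓘(ℂ, Fin m → ℂ) 𝓘(ℂ, EX) ω (slice h x w) (sliceDomain h x w) :=
  (contMDiffOn_adaptedParam h x).comp
    (ContDiff.contMDiff (by fun_prop : ContDiff ℂ ω fun z : Fin m → ℂ => (w, z))).contMDiffOn
    fun _ hz => hz

lemma contMDiffAt_slice {x : X} {w : EB} {z : Fin m → ℂ} (hz : z ∈ sliceDomain h x w) :
    ContMDiffAt 𝓘(ℂ, Fin m → ℂ) 𝓘(ℂ, EX) ω (slice h x w) z :=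
  (contMDiffOn_slice x w).contMDiffAt ((isOpen_sliceDomain h x w).mem_nhds hz)

lemma mdifferentiableAt_slice {x : X} {w : EB} {z : Fin m → ℂ} (hz : z ∈ sliceDomain h x w) :
    MDifferentiableAt 𝓘(ℝ, Fin m → ℂ) 𝓘(ℝ, EX) (slice h x w) z :=
  (ContMDiffAt.real (contMDiffAt_slice hz)).mdifferentiableAt (by simp)

lemma fderiv_prodMk_const (w : EB) (z u : Fin m → ℂ) :
    fderiv ℝ (fun z : Fin m → ℂ => (w, z)) z u = (0, u) := by
  have h1 : HasFDerivAt (fun z : Fin m → ℂ => (w, z)) (ContinuousLinearMap.inr ℝ EB (Fin m → ℂ)) z :=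
    hasFDerivAt_prodMk_right w z
  rw [h1.fderiv]
  rfl

lemma tangentMapAt_slice {x : X} {w : EB} {z : Fin m → ℂ} (hz : z ∈ sliceDomain h x w)
    (u : Fin m → ℂ) :
    tangentMapAt (E := Fin m → ℂ) (E' := EX) (slice h x w) z u = paramDeriv h x (w, z) (0, u) := by
  have h4 : MDifferentiableAt 𝓘(ℝ, Fin m → ℂ) 𝓘(ℝ, EB × (Fin m → ℂ))
      (fun z : Fin m → ℂ => (w, z)) z := by
    rw [mdifferentiableAt_iff_differentiableAt]; fun_prop
  have h1 := tangentMapAt_comp (f := fun z : Fin m → ℂ => (w, z))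
    (mdifferentiableAt_adaptedParam hz) h4
  have h2 := congrArg (fun L => L u) h1
  simp only [ContinuousLinearMap.coe_comp, Function.comp_apply] at h2
  rw [tangentMapAt_eq_fderiv, fderiv_prodMk_const] at h2
  exact h2

lemma tangentMapAt_slice_injective {x : X} {w : EB} {z : Fin m → ℂ} (hz : z ∈ sliceDomain h x w) :
    Function.Injective (tangentMapAt (E := Fin m → ℂ) (E' := EX) (slice h x w) z) := by
  intro u v huv
  rw [tangentMapAt_slice hz, tangentMapAt_slice hz] at huv
  have h1 := congrArg (coordDeriv h x (adaptedParam h x (w, z))) huv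
  rw [coordDeriv_paramDeriv hz, coordDeriv_paramDeriv hz] at h1
  exact (Prod.ext_iff.1 h1).2

/-- The pullback of `Ω` by the adapted parametrization. -/
def adaptedForm {k : ℕ} (h : IsHolSubmersion EX EB m π) (Ω : Form EX X k) (x : X) :
    Form (EB × (Fin m → ℂ)) (EB × (Fin m → ℂ)) k :=
  Form.pull (E := EB × (Fin m → ℂ)) (E' := EX) (adaptedParam h x) Ω

lemma adaptedForm_at₂ (Ω : Form EX X 2) (x : X) (p u v : EB × (Fin m → ℂ)) :
    (adaptedForm h Ω x).at₂ p u v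
      = Ω.at₂ (adaptedParam h x p) (paramDeriv h x p u) (paramDeriv h x p v) :=
  Form.pull_at₂ _ _ _ _

lemma sliceForm_at₂ (Ω : Form EX X 2) {x : X} {w : EB} {z : Fin m → ℂ}
    (hz : z ∈ sliceDomain h x w) (u v : Fin m → ℂ) :
    (sliceForm h Ω x w).at₂ z u v = (adaptedForm h Ω x).at₂ (w, z) (0, u) (0, v) := by
  rw [adaptedForm_at₂, sliceForm, Form.pull_at₂, tangentMapAt_slice hz, tangentMapAt_slice hz]
  rfl

variable [IsManifold 𝓘(ℂ, EX) ω X] [IsManifold 𝓘(ℂ, EB) ω B]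

lemma isVertical_tangentMapAt_slice {x : X} {w : EB} {z : Fin m → ℂ} (hz : z ∈ sliceDomain h x w)
    (u : Fin m → ℂ) : IsVertical (EB := EB) π (slice h x w z)
      (tangentMapAt (E := Fin m → ℂ) (E' := EX) (slice h x w) z u) := by
  rw [tangentMapAt_slice hz]
  exact (isVertical_paramDeriv_iff hz _).2 rfl

lemma contDiffOn_adaptedForm [FiniteDimensional ℂ EB] {k : ℕ} {η : Form EX X k}
    (hη : η.IsSmooth) (x : X) : ContDiffOn ℝ ∞ (adaptedForm h η x) (adaptedDomain h x) := by
  have : IsManifold 𝓘(ℝ, EX) ∞ X := isManifold_real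
  exact Form.contDiffOn_pull (isOpen_adaptedDomain h x)
    (ContMDiffOn.real (contMDiffOn_adaptedParam h x) (isOpen_adaptedDomain h x)) hη

lemma extDeriv_adaptedForm {k : ℕ} {η : Form EX X k} {ζ : Form EX X (k + 1)}
    (hη : η.IsSmooth) (hζ : η.HasExtDeriv ζ) {x : X} {p : EB × (Fin m → ℂ)}
    (hp : p ∈ adaptedDomain h x) :
    extDeriv (adaptedForm h η x) p = adaptedForm h ζ x p := by
  have : IsManifold 𝓘(ℝ, EX) ∞ X := isManifold_real
  exact Form.extDeriv_pull (isOpen_adaptedDomain h x)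
    (ContMDiffOn.real (contMDiffOn_adaptedParam h x) (isOpen_adaptedDomain h x)) hη hζ hp

lemma contDiffOn_pull_slice {k : ℕ} {η : Form EX X k} (hη : η.IsSmooth) (x : X) (w : EB) :
    ContDiffOn ℝ ∞ (Form.pull (E := Fin m → ℂ) (E' := EX) (slice h x w) η) (sliceDomain h x w) := by
  have : IsManifold 𝓘(ℝ, EX) ∞ X := isManifold_real
  exact Form.contDiffOn_pull (isOpen_sliceDomain h x w)
    (ContMDiffOn.real (contMDiffOn_slice x w) (isOpen_sliceDomain h x w)) hη

lemma extDeriv_pull_slice {k : ℕ} {η : Form EX X k} {ζ : Form EX X (k + 1)}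
    (hη : η.IsSmooth) (hζ : η.HasExtDeriv ζ) {x : X} {w : EB} {z : Fin m → ℂ}
    (hz : z ∈ sliceDomain h x w) :
    extDeriv (Form.pull (E := Fin m → ℂ) (E' := EX) (slice h x w) η) z
      = Form.pull (E := Fin m → ℂ) (E' := EX) (slice h x w) ζ z := by
  have : IsManifold 𝓘(ℝ, EX) ∞ X := isManifold_real
  exact Form.extDeriv_pull (isOpen_sliceDomain h x w)
    (ContMDiffOn.real (contMDiffOn_slice x w) (isOpen_sliceDomain h x w)) hη hζ hz

lemma contDiffOn_pull_fibreParam {k : ℕ} {η : Form EX X k} (hη : η.IsSmooth) (x : X) :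
    ContDiffOn ℝ ∞ (Form.pull (E := Fin m → ℂ) (E' := EX) (fibreParam h x) η) (fibreDomain h x) :=
  contDiffOn_pull_slice hη x _

lemma extDeriv_pull_fibreParam {k : ℕ} {η : Form EX X k} {ζ : Form EX X (k + 1)}
    (hη : η.IsSmooth) (hζ : η.HasExtDeriv ζ) {x : X} {z : Fin m → ℂ} (hz : z ∈ fibreDomain h x) :
    extDeriv (Form.pull (E := Fin m → ℂ) (E' := EX) (fibreParam h x) η) z
      = Form.pull (E := Fin m → ℂ) (E' := EX) (fibreParam h x) ζ z :=
  extDeriv_pull_slice hη hζ hz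

lemma isClosedOneOneOn_sliceForm {η : Form EX X 2} (hη : η.IsClosed) (h11 : η.IsOneOne) (x : X)
    (w : EB) : IsClosedOneOneOn (sliceForm h η x w) (sliceDomain h x w) where
  smooth := contDiffOn_pull_slice hη.1 x w
  closed z hz := by
    rw [sliceForm, extDeriv_pull_slice hη.1 hη.2 hz]
    rfl
  oneOne z hz u v := by
    rw [sliceForm, Form.pull_at₂, Form.pull_at₂, tangentMapAt_smul (contMDiffAt_slice hz),
      tangentMapAt_smul (contMDiffAt_slice hz), h11]

lemma IsRelativelyKahler.sliceForm {Ω : Form EX X 2} (hΩ : IsRelativelyKahler EB π Ω) (x : X)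
    (w : EB) : IsKahlerOn (sliceForm h Ω x w) (sliceDomain h x w) where
  toIsClosedOneOneOn := isClosedOneOneOn_sliceForm hΩ.closed hΩ.oneOne x w
  isOpen := isOpen_sliceDomain h x w
  pos z hz v hv := by
    rw [FibrationGeometry.sliceForm, Form.pull_at₂, tangentMapAt_smul (contMDiffAt_slice hz)]
    refine hΩ.pos _ _ (isVertical_tangentMapAt_slice hz v) fun h0 => hv ?_
    apply tangentMapAt_slice_injective hz
    rw [h0, map_zero]

lemma IsRelativelyKahler.fibreForm {Ω : Form EX X 2} (hΩ : IsRelativelyKahler EB π Ω) (x : X) :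
    IsKahlerOn (fibreForm h Ω x) (fibreDomain h x) :=
  hΩ.sliceForm x _

end Slices

/-! ### Holomorphic changes of fibre coordinates and invariance of fibre quantities. -/

section LinearChange

variable {V W : Type*} [AddCommGroup V] [Module ℂ V] [AddCommGroup W] [Module ℂ W]

lemma hermMatrix_comp {ι : Type*} {L : V → W} (hL : ∀ v, L (Complex.I • v) = Complex.I • L v)
    {σ : V → V → ℝ} {σ' : W → W → ℝ} (hσ : ∀ u v, σ u v = σ' (L u) (L v)) (e : ι → V) :
    hermMatrix e σ = hermMatrix (fun j => L (e j)) σ' := by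
  ext j k
  simp only [hermMatrix, Matrix.of_apply, hermCoeff, hσ, hL]

lemma contraction_comp {ι : Type*} [Fintype ι] [DecidableEq ι] {L : V → W}
    (hL : ∀ v, L (Complex.I • v) = Complex.I • L v)
    {θ σ : V → V → ℝ} {θ' σ' : W → W → ℝ} (hθ : ∀ u v, θ u v = θ' (L u) (L v))
    (hσ : ∀ u v, σ u v = σ' (L u) (L v)) (e : ι → V) :
    contraction e θ σ = contraction (fun j => L (e j)) θ' σ' := by
  rw [contraction, contraction, hermMatrix_comp hL hθ, hermMatrix_comp hL hσ]

lemma normSqForm_comp {ι : Type*} [Fintype ι] [DecidableEq ι] {L : V → W}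
    (hL : ∀ v, L (Complex.I • v) = Complex.I • L v)
    {θ σ τ : V → V → ℝ} {θ' σ' τ' : W → W → ℝ} (hθ : ∀ u v, θ u v = θ' (L u) (L v))
    (hσ : ∀ u v, σ u v = σ' (L u) (L v)) (hτ : ∀ u v, τ u v = τ' (L u) (L v)) (e : ι → V) :
    normSqForm e θ σ τ = normSqForm (fun j => L (e j)) θ' σ' τ' := by
  rw [normSqForm, normSqForm, hermMatrix_comp hL hθ, hermMatrix_comp hL hσ, hermMatrix_comp hL hτ]

end LinearChange

section Transition

variable {EX EB X B : Type*}
  [NormedAddCommGroup EX] [NormedSpace ℂ EX] [NormedAddCommGroup EB] [NormedSpace ℂ EB]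
  [TopologicalSpace X] [ChartedSpace EX X] [TopologicalSpace B] [ChartedSpace EB B]
  {m : ℕ} {π : X → B} (h : IsHolSubmersion EX EB m π)

/-- The change of fibre coordinates from a slice of the chart at `y` to the chart at `x`. -/
def transition (y : X) (w' : EB) (x : X) (z : Fin m → ℂ) : Fin m → ℂ :=
  (adaptedCoord h x (slice h y w' z)).2

/-- The domain of `transition`. -/
def transitionDomain (y : X) (w' : EB) (x : X) : Set (Fin m → ℂ) :=
  sliceDomain h y w' ∩ slice h y w' ⁻¹' adaptedSource h x

lemma isOpen_transitionDomain (y : X) (w' : EB) (x : X) : IsOpen (transitionDomain h y w' x) :=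
  (contMDiffOn_slice y w').continuousOn.isOpen_inter_preimage (isOpen_sliceDomain h y w')
    (isOpen_adaptedSource h x)

lemma contDiffOn_transition (y : X) (w' : EB) (x : X) :
    ContDiffOn ℂ ω (transition h y w' x) (transitionDomain h y w' x) := by
  have h1 : ContMDiffOn 𝓘(ℂ, Fin m → ℂ) 𝓘(ℂ, EB × (Fin m → ℂ)) ω
      (adaptedCoord h x ∘ slice h y w') (transitionDomain h y w' x) :=
    (contMDiffOn_adaptedCoord h x).comp ((contMDiffOn_slice y w').mono Set.inter_subset_left)
      fun z hz => hz.2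
  exact contDiff_snd.comp_contDiffOn h1.contDiffOn

variable {h} {x y : X} {w w' : EB} {z : Fin m → ℂ}

lemma adaptedCoord_slice (hw : (h x).codChart ((h y).codChart.symm w') = w)
    (hz : z ∈ transitionDomain h y w' x) :
    adaptedCoord h x (slice h y w' z) = (w, transition h y w' x z) := by
  refine Prod.ext ?_ rfl
  rw [adaptedCoord_fst hz.2, proj_slice hz.1]
  exact hw

/-- The hypothesis `hw` says that the two slices lie over the same point of B, so the change of
chart maps one slice to the other. -/
lemma transition_mem (hw : (h x).codChart ((h y).codChart.symm w') = w)
    (hz : z ∈ transitionDomain h y w' x) : transition h y w' x z ∈ sliceDomain h x w := by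
  have h1 := adaptedCoord_mem hz.2
  rwa [adaptedCoord_slice hw hz] at h1

lemma slice_transition (hw : (h x).codChart ((h y).codChart.symm w') = w)
    (hz : z ∈ transitionDomain h y w' x) :
    slice h x w (transition h y w' x z) = slice h y w' z := by
  rw [slice, ← adaptedCoord_slice hw hz, adaptedParam_adaptedCoord hz.2]

lemma slice_transition_eventually (hw : (h x).codChart ((h y).codChart.symm w') = w)
    (hz : z ∈ transitionDomain h y w' x) :
    slice h y w' =ᶠ[nhds z] slice h x w ∘ transition h y w' x := by
  filter_upwards [(isOpen_transitionDomain h y w' x).mem_nhds hz] with q hq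
  exact (slice_transition hw hq).symm

lemma contDiffAt_transition (hz : z ∈ transitionDomain h y w' x) :
    ContDiffAt ℂ ω (transition h y w' x) z :=
  (contDiffOn_transition h y w' x).contDiffAt ((isOpen_transitionDomain h y w' x).mem_nhds hz)

lemma fderiv_transition_smul (hz : z ∈ transitionDomain h y w' x) (c : ℂ) (v : Fin m → ℂ) :
    fderiv ℝ (transition h y w' x) z (c • v) = c • fderiv ℝ (transition h y w' x) z v := by
  rw [((contDiffAt_transition hz).differentiableAt (by simp)).fderiv_restrictScalars ℝ]
  simp

lemma tangentMapAt_slice_transition (hw : (h x).codChart ((h y).codChart.symm w') = w)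
    (hz : z ∈ transitionDomain h y w' x) (u : Fin m → ℂ) :
    tangentMapAt (E := Fin m → ℂ) (E' := EX) (slice h y w') z u
      = tangentMapAt (E := Fin m → ℂ) (E' := EX) (slice h x w) (transition h y w' x z)
        (fderiv ℝ (transition h y w' x) z u) := by
  have hd : DifferentiableAt ℝ (transition h y w' x) z :=
    ((contDiffAt_transition hz).differentiableAt (by simp)).restrictScalars ℝ
  rw [tangentMapAt_congr (slice_transition_eventually hw hz),
    tangentMapAt_comp (mdifferentiableAt_slice (transition_mem hw hz))
      (mdifferentiableAt_iff_differentiableAt.2 hd), tangentMapAt_eq_fderiv]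
  rfl

lemma sliceForm_transition (hw : (h x).codChart ((h y).codChart.symm w') = w)
    (hz : z ∈ transitionDomain h y w' x) (η : Form EX X 2) (u v : Fin m → ℂ) :
    (sliceForm h η y w').at₂ z u v
      = (sliceForm h η x w).at₂ (transition h y w' x z)
        (fderiv ℝ (transition h y w' x) z u) (fderiv ℝ (transition h y w' x) z v) := by
  rw [sliceForm, sliceForm, Form.pull_at₂, Form.pull_at₂, tangentMapAt_slice_transition hw hz,
    tangentMapAt_slice_transition hw hz, slice_transition hw hz]

/-- The Jacobian matrix of the change of fibre coordinates. -/
lemma exists_transition_matrix (hw : (h x).codChart ((h y).codChart.symm w') = w)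
    (hz : z ∈ transitionDomain h y w' x) :
    ∃ A : Matrix (Fin m) (Fin m) ℂ, IsUnit A.det ∧
      (∀ j, fderiv ℝ (transition h y w' x) z (stdVec m j) = ∑ k, A j k • stdVec m k) ∧
      |(fderiv ℝ (transition h y w' x) z).det| = Complex.normSq A.det := by
  have hd := (contDiffAt_transition hz).differentiableAt (n := ω) (by simp)
  have hL : fderiv ℝ (transition h y w' x) z
      = (fderiv ℂ (transition h y w' x) z).restrictScalars ℝ := hd.fderiv_restrictScalars ℝ
  set L := fderiv ℂ (transition h y w' x) z with hLdef
  have hinj : Function.Injective L := by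
    intro u v huv
    apply tangentMapAt_slice_injective hz.1
    rw [tangentMapAt_slice_transition hw hz, tangentMapAt_slice_transition hw hz, hL]
    simp only [ContinuousLinearMap.coe_restrictScalars']
    rw [huv]
  have hunit : IsUnit (LinearMap.toMatrix' (L : (Fin m → ℂ) →ₗ[ℂ] (Fin m → ℂ))).det := by
    rw [LinearMap.det_toMatrix']
    exact LinearMap.isUnit_det _ ((LinearMap.isUnit_iff_ker_eq_bot _).2 (LinearMap.ker_eq_bot.2 hinj))
  refine ⟨(LinearMap.toMatrix' (L : (Fin m → ℂ) →ₗ[ℂ] (Fin m → ℂ)))ᵀ, ?_, fun j => ?_, ?_⟩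
  · rwa [Matrix.det_transpose]
  · rw [hL]
    ext i
    simp [stdVec, LinearMap.toMatrix'_apply, Pi.single_apply]
  · rw [Matrix.det_transpose, LinearMap.det_toMatrix', hL]
    -- The real determinant of a complex linear map is the norm from ℂ to ℝ of its complex
    -- determinant, hence |det|².
    have h2 : ((L.restrictScalars ℝ : (Fin m → ℂ) →L[ℝ] (Fin m → ℂ))).det
        = LinearMap.det ((L : (Fin m → ℂ) →ₗ[ℂ] (Fin m → ℂ)).restrictScalars ℝ) := rfl
    rw [h2, LinearMap.det_restrictScalars, Algebra.norm_complex_eq]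
    exact abs_of_nonneg (Complex.normSq_nonneg _)

lemma contraction_transition (hw : (h x).codChart ((h y).codChart.symm w') = w)
    (hz : z ∈ transitionDomain h y w' x) (Ω : Form EX X 2)
    {σ σ' : (Fin m → ℂ) → (Fin m → ℂ) → ℝ} (hσ' : IsRealBilin σ')
    (hσ : ∀ u v, σ u v = σ' (fderiv ℝ (transition h y w' x) z u)
      (fderiv ℝ (transition h y w' x) z v)) :
    contraction (stdVec m) ((sliceForm h Ω y w').at₂ z) σ
      = contraction (stdVec m) ((sliceForm h Ω x w).at₂ (transition h y w' x z)) σ' := by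
  obtain ⟨A, hA, hAj, -⟩ := exists_transition_matrix hw hz
  rw [contraction_comp (fun v => fderiv_transition_smul hz Complex.I v)
    (sliceForm_transition hw hz Ω) hσ]
  simp only [hAj]
  exact contraction_change (Form.isRealBilin _ _) hσ' hA _

lemma normSqForm_transition (hw : (h x).codChart ((h y).codChart.symm w') = w)
    (hz : z ∈ transitionDomain h y w' x) (Ω η ζ : Form EX X 2) :
    normSqForm (stdVec m) ((sliceForm h Ω y w').at₂ z) ((sliceForm h η y w').at₂ z)
        ((sliceForm h ζ y w').at₂ z)
      = normSqForm (stdVec m) ((sliceForm h Ω x w).at₂ (transition h y w' x z))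
        ((sliceForm h η x w).at₂ (transition h y w' x z))
        ((sliceForm h ζ x w).at₂ (transition h y w' x z)) := by
  obtain ⟨A, hA, hAj, -⟩ := exists_transition_matrix hw hz
  rw [normSqForm_comp (fun v => fderiv_transition_smul hz Complex.I v)
    (sliceForm_transition hw hz Ω) (sliceForm_transition hw hz η) (sliceForm_transition hw hz ζ)]
  simp only [hAj]
  exact normSqForm_change (Form.isRealBilin _ _) (Form.isRealBilin _ _) (Form.isRealBilin _ _) hA _

/-- i∂∂̄ commutes with the holomorphic change of coordinates, and the contraction does not depend on
the frame. -/
lemma localLaplacian_transition (hw : (h x).codChart ((h y).codChart.symm w') = w)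
    (hz : z ∈ transitionDomain h y w' x) (Ω : Form EX X 2) {f : X → ℝ}
    (hf : ContDiffAt ℝ 2 (f ∘ slice h x w) (transition h y w' x z)) :
    localLaplacian (sliceForm h Ω y w') (f ∘ slice h y w') z
      = localLaplacian (sliceForm h Ω x w) (f ∘ slice h x w) (transition h y w' x z) := by
  rw [localLaplacian, localLaplacian, contraction_transition hw hz Ω
    (Form.isRealBilin (iddbar (f ∘ slice h x w)) _) fun u v => ?_]
  have h1 : f ∘ slice h y w' =ᶠ[nhds z] (f ∘ slice h x w) ∘ transition h y w' x := by
    filter_upwards [slice_transition_eventually hw hz] with q hq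
    simp only [Function.comp_apply] at hq ⊢
    rw [hq]
  rw [← iddbar_comp hf ((contDiffAt_transition hz).of_le le_top)]
  have h2 : dc (f ∘ slice h y w') =ᶠ[nhds z] dc ((f ∘ slice h x w) ∘ transition h y w' x) := by
    filter_upwards [h1.eventuallyEq_nhds] with q hq
    rw [dc, dc, hq.fderiv_eq]
  rw [Form.at₂, Form.at₂, iddbar, iddbar, h2.extDeriv_eq]

/-- det g is multiplied by |det A|² for the complex Jacobian A, which is the real Jacobian. This
makes the measures of different patches agree on overlaps. -/
lemma volumeDensity_transition (hw : (h x).codChart ((h y).codChart.symm w') = w)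
    (hz : z ∈ transitionDomain h y w' x) (Ω : Form EX X 2) :
    volumeDensity (sliceForm h Ω y w') z
      = |(fderiv ℝ (transition h y w' x) z).det|
        * volumeDensity (sliceForm h Ω x w) (transition h y w' x z) := by
  obtain ⟨A, hA, hAj, hdet⟩ := exists_transition_matrix hw hz
  rw [volumeDensity, volumeDensity, metricMatrix, metricMatrix,
    hermMatrix_comp (fun v => fderiv_transition_smul hz Complex.I v)
    (sliceForm_transition hw hz Ω), hdet]
  simp only [hAj]
  rw [hermMatrix_change (Form.isRealBilin _ _), Matrix.det_mul, Matrix.det_mul,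
    Matrix.det_conjTranspose]
  set d := A.det
  have h1 : ∀ t : ℂ, (d * t * star d).re = Complex.normSq d * t.re := by
    intro t
    have : d * t * star d = (Complex.normSq d : ℂ) * t := by
      rw [Complex.normSq_eq_conj_mul_self]
      simp only [Complex.star_def]
      ring
    rw [this, Complex.re_ofReal_mul]
  rw [h1]
  ring

end Transition

/-! ### The vertical Laplacian in a fixed chart. -/

section VerticalLaplacian

variable {EX EB X B : Type*}
  [NormedAddCommGroup EX] [NormedSpace ℂ EX] [NormedAddCommGroup EB] [NormedSpace ℂ EB]
  [TopologicalSpace X] [ChartedSpace EX X] [TopologicalSpace B] [ChartedSpace EB B]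
  {m : ℕ} {π : X → B} {h : IsHolSubmersion EX EB m π} {x y : X} {w : EB} {z : Fin m → ℂ}

lemma codChart_basePoint (hy : y ∈ adaptedSource h x) :
    (h x).codChart ((h y).codChart.symm (basePoint h y)) = (adaptedCoord h x y).1 := by
  rw [codChart_symm_basePoint, adaptedCoord_fst hy]

lemma codChart_basePoint_of_proj_eq (hxy : π y = π x) :
    (h x).codChart ((h y).codChart.symm (basePoint h y)) = basePoint h x := by
  rw [codChart_symm_basePoint, hxy, basePoint, adaptedCoord_fst (mem_adaptedSource h x)]

lemma fibrePoint_mem_transitionDomain (hy : y ∈ adaptedSource h x) :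
    fibrePoint h y ∈ transitionDomain h y (basePoint h y) x := by
  refine ⟨fibrePoint_mem h y, ?_⟩
  rw [Set.mem_preimage, ← fibreParam_eq_slice, fibreParam_fibrePoint]
  exact hy

lemma transition_fibrePoint (y x : X) :
    transition h y (basePoint h y) x (fibrePoint h y) = (adaptedCoord h x y).2 := by
  rw [transition, ← fibreParam_eq_slice, fibreParam_fibrePoint]

lemma slice_mem_adaptedSource (hz : z ∈ sliceDomain h x w) : slice h x w z ∈ adaptedSource h x :=
  adaptedParam_mem hz

lemma adaptedCoord_slice_self (hz : z ∈ sliceDomain h x w) :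
    adaptedCoord h x (slice h x w z) = (w, z) :=
  adaptedCoord_adaptedParam hz

lemma fibreParam_mem_adaptedSource (hz : z ∈ fibreDomain h x) :
    fibreParam h x z ∈ adaptedSource h x :=
  adaptedParam_mem hz

/-- The definition uses at each point the chart centred there. Independence of coordinates allows a
whole slice to be treated in a single chart, which is needed before differentiating or integrating.
-/
lemma verticalLaplacian_slice (Ω : Form EX X 2) {f : X → ℝ} (hz : z ∈ sliceDomain h x w)
    (hf : ContDiffAt ℝ 2 (f ∘ slice h x w) z) :
    verticalLaplacian h Ω f (slice h x w z)
      = localLaplacian (sliceForm h Ω x w) (f ∘ slice h x w) z := by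
  have hy := slice_mem_adaptedSource hz
  have hw := codChart_basePoint hy
  have ht := transition_fibrePoint (h := h) (slice h x w z) x
  rw [adaptedCoord_slice_self hz] at hw ht
  have := localLaplacian_transition hw (fibrePoint_mem_transitionDomain hy) Ω (f := f)
    (by rwa [ht])
  rw [ht] at this
  exact this

lemma verticalLaplacian_fibreParam (Ω : Form EX X 2) {f : X → ℝ} (hf : SmoothOnFibre h (π x) f)
    (hz : z ∈ fibreDomain h x) :
    verticalLaplacian h Ω f (fibreParam h x z)
      = localLaplacian (fibreForm h Ω x) (f ∘ fibreParam h x) z :=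
  verticalLaplacian_slice Ω hz (((hf x rfl).contDiffAt
    ((isOpen_fibreDomain h x).mem_nhds hz)).of_le two_le_infty)

variable [IsManifold 𝓘(ℂ, EX) ω X] [IsManifold 𝓘(ℂ, EB) ω B]

lemma smoothOnFibre_verticalLaplacian {Ω : Form EX X 2} (hΩ : IsRelativelyKahler EB π Ω)
    {f : X → ℝ} {b : B} (hf : SmoothOnFibre h b f) :
    SmoothOnFibre h b (verticalLaplacian h Ω f) := by
  rintro x rfl
  exact ((hΩ.fibreForm (h := h) x).contDiffOn_localLaplacian (hf x rfl)).congr fun z hz =>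
    verticalLaplacian_fibreParam Ω hf hz

lemma ContMDiff.smoothOnFibre {f : X → ℝ} (hf : ContMDiff 𝓘(ℝ, EX) 𝓘(ℝ, ℝ) ∞ f) (b : B) :
    SmoothOnFibre h b f := by
  intro x _
  exact (hf.comp_contMDiffOn (ContMDiffOn.real (contMDiffOn_slice (h := h) x (basePoint h x))
    (isOpen_sliceDomain h x _))).contDiffOn

lemma contMDiff_of_adaptedParam {f : X → ℝ}
    (hf : ∀ x, ContDiffAt ℝ ∞ (f ∘ adaptedParam h x) (adaptedCoord h x x)) :
    ContMDiff 𝓘(ℝ, EX) 𝓘(ℝ, ℝ) ∞ f := by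
  intro x
  have h1 : ContMDiffAt 𝓘(ℝ, EX) 𝓘(ℝ, ℝ) ∞ ((f ∘ adaptedParam h x) ∘ adaptedCoord h x) x :=
    ContMDiffAt.comp x (hf x).contMDiffAt
      (ContMDiffAt.real (contMDiffAt_adaptedCoord (mem_adaptedSource h x)))
  refine h1.congr_of_eventuallyEq ?_
  filter_upwards [(isOpen_adaptedSource h x).mem_nhds (mem_adaptedSource h x)] with y hy
  simp only [Function.comp_apply]
  rw [adaptedParam_adaptedCoord hy]

lemma ContMDiff.contDiffOn_adaptedParam {f : X → ℝ} (hf : ContMDiff 𝓘(ℝ, EX) 𝓘(ℝ, ℝ) ∞ f) (x : X) :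
    ContDiffOn ℝ ∞ (f ∘ adaptedParam h x) (adaptedDomain h x) :=
  (hf.comp_contMDiffOn (ContMDiffOn.real (contMDiffOn_adaptedParam h x)
    (isOpen_adaptedDomain h x))).contDiffOn

end VerticalLaplacian

/-! ### The measure ω_b^m on a fibre. -/

section FibreMeasure

variable {EX EB X B : Type*}
  [NormedAddCommGroup EX] [NormedSpace ℂ EX] [NormedAddCommGroup EB] [NormedSpace ℂ EB]
  [TopologicalSpace X] [ChartedSpace EX X] [TopologicalSpace B] [ChartedSpace EB B]
  {m : ℕ} {π : X → B} (h : IsHolSubmersion EX EB m π) (Ω : Form EX X 2)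

lemma continuousOn_fibreParam (x : X) : ContinuousOn (fibreParam h x) (fibreDomain h x) :=
  (contMDiffOn_slice x (basePoint h x)).continuousOn

lemma continuousOn_adaptedCoord (x : X) : ContinuousOn (adaptedCoord h x) (adaptedSource h x) :=
  (contMDiffOn_adaptedCoord h x).continuousOn

variable {h} in
lemma adaptedCoord_fibreParam {x : X} {z : Fin m → ℂ} (hz : z ∈ fibreDomain h x) :
    adaptedCoord h x (fibreParam h x z) = (basePoint h x, z) :=
  adaptedCoord_slice_self hz

variable {h} in
lemma adaptedCoord_snd_mem {x y : X} (hxy : π y = π x) (hy : y ∈ adaptedSource h x) :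
    (adaptedCoord h x y).2 ∈ fibreDomain h x ∧ fibreParam h x (adaptedCoord h x y).2 = y := by
  have h1 : (basePoint h x, (adaptedCoord h x y).2) = adaptedCoord h x y := by
    refine Prod.ext ?_ rfl
    rw [adaptedCoord_fst hy, hxy, basePoint, adaptedCoord_fst (mem_adaptedSource h x)]
  constructor
  · change (basePoint h x, (adaptedCoord h x y).2) ∈ adaptedDomain h x
    rw [h1]
    exact adaptedCoord_mem hy
  · change adaptedParam h x (basePoint h x, (adaptedCoord h x y).2) = y
    rw [h1]
    exact adaptedParam_adaptedCoord hy

variable {h} in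
lemma SmoothOnFibre.continuousOn {b : B} {f : X → ℝ} (hf : SmoothOnFibre h b f) :
    ContinuousOn f (π ⁻¹' {b}) := by
  intro x hx
  have h1 : ContinuousAt (fun y => (adaptedCoord h x y).2) x :=
    continuousAt_snd.comp ((continuousOn_adaptedCoord h x).continuousAt
      ((isOpen_adaptedSource h x).mem_nhds (mem_adaptedSource h x)))
  have h2 : ContinuousAt (f ∘ fibreParam h x) (adaptedCoord h x x).2 :=
    ((hf x hx).continuousOn).continuousAt
      ((isOpen_fibreDomain h x).mem_nhds (fibrePoint_mem h x))
  have h3 : ContinuousAt ((f ∘ fibreParam h x) ∘ fun y => (adaptedCoord h x y).2) x :=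
    ContinuousAt.comp h2 h1
  refine h3.continuousWithinAt.congr_of_eventuallyEq_of_mem ?_ hx
  filter_upwards [self_mem_nhdsWithin, mem_nhdsWithin_of_mem_nhds
    ((isOpen_adaptedSource h x).mem_nhds (mem_adaptedSource h x))] with y hy hys
  simp only [Function.comp_apply]
  rw [(adaptedCoord_snd_mem (hy.trans hx.symm) hys).2]

lemma isClosed_fibre [IsManifold 𝓘(ℂ, EX) ω X] [IsManifold 𝓘(ℂ, EB) ω B] [T2Space B]
    (h : IsHolSubmersion EX EB m π) (b : B) : IsClosed (π ⁻¹' {b}) :=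
  isClosed_singleton.preimage h.contMDiff.continuous

variable [MeasurableSpace X] [BorelSpace X]

/-- The measure `ω_b^m` in the fibre coordinates around `x`. -/
def patchMeasure (x : X) : Measure X :=
  (((volume : Measure (Fin m → ℂ)).restrict (fibreDomain h x)).withDensity
      fun z => ENNReal.ofReal (volumeDensity (fibreForm h Ω x) z)).map (fibreParam h x)

lemma aemeasurable_fibreParam (x : X) : AEMeasurable (fibreParam h x)
    (((volume : Measure (Fin m → ℂ)).restrict (fibreDomain h x)).withDensity
      fun z => ENNReal.ofReal (volumeDensity (fibreForm h Ω x) z)) :=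
  ((continuousOn_fibreParam h x).aemeasurable (isOpen_fibreDomain h x).measurableSet).mono_ac
    (withDensity_absolutelyContinuous _ _)

lemma measurableSet_inter_fibreParam (x : X) {A : Set X} (hA : MeasurableSet A) :
    MeasurableSet (fibreDomain h x ∩ fibreParam h x ⁻¹' A) := by
  classical
  have h1 : Measurable ((fibreDomain h x).piecewise (fibreParam h x) fun _ => x) :=
    (continuousOn_fibreParam h x).measurable_piecewise continuousOn_const
      (isOpen_fibreDomain h x).measurableSet
  have h2 : fibreDomain h x ∩ fibreParam h x ⁻¹' A = fibreDomain h x ∩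
      ((fibreDomain h x).piecewise (fibreParam h x) fun _ => x) ⁻¹' A := by
    ext z
    simp only [Set.mem_inter_iff, Set.mem_preimage]
    refine and_congr_right fun hz => ?_
    rw [Set.piecewise_eq_of_mem _ _ _ hz]
  rw [h2]
  exact (isOpen_fibreDomain h x).measurableSet.inter (h1 hA)

lemma patchMeasure_apply (x : X) {A : Set X} (hA : MeasurableSet A) :
    patchMeasure h Ω x A = ∫⁻ z in fibreDomain h x ∩ fibreParam h x ⁻¹' A,
      ENNReal.ofReal (volumeDensity (fibreForm h Ω x) z) := by
  rw [patchMeasure, Measure.map_apply_of_aemeasurable (aemeasurable_fibreParam h Ω x) hA,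
    withDensity_apply', Measure.restrict_restrict' (isOpen_fibreDomain h x).measurableSet,
    Set.inter_comm]

lemma patchMeasure_restrict (x : X) {A : Set X} (hA : MeasurableSet A)
    (hx : ∀ z ∈ fibreDomain h x, fibreParam h x z ∈ A) :
    (patchMeasure h Ω x).restrict A = patchMeasure h Ω x := by
  refine Measure.ext fun S hS => ?_
  rw [Measure.restrict_apply hS, patchMeasure_apply h Ω x (hS.inter hA),
    patchMeasure_apply h Ω x hS]
  congr 2
  ext z
  simp only [Set.mem_inter_iff, Set.mem_preimage]
  exact ⟨fun hz => ⟨hz.1, hz.2.1⟩, fun hz => ⟨hz.1, hz.2, hx z hz.1⟩⟩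

/-- Change of variables along the transition map, injective on the overlap, whose Jacobian is
absorbed by the volume densities. -/
lemma patchMeasure_eq_of_subset {x y : X} (hxy : π y = π x) {A : Set X} (hA : MeasurableSet A)
    (hAx : A ⊆ adaptedSource h x) (hAy : A ⊆ adaptedSource h y) :
    patchMeasure h Ω y A = patchMeasure h Ω x A := by
  rw [patchMeasure_apply h Ω x hA, patchMeasure_apply h Ω y hA]
  have hw := codChart_basePoint_of_proj_eq (h := h) hxy
  set S := fibreDomain h y ∩ fibreParam h y ⁻¹' A with hS
  set τ := transition h y (basePoint h y) x with hτ
  have hmem : ∀ z ∈ S, z ∈ transitionDomain h y (basePoint h y) x := fun z hz =>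
    ⟨hz.1, hAx hz.2⟩
  have himg : τ '' S = fibreDomain h x ∩ fibreParam h x ⁻¹' A := by
    ext z'
    constructor
    · rintro ⟨z, hz, rfl⟩
      refine ⟨transition_mem hw (hmem z hz), ?_⟩
      change slice h x (basePoint h x) (τ z) ∈ A
      rw [hτ, slice_transition hw (hmem z hz)]
      exact hz.2
    · intro hz'
      have hp : π (fibreParam h x z') = π y := (proj_fibreParam hz'.1).trans hxy.symm
      obtain ⟨h1, h2⟩ := adaptedCoord_snd_mem hp (hAy hz'.2)
      refine ⟨(adaptedCoord h y (fibreParam h x z')).2, ⟨h1, ?_⟩, ?_⟩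
      · rw [Set.mem_preimage, h2]
        exact hz'.2
      · rw [hτ, transition, ← fibreParam_eq_slice, h2, adaptedCoord_fibreParam hz'.1]
  have hinj : Set.InjOn τ S := by
    intro z₁ h₁ z₂ h₂ heq
    have e1 := slice_transition hw (hmem z₁ h₁)
    have e2 := slice_transition hw (hmem z₂ h₂)
    rw [← hτ, heq] at e1
    rw [← hτ, e1] at e2
    have e3 := adaptedCoord_fibreParam h₁.1
    rw [fibreParam_eq_slice, e2, ← fibreParam_eq_slice, adaptedCoord_fibreParam h₂.1] at e3
    exact (Prod.ext_iff.1 e3).2.symm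
  rw [← himg, lintegral_image_eq_lintegral_abs_det_fderiv_mul volume
    (measurableSet_inter_fibreParam h y hA)
    (fun z hz => ((((contDiffAt_transition (hmem z hz)).differentiableAt
      (by simp)).restrictScalars ℝ).hasFDerivAt).hasFDerivWithinAt) hinj]
  refine setLIntegral_congr_fun (measurableSet_inter_fibreParam h y hA) fun z hz => ?_
  rw [← ENNReal.ofReal_mul (abs_nonneg _), fibreForm_eq_sliceForm, fibreForm_eq_sliceForm,
    volumeDensity_transition hw (hmem z hz)]

lemma patchMeasure_le_fibreMeasure (x : X) : patchMeasure h Ω x ≤ fibreMeasure h Ω (π x) :=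
  le_iSup (fun y : {y : X // π y = π x} => patchMeasure h Ω y.1) ⟨x, rfl⟩

lemma fibreMeasure_le {b : B} {M : Measure X} (hM : ∀ x, π x = b → patchMeasure h Ω x ≤ M) :
    fibreMeasure h Ω b ≤ M :=
  iSup_le fun x => hM x.1 x.2

/-- The fibre measure restricts to the coordinate patches as it should. -/
lemma fibreMeasure_restrict_adaptedSource (x : X) :
    (fibreMeasure h Ω (π x)).restrict (adaptedSource h x) = patchMeasure h Ω x := by
  have hs := (isOpen_adaptedSource h x).measurableSet
  have hself := patchMeasure_restrict h Ω x hs fun z hz => fibreParam_mem_adaptedSource hz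
  apply le_antisymm
  -- The supremum is bounded by the measure that equals the patch at x on its chart domain and the
  -- fibre measure off it: each patch measure lies below this one, since it agrees with the patch at
  -- x on the overlap.
  · have h1 : fibreMeasure h Ω (π x) ≤ (patchMeasure h Ω x).restrict (adaptedSource h x)
        + (fibreMeasure h Ω (π x)).restrict (adaptedSource h x)ᶜ := by
      refine fibreMeasure_le h Ω fun y hy => ?_
      rw [← Measure.restrict_add_restrict_compl (μ := patchMeasure h Ω y) hs]
      refine add_le_add ?_ (Measure.restrict_mono le_rfl ?_)
      · refine Measure.le_iff.2 fun A hA => ?_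
        have hsy := (isOpen_adaptedSource h y).measurableSet
        rw [← patchMeasure_restrict h Ω y hsy fun z hz => fibreParam_mem_adaptedSource hz,
          Measure.restrict_restrict hs, Measure.restrict_apply hA, Measure.restrict_apply hA,
          patchMeasure_eq_of_subset h Ω hy (hA.inter (hs.inter hsy)) (fun a ha => ha.2.1)
            (fun a ha => ha.2.2)]
        exact measure_mono fun a ha => ⟨ha.1, ha.2.1⟩
      · rw [← hy]
        exact patchMeasure_le_fibreMeasure h Ω y
    refine (Measure.restrict_mono le_rfl h1).trans ?_
    rw [Measure.restrict_add, Measure.restrict_restrict hs, Measure.restrict_restrict hs,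
      Set.inter_self, Set.inter_compl_self, Measure.restrict_empty, add_zero, hself]
  · rw [← hself]
    exact Measure.restrict_mono le_rfl (patchMeasure_le_fibreMeasure h Ω x)

variable [IsManifold 𝓘(ℂ, EX) ω X] [IsManifold 𝓘(ℂ, EB) ω B] [T2Space B]

lemma fibreMeasure_restrict_fibre (b : B) :
    (fibreMeasure h Ω b).restrict (π ⁻¹' {b}) = fibreMeasure h Ω b := by
  have hF := (isClosed_fibre h b).measurableSet
  refine le_antisymm Measure.restrict_le_self (fibreMeasure_le h Ω fun x hx => ?_)
  rw [← patchMeasure_restrict h Ω x hF fun z hz => (proj_fibreParam hz).trans hx]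
  refine Measure.restrict_mono le_rfl ?_
  rw [← hx]
  exact patchMeasure_le_fibreMeasure h Ω x

lemma ae_mem_fibre (b : B) : ∀ᵐ y ∂(fibreMeasure h Ω b), π y = b := by
  rw [← fibreMeasure_restrict_fibre]
  exact ae_restrict_mem (isClosed_fibre h b).measurableSet

variable {h Ω}

lemma aestronglyMeasurable_of_continuousOn {b : B} {f : X → ℝ} (hf : ContinuousOn f (π ⁻¹' {b})) :
    AEStronglyMeasurable f (fibreMeasure h Ω b) := by
  rw [← fibreMeasure_restrict_fibre]
  exact hf.aestronglyMeasurable (isClosed_fibre h b).measurableSet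

lemma contDiffOn_volumeDensity (hΩ : IsRelativelyKahler EB π Ω) (x : X) :
    ContDiffOn ℝ ∞ (volumeDensity (fibreForm h Ω x)) (fibreDomain h x) := by
  have h1 := contDiffOn_det (hΩ.fibreForm (h := h) x).contDiffOn_matrix
  exact contDiffOn_const.mul (Complex.reCLM.contDiff.comp_contDiffOn h1)

lemma volumeDensity_pos (hΩ : IsRelativelyKahler EB π Ω) {x : X} {z : Fin m → ℂ}
    (hz : z ∈ fibreDomain h x) : 0 < volumeDensity (fibreForm h Ω x) z := by
  have := (hΩ.fibreForm (h := h) x).det_re_pos hz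
  rw [volumeDensity]
  positivity

lemma integral_patchMeasure (hΩ : IsRelativelyKahler EB π Ω) {x : X} {f : X → ℝ}
    (hf : AEStronglyMeasurable f (patchMeasure h Ω x)) :
    ∫ y, f y ∂(patchMeasure h Ω x)
      = ∫ z in fibreDomain h x, f (fibreParam h x z) * volumeDensity (fibreForm h Ω x) z := by
  have hO := (isOpen_fibreDomain h x).measurableSet
  rw [patchMeasure, integral_map (aemeasurable_fibreParam h Ω x) hf,
    integral_withDensity_eq_integral_toReal_smul₀]
  · refine setIntegral_congr_fun hO fun z hz => ?_
    simp only [smul_eq_mul]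
    rw [ENNReal.toReal_ofReal (volumeDensity_pos hΩ hz).le, mul_comm]
  · exact ((contDiffOn_volumeDensity hΩ x).continuousOn.aemeasurable hO).ennreal_ofReal
  · exact Filter.Eventually.of_forall fun z => ENNReal.ofReal_lt_top

/-- Integration over a fibre of functions supported in a coordinate patch. -/
lemma integral_fibreMeasure_of_support (hΩ : IsRelativelyKahler EB π Ω) {x : X} {f : X → ℝ}
    (hf : ContinuousOn f (π ⁻¹' {π x})) (hs : ∀ y, π y = π x → y ∉ adaptedSource h x → f y = 0) :
    ∫ y, f y ∂(fibreMeasure h Ω (π x))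
      = ∫ z in fibreDomain h x, f (fibreParam h x z) * volumeDensity (fibreForm h Ω x) z := by
  rw [← integral_patchMeasure hΩ, ← fibreMeasure_restrict_adaptedSource]
  · refine (setIntegral_eq_integral_of_ae_compl_eq_zero ?_).symm
    filter_upwards [ae_mem_fibre h Ω (π x)] with y hy hys
    exact hs y hy hys
  · rw [← fibreMeasure_restrict_adaptedSource]
    exact (aestronglyMeasurable_of_continuousOn hf).mono_measure Measure.restrict_le_self

/-- The fibre is compact, so local finiteness suffices. Near a point the measure is that of one
patch, whose continuous density is integrable over a compact coordinate set. -/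
lemma isFiniteMeasure_fibreMeasure [CompactSpace X] (hΩ : IsRelativelyKahler EB π Ω) (b : B) :
    IsFiniteMeasure (fibreMeasure h Ω b) := by
  refine ⟨?_⟩
  rw [← fibreMeasure_restrict_fibre, Measure.restrict_apply_univ]
  refine (isClosed_fibre h b).isCompact.measure_lt_top_of_nhdsWithin fun x hx => ?_
  obtain rfl : π x = b := hx
  obtain ⟨K, hK, hxK, hKO⟩ := exists_compact_subset (isOpen_fibreDomain h x) (fibrePoint_mem h x)
  set U : Set X := adaptedSource h x ∩ (fun y => (adaptedCoord h x y).2) ⁻¹' interior K with hU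
  have hUo : IsOpen U :=
    (continuous_snd.comp_continuousOn (continuousOn_adaptedCoord h x)).isOpen_inter_preimage
      (isOpen_adaptedSource h x) isOpen_interior
  refine ⟨U, mem_nhdsWithin_of_mem_nhds (hUo.mem_nhds ⟨mem_adaptedSource h x, hxK⟩), ?_⟩
  have h1 : fibreMeasure h Ω (π x) U = patchMeasure h Ω x U := by
    rw [← fibreMeasure_restrict_adaptedSource, Measure.restrict_apply hUo.measurableSet,
      Set.inter_eq_left.2 Set.inter_subset_left]
  rw [h1, patchMeasure_apply h Ω x hUo.measurableSet]
  have h2 : fibreDomain h x ∩ fibreParam h x ⁻¹' U ⊆ K := by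
    rintro z ⟨hz, hz'⟩
    have := hz'.2
    rw [Set.mem_preimage, adaptedCoord_fibreParam hz] at this
    exact interior_subset this
  refine lt_of_le_of_lt (lintegral_mono_set h2) ?_
  have h3 : IntegrableOn (volumeDensity (fibreForm h Ω x)) K :=
    ((contDiffOn_volumeDensity hΩ x).continuousOn.mono hKO).integrableOn_compact hK
  exact h3.lintegral_lt_top

lemma integrable_of_continuousOn [CompactSpace X] (hΩ : IsRelativelyKahler EB π Ω) {b : B}
    {f : X → ℝ} (hf : ContinuousOn f (π ⁻¹' {b})) : Integrable f (fibreMeasure h Ω b) := by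
  have := isFiniteMeasure_fibreMeasure (h := h) hΩ b
  obtain ⟨C, hC⟩ := (isClosed_fibre h b).isCompact.exists_bound_of_continuousOn hf
  refine Integrable.of_bound (aestronglyMeasurable_of_continuousOn hf) C ?_
  filter_upwards [ae_mem_fibre h Ω b] with y hy
  exact hC y hy

/-- A nonnegative continuous function on a fibre with integral zero vanishes. -/
lemma eq_zero_of_integral_eq_zero [CompactSpace X] (hΩ : IsRelativelyKahler EB π Ω) {b : B}
    {f : X → ℝ} (hf : ContinuousOn f (π ⁻¹' {b})) (h0 : ∀ y, π y = b → 0 ≤ f y)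
    (hInt : ∫ y, f y ∂(fibreMeasure h Ω b) = 0) {x : X} (hx : π x = b) : f x = 0 := by
  subst hx
  have h1 : f =ᵐ[fibreMeasure h Ω (π x)] 0 := by
    refine (integral_eq_zero_iff_of_nonneg_ae ?_ (integrable_of_continuousOn hΩ hf)).1 hInt
    filter_upwards [ae_mem_fibre h Ω (π x)] with y hy
    exact h0 y hy
  have h2 : f =ᵐ[patchMeasure h Ω x] 0 := by
    rw [← fibreMeasure_restrict_adaptedSource]
    exact ae_restrict_of_ae h1
  have h3 := ae_of_ae_map (aemeasurable_fibreParam h Ω x) h2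
  have hO := isOpen_fibreDomain h x
  rw [ae_withDensity_iff' ((contDiffOn_volumeDensity hΩ x).continuousOn.aemeasurable
    hO.measurableSet).ennreal_ofReal] at h3
  -- The density is strictly positive, so null sets for the patch measure are Lebesgue null;
  -- continuity upgrades vanishing almost everywhere to vanishing at every point.
  have h4 : f ∘ fibreParam h x =ᵐ[volume.restrict (fibreDomain h x)] 0 := by
    filter_upwards [h3, ae_restrict_mem hO.measurableSet] with z hz hzO
    exact hz (ENNReal.ofReal_pos.2 (volumeDensity_pos hΩ hzO)).ne'
  have h5 : ContinuousOn (f ∘ fibreParam h x) (fibreDomain h x) :=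
    hf.comp (continuousOn_fibreParam h x) fun z hz => proj_fibreParam hz
  have h6 := Measure.eqOn_open_of_ae_eq h4 hO h5 continuousOn_const (fibrePoint_mem h x)
  simpa [fibreParam_fibrePoint] using h6

end FibreMeasure

/-! ### Existence and closedness of exterior derivatives on manifolds. -/

section FormCalculus

variable {E M : Type*} [NormedAddCommGroup E] [NormedSpace ℝ E] [TopologicalSpace M]
  [ChartedSpace E M] [IsManifold 𝓘(ℝ, E) ∞ M]

lemma contDiffOn_extDeriv {k : ℕ} {O : Set E} (hO : IsOpen O) {γ : E → E [⋀^Fin k]→L[ℝ] ℝ}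
    (hγ : ContDiffOn ℝ ∞ γ O) : ContDiffOn ℝ ∞ (fun y => extDeriv γ y) O :=
  (ContinuousAlternatingMap.alternatizeUncurryFinCLM ℝ E ℝ).contDiff.comp_contDiffOn
    (hγ.fderiv_of_isOpen hO (by simp))

lemma extDeriv_fun_sum {ι : Type*} (s : Finset ι) {k : ℕ} {γ : ι → E → E [⋀^Fin k]→L[ℝ] ℝ} {z : E}
    (hγ : ∀ i ∈ s, DifferentiableAt ℝ (γ i) z) :
    extDeriv (fun y => ∑ i ∈ s, γ i y) z = ∑ i ∈ s, extDeriv (γ i) z := by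
  classical
  induction s using Finset.induction_on with
  | empty =>
    have := extDeriv_fun_smul (x := z) (0 : ℝ) (fun _ : E => (0 : E [⋀^Fin k]→L[ℝ] ℝ))
    simpa [Pi.zero_def] using this
  | insert i s hi ih =>
    simp only [Finset.sum_insert hi]
    rw [extDeriv_fun_add (hγ i (Finset.mem_insert_self i s))
      (DifferentiableAt.fun_sum fun j hj => hγ j (Finset.mem_insert_of_mem hj)),
      ih fun j hj => hγ j (Finset.mem_insert_of_mem hj)]

lemma Form.isClosed_of_hasExtDeriv {k : ℕ} {γ : Form E M k} {η : Form E M (k + 1)}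
    (hγ : γ.IsSmooth) (hη : γ.HasExtDeriv η) : η.IsClosed := by
  constructor
  · intro e he
    exact (contDiffOn_extDeriv e.open_target (hγ e he)).congr fun z hz => (hη e he z hz).symm
  · intro e he z hz
    have h1 : Form.pull (E := E) (M := E) e.symm η
        =ᶠ[nhds z] extDeriv (Form.pull (E := E) (M := E) e.symm γ) := by
      filter_upwards [e.open_target.mem_nhds hz] with y hy
      exact (hη e he y hy).symm
    rw [h1.extDeriv_eq, extDeriv_extDeriv_apply ((hγ e he).contDiffAt (e.open_target.mem_nhds hz))
      (by rw [minSmoothness_of_isRCLikeNormedField]; exact two_le_infty)]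
    rfl

/-- Every smooth form has an exterior derivative. -/
lemma Form.exists_hasExtDeriv {k : ℕ} {γ : Form E M k} (hγ : γ.IsSmooth) :
    ∃ ζ : Form E M (k + 1), γ.HasExtDeriv ζ := by
  -- The value at x is computed in the preferred chart at x. Naturality of d under transition maps
  -- shows that it is right in every chart.
  refine ⟨fun x => Form.pull (E := E) (E' := E) (chartAt E x)
    (extDeriv (Form.pull (E := E) (M := E) (chartAt E x).symm γ)) x, fun e he z hz => ?_⟩
  have heA : e ∈ IsManifold.maximalAtlas 𝓘(ℝ, E) ∞ M := IsManifold.subset_maximalAtlas he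
  have hes := contMDiffOn_symm_of_mem_maximalAtlas heA
  obtain ⟨D', -, hD'o, hpD', hτ, hm, hq⟩ := Form.pull_eventually e.open_target hes γ hz
  have h1 : DifferentiableAt ℝ (Form.pull (E := E) (E' := E) (chartAt E (e.symm z)).symm γ)
      ((chartAt E (e.symm z) ∘ e.symm) z) :=
    ContDiffOn.differentiableAt_of_isOpen (hγ _ (chart_mem_atlas E (e.symm z)))
      (chartAt E (e.symm z)).open_target (hm z hpD')
  have h2 : MDifferentiableAt 𝓘(ℝ, E) 𝓘(ℝ, E) (chartAt E (e.symm z)) (e.symm z) :=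
    ((contMDiffOn_of_mem_maximalAtlas (IsManifold.chart_mem_maximalAtlas
      (n := ∞) (I := 𝓘(ℝ, E)) (e.symm z))).contMDiffAt
      ((chartAt E (e.symm z)).open_source.mem_nhds (mem_chart_source E _))).mdifferentiableAt
      (by simp)
  have h3 : MDifferentiableAt 𝓘(ℝ, E) 𝓘(ℝ, E) e.symm z :=
    (hes.contMDiffAt (e.open_target.mem_nhds hz)).mdifferentiableAt (by simp)
  rw [(Filter.eventuallyEq_of_mem (hD'o.mem_nhds hpD') hq).extDeriv_eq,
    extDeriv_pullback h1 ((hτ.contDiffAt (hD'o.mem_nhds hpD')).of_le two_le_infty)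
      (by rw [minSmoothness_of_isRCLikeNormedField])]
  have h4 := Form.pull_comp (E := E) (E' := E) (E'' := E)
    (extDeriv (Form.pull (E := E) (M := E) (chartAt E (e.symm z)).symm γ)) h2 h3
  refine Eq.trans ?_ (h4.trans rfl)
  rw [Form.pull, tangentMapAt_eq_fderiv]

lemma Form.isSmooth_smul {k : ℕ} {γ : Form E M k} (hγ : γ.IsSmooth) {χ : M → ℝ}
    (hχ : ContMDiff 𝓘(ℝ, E) 𝓘(ℝ, ℝ) ∞ χ) : Form.IsSmooth (E := E) (fun x => χ x • γ x) := by
  intro e he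
  have heA : e ∈ IsManifold.maximalAtlas 𝓘(ℝ, E) ∞ M := IsManifold.subset_maximalAtlas he
  have h1 : ContDiffOn ℝ ∞ (χ ∘ e.symm) e.target :=
    (hχ.comp_contMDiffOn (contMDiffOn_symm_of_mem_maximalAtlas heA)).contDiffOn
  exact (h1.smul (hγ e he)).congr fun z _ => rfl

end FormCalculus

/-! ### Partitions of unity along a fibre. -/

section Partition

variable {EX EB X B : Type*}
  [NormedAddCommGroup EX] [NormedSpace ℂ EX] [FiniteDimensional ℂ EX]
  [NormedAddCommGroup EB] [NormedSpace ℂ EB]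
  [TopologicalSpace X] [ChartedSpace EX X] [IsManifold 𝓘(ℂ, EX) ω X] [T2Space X] [CompactSpace X]
  [TopologicalSpace B] [ChartedSpace EB B] [IsManifold 𝓘(ℂ, EB) ω B] [T2Space B]
  {m : ℕ} {π : X → B} (h : IsHolSubmersion EX EB m π)

/-- A smooth partition of unity along a fibre, subordinate to coordinate patches. -/
lemma exists_fibre_partition (b : B) :
    ∃ (t : Finset X) (χ : X → X → ℝ), (∀ x ∈ t, π x = b) ∧
      (∀ x ∈ t, ContMDiff 𝓘(ℝ, EX) 𝓘(ℝ, ℝ) ∞ (χ x)) ∧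
      (∀ x ∈ t, tsupport (χ x) ⊆ adaptedSource h x) ∧ ∀ y, π y = b → ∑ x ∈ t, χ x y = 1 := by
  classical
  have : IsManifold 𝓘(ℝ, EX) ∞ X := isManifold_real
  have hF := isClosed_fibre h b
  obtain ⟨t, ht⟩ := hF.isCompact.elim_finite_subcover
    (fun x : {x : X // π x = b} => adaptedSource h x.1) (fun x => isOpen_adaptedSource h x.1)
    fun x hx => Set.mem_iUnion.2 ⟨⟨x, hx⟩, mem_adaptedSource h x⟩
  set s : Finset X := t.image Subtype.val with hs
  have hcov : π ⁻¹' {b} ⊆ ⋃ x : s, adaptedSource h x.1 := by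
    intro y hy
    obtain ⟨x, hx, hyx⟩ := Set.mem_iUnion₂.1 (ht hy)
    exact Set.mem_iUnion.2 ⟨⟨x.1, Finset.mem_image_of_mem _ hx⟩, hyx⟩
  obtain ⟨ρ, hρ⟩ := SmoothPartitionOfUnity.exists_isSubordinate 𝓘(ℝ, EX) hF
    (fun x : s => adaptedSource h x.1) (fun x => isOpen_adaptedSource h x.1) hcov
  refine ⟨s, fun x => if hx : x ∈ s then ρ ⟨x, hx⟩ else 0, ?_, ?_, ?_, ?_⟩
  · intro x hx
    obtain ⟨y, -, rfl⟩ := Finset.mem_image.1 hx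
    exact y.2
  · intro x hx
    simp only [hx, dif_pos]
    exact (ρ ⟨x, hx⟩).contMDiff
  · intro x hx
    simp only [hx, dif_pos]
    exact hρ ⟨x, hx⟩
  · intro y hy
    have h1 := ρ.sum_eq_one hy
    rw [finsum_eq_sum_of_fintype] at h1
    rw [← h1, ← Finset.sum_coe_sort s]
    refine Finset.sum_congr rfl fun x _ => ?_
    simp [x.2]

variable {h}

/-- K is the coordinate image of the part of the closed support lying in the fibre, compact because
X is. It provides the compact support required by the local Stokes theorem. -/
lemma exists_compact_of_tsupport {χ : X → ℝ} {x : X} (hχ : tsupport χ ⊆ adaptedSource h x) :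
    ∃ K, IsCompact K ∧ K ⊆ fibreDomain h x ∧
      ∀ z ∈ fibreDomain h x, z ∉ K → χ (fibreParam h x z) = 0 := by
  have h1 : IsCompact (tsupport χ ∩ π ⁻¹' {π x}) :=
    ((isClosed_tsupport χ).inter (isClosed_fibre h (π x))).isCompact
  refine ⟨(fun y => (adaptedCoord h x y).2) '' (tsupport χ ∩ π ⁻¹' {π x}),
    h1.image_of_continuousOn (continuous_snd.comp_continuousOn
      ((continuousOn_adaptedCoord h x).mono fun y hy => hχ hy.1)), ?_, ?_⟩
  · rintro _ ⟨y, hy, rfl⟩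
    exact (adaptedCoord_snd_mem hy.2 (hχ hy.1)).1
  · intro z hz hzK
    by_contra hne
    refine hzK ⟨fibreParam h x z, ⟨subset_tsupport _ hne, proj_fibreParam hz⟩, ?_⟩
    simp only
    rw [adaptedCoord_fibreParam hz]

end Partition

/-! ### Functions smooth along a fibre: algebra and locality of the Laplacian. -/

section FibreSmooth

variable {EX EB X B : Type*}
  [NormedAddCommGroup EX] [NormedSpace ℂ EX]
  [NormedAddCommGroup EB] [NormedSpace ℂ EB]
  [TopologicalSpace X] [ChartedSpace EX X] [IsManifold 𝓘(ℂ, EX) ω X]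
  [TopologicalSpace B] [ChartedSpace EB B] [IsManifold 𝓘(ℂ, EB) ω B]
  {m : ℕ} {π : X → B} {h : IsHolSubmersion EX EB m π} {b : B} {f g : X → ℝ}

lemma SmoothOnFibre.mul (hf : SmoothOnFibre h b f) (hg : SmoothOnFibre h b g) :
    SmoothOnFibre h b (fun y => f y * g y) := fun x hx => (hf x hx).mul (hg x hx)

lemma SmoothOnFibre.sub (hf : SmoothOnFibre h b f) (hg : SmoothOnFibre h b g) :
    SmoothOnFibre h b (fun y => f y - g y) := fun x hx => (hf x hx).sub (hg x hx)

lemma SmoothOnFibre.add (hf : SmoothOnFibre h b f) (hg : SmoothOnFibre h b g) :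
    SmoothOnFibre h b (fun y => f y + g y) := fun x hx => (hf x hx).add (hg x hx)

lemma SmoothOnFibre.const (c : ℝ) : SmoothOnFibre h b (fun _ => c) := fun _ _ => contDiffOn_const

lemma SmoothOnFibre.congr (hf : SmoothOnFibre h b f) (hfg : ∀ y, π y = b → g y = f y) :
    SmoothOnFibre h b g := fun x hx =>
  (hf x hx).congr fun _ hz => hfg _ ((proj_fibreParam hz).trans hx)

lemma iddbar_congr {E : Type*} [NormedAddCommGroup E] [NormedSpace ℂ E] {f g : E → ℝ} {z : E}
    (hfg : f =ᶠ[nhds z] g) : iddbar f z = iddbar g z := by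
  have h2 : dc f =ᶠ[nhds z] dc g := by
    filter_upwards [hfg.eventuallyEq_nhds] with q hq
    rw [dc, dc, hq.fderiv_eq]
  rw [iddbar, iddbar, h2.extDeriv_eq]

lemma localLaplacian_congr {θ : Form (Fin m → ℂ) (Fin m → ℂ) 2} {f g : (Fin m → ℂ) → ℝ}
    {z : Fin m → ℂ} (hfg : f =ᶠ[nhds z] g) : localLaplacian θ f z = localLaplacian θ g z := by
  have h1 : (iddbar f).at₂ z = (iddbar g).at₂ z := by
    funext u v
    rw [Form.at₂, Form.at₂, iddbar_congr hfg]
  rw [localLaplacian, localLaplacian, h1]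

lemma IsKahlerOn.localLaplacian_sum {θ : Form (Fin m → ℂ) (Fin m → ℂ) 2} {O : Set (Fin m → ℂ)}
    (hθ : IsKahlerOn θ O) {ι : Type*} (s : Finset ι) {f : ι → (Fin m → ℂ) → ℝ}
    (hf : ∀ i ∈ s, ContDiffOn ℝ ∞ (f i) O) {z : Fin m → ℂ} (hz : z ∈ O) :
    localLaplacian θ (fun y => ∑ i ∈ s, f i y) z = ∑ i ∈ s, localLaplacian θ (f i) z := by
  have hO := hθ.isOpen
  apply Complex.ofReal_injective
  rw [hθ.localLaplacian_eq (ContDiffOn.sum hf) hz, Complex.ofReal_sum,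
    Finset.sum_congr rfl fun i hi => hθ.localLaplacian_eq (hf i hi) hz, Finset.sum_neg_distrib]
  congr 1
  rw [Finset.sum_comm (s := s)]
  refine Finset.sum_congr rfl fun k _ => ?_
  rw [Finset.sum_comm (s := s)]
  refine Finset.sum_congr rfl fun l _ => ?_
  rw [← Finset.mul_sum]
  congr 1
  have h1 : ∀ i ∈ s, ContDiffOn ℝ ∞ (fun x => (f i x : ℂ)) O := fun i hi => contDiffOn_ofReal (hf i hi)
  rw [← wirt_sum s fun i hi => ContDiffOn.differentiableAt_of_isOpen
    (ContDiffOn.wirt hO (h1 i hi)) hO hz]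
  refine wirt_congr_of_eqOn hO hz fun y hy => ?_
  simp only [Complex.ofReal_sum]
  exact wirt_sum s fun i hi => ContDiffOn.differentiableAt_of_isOpen (h1 i hi) hO hy

variable {Ω : Form EX X 2}

lemma verticalLaplacian_sum (hΩ : IsRelativelyKahler EB π Ω) {ι : Type*} (s : Finset ι)
    {f : ι → X → ℝ} (hf : ∀ i ∈ s, SmoothOnFibre h b (f i)) {x : X} (hx : π x = b) :
    verticalLaplacian h Ω (fun y => ∑ i ∈ s, f i y) x = ∑ i ∈ s, verticalLaplacian h Ω (f i) x :=
  (hΩ.fibreForm (h := h) x).localLaplacian_sum s (fun i hi => hf i hi x hx) (fibrePoint_mem h x)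

lemma verticalLaplacian_congr_fibre {x : X} (hfg : ∀ y, π y = π x → f y = g y) :
    verticalLaplacian h Ω f x = verticalLaplacian h Ω g x := by
  refine localLaplacian_congr ?_
  filter_upwards [(isOpen_fibreDomain h x).mem_nhds (fibrePoint_mem h x)] with z hz
  exact hfg _ (proj_fibreParam hz)

lemma verticalLaplacian_eq_zero_of_notMem_tsupport (hΩ : IsRelativelyKahler EB π Ω) {x : X}
    (hx : x ∉ tsupport f) : verticalLaplacian h Ω f x = 0 := by
  -- The zero function is treated as an empty sum, so that additivity gives its Laplacian.
  have h0 := verticalLaplacian_sum (h := h) hΩ (∅ : Finset X) (f := fun _ => f) (by simp)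
    (rfl : π x = π x)
  simp only [Finset.sum_empty] at h0
  rw [← h0]
  refine localLaplacian_congr ?_
  have hc : ContinuousAt (fibreParam h x) (fibrePoint h x) :=
    (continuousOn_fibreParam h x).continuousAt
      ((isOpen_fibreDomain h x).mem_nhds (fibrePoint_mem h x))
  have hn : (tsupport f)ᶜ ∈ nhds (fibreParam h x (fibrePoint h x)) := by
    rw [fibreParam_fibrePoint]
    exact (isClosed_tsupport f).isOpen_compl.mem_nhds hx
  filter_upwards [hc hn] with z hz
  exact image_eq_zero_of_notMem_tsupport (f := f) hz

end FibreSmooth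

/-! ### Smooth dependence of contractions and norms on parameters. -/

section Smoothness

variable {E V ι : Type*} [NormedAddCommGroup E] [NormedSpace ℝ E] [AddCommGroup V] [Module ℂ V]
  [Fintype ι] [DecidableEq ι] {O : Set E} {e : ι → V} {θ σ τ : E → V → V → ℝ}

lemma contDiffOn_trace_re {M : E → Matrix ι ι ℂ} (hM : ∀ i j, ContDiffOn ℝ ∞ (fun y => M y i j) O) :
    ContDiffOn ℝ ∞ (fun y => (M y).trace.re) O := by
  simp only [Matrix.trace, Matrix.diag_apply]
  exact Complex.reCLM.contDiff.comp_contDiffOn (ContDiffOn.sum fun i _ => hM i i)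

lemma contDiffOn_matrix_mul {M N : E → Matrix ι ι ℂ}
    (hM : ∀ i j, ContDiffOn ℝ ∞ (fun y => M y i j) O)
    (hN : ∀ i j, ContDiffOn ℝ ∞ (fun y => N y i j) O) (i j : ι) :
    ContDiffOn ℝ ∞ (fun y => (M y * N y) i j) O := by
  simp only [Matrix.mul_apply]
  exact ContDiffOn.sum fun k _ => (hM i k).mul (hN k j)

lemma contDiffOn_contraction (hθ : ∀ i j, ContDiffOn ℝ ∞ (fun y => hermMatrix e (θ y) i j) O)
    (hdet : ∀ y ∈ O, (hermMatrix e (θ y)).det ≠ 0)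
    (hσ : ∀ i j, ContDiffOn ℝ ∞ (fun y => hermMatrix e (σ y) i j) O) :
    ContDiffOn ℝ ∞ (fun y => contraction e (θ y) (σ y)) O :=
  contDiffOn_trace_re (contDiffOn_matrix_mul (contDiffOn_inv hθ hdet) hσ)

lemma contDiffOn_normSqForm (hθ : ∀ i j, ContDiffOn ℝ ∞ (fun y => hermMatrix e (θ y) i j) O)
    (hdet : ∀ y ∈ O, (hermMatrix e (θ y)).det ≠ 0)
    (hσ : ∀ i j, ContDiffOn ℝ ∞ (fun y => hermMatrix e (σ y) i j) O)
    (hτ : ∀ i j, ContDiffOn ℝ ∞ (fun y => hermMatrix e (τ y) i j) O) :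
    ContDiffOn ℝ ∞ (fun y => normSqForm e (θ y) (σ y) (τ y)) O :=
  contDiffOn_trace_re (contDiffOn_matrix_mul (contDiffOn_matrix_mul (contDiffOn_matrix_mul
    (contDiffOn_inv hθ hdet) hσ) (contDiffOn_inv hθ hdet)) hτ)

lemma normSqForm_add (e : ι → V) (θ σ τ τ' : V → V → ℝ) :
    normSqForm e θ σ (fun u v => τ u v + τ' u v) = normSqForm e θ σ τ + normSqForm e θ σ τ' := by
  have : hermMatrix e (fun u v => τ u v + τ' u v) = hermMatrix e τ + hermMatrix e τ' := by
    ext j k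
    simp only [hermMatrix, hermCoeff, Matrix.of_apply, Matrix.add_apply]
    push_cast
    ring
  rw [normSqForm, this, Matrix.mul_add, Matrix.trace_add, Complex.add_re]
  rfl

end Smoothness

/-! ### Integration by parts on whole fibres. -/

section GlobalIntegrals

variable {EX EB X B : Type*}
  [NormedAddCommGroup EX] [NormedSpace ℂ EX] [FiniteDimensional ℂ EX]
  [NormedAddCommGroup EB] [NormedSpace ℂ EB]
  [TopologicalSpace X] [ChartedSpace EX X] [IsManifold 𝓘(ℂ, EX) ω X] [T2Space X] [CompactSpace X]
  [MeasurableSpace X] [BorelSpace X]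
  [TopologicalSpace B] [ChartedSpace EB B] [IsManifold 𝓘(ℂ, EB) ω B] [T2Space B]
  {m : ℕ} {π : X → B} {h : IsHolSubmersion EX EB m π} {b : B} {Ω : Form EX X 2}

lemma SmoothOnFibre.integrable (hΩ : IsRelativelyKahler EB π Ω) {f : X → ℝ}
    (hf : SmoothOnFibre h b f) : Integrable f (fibreMeasure h Ω b) :=
  integrable_of_continuousOn hΩ hf.continuousOn

/-- The Laplacian on a fibre is symmetric. -/
lemma integral_mul_laplacian_symm (hΩ : IsRelativelyKahler EB π Ω) {u g : X → ℝ}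
    (hu : SmoothOnFibre h b u) (hg : SmoothOnFibre h b g) :
    ∫ y, u y * verticalLaplacian h Ω g y ∂(fibreMeasure h Ω b)
      = ∫ y, g y * verticalLaplacian h Ω u y ∂(fibreMeasure h Ω b) := by
  obtain ⟨t, χ, ht, hχ, hsupp, hsum⟩ := exists_fibre_partition h b
  have hχu : ∀ x ∈ t, SmoothOnFibre h b (fun y => χ x y * u y) := fun x hx =>
    (ContMDiff.smoothOnFibre (hχ x hx) b).mul hu
  have hΔg := smoothOnFibre_verticalLaplacian hΩ hg
  have hint1 := ((hu.mul hΔg).integrable hΩ)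
  have hint2 := ((hg.mul (smoothOnFibre_verticalLaplacian hΩ hu)).integrable hΩ)
  rw [← sub_eq_zero, ← integral_sub hint1 hint2]
  have hsm : ∀ x ∈ t, SmoothOnFibre h b (fun y => χ x y * u y * verticalLaplacian h Ω g y
      - g y * verticalLaplacian h Ω (fun y => χ x y * u y) y) := fun x hx =>
    ((hχu x hx).mul hΔg).sub (hg.mul (smoothOnFibre_verticalLaplacian hΩ (hχu x hx)))
  -- Only u is cut off. As the χ sum to 1 on the fibre and Δ is additive, the integrand splits into
  -- terms supported in single patches, and no derivative of a cutoff has to be computed.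
  have key : ∀ y, π y = b → u y * verticalLaplacian h Ω g y - g y * verticalLaplacian h Ω u y
      = ∑ x ∈ t, (χ x y * u y * verticalLaplacian h Ω g y
        - g y * verticalLaplacian h Ω (fun y => χ x y * u y) y) := by
    intro y hy
    have h1 : verticalLaplacian h Ω u y
        = verticalLaplacian h Ω (fun y => ∑ x ∈ t, χ x y * u y) y := by
      refine verticalLaplacian_congr_fibre fun y' hy' => ?_
      rw [← Finset.sum_mul, hsum y' (hy'.trans hy), one_mul]
    rw [h1, verticalLaplacian_sum hΩ t hχu hy, Finset.sum_sub_distrib, ← Finset.sum_mul,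
      ← Finset.sum_mul, hsum y hy, one_mul, Finset.mul_sum]
  have hae : (fun y => u y * verticalLaplacian h Ω g y - g y * verticalLaplacian h Ω u y)
      =ᵐ[fibreMeasure h Ω b] fun y => ∑ x ∈ t, (χ x y * u y * verticalLaplacian h Ω g y
        - g y * verticalLaplacian h Ω (fun y => χ x y * u y) y) := by
    filter_upwards [ae_mem_fibre h Ω b] with y hy
    exact key y hy
  rw [integral_congr_ae hae, integral_finsetSum _ fun x hx => (hsm x hx).integrable hΩ]
  refine Finset.sum_eq_zero fun x hx => ?_
  obtain ⟨K, hK, hKO, hv⟩ := exists_compact_of_tsupport (hsupp x hx)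
  obtain rfl := ht x hx
  rw [integral_fibreMeasure_of_support hΩ (hsm x hx).continuousOn]
  · rw [← (hΩ.fibreForm (h := h) x).integral_laplacian_symm (hχu x hx x rfl) (hg x rfl) hK hKO
      fun z hz hzK => by simp [hv z hz hzK]]
    refine setIntegral_congr_fun (isOpen_fibreDomain h x).measurableSet fun z hz => ?_
    rw [verticalLaplacian_fibreParam Ω hg hz, verticalLaplacian_fibreParam Ω (hχu x hx) hz]
    rfl
  · intro y _ hys
    have h1 : y ∉ tsupport (χ x) := fun hy' => hys (hsupp x hx hy')
    have h2 : y ∉ tsupport (fun y => χ x y * u y) := fun hy' =>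
      h1 (closure_mono (Function.support_mul_subset_left _ _) hy')
    rw [verticalLaplacian_eq_zero_of_notMem_tsupport hΩ h2,
      image_eq_zero_of_notMem_tsupport (f := χ x) h1]
    ring

lemma verticalLaplacian_const (hΩ : IsRelativelyKahler EB π Ω) (c : ℝ) (x : X) :
    verticalLaplacian h Ω (fun _ => c) x = 0 := by
  apply Complex.ofReal_injective
  change ((localLaplacian (fibreForm h Ω x) (fun _ => c) (fibrePoint h x) : ℝ) : ℂ) = _
  rw [(hΩ.fibreForm (h := h) x).localLaplacian_eq contDiffOn_const (fibrePoint_mem h x)]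
  simp [wirt_const]

/-- Symmetry of the Laplacian, tested against the constant 1. -/
lemma integral_verticalLaplacian (hΩ : IsRelativelyKahler EB π Ω) {u : X → ℝ}
    (hu : SmoothOnFibre h b u) :
    ∫ y, verticalLaplacian h Ω u y ∂(fibreMeasure h Ω b) = 0 := by
  have := integral_mul_laplacian_symm hΩ hu (SmoothOnFibre.const (h := h) (b := b) 1)
  simp only [verticalLaplacian_const hΩ, mul_zero, integral_zero, one_mul] at this
  exact this.symm

/-- Reduction of a fibre integral of an expression which is linear in an exact two-form to
exact forms supported in a coordinate patch. -/
lemma integral_exact_eq_zero (hΩ : IsRelativelyKahler EB π Ω)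
    (R : X → ((Fin m → ℂ) → (Fin m → ℂ) → ℝ) → ℝ)
    (hadd : ∀ y σ τ, R y (fun u v => σ u v + τ u v) = R y σ + R y τ)
    (hcont : ∀ ζ : Form EX X 2, ζ.IsSmooth →
      ContinuousOn (fun y => R y ((fibreForm h ζ y).at₂ (fibrePoint h y))) (π ⁻¹' {b}))
    (hloc : ∀ x, π x = b → ∀ (γ : Form EX X 1) (ζ : Form EX X 2), γ.IsSmooth → γ.HasExtDeriv ζ →
      ∀ K, IsCompact K → K ⊆ fibreDomain h x → (∀ z ∈ fibreDomain h x, z ∉ K →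
        Form.pull (E := Fin m → ℂ) (E' := EX) (fibreParam h x) γ z = 0) →
      ∫ z in fibreDomain h x, R (fibreParam h x z)
        ((fibreForm h ζ (fibreParam h x z)).at₂ (fibrePoint h (fibreParam h x z)))
          * volumeDensity (fibreForm h Ω x) z = 0)
    {γ : Form EX X 1} {ζ : Form EX X 2} (hγ : γ.IsSmooth) (hζ : γ.HasExtDeriv ζ) :
    ∫ y, R y ((fibreForm h ζ y).at₂ (fibrePoint h y)) ∂(fibreMeasure h Ω b) = 0 := by
  classical
  have : IsManifold 𝓘(ℝ, EX) ∞ X := isManifold_real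
  obtain ⟨t, χ, ht, hχ, hsupp, hsum⟩ := exists_fibre_partition h b
  have hR0 : ∀ y, R y (fun _ _ => 0) = 0 := by
    intro y
    have := hadd y (fun _ _ => 0) (fun _ _ => 0)
    simpa using this
  have hRsum : ∀ y (s : Finset X) (σ : X → (Fin m → ℂ) → (Fin m → ℂ) → ℝ),
      R y (fun u v => ∑ i ∈ s, σ i u v) = ∑ i ∈ s, R y (σ i) := by
    intro y s σ
    induction s using Finset.induction_on with
    | empty => simpa using hR0 y
    | insert i s hi ih =>
      simp only [Finset.sum_insert hi]
      rw [← ih]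
      exact hadd y _ _
  have hγs : ∀ x ∈ t, Form.IsSmooth (E := EX) (fun y => χ x y • γ y) := fun x hx =>
    Form.isSmooth_smul hγ (hχ x hx)
  have hex : ∀ x, ∃ ζ' : Form EX X 2, x ∈ t →
      Form.HasExtDeriv (E := EX) (fun y => χ x y • γ y) ζ' := by
    intro x
    by_cases hx : x ∈ t
    · obtain ⟨ζ', hζ'⟩ := Form.exists_hasExtDeriv (hγs x hx)
      exact ⟨ζ', fun _ => hζ'⟩
    · exact ⟨0, fun hx' => (hx hx').elim⟩
  choose ζ' hζ' using hex
  have hζs : ∀ x ∈ t, (ζ' x).IsSmooth := fun x hx =>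
    (Form.isClosed_of_hasExtDeriv (hγs x hx) (hζ' x hx)).1
  -- The cutoffs sum to 1 only on the fibre. This is enough because ζ enters only through its
  -- restriction to the fibre, which is d of the restricted primitive.
  have key : ∀ y, π y = b → R y ((fibreForm h ζ y).at₂ (fibrePoint h y))
      = ∑ x ∈ t, R y ((fibreForm h (ζ' x) y).at₂ (fibrePoint h y)) := by
    intro y hy
    rw [← hRsum]
    congr 1
    funext u v
    have e1 : fibreForm h ζ y (fibrePoint h y)
        = ∑ x ∈ t, fibreForm h (ζ' x) y (fibrePoint h y) := by
      rw [fibreForm, ← extDeriv_pull_fibreParam hγ hζ (fibrePoint_mem h y)]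
      have e2 : ∀ x ∈ t, fibreForm h (ζ' x) y (fibrePoint h y)
          = extDeriv (Form.pull (E := Fin m → ℂ) (E' := EX) (fibreParam h y)
            (fun y => χ x y • γ y)) (fibrePoint h y) := fun x hx =>
        (extDeriv_pull_fibreParam (hγs x hx) (hζ' x hx) (fibrePoint_mem h y)).symm
      rw [Finset.sum_congr rfl e2, ← extDeriv_fun_sum t fun x hx =>
        ContDiffOn.differentiableAt_of_isOpen (contDiffOn_pull_fibreParam (hγs x hx) y)
          (isOpen_fibreDomain h y) (fibrePoint_mem h y)]
      refine Filter.EventuallyEq.extDeriv_eq ?_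
      filter_upwards [(isOpen_fibreDomain h y).mem_nhds (fibrePoint_mem h y)]
        with z hz
      have e3 : ∀ x, Form.pull (E := Fin m → ℂ) (E' := EX) (fibreParam h y)
          (fun y => χ x y • γ y) z = χ x (fibreParam h y z) •
            Form.pull (E := Fin m → ℂ) (E' := EX) (fibreParam h y) γ z := fun x => rfl
      simp only [e3]
      rw [← Finset.sum_smul, hsum _ ((proj_fibreParam hz).trans hy), one_smul]
    rw [Form.at₂, e1]
    simp only [Form.at₂, ContinuousAlternatingMap.sum_apply]
  have hae : (fun y => R y ((fibreForm h ζ y).at₂ (fibrePoint h y))) =ᵐ[fibreMeasure h Ω b]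
      fun y => ∑ x ∈ t, R y ((fibreForm h (ζ' x) y).at₂ (fibrePoint h y)) := by
    filter_upwards [ae_mem_fibre h Ω b] with y hy
    exact key y hy
  rw [integral_congr_ae hae, integral_finsetSum _ fun x hx =>
    integrable_of_continuousOn hΩ (hcont _ (hζs x hx))]
  refine Finset.sum_eq_zero fun x hx => ?_
  obtain ⟨K, hK, hKO, hv⟩ := exists_compact_of_tsupport (hsupp x hx)
  obtain rfl := ht x hx
  rw [integral_fibreMeasure_of_support hΩ (hcont _ (hζs x hx))]
  · refine hloc x rfl _ _ (hγs x hx) (hζ' x hx) K hK hKO fun z hz hzK => ?_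
    change χ x (fibreParam h x z) •
      Form.pull (E := Fin m → ℂ) (E' := EX) (fibreParam h x) γ z = 0
    rw [hv z hz hzK, zero_smul]
  · intro y _ hys
    have h1 : y ∉ tsupport (χ x) := fun hy' => hys (hsupp x hx hy')
    have h2 : fibreForm h (ζ' x) y (fibrePoint h y) = 0 := by
      rw [fibreForm, ← extDeriv_pull_fibreParam (hγs x hx) (hζ' x hx) (fibrePoint_mem h y)]
      have h3 : Form.pull (E := Fin m → ℂ) (E' := EX) (fibreParam h y)
          (fun y => χ x y • γ y) =ᶠ[nhds (fibrePoint h y)]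
            fun _ => ∑ i ∈ (∅ : Finset X), (0 : (Fin m → ℂ) [⋀^Fin 1]→L[ℝ] ℝ) := by
        have hc : ContinuousAt (fibreParam h y) (fibrePoint h y) :=
          (continuousOn_fibreParam h y).continuousAt
            ((isOpen_fibreDomain h y).mem_nhds (fibrePoint_mem h y))
        have hn : (tsupport (χ x))ᶜ ∈ nhds (fibreParam h y (fibrePoint h y)) := by
          rw [fibreParam_fibrePoint]
          exact (isClosed_tsupport _).isOpen_compl.mem_nhds h1
        filter_upwards [hc hn] with z hz
        change χ x (fibreParam h y z) •
          Form.pull (E := Fin m → ℂ) (E' := EX) (fibreParam h y) γ z = _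
        rw [image_eq_zero_of_notMem_tsupport (f := χ x) hz, zero_smul, Finset.sum_empty]
      rw [h3.extDeriv_eq, extDeriv_fun_sum (γ := fun _ _ => 0) ∅ (by simp), Finset.sum_empty]
    rw [← hR0 y]
    congr 1
    funext u v
    rw [Form.at₂, h2]
    rfl

/-- The contraction of a two-form with the metrics of the fibres. -/
def fibreTrace (h : IsHolSubmersion EX EB m π) (Ω ζ : Form EX X 2) (y : X) : ℝ :=
  contraction (stdVec m) ((fibreForm h Ω y).at₂ (fibrePoint h y))
    ((fibreForm h ζ y).at₂ (fibrePoint h y))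

/-- The inner product of two-forms with respect to the metrics of the fibres. -/
def fibrePairing (h : IsHolSubmersion EX EB m π) (Ω η ζ : Form EX X 2) (y : X) : ℝ :=
  normSqForm (stdVec m) ((fibreForm h Ω y).at₂ (fibrePoint h y))
    ((fibreForm h η y).at₂ (fibrePoint h y)) ((fibreForm h ζ y).at₂ (fibrePoint h y))

lemma fibreTrace_fibreParam (Ω ζ : Form EX X 2) {x : X} {z : Fin m → ℂ} (hz : z ∈ fibreDomain h x) :
    fibreTrace h Ω ζ (fibreParam h x z)
      = contraction (stdVec m) ((fibreForm h Ω x).at₂ z) ((fibreForm h ζ x).at₂ z) := by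
  have hy := fibreParam_mem_adaptedSource hz
  have hw := codChart_basePoint_of_proj_eq (h := h) (proj_fibreParam hz)
  have ht := transition_fibrePoint (h := h) (fibreParam h x z) x
  have := contraction_transition hw (fibrePoint_mem_transitionDomain hy) Ω
    (Form.isRealBilin (sliceForm h ζ x (basePoint h x)) _)
    (sliceForm_transition hw (fibrePoint_mem_transitionDomain hy) ζ)
  rw [ht, adaptedCoord_fibreParam hz] at this
  exact this

lemma fibrePairing_fibreParam (Ω η ζ : Form EX X 2) {x : X} {z : Fin m → ℂ}
    (hz : z ∈ fibreDomain h x) :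
    fibrePairing h Ω η ζ (fibreParam h x z)
      = normSqForm (stdVec m) ((fibreForm h Ω x).at₂ z) ((fibreForm h η x).at₂ z)
        ((fibreForm h ζ x).at₂ z) := by
  have hy := fibreParam_mem_adaptedSource hz
  have hw := codChart_basePoint_of_proj_eq (h := h) (proj_fibreParam hz)
  have ht := transition_fibrePoint (h := h) (fibreParam h x z) x
  have := normSqForm_transition hw (fibrePoint_mem_transitionDomain hy) Ω η ζ
  rw [ht, adaptedCoord_fibreParam hz] at this
  exact this

lemma smoothOnFibre_fibrePairing (hΩ : IsRelativelyKahler EB π Ω) {η ζ : Form EX X 2}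
    (hη : η.IsSmooth) (hζ : ζ.IsSmooth) (b : B) : SmoothOnFibre h b (fibrePairing h Ω η ζ) :=
  fun x _ => (contDiffOn_normSqForm (hΩ.fibreForm (h := h) x).contDiffOn_matrix
    (fun _ hy => (hΩ.fibreForm (h := h) x).det_ne_zero hy) (contDiffOn_metricMatrix
      (contDiffOn_pull_slice hη x _)) (contDiffOn_metricMatrix
      (contDiffOn_pull_slice hζ x _))).congr fun _ hz => fibrePairing_fibreParam Ω η ζ hz

/-- An exact form is orthogonal on every fibre to closed `(1,1)`-forms of constant trace. -/
lemma integral_fibrePairing_eq_zero (hΩ : IsRelativelyKahler EB π Ω) {η : Form EX X 2}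
    (hη : η.IsClosed) (h11 : η.IsOneOne) {c : ℝ} (hc : ∀ y, π y = b → fibreTrace h Ω η y = c)
    {γ : Form EX X 1} {ζ : Form EX X 2} (hγ : γ.IsSmooth) (hζ : γ.HasExtDeriv ζ) :
    ∫ y, fibrePairing h Ω η ζ y ∂(fibreMeasure h Ω b) = 0 := by
  refine integral_exact_eq_zero hΩ
    (fun y σ => normSqForm (stdVec m) ((fibreForm h Ω y).at₂ (fibrePoint h y))
      ((fibreForm h η y).at₂ (fibrePoint h y)) σ)
    (fun y σ τ => normSqForm_add _ _ _ _ _)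
    (fun ζ hζ => (smoothOnFibre_fibrePairing hΩ hη.1 hζ b).continuousOn) ?_ hγ hζ
  intro x hx γ ζ hγ hζ K hK hKO hv
  rw [← (hΩ.fibreForm (h := h) x).integral_normSqForm_extDeriv
    (isClosedOneOneOn_sliceForm hη h11 x (basePoint h x)) (t := c) (fun z hz =>
      (fibreTrace_fibreParam Ω η hz).symm.trans (hc _ ((proj_fibreParam hz).trans hx))) hK hKO
    (contDiffOn_pull_fibreParam hγ x) hv]
  refine setIntegral_congr_fun (isOpen_fibreDomain h x).measurableSet fun z hz => ?_
  refine congrArg (· * volumeDensity (fibreForm h Ω x) z) ?_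
  refine (fibrePairing_fibreParam Ω η ζ hz).trans ?_
  congr 1
  funext u v
  simp only [Form.at₂]
  rw [extDeriv_pull_fibreParam hγ hζ hz]
  rfl

end GlobalIntegrals

/-- The matrix records only the (1,1)-part, hence the type condition; given it, σ(u, v) is read off
from the imaginary part of the hermitian coefficient. -/
lemma eq_zero_of_hermMatrix_eq_zero {V ι : Type*} [AddCommGroup V] [Module ℂ V] [Fintype ι]
    {σ : V → V → ℝ} (hσ : IsRealBilin σ) (h11 : ∀ u v, σ (Complex.I • u) (Complex.I • v) = σ u v)
    {e : ι → V} (he : ⊤ ≤ Submodule.span ℂ (Set.range e)) (h0 : hermMatrix e σ = 0) (u v : V) :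
    σ u v = 0 := by
  obtain ⟨a, rfl⟩ := (Submodule.mem_span_range_iff_exists_fun ℂ).1 (he (Submodule.mem_top (x := u)))
  obtain ⟨c, rfl⟩ := (Submodule.mem_span_range_iff_exists_fun ℂ).1 (he (Submodule.mem_top (x := v)))
  have h1 : hermCoeff σ (∑ i, a i • e i) (∑ i, c i • e i) = 0 := by
    rw [hermCoeff_sum_left hσ]
    refine Finset.sum_eq_zero fun i _ => ?_
    rw [hermCoeff_sum_right hσ]
    refine Finset.sum_eq_zero fun j _ => ?_
    have h2 : hermCoeff σ (e i) (e j) = 0 := congrFun (congrFun h0 i) j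
    rw [hermCoeff_smul_left hσ, hermCoeff_smul_right hσ, h2, mul_zero, mul_zero]
  rw [hermCoeff_of_oneOne hσ h11] at h1
  have h2 := congrArg Complex.im h1
  simp at h2
  exact h2

lemma span_stdVec (m : ℕ) : ⊤ ≤ Submodule.span ℂ (Set.range (stdVec m)) := by
  intro v _
  rw [Submodule.mem_span_range_iff_exists_fun]
  refine ⟨v, ?_⟩
  ext i
  simp [stdVec, Finset.sum_apply, Pi.single_apply]

/-! ### Functions with vanishing derivative on a connected fibre. -/

section FibreConnected

variable {EX EB X B : Type*}
  [NormedAddCommGroup EX] [NormedSpace ℂ EX]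
  [NormedAddCommGroup EB] [NormedSpace ℂ EB]
  [TopologicalSpace X] [ChartedSpace EX X]
  [TopologicalSpace B] [ChartedSpace EB B]
  {m : ℕ} {π : X → B} {h : IsHolSubmersion EX EB m π} {b : B} {f : X → ℝ}

/-- The derivative of a function along the fibre at `x`, in the fibre coordinates around `x`. -/
def fibreDeriv (h : IsHolSubmersion EX EB m π) (f : X → ℝ) (x : X) : (Fin m → ℂ) →L[ℝ] ℝ :=
  fderiv ℝ (f ∘ fibreParam h x) (fibrePoint h x)

lemma SmoothOnFibre.differentiableAt (hf : SmoothOnFibre h b f) {x : X} (hx : π x = b)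
    {z : Fin m → ℂ} (hz : z ∈ fibreDomain h x) :
    DifferentiableAt ℝ (f ∘ fibreParam h x) z :=
  ContDiffOn.differentiableAt_of_isOpen (hf x hx) (isOpen_fibreDomain h x) hz

/-- The hypothesis concerns each point in its own centred chart; the chain rule along the transition
map carries it to the fixed chart at x. -/
lemma fderiv_eq_zero_of_fibreDeriv (hf : SmoothOnFibre h b f)
    (h0 : ∀ y, π y = b → fibreDeriv h f y = 0) {x : X} (hx : π x = b) {z : Fin m → ℂ}
    (hz : z ∈ fibreDomain h x) : fderiv ℝ (f ∘ fibreParam h x) z = 0 := by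
  set y := fibreParam h x z with hy
  have hyb : π y = b := (proj_fibreParam hz).trans hx
  have hw := codChart_basePoint_of_proj_eq (h := h) (hx.trans hyb.symm)
  have hzt : z ∈ transitionDomain h x (basePoint h x) y := ⟨hz, mem_adaptedSource h y⟩
  have h1 : transition h x (basePoint h x) y z = fibrePoint h y := rfl
  have h2 : f ∘ fibreParam h x
      =ᶠ[nhds z] (f ∘ fibreParam h y) ∘ transition h x (basePoint h x) y := by
    filter_upwards [slice_transition_eventually hw hzt] with q hq
    simp only [Function.comp_apply] at hq ⊢
    rw [fibreParam_eq_slice, hq]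
    rfl
  have h3 : DifferentiableAt ℝ (f ∘ fibreParam h y) (transition h x (basePoint h x) y z) :=
    hf.differentiableAt hyb (fibrePoint_mem h y)
  rw [h2.fderiv_eq, fderiv_comp z h3
    (((contDiffAt_transition hzt).differentiableAt (by simp)).restrictScalars ℝ), h1]
  have h4 := h0 y hyb
  rw [fibreDeriv] at h4
  rw [h4, ContinuousLinearMap.zero_comp]

/-- A function on a connected fibre with vanishing derivative is constant. -/
lemma eq_of_fibreDeriv_eq_zero (hconn : IsConnected (π ⁻¹' {b})) (hf : SmoothOnFibre h b f)
    (h0 : ∀ y, π y = b → fibreDeriv h f y = 0) {x y : X} (hx : π x = b) (hy : π y = b) :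
    f x = f y := by
  have hlc : IsLocallyConstant (fun p : π ⁻¹' {b} => f p.1) := by
    rw [IsLocallyConstant.iff_eventually_eq]
    rintro ⟨p, hp⟩
    obtain ⟨r, hr, hball⟩ := Metric.isOpen_iff.1 (isOpen_fibreDomain h p) _ (fibrePoint_mem h p)
    have hconst : ∀ z ∈ Metric.ball (fibrePoint h p) r,
        (f ∘ fibreParam h p) z = (f ∘ fibreParam h p) (fibrePoint h p) := fun z hz =>
      Metric.isOpen_ball.is_const_of_fderiv_eq_zero (𝕜 := ℝ)
        (convex_ball (fibrePoint h p) r).isPreconnected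
        (fun q hq => (hf.differentiableAt hp (hball hq)).differentiableWithinAt)
        (fun q hq => fderiv_eq_zero_of_fibreDeriv hf h0 hp (hball hq)) hz
        (Metric.mem_ball_self hr)
    have hU : adaptedSource h p ∩ (fun y => (adaptedCoord h p y).2) ⁻¹'
        Metric.ball (fibrePoint h p) r ∈ nhds p :=
      ((continuous_snd.comp_continuousOn (continuousOn_adaptedCoord h p)).isOpen_inter_preimage
        (isOpen_adaptedSource h p) Metric.isOpen_ball).mem_nhds
          ⟨mem_adaptedSource h p, Metric.mem_ball_self hr⟩
    filter_upwards [continuous_subtype_val.continuousAt (x := (⟨p, hp⟩ : π ⁻¹' {b})) hU] with q hq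
    have h1 := hconst _ hq.2
    simp only [Function.comp_apply] at h1
    rw [(adaptedCoord_snd_mem (q.2.trans hp.symm) hq.1).2, fibreParam_fibrePoint] at h1
    exact h1
  have : PreconnectedSpace (π ⁻¹' {b}) := isPreconnected_iff_preconnectedSpace.1 hconn.isPreconnected
  exact hlc.apply_eq_of_isPreconnected isPreconnected_univ (x := ⟨x, hx⟩) (y := ⟨y, hy⟩)
    (Set.mem_univ _) (Set.mem_univ _)

end FibreConnected

/-! ### The relative Ricci form and the Kähler–Einstein property of the fibres. -/

section RelativeRicci

variable {EX EB X B : Type*}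
  [NormedAddCommGroup EX] [NormedSpace ℂ EX] [FiniteDimensional ℂ EX]
  [NormedAddCommGroup EB] [NormedSpace ℂ EB] [FiniteDimensional ℂ EB]
  [TopologicalSpace X] [ChartedSpace EX X] [IsManifold 𝓘(ℂ, EX) ω X]
  [TopologicalSpace B] [ChartedSpace EB B] [IsManifold 𝓘(ℂ, EB) ω B]
  {m : ℕ} {π : X → B} {h : IsHolSubmersion EX EB m π} {Ω : Form EX X 2}

/-- The vertical coordinate vectors of the adapted coordinates. -/
def vertVec (EB : Type*) [NormedAddCommGroup EB] (m : ℕ) (j : Fin m) : EB × (Fin m → ℂ) :=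
  (0, stdVec m j)

/-- The local potential of the relative Ricci form. -/
def relativePotential (h : IsHolSubmersion EX EB m π) (Ω : Form EX X 2) (x : X)
    (p : EB × (Fin m → ℂ)) : ℝ :=
  -Real.log (hermMatrix (vertVec EB m) ((adaptedForm h Ω x).at₂ p)).det.re

lemma hermMatrix_vertVec {ζ : Form EX X 2} {x : X} {p : EB × (Fin m → ℂ)}
    (hp : p ∈ adaptedDomain h x) :
    hermMatrix (vertVec EB m) ((adaptedForm h ζ x).at₂ p)
      = metricMatrix (sliceForm h ζ x p.1) p.2 := by
  refine (hermMatrix_comp (L := fun u => ((0 : EB), u)) (fun v => ?_)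
    (fun u v => sliceForm_at₂ ζ hp u v) (stdVec m)).symm
  simp

lemma contDiffOn_relativePotential (hΩ : IsRelativelyKahler EB π Ω) (x : X) :
    ContDiffOn ℝ ∞ (relativePotential h Ω x) (adaptedDomain h x) := by
  have h1 : ContDiffOn ℝ ∞ (fun p => (hermMatrix (vertVec EB m)
      ((adaptedForm h Ω x).at₂ p)).det) (adaptedDomain h x) :=
    contDiffOn_det fun i j => contDiffOn_hermCoeff (contDiffOn_adaptedForm hΩ.closed.1 x) _ _
  refine ((Complex.reCLM.contDiff.comp_contDiffOn h1).log fun p hp => ?_).neg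
  change (hermMatrix (vertVec EB m) ((adaptedForm h Ω x).at₂ p)).det.re ≠ 0
  rw [hermMatrix_vertVec hp]
  exact ((hΩ.sliceForm x p.1).det_re_pos hp).ne'

lemma contDiffAt_relativePotential (hΩ : IsRelativelyKahler EB π Ω) (x : X) :
    ContDiffAt ℝ 2 (relativePotential h Ω x) (adaptedCoord h x x) :=
  ((contDiffOn_relativePotential hΩ x).contDiffAt ((isOpen_adaptedDomain h x).mem_nhds
    (adaptedCoord_mem (mem_adaptedSource h x)))).of_le two_le_infty

lemma relativeRicci_at₂ (x : X) (u v : EX) :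
    (relativeRicci h Ω).at₂ x u v = (iddbar (relativePotential h Ω x)).at₂ (adaptedCoord h x x)
      (coordDeriv h x x u) (coordDeriv h x x v) := by
  have h1 : (fun p => -Real.log (hermMatrix (fun j => ((0 : EB), stdVec m j))
      (Form.at₂ (Form.pull (E := EB × (Fin m → ℂ)) (E' := EX) (adaptedParam h x) Ω) p)).det.re)
      = relativePotential h Ω x := rfl
  have h2 : relativeRicci h Ω x = Form.pull (E := EX) (E' := EB × (Fin m → ℂ)) (adaptedCoord h x)
      (iddbar (relativePotential h Ω x)) x := by
    rw [relativeRicci, h1]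
  have h3 := Form.pull_at₂ (E := EX) (E' := EB × (Fin m → ℂ)) (f := adaptedCoord h x)
    (iddbar (relativePotential h Ω x)) x u v
  rw [Form.at₂, ← h2] at h3
  exact h3

lemma relativeRicci_isOneOne (hΩ : IsRelativelyKahler EB π Ω) : (relativeRicci h Ω).IsOneOne := by
  intro x u v
  rw [relativeRicci_at₂, relativeRicci_at₂, coordDeriv_smul (mem_adaptedSource h x),
    coordDeriv_smul (mem_adaptedSource h x), iddbar_oneOne (contDiffAt_relativePotential hΩ x)]

/-- The metric matrix of a fibre is the vertical block in adapted coordinates. The potential of ρ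
thus restricts to that of the fibre's Ricci form, and i∂∂̄ commutes with z ↦ (w, z). The comparison
is made at the centre of the chart, since ρ at y is defined by the chart at y. -/
lemma fibreForm_relativeRicci (hΩ : IsRelativelyKahler EB π Ω) (y : X) (u v : Fin m → ℂ) :
    (fibreForm h (relativeRicci h Ω) y).at₂ (fibrePoint h y) u v
      = (ricciForm (fibreForm h Ω y)).at₂ (fibrePoint h y) u v := by
  have hz := fibrePoint_mem h y
  have hc : ∀ u, coordDeriv h y y (tangentMapAt (E := Fin m → ℂ) (E' := EX) (fibreParam h y)
      (fibrePoint h y) u) = (0, u) := by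
    intro u
    have h1 := coordDeriv_paramDeriv (h := h) (x := y) (p := (basePoint h y, fibrePoint h y)) hz
      (0, u)
    rw [← tangentMapAt_slice (w := basePoint h y) hz] at h1
    have h2 : adaptedParam h y (basePoint h y, fibrePoint h y) = y := fibreParam_fibrePoint h y
    rw [h2] at h1
    exact h1
  rw [fibreForm, Form.pull_at₂, fibreParam_fibrePoint, relativeRicci_at₂, hc, hc]
  have h3 := iddbar_comp (E := Fin m → ℂ) (τ := fun z : Fin m → ℂ => (basePoint h y, z))
    (z := fibrePoint h y) (f := relativePotential h Ω y) (contDiffAt_relativePotential hΩ y)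
    (by fun_prop) u v
  rw [fderiv_prodMk_const, fderiv_prodMk_const] at h3
  refine h3.symm.trans ?_
  have h4 : relativePotential h Ω y ∘ (fun z : Fin m → ℂ => (basePoint h y, z))
      =ᶠ[nhds (fibrePoint h y)] fun z => -Real.log (metricMatrix (fibreForm h Ω y) z).det.re := by
    filter_upwards [(isOpen_fibreDomain h y).mem_nhds hz] with z hz
    simp only [Function.comp_apply, relativePotential]
    rw [hermMatrix_vertVec (p := (basePoint h y, z)) hz]
    rfl
  rw [Form.at₂, iddbar_congr h4]
  rfl

variable [T2Space X] [CompactSpace X] [MeasurableSpace X] [BorelSpace X] [T2Space B]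

lemma fibreTrace_relativeRicci (hΩ : IsRelativelyKahler EB π Ω) (y : X) :
    fibreTrace h Ω (relativeRicci h Ω) y = fibreScalarCurvature h Ω y := by
  rw [fibreTrace, fibreScalarCurvature, localScalarCurvature]
  congr 1
  funext u v
  exact fibreForm_relativeRicci hΩ y u v

lemma fibreTrace_self (hΩ : IsRelativelyKahler EB π Ω) (y : X) : fibreTrace h Ω Ω y = m := by
  have h1 := (hΩ.fibreForm (h := h) y).isUnit_det (fibrePoint_mem h y)
  rw [metricMatrix] at h1
  rw [fibreTrace, contraction, Matrix.nonsing_inv_mul _ h1]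
  simp

lemma fibreForm_sub_at₂ (η ζ : Form EX X 2) (y : X) (z u v : Fin m → ℂ) :
    (fibreForm h (η - ζ) y).at₂ z u v
      = (fibreForm h η y).at₂ z u v - (fibreForm h ζ y).at₂ z u v := rfl

/-- The difference of the relative Ricci form and `Ω`. -/
def ricciDefect (h : IsHolSubmersion EX EB m π) (Ω : Form EX X 2) : Form EX X 2 :=
  relativeRicci h Ω - Ω

lemma ricciDefect_at₂ (x : X) (u v : EX) :
    (ricciDefect h Ω).at₂ x u v = (relativeRicci h Ω).at₂ x u v - Ω.at₂ x u v := rfl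

lemma ricciDefect_isOneOne (hΩ : IsRelativelyKahler EB π Ω) : (ricciDefect h Ω).IsOneOne := by
  intro x u v
  rw [ricciDefect_at₂, ricciDefect_at₂, relativeRicci_isOneOne hΩ, hΩ.oneOne]

/-- Since ρ is defined point by point in varying charts, its smoothness is not evident. The class
hypothesis presents η as d of a smooth one-form, which yields both smoothness and closedness. -/
lemma ricciDefect_isClosed (hclass : InRelativeAnticanonicalClass h Ω) :
    (ricciDefect h Ω).IsClosed := by
  have : IsManifold 𝓘(ℝ, EX) ∞ X := isManifold_real
  obtain ⟨γ, hγ, hη⟩ := hclass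
  exact Form.isClosed_of_hasExtDeriv hγ hη

/-- A relatively cscK form in the relative anticanonical class is Kähler–Einstein on the fibres. -/
lemma fibreForm_ricciDefect (hΩ : IsRelativelyCscK h Ω)
    (hclass : InRelativeAnticanonicalClass h Ω) (y : X) (u v : Fin m → ℂ) :
    (fibreForm h (ricciDefect h Ω) y).at₂ (fibrePoint h y) u v = 0 := by
  have hK := hΩ.relKahler
  have hcl := ricciDefect_isClosed hclass
  have h11 := ricciDefect_isOneOne (h := h) hK
  obtain ⟨γ, hγ, hη⟩ := hclass
  obtain ⟨c, hc⟩ := hΩ.cscK (π y)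
  have htr : ∀ y', π y' = π y → fibreTrace h Ω (ricciDefect h Ω) y' = c - m := by
    intro y' hy'
    rw [← hc y' hy', ← fibreTrace_relativeRicci hK, ← fibreTrace_self (h := h) hK y']
    exact contraction_sub _ _ _ _
  -- η plays both roles here: closed (1,1)-form of constant trace, and exact form. The conclusion is
  -- that its fibrewise L²-norm is zero.
  have hInt := integral_fibrePairing_eq_zero hK hcl h11 htr hγ hη
  have hnn : ∀ y', 0 ≤ fibrePairing h Ω (ricciDefect h Ω) (ricciDefect h Ω) y' ∧
      (fibrePairing h Ω (ricciDefect h Ω) (ricciDefect h Ω) y' = 0 →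
        hermMatrix (stdVec m) ((fibreForm h (ricciDefect h Ω) y').at₂ (fibrePoint h y')) = 0) :=
    fun y' => trace_norm_nonneg ((hK.fibreForm (h := h) y').posDef (fibrePoint_mem h y')).inv
      (hermMatrix_isHermitian (Form.at₂_antisymm _ _) _)
  have h0 := eq_zero_of_integral_eq_zero hK (smoothOnFibre_fibrePairing hK hcl.1 hcl.1
    (π y)).continuousOn (fun y' _ => (hnn y').1) hInt rfl
  exact eq_zero_of_hermMatrix_eq_zero (Form.isRealBilin _ _)
    ((isClosedOneOneOn_sliceForm hcl h11 y (basePoint h y)).oneOne _ (fibrePoint_mem h y))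
    (span_stdVec m) ((hnn y).2 h0) u v

lemma ricciForm_fibreForm_eq (hΩ : IsRelativelyCscK h Ω)
    (hclass : InRelativeAnticanonicalClass h Ω) (y : X) (u v : Fin m → ℂ) :
    (ricciForm (fibreForm h Ω y)).at₂ (fibrePoint h y) u v
      = (fibreForm h Ω y).at₂ (fibrePoint h y) u v := by
  have h1 := fibreForm_ricciDefect hΩ hclass y u v
  rw [ricciDefect, fibreForm_sub_at₂, fibreForm_relativeRicci hΩ.relKahler] at h1
  exact sub_eq_zero.1 h1

/-- A function which is constant on a fibre and has integral zero vanishes there. -/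
lemma eq_zero_of_const_of_integral (hΩ : IsRelativelyKahler EB π Ω) {b : B} {f : X → ℝ}
    (hf : ∀ x y, π x = b → π y = b → f x = f y) (hInt : ∫ y, f y ∂(fibreMeasure h Ω b) = 0) {x : X}
    (hx : π x = b) : f x = 0 := by
  have hcont : ContinuousOn f (π ⁻¹' {b}) :=
    (continuousOn_const (c := f x)).congr fun y hy => hf y x hy hx
  rcases le_total 0 (f x) with h0 | h0
  · exact eq_zero_of_integral_eq_zero hΩ hcont (fun y hy => by rwa [hf y x hy hx]) hInt hx
  · have := eq_zero_of_integral_eq_zero hΩ (f := fun y => -f y) hcont.neg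
      (fun y hy => by rw [hf y x hy hx]; linarith) (by rw [integral_neg, hInt, neg_zero]) hx
    simpa using this

/-- Holomorphy potentials of integral zero on Kähler–Einstein fibres are eigenfunctions of the
Laplacian. -/
lemma IsFibrePotential.verticalLaplacian_eq (hΩ : IsRelativelyCscK h Ω)
    (hclass : InRelativeAnticanonicalClass h Ω) {b : B} (hconn : IsConnected (π ⁻¹' {b}))
    {g : X → ℝ} (hg : IsFibrePotential h Ω b g) {x : X} (hx : π x = b) :
    verticalLaplacian h Ω g x = g x := by
  have hK := hΩ.relKahler
  have hΔ := smoothOnFibre_verticalLaplacian hK hg.1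
  have hD := hΔ.sub hg.1
  have h0 : ∀ y, π y = b → fibreDeriv h (fun y => verticalLaplacian h Ω g y - g y) y = 0 := by
    rintro y rfl
    have hz := fibrePoint_mem h y
    have h1 : (verticalLaplacian h Ω g ∘ fibreParam h y) =ᶠ[nhds (fibrePoint h y)]
        localLaplacian (fibreForm h Ω y) (g ∘ fibreParam h y) := by
      filter_upwards [(isOpen_fibreDomain h y).mem_nhds hz] with z hz
      exact verticalLaplacian_fibreParam Ω hg.1 hz
    have h2 := (hK.fibreForm (h := h) y).fderiv_localLaplacian (hg.1 y rfl) (hg.2.1 y rfl) hz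
      (ricciForm_fibreForm_eq hΩ hclass y)
    rw [← h1.fderiv_eq] at h2
    have h3 := fderiv_sub (hΔ.differentiableAt rfl hz) (hg.1.differentiableAt rfl hz)
    rw [h2, sub_self] at h3
    exact h3
  -- d(Δg) = dg only gives Δg = g + const on the connected fibre; the constant is zero because Δg
  -- and g both have integral zero.
  have hInt : ∫ y, (verticalLaplacian h Ω g y - g y) ∂(fibreMeasure h Ω b) = 0 := by
    rw [integral_sub (hΔ.integrable hK) (hg.1.integrable hK), integral_verticalLaplacian hK hg.1,
      hg.2.2, sub_zero]
  have := eq_zero_of_const_of_integral hK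
    (fun x y hx hy => eq_of_fibreDeriv_eq_zero hconn hD h0 hx hy) hInt hx
  linarith

end RelativeRicci

/-! ### Horizontal lifts: existence, uniqueness, complex linearity, coordinates. -/

section HorizontalLift

variable {EX EB X B : Type*}
  [NormedAddCommGroup EX] [NormedSpace ℂ EX] [FiniteDimensional ℂ EX]
  [NormedAddCommGroup EB] [NormedSpace ℂ EB] [FiniteDimensional ℂ EB]
  [TopologicalSpace X] [ChartedSpace EX X] [IsManifold 𝓘(ℂ, EX) ω X]
  [TopologicalSpace B] [ChartedSpace EB B] [IsManifold 𝓘(ℂ, EB) ω B]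
  {m : ℕ} {π : X → B} {h : IsHolSubmersion EX EB m π} {Ω : Form EX X 2}

lemma adaptedForm_oneOne {η : Form EX X 2} (h11 : η.IsOneOne) {x : X} {p : EB × (Fin m → ℂ)}
    (hp : p ∈ adaptedDomain h x) (u v : EB × (Fin m → ℂ)) :
    (adaptedForm h η x).at₂ p (Complex.I • u) (Complex.I • v) = (adaptedForm h η x).at₂ p u v := by
  rw [adaptedForm_at₂, adaptedForm_at₂, paramDeriv_smul hp, paramDeriv_smul hp, h11]

/-- The horizontal lift, in adapted coordinates, of a vector on the base. -/
def coordLift (h : IsHolSubmersion EX EB m π) (Ω : Form EX X 2) (x : X) (w : EB)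
    (p : EB × (Fin m → ℂ)) : EB × (Fin m → ℂ) :=
  (w, fun l => -∑ k, (hermMatrix (vertVec EB m) ((adaptedForm h Ω x).at₂ p))⁻¹ k l
    * hermCoeff ((adaptedForm h Ω x).at₂ p) (w, 0) (vertVec EB m k))

lemma eq_sum_vertVec (a : Fin m → ℂ) : ((0 : EB), a) = ∑ j, a j • vertVec EB m j := by
  refine Prod.ext ?_ ?_
  · simp [vertVec, Prod.fst_sum]
  · ext i
    simp [vertVec, Prod.snd_sum, stdVec, Finset.sum_apply, Pi.single_apply]

lemma isUnit_det_vertVec (hΩ : IsRelativelyKahler EB π Ω) {x : X} {p : EB × (Fin m → ℂ)}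
    (hp : p ∈ adaptedDomain h x) :
    IsUnit (hermMatrix (vertVec EB m) ((adaptedForm h Ω x).at₂ p)).det := by
  rw [hermMatrix_vertVec hp]
  exact (hΩ.sliceForm x p.1).isUnit_det hp

/-- The vertical correction in `coordLift` solves the linear system whose matrix is the vertical
block, so all hermitian coefficients against vertical vectors vanish; type (1,1) turns this into
vanishing of the real form. -/
lemma adaptedForm_coordLift (hΩ : IsRelativelyKahler EB π Ω) {x : X} {p : EB × (Fin m → ℂ)}
    (hp : p ∈ adaptedDomain h x) (w : EB) (v : Fin m → ℂ) :
    (adaptedForm h Ω x).at₂ p (coordLift h Ω x w p) (0, v) = 0 := by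
  set σ := (adaptedForm h Ω x).at₂ p with hσ
  have hb : IsRealBilin σ := Form.isRealBilin _ _
  have h11 : ∀ u v, σ (Complex.I • u) (Complex.I • v) = σ u v := adaptedForm_oneOne hΩ.oneOne hp
  set G := hermMatrix (vertVec EB m) σ with hG
  set c : Fin m → ℂ := fun k => hermCoeff σ (w, 0) (vertVec EB m k) with hc
  have hsplit : coordLift h Ω x w p = (w, 0)
      + ∑ l, (-∑ k, G⁻¹ k l * c k) • vertVec EB m l := by
    rw [← eq_sum_vertVec]
    refine Prod.ext ?_ ?_ <;> simp [coordLift, hG, hc, hσ]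
  have hk : ∀ k, hermCoeff σ (coordLift h Ω x w p) (vertVec EB m k) = 0 := by
    intro k
    rw [hsplit, hermCoeff_add_left hb, hermCoeff_sum_left hb]
    simp only [hermCoeff_smul_left hb]
    have h1 : ∀ l, hermCoeff σ (vertVec EB m l) (vertVec EB m k) = G l k := fun l => rfl
    simp only [h1, neg_mul, Finset.sum_neg_distrib, Finset.sum_mul]
    rw [Finset.sum_comm]
    have h2 : ∀ i, ∑ l, G⁻¹ i l * c i * G l k = c i * (G⁻¹ * G) i k := by
      intro i
      rw [Matrix.mul_apply, Finset.mul_sum]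
      exact Finset.sum_congr rfl fun l _ => by ring
    have hu : IsUnit G.det := isUnit_det_vertVec hΩ hp
    simp only [h2, Matrix.nonsing_inv_mul _ hu, Matrix.one_apply]
    simp [hc]
  have h3 : hermCoeff σ (coordLift h Ω x w p) (0, v) = 0 := by
    rw [eq_sum_vertVec, hermCoeff_sum_right hb]
    exact Finset.sum_eq_zero fun k _ => by rw [hermCoeff_smul_right hb, hk, mul_zero]
  rw [hermCoeff_of_oneOne hb h11] at h3
  have h4 := congrArg Complex.im h3
  simp at h4
  exact h4

lemma contDiffOn_coordLift (hΩ : IsRelativelyKahler EB π Ω) (x : X) (w : EB) :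
    ContDiffOn ℝ ∞ (coordLift h Ω x w) (adaptedDomain h x) := by
  have hs := contDiffOn_adaptedForm (h := h) hΩ.closed.1 x
  refine contDiffOn_const.prodMk (contDiffOn_pi.2 fun l => (ContDiffOn.sum fun k _ => ?_).neg)
  exact (contDiffOn_inv (fun i j => contDiffOn_hermCoeff hs _ _)
    (fun p hp => (isUnit_det_vertVec hΩ hp).ne_zero) k l).mul (contDiffOn_hermCoeff hs _ _)

lemma exists_paramDeriv_of_isVertical {x : X} {p : EB × (Fin m → ℂ)} (hp : p ∈ adaptedDomain h x)
    {v : EX} (hv : IsVertical (EB := EB) π (adaptedParam h x p) v) :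
    ∃ u : Fin m → ℂ, v = paramDeriv h x p (0, u) := by
  have h1 := paramDeriv_coordDeriv (adaptedParam_mem hp) v
  rw [adaptedCoord_adaptedParam hp] at h1
  rw [← h1, isVertical_paramDeriv_iff hp] at hv
  refine ⟨(coordDeriv h x (adaptedParam h x p) v).2, ?_⟩
  conv_lhs => rw [← h1]
  congr 1
  exact Prod.ext hv rfl

lemma isHorizontal_coordLift (hΩ : IsRelativelyKahler EB π Ω) {x : X} {p : EB × (Fin m → ℂ)}
    (hp : p ∈ adaptedDomain h x) (w : EB) :
    IsHorizontal EB π Ω (adaptedParam h x p) (paramDeriv h x p (coordLift h Ω x w p)) := by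
  intro v hv
  obtain ⟨u, rfl⟩ := exists_paramDeriv_of_isVertical hp hv
  rw [← adaptedForm_at₂, adaptedForm_coordLift hΩ hp]

lemma tangentMapAt_proj_smul (h : IsHolSubmersion EX EB m π) (y : X) (c : ℂ) (u : EX) :
    tangentMapAt (E := EX) (E' := EB) π y (c • u)
      = c • tangentMapAt (E := EX) (E' := EB) π y u :=
  tangentMapAt_smul (h y).contMDiffAt c u

/-- The difference d of two lifts is vertical, and so is i·d. Both lifts are orthogonal to i·d, so
Ω(d, i·d) = 0, and positivity on the fibres forces d = 0. -/
lemma eq_of_isHorizontal (h : IsHolSubmersion EX EB m π) (hΩ : IsRelativelyKahler EB π Ω) {y : X}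
    {u v : EX} (huv : tangentMapAt (E := EX) (E' := EB) π y u
      = tangentMapAt (E := EX) (E' := EB) π y v)
    (hu : IsHorizontal EB π Ω y u) (hv : IsHorizontal EB π Ω y v) : u = v := by
  by_contra hne
  have hd : IsVertical (EB := EB) π y (u - v) := by
    rw [IsVertical, map_sub, huv, sub_self]
  have hId : IsVertical (EB := EB) π y (Complex.I • (u - v)) := by
    rw [IsVertical, tangentMapAt_proj_smul h, hd, smul_zero]
  have h1 := hΩ.pos y (u - v) hd (sub_ne_zero.2 hne)
  have hb := Form.isRealBilin Ω y
  rw [sub_eq_add_neg u v, hb.add_left, hb.neg_left, ← sub_eq_add_neg u v, hu _ hId, hv _ hId] at h1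
  simp at h1

lemma horizontalLift_eq (h : IsHolSubmersion EX EB m π) (hΩ : IsRelativelyKahler EB π Ω) {y : X}
    {w : EB} {u : EX} (hw : tangentMapAt (E := EX) (E' := EB) π y u = w)
    (hu : IsHorizontal EB π Ω y u) : horizontalLift π Ω y w = u := by
  have h1 := Classical.epsilon_spec (p := fun u =>
    tangentMapAt (E := EX) (E' := EB) π y u = w ∧ IsHorizontal EB π Ω y u) ⟨u, hw, hu⟩
  exact eq_of_isHorizontal h hΩ (h1.1.trans hw.symm) h1.2 hu

/-- The horizontal lift in adapted coordinates. -/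
lemma horizontalLift_adaptedParam (hΩ : IsRelativelyKahler EB π Ω) {x : X}
    {p : EB × (Fin m → ℂ)} (hp : p ∈ adaptedDomain h x) (w : EB) :
    horizontalLift π Ω (adaptedParam h x p)
      (tangentMapAt (E := EB) (E' := EB) (h x).codChart.symm p.1 w)
      = paramDeriv h x p (coordLift h Ω x w p) :=
  horizontalLift_eq h hΩ (tangentMapAt_proj_paramDeriv hp _) (isHorizontal_coordLift hΩ hp w)

lemma exists_tangentMapAt_codChart_symm {x : X} {w : EB} (hw : w ∈ (h x).codChart.target) (v : EB) :
    ∃ u, tangentMapAt (E := EB) (E' := EB) (h x).codChart.symm w u = v :=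
  (LinearMap.injective_iff_surjective (f := (tangentMapAt (E := EB) (E' := EB)
    (h x).codChart.symm w : EB →ₗ[ℝ] EB))).1 (tangentMapAt_codChart_symm_injective hw) v

lemma horizontalLift_spec (h : IsHolSubmersion EX EB m π) (hΩ : IsRelativelyKahler EB π Ω) (y : X)
    (w : EB) : tangentMapAt (E := EX) (E' := EB) π y (horizontalLift π Ω y w) = w ∧
      IsHorizontal EB π Ω y (horizontalLift π Ω y w) := by
  have hp := adaptedCoord_mem (mem_adaptedSource h y)
  obtain ⟨u, rfl⟩ := exists_tangentMapAt_codChart_symm (fst_mem_codChart_target hp) w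
  have h1 := tangentMapAt_proj_paramDeriv hp (coordLift h Ω y u (adaptedCoord h y y))
  have h2 := isHorizontal_coordLift hΩ hp u
  rw [adaptedParam_adaptedCoord (mem_adaptedSource h y)] at h1 h2
  exact Classical.epsilon_spec (p := fun v => tangentMapAt (E := EX) (E' := EB) π y v
    = tangentMapAt (E := EB) (E' := EB) (h y).codChart.symm (adaptedCoord h y y).1 u
      ∧ IsHorizontal EB π Ω y v) ⟨_, h1, h2⟩

lemma horizontalLift_add (h : IsHolSubmersion EX EB m π) (hΩ : IsRelativelyKahler EB π Ω) (y : X)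
    (w w' : EB) : horizontalLift π Ω y (w + w')
      = horizontalLift π Ω y w + horizontalLift π Ω y w' := by
  obtain ⟨h1, h2⟩ := horizontalLift_spec h hΩ y w
  obtain ⟨h3, h4⟩ := horizontalLift_spec h hΩ y w'
  refine horizontalLift_eq h hΩ (by rw [map_add, h1, h3]) fun v hv => ?_
  rw [(Form.isRealBilin Ω y).add_left, h2 v hv, h4 v hv, add_zero]

/-- Since Ω is of type (1,1) and the vertical space is complex, the horizontal space is stable under
multiplication by i. -/
lemma horizontalLift_smul (h : IsHolSubmersion EX EB m π) (hΩ : IsRelativelyKahler EB π Ω) (y : X)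
    (c : ℂ) (w : EB) : horizontalLift π Ω y (c • w) = c • horizontalLift π Ω y w := by
  obtain ⟨h1, h2⟩ := horizontalLift_spec h hΩ y w
  refine horizontalLift_eq h hΩ (by rw [tangentMapAt_proj_smul h, h1]) fun v hv => ?_
  have hb := Form.isRealBilin Ω y
  have hIv : IsVertical (EB := EB) π y (Complex.I • v) := by
    rw [IsVertical, tangentMapAt_proj_smul h, hv, smul_zero]
  have hI : Ω.at₂ y (Complex.I • horizontalLift π Ω y w) v = 0 := by
    rw [← neg_eq_zero, ← hb.neg_right, ← neg_one_smul ℂ v, ← Complex.I_mul_I, mul_smul, hΩ.oneOne,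
      h2 _ hIv]
  have hc : c • horizontalLift π Ω y w = (c.re : ℂ) • horizontalLift π Ω y w
      + (c.im : ℂ) • (Complex.I • horizontalLift π Ω y w) := by
    rw [smul_smul, ← add_smul, Complex.re_add_im]
  rw [hc, hb.add_left, hb.smul_left, hb.smul_left, hI, h2 v hv]
  simp

end HorizontalLift

/-! ### The norm of a covector as the contraction of a rank one (1,1)-form. -/

section RankOne

variable {V : Type*} [AddCommGroup V] [Module ℂ V]

/-- Real linear functionals on a complex vector space. -/
structure IsRealLinear (a : V → ℝ) : Prop where
  add : ∀ u v, a (u + v) = a u + a v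
  smul : ∀ (r : ℝ) u, a ((r : ℂ) • u) = r * a u

/-- The positive `(1,1)`-form `i β ∧ β̄` attached to the `(1,0)`-part `β` of a covector. -/
def squareForm (a : V → ℝ) (u v : V) : ℝ :=
  2 * (a (Complex.I • u) * a v - a u * a (Complex.I • v))

/-- The `(1,0)`-part of (twice) a real covector. -/
def part10 (a : V → ℝ) (u : V) : ℂ := (a u : ℂ) - Complex.I * (a (Complex.I • u) : ℂ)

variable {a : V → ℝ}

lemma IsRealLinear.neg (ha : IsRealLinear a) (u : V) : a (-u) = -a u := by
  have := ha.smul (-1) u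
  simpa using this

lemma IsRealLinear.I_I (ha : IsRealLinear a) (u : V) : a (Complex.I • Complex.I • u) = -a u := by
  rw [smul_smul, Complex.I_mul_I, neg_one_smul, ha.neg]

lemma IsRealLinear.squareForm (ha : IsRealLinear a) : IsRealBilin (squareForm a) where
  add_left u v w := by
    simp only [FibrationGeometry.squareForm, smul_add, ha.add]; ring
  add_right u v w := by
    simp only [FibrationGeometry.squareForm, smul_add, ha.add]; ring
  smul_left r u v := by
    simp only [FibrationGeometry.squareForm, smul_comm Complex.I (r : ℂ), ha.smul]; ring
  smul_right r u v := by
    simp only [FibrationGeometry.squareForm, smul_comm Complex.I (r : ℂ), ha.smul]; ring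

lemma squareForm_antisymm (a : V → ℝ) (u v : V) : squareForm a v u = -squareForm a u v := by
  simp only [squareForm]; ring

/-- The factor 2 in `squareForm` is chosen so that the coefficients are exactly β_j times the
conjugate of β_k, which makes the contraction equal to the norm in `IsKahlerOn.bochner`. -/
lemma hermCoeff_squareForm (ha : IsRealLinear a) (u v : V) :
    hermCoeff (squareForm a) u v = part10 a u * star (part10 a v) := by
  simp only [hermCoeff, squareForm, part10, ha.I_I, star_sub, star_mul', Complex.star_def,
    Complex.conj_ofReal, Complex.conj_I]
  push_cast
  linear_combination ((a (Complex.I • u) : ℂ) * (a (Complex.I • v) : ℂ))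
    * Complex.I_sq

end RankOne

section LocalNorm

variable {m : ℕ} {O : Set (Fin m → ℂ)} {z : Fin m → ℂ} {θ : Form (Fin m → ℂ) (Fin m → ℂ) 2}

lemma contraction_squareForm {a : (Fin m → ℂ) → ℝ} (hθ : IsKahlerOn θ O) (hz : z ∈ O)
    (ha : IsRealLinear a) :
    (contraction (stdVec m) (θ.at₂ z) (squareForm a) : ℂ)
      = ∑ j, part10 a (stdVec m j)
        * ∑ k, (metricMatrix θ z)⁻¹ k j * star (part10 a (stdVec m k)) := by
  change ((((metricMatrix θ z)⁻¹ * hermMatrix (stdVec m) (squareForm a)).trace.re : ℝ) : ℂ) = _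
  rw [← trace_mul_re (hθ.posDef hz).isHermitian.inv
    (hermMatrix_isHermitian (squareForm_antisymm a) _), trace_mul_eq_sum, Finset.sum_comm]
  refine Finset.sum_congr rfl fun j _ => ?_
  rw [Finset.mul_sum]
  refine Finset.sum_congr rfl fun k _ => ?_
  have : hermMatrix (stdVec m) (squareForm a) j k
      = part10 a (stdVec m j) * star (part10 a (stdVec m k)) := hermCoeff_squareForm ha _ _
  rw [this]
  ring

lemma contraction_squareForm_nonneg {a : (Fin m → ℂ) → ℝ} (hθ : IsKahlerOn θ O) (hz : z ∈ O)
    (ha : IsRealLinear a) : 0 ≤ contraction (stdVec m) (θ.at₂ z) (squareForm a) ∧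
      (contraction (stdVec m) (θ.at₂ z) (squareForm a) = 0 → ∀ u, a u = 0) := by
  have hH := (hθ.posDef hz).inv
  set H := (metricMatrix θ z)⁻¹ with hHdef
  set β : Fin m → ℂ := fun j => part10 a (stdVec m j) with hβ
  have h1 : (contraction (stdVec m) (θ.at₂ z) (squareForm a) : ℂ) = star β ⬝ᵥ (H *ᵥ β) := by
    rw [contraction_squareForm hθ hz ha]
    simp only [dotProduct, Matrix.mulVec, Pi.star_apply, Finset.mul_sum]
    rw [Finset.sum_comm]
    exact Finset.sum_congr rfl fun k _ => Finset.sum_congr rfl fun j _ => by ring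
  have h2 : contraction (stdVec m) (θ.at₂ z) (squareForm a) = (star β ⬝ᵥ (H *ᵥ β)).re := by
    rw [← h1, Complex.ofReal_re]
  refine ⟨?_, fun h0 => ?_⟩
  · rw [h2]
    exact hH.posSemidef.re_dotProduct_nonneg β
  · have hβ0 : β = 0 := by
      by_contra hne
      have := hH.re_dotProduct_pos hne
      rw [RCLike.re_to_complex, ← h2, h0] at this
      exact lt_irrefl _ this
    have hj : ∀ j, a (stdVec m j) = 0 ∧ a (Complex.I • stdVec m j) = 0 := by
      intro j
      have h3 : part10 a (stdVec m j) = 0 := congrFun hβ0 j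
      have hr := congrArg Complex.re h3
      have hi := congrArg Complex.im h3
      simp [part10] at hr hi
      exact ⟨hr, hi⟩
    intro u
    have hu : u = ∑ j, u j • stdVec m j := (stdVec_sum u)
    have hsum : ∀ (s : Finset (Fin m)) (f : Fin m → Fin m → ℂ),
        a (∑ j ∈ s, f j) = ∑ j ∈ s, a (f j) := by
      intro s f
      induction s using Finset.induction_on with
      | empty => simpa using ha.smul 0 0
      | insert i s hi ih => rw [Finset.sum_insert hi, Finset.sum_insert hi, ha.add, ih]
    rw [hu, hsum]
    refine Finset.sum_eq_zero fun j _ => ?_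
    have hc : u j • stdVec m j = ((u j).re : ℂ) • stdVec m j
        + ((u j).im : ℂ) • (Complex.I • stdVec m j) := by
      rw [smul_smul, ← add_smul, Complex.re_add_im]
    rw [hc, ha.add, ha.smul, ha.smul, (hj j).1, (hj j).2]
    simp

/-- On a Kähler–Einstein manifold with `Ric = θ`, the squared norm `f` of a holomorphic closed
`(1,0)`-form satisfies `Δ f ≤ - f`. -/
lemma IsKahlerOn.localLaplacian_normSq_le (h : IsKahlerOn θ O) {β : Fin m → (Fin m → ℂ) → ℂ}
    (hβ : ∀ k, ContDiffOn ℝ ∞ (β k) O) (hol : ∀ j k, ∀ y ∈ O, wirt Complex.I k (β j) y = 0)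
    (hcl : ∀ j k, ∀ y ∈ O, wirt (-Complex.I) k (β j) y = wirt (-Complex.I) j (β k) y) (hz : z ∈ O)
    (hric : ∀ u v, (ricciForm θ).at₂ z u v = θ.at₂ z u v) {f : (Fin m → ℂ) → ℝ}
    (hf : ∀ y ∈ O, (f y : ℂ) = ∑ j, β j y * raise θ (fun k y => star (β k y)) j y) :
    ContDiffOn ℝ ∞ f O ∧ localLaplacian θ f z ≤ -f z := by
  have hO := h.isOpen
  have hs : ContDiffOn ℝ ∞ (fun y => ∑ j, β j y * raise θ (fun k y => star (β k y)) j y) O :=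
    ContDiffOn.sum fun j _ => (hβ j).mul (h.contDiffOn_raise (fun k => contDiffOn_star (hβ k)) j)
  have hfs : ContDiffOn ℝ ∞ f O := by
    refine (Complex.reCLM.contDiff.comp_contDiffOn hs).congr fun y hy => ?_
    rw [Function.comp_apply, ← hf y hy]
    rfl
  refine ⟨hfs, ?_⟩
  have h1 := h.bochner hβ hol hcl hz hric
  rw [← hf z hz, Complex.ofReal_re] at h1
  have h2 := congrArg Complex.re (h.localLaplacian_eq hfs hz)
  rw [Complex.ofReal_re, Complex.neg_re] at h2
  rw [h2, neg_le_neg_iff]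
  refine h1.trans (le_of_eq ?_)
  congr 1
  refine Finset.sum_congr rfl fun k _ => Finset.sum_congr rfl fun l _ => ?_
  congr 1
  refine wirt_congr_of_eqOn hO hz fun y hy => ?_
  exact wirt_congr_of_eqOn hO hy fun q hq => (hf q hq).symm

end LocalNorm

/-! ### A closed (1,1)-form that vanishes vertically yields holomorphic one-forms on slices. -/

section MixedLocal

variable {EB : Type*} [NormedAddCommGroup EB] [NormedSpace ℂ EB] {m : ℕ}
  {D : Set (EB × (Fin m → ℂ))} {σ : Form (EB × (Fin m → ℂ)) (EB × (Fin m → ℂ)) 2}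

/-- The restriction to a slice of the covector obtained by inserting the vector `(w, 0)`. -/
def mixedCovector (σ : Form (EB × (Fin m → ℂ)) (EB × (Fin m → ℂ)) 2) (w₀ w : EB)
    (z v : Fin m → ℂ) : ℝ :=
  σ.at₂ (w₀, z) (w, 0) (0, v)

lemma isRealLinear_mixedCovector (w₀ w : EB) (z : Fin m → ℂ) :
    IsRealLinear (mixedCovector σ w₀ w z) where
  add u v := by
    have := (σ.isRealBilin (w₀, z)).add_right (w, 0) (0, u) (0, v)
    simpa [mixedCovector] using this
  smul r u := by
    have := (σ.isRealBilin (w₀, z)).smul_right r (w, 0) (0, u)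
    simpa [mixedCovector] using this

variable (hD : IsOpen D) (hs : ContDiffOn ℝ ∞ σ D) (hcl : ∀ p ∈ D, extDeriv σ p = 0)
  (h11 : ∀ p ∈ D, ∀ u v, σ.at₂ p (Complex.I • u) (Complex.I • v) = σ.at₂ p u v)
  (hvert : ∀ p ∈ D, ∀ u v : Fin m → ℂ, σ.at₂ p (0, u) (0, v) = 0)

include hs in
lemma contDiffOn_mixedCovector (w₀ w : EB) (v : Fin m → ℂ) :
    ContDiffOn ℝ ∞ (fun z => mixedCovector σ w₀ w z v) {z | (w₀, z) ∈ D} :=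
  (contDiffOn_form_apply hs ![(w, 0), (0, v)]).comp
    (by fun_prop : ContDiff ℝ ∞ fun z : Fin m → ℂ => (w₀, z)).contDiffOn fun _ hz => hz

include hD hs hcl hvert in
-- Evaluate dσ = 0 on (w, 0), (0, u), (0, v). The derivative of σ on the two vertical vectors drops
-- out since σ vanishes there, and what is left says that the one-form σ((w, 0), ·) is closed on the
-- slice.
lemma fderiv_mixedCovector_symm {w₀ : EB} {z : Fin m → ℂ} (hz : (w₀, z) ∈ D) (w : EB)
    (u v : Fin m → ℂ) :
    fderiv ℝ (fun z => mixedCovector σ w₀ w z v) z u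
      = fderiv ℝ (fun z => mixedCovector σ w₀ w z u) z v := by
  have hd : DifferentiableAt ℝ σ (w₀, z) := ContDiffOn.differentiableAt_of_isOpen hs hD hz
  have h1 := extDeriv_two_apply hd (w, 0) ((0 : EB), u) ((0 : EB), v)
  rw [hcl _ hz] at h1
  have h2 : fderiv ℝ (fun y => σ.at₂ y ((0 : EB), u) ((0 : EB), v)) (w₀, z) = 0 := by
    have : (fun y => σ.at₂ y ((0 : EB), u) ((0 : EB), v)) =ᶠ[nhds (w₀, z)] fun _ => 0 := by
      filter_upwards [hD.mem_nhds hz] with p hp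
      exact hvert p hp u v
    rw [this.fderiv_eq]
    simp
  have h3 : ∀ a b : Fin m → ℂ, fderiv ℝ (fun z => mixedCovector σ w₀ w z a) z b
      = fderiv ℝ (fun y => σ.at₂ y (w, 0) ((0 : EB), a)) (w₀, z) (0, b) := by
    intro a b
    have hda : DifferentiableAt ℝ (fun y => σ.at₂ y (w, 0) ((0 : EB), a)) (w₀, z) :=
      ContDiffOn.differentiableAt_of_isOpen (contDiffOn_form_apply hs _) hD hz
    have h4 := fderiv_comp z (f := fun z : Fin m → ℂ => (w₀, z)) hda (by fun_prop)
    have h5 := congrArg (fun L => L b) h4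
    simp only [ContinuousLinearMap.coe_comp, Function.comp_apply, fderiv_prodMk_const] at h5
    exact h5
  rw [h3, h3]
  rw [h2] at h1
  change (0 : ℝ) = (0 : ℝ) - _ + _ at h1
  linarith

include h11 in
lemma mixedCovector_I {w₀ : EB} {z : Fin m → ℂ} (hz : (w₀, z) ∈ D) (w : EB) (v : Fin m → ℂ) :
    mixedCovector σ w₀ (Complex.I • w) z v = -mixedCovector σ w₀ w z (Complex.I • v) := by
  have hb := σ.isRealBilin (w₀, z)
  have h1 := h11 _ hz (w, 0) (Complex.I • ((0 : EB), v))
  rw [smul_smul, Complex.I_mul_I, neg_one_smul, hb.neg_right] at h1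
  simp only [Prod.smul_mk, smul_zero] at h1
  rw [mixedCovector, mixedCovector, ← h1, neg_neg]

include hD hs hcl h11 hvert in
-- Composing the one-form with the complex structure amounts, up to sign, to replacing w by iw, so
-- this one-form is closed for the same reason.
lemma fderiv_mixedCovector_symm_I {w₀ : EB} {z : Fin m → ℂ} (hz : (w₀, z) ∈ D) (w : EB)
    (u v : Fin m → ℂ) :
    fderiv ℝ (fun z => mixedCovector σ w₀ w z (Complex.I • v)) z u
      = fderiv ℝ (fun z => mixedCovector σ w₀ w z (Complex.I • u)) z v := by
  have hO : IsOpen {z : Fin m → ℂ | (w₀, z) ∈ D} := hD.preimage (by fun_prop)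
  have h1 : ∀ a, fderiv ℝ (fun z => mixedCovector σ w₀ w z (Complex.I • a)) z
      = -fderiv ℝ (fun z => mixedCovector σ w₀ (Complex.I • w) z a) z := by
    intro a
    rw [← fderiv_fun_neg]
    refine Filter.EventuallyEq.fderiv_eq ?_
    filter_upwards [hO.mem_nhds hz] with q hq
    rw [mixedCovector_I h11 hq, neg_neg]
  rw [h1, h1]
  simp only [_root_.neg_apply]
  rw [fderiv_mixedCovector_symm hD hs hcl hvert hz]

/-- The coefficients of the `(1,0)`-form on a slice obtained by inserting `(w, 0)`. -/
def mixedCoeff (σ : Form (EB × (Fin m → ℂ)) (EB × (Fin m → ℂ)) 2) (w₀ w : EB) (j : Fin m)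
    (z : Fin m → ℂ) : ℂ :=
  part10 (mixedCovector σ w₀ w z) (stdVec m j)

include hs in
lemma contDiffOn_mixedCoeff (w₀ w : EB) (j : Fin m) :
    ContDiffOn ℝ ∞ (mixedCoeff σ w₀ w j) {z | (w₀, z) ∈ D} :=
  (contDiffOn_ofReal (contDiffOn_mixedCovector hs w₀ w _)).sub
    (contDiffOn_const.mul (contDiffOn_ofReal (contDiffOn_mixedCovector hs w₀ w _)))

include hD hs hcl h11 hvert in
-- If a and a∘J are both closed, so is the (1,0)-form a - i a∘J. The (1,1)-part of this closedness
-- is holomorphy and the (2,0)-part is the symmetry of the ∂-derivatives.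
lemma wirt_mixedCoeff {w₀ : EB} {z : Fin m → ℂ} (hz : (w₀, z) ∈ D) (w : EB) (j k : Fin m) :
    wirt Complex.I k (mixedCoeff σ w₀ w j) z = 0 ∧
      wirt (-Complex.I) k (mixedCoeff σ w₀ w j) z
        = wirt (-Complex.I) j (mixedCoeff σ w₀ w k) z := by
  have hO : IsOpen {z : Fin m → ℂ | (w₀, z) ∈ D} := hD.preimage (by fun_prop)
  set A : (Fin m → ℂ) → (Fin m → ℂ) → ℝ := fun v z => mixedCovector σ w₀ w z v with hA
  have hAd : ∀ v, DifferentiableAt ℝ (A v) z := fun v =>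
    ContDiffOn.differentiableAt_of_isOpen (contDiffOn_mixedCovector hs w₀ w v) hO hz
  have hAc : ∀ v, DifferentiableAt ℝ (fun z => ((A v z : ℝ) : ℂ)) z := fun v =>
    Complex.ofRealCLM.differentiableAt.comp z (hAd v)
  have hsym : ∀ u v, fderiv ℝ (A v) z u = fderiv ℝ (A u) z v :=
    fun u v => fderiv_mixedCovector_symm hD hs hcl hvert hz w u v
  have hsymI : ∀ u v, fderiv ℝ (A (Complex.I • v)) z u = fderiv ℝ (A (Complex.I • u)) z v :=
    fun u v => fderiv_mixedCovector_symm_I hD hs hcl h11 hvert hz w u v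
  have hII : ∀ u v, fderiv ℝ (A (Complex.I • Complex.I • v)) z u = -fderiv ℝ (A v) z u := by
    intro u v
    have : A (Complex.I • Complex.I • v) = fun z => -A v z := by
      funext q
      exact (isRealLinear_mixedCovector w₀ w q).I_I v
    rw [this, fderiv_fun_neg, _root_.neg_apply]
  have hder : ∀ i u, fderiv ℝ (mixedCoeff σ w₀ w i) z u
      = (fderiv ℝ (A (stdVec m i)) z u : ℂ)
        - Complex.I * (fderiv ℝ (A (Complex.I • stdVec m i)) z u : ℂ) := by
    intro i u
    have h1 : mixedCoeff σ w₀ w i = fun z => ((A (stdVec m i) z : ℝ) : ℂ)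
        - Complex.I * ((A (Complex.I • stdVec m i) z : ℝ) : ℂ) := rfl
    rw [h1, fderiv_fun_sub (hAc _) ((hAc _).const_mul _), fderiv_const_mul (hAc _)]
    simp only [_root_.sub_apply, _root_.smul_apply, smul_eq_mul]
    rw [fderiv_ofReal (hAd _), fderiv_ofReal (hAd _)]
  have hP : ∀ i l, fderiv ℝ (A (stdVec m i)) z (Complex.I • stdVec m l)
      = fderiv ℝ (A (Complex.I • stdVec m i)) z (stdVec m l) := fun i l => by
    rw [hsym, hsymI]
  have hQ : ∀ i l, fderiv ℝ (A (Complex.I • stdVec m i)) z (Complex.I • stdVec m l)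
      = -fderiv ℝ (A (stdVec m i)) z (stdVec m l) := fun i l => by
    rw [hsymI, hII, hsym]
  constructor
  · simp only [wirt, hder, hP, hQ]
    push_cast
    linear_combination (fderiv ℝ (A (stdVec m j)) z (stdVec m k) : ℂ) / 2 * Complex.I_sq
  · simp only [wirt, hder, hP, hQ]
    rw [hsym (stdVec m k) (stdVec m j), hsymI (stdVec m k) (stdVec m j)]

end MixedLocal

/-! ### Vanishing of the mixed part of ρ - Ω. -/

section MixedPart

variable {EX EB X B : Type*}
  [NormedAddCommGroup EX] [NormedSpace ℂ EX] [FiniteDimensional ℂ EX]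
  [NormedAddCommGroup EB] [NormedSpace ℂ EB] [FiniteDimensional ℂ EB]
  [TopologicalSpace X] [ChartedSpace EX X] [IsManifold 𝓘(ℂ, EX) ω X]
  [TopologicalSpace B] [ChartedSpace EB B] [IsManifold 𝓘(ℂ, EB) ω B]
  {m : ℕ} {π : X → B} {h : IsHolSubmersion EX EB m π} {Ω : Form EX X 2}

/-- The covector on the fibre through `y` obtained by inserting the horizontal lift of `w`. -/
def liftCovector (h : IsHolSubmersion EX EB m π) (Ω η : Form EX X 2) (w : EB) (y : X)
    (u : Fin m → ℂ) : ℝ :=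
  η.at₂ y (horizontalLift π Ω y w)
    (tangentMapAt (E := Fin m → ℂ) (E' := EX) (fibreParam h y) (fibrePoint h y) u)

/-- The squared norm of `liftCovector`. -/
def mixedNorm (h : IsHolSubmersion EX EB m π) (Ω η : Form EX X 2) (w : EB) (y : X) : ℝ :=
  contraction (stdVec m) ((fibreForm h Ω y).at₂ (fibrePoint h y))
    (squareForm (liftCovector h Ω η w y))

/-- `η` vanishes on pairs of vertical vectors. -/
def VanishesVertically (EB : Type*) [NormedAddCommGroup EB] [NormedSpace ℂ EB] {B : Type*}
    [TopologicalSpace B] [ChartedSpace EB B] (π : X → B) (η : Form EX X 2) : Prop :=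
  ∀ y u v, IsVertical (EB := EB) π y u → IsVertical (EB := EB) π y v → η.at₂ y u v = 0

lemma isRealLinear_liftCovector (η : Form EX X 2) (w : EB) (y : X) :
    IsRealLinear (liftCovector h Ω η w y) where
  add u v := by
    rw [liftCovector, map_add, (η.isRealBilin y).add_right]
    rfl
  smul r u := by
    have h1 : tangentMapAt (E := Fin m → ℂ) (E' := EX) (fibreParam h y) (fibrePoint h y)
        ((r : ℂ) • u) = (r : ℂ) • tangentMapAt (E := Fin m → ℂ) (E' := EX) (fibreParam h y)
          (fibrePoint h y) u :=
      tangentMapAt_smul (contMDiffAt_slice (fibrePoint_mem h y)) _ _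
    rw [liftCovector, h1, (η.isRealBilin y).smul_right]
    rfl

lemma VanishesVertically.adaptedForm {η : Form EX X 2} (hη : VanishesVertically EB π η) {x : X}
    {p : EB × (Fin m → ℂ)} (hp : p ∈ adaptedDomain h x) (u v : Fin m → ℂ) :
    (adaptedForm h η x).at₂ p (0, u) (0, v) = 0 := by
  rw [adaptedForm_at₂]
  exact hη _ _ _ ((isVertical_paramDeriv_iff hp _).2 rfl) ((isVertical_paramDeriv_iff hp _).2 rfl)

/-- The horizontal lift differs from the coordinate vector (w', 0) by a vertical vector, to which η
is blind. The globally defined covector is therefore the coordinate one of the preceding section,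
for which holomorphy is known. -/
lemma liftCovector_fibreParam (hΩ : IsRelativelyKahler EB π Ω) {η : Form EX X 2}
    (hη : VanishesVertically EB π η) {x : X} {z : Fin m → ℂ} (hz : z ∈ fibreDomain h x) {w w' : EB}
    (hw : tangentMapAt (E := EB) (E' := EB) (h x).codChart.symm (basePoint h x) w' = w)
    (u : Fin m → ℂ) :
    liftCovector h Ω η w (fibreParam h x z) u
      = mixedCovector (adaptedForm h η x) (basePoint h x) w' z
        (fderiv ℝ (transition h (fibreParam h x z) (basePoint h (fibreParam h x z)) x)
          (fibrePoint h (fibreParam h x z)) u) := by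
  set y := fibreParam h x z with hy
  have hys : y ∈ adaptedSource h x := fibreParam_mem_adaptedSource hz
  have hwc := codChart_basePoint_of_proj_eq (h := h) (y := y) (proj_fibreParam hz)
  have htd := fibrePoint_mem_transitionDomain hys
  have ht : transition h y (basePoint h y) x (fibrePoint h y) = z := by
    rw [transition_fibrePoint, hy, adaptedCoord_fibreParam hz]
  set u' := fderiv ℝ (transition h y (basePoint h y) x) (fibrePoint h y) u
  have h1 := tangentMapAt_slice_transition hwc htd u
  rw [ht, tangentMapAt_slice (w := basePoint h x) hz] at h1
  have h2 := horizontalLift_adaptedParam hΩ (p := (basePoint h x, z)) hz w'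
  have h3 : (tangentMapAt (E := EB) (E' := EB) (h x).codChart.symm (basePoint h x, z).1 w') = w := hw
  rw [h3] at h2
  have h4 : coordLift h Ω x w' (basePoint h x, z)
      = (w', 0) + (0, (coordLift h Ω x w' (basePoint h x, z)).2) := by
    refine Prod.ext ?_ ?_ <;> simp [coordLift]
  have h5 : liftCovector h Ω η w y u = (adaptedForm h η x).at₂ (basePoint h x, z)
      (coordLift h Ω x w' (basePoint h x, z)) (0, u') := by
    rw [adaptedForm_at₂, ← h2, liftCovector, fibreParam_eq_slice h y, h1]
    rfl
  rw [h5, h4, (Form.isRealBilin _ _).add_left, hη.adaptedForm (p := (basePoint h x, z)) hz,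
    add_zero]
  rfl

lemma mixedNorm_fibreParam (hΩ : IsRelativelyKahler EB π Ω) {η : Form EX X 2}
    (hη : VanishesVertically EB π η) {x : X} {z : Fin m → ℂ} (hz : z ∈ fibreDomain h x) {w w' : EB}
    (hw : tangentMapAt (E := EB) (E' := EB) (h x).codChart.symm (basePoint h x) w' = w) :
    mixedNorm h Ω η w (fibreParam h x z)
      = contraction (stdVec m) ((fibreForm h Ω x).at₂ z)
        (squareForm (mixedCovector (adaptedForm h η x) (basePoint h x) w' z)) := by
  have hys := fibreParam_mem_adaptedSource hz
  have hwc := codChart_basePoint_of_proj_eq (h := h) (proj_fibreParam hz)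
  have htd := fibrePoint_mem_transitionDomain hys
  have ht := transition_fibrePoint (h := h) (fibreParam h x z) x
  rw [adaptedCoord_fibreParam hz] at ht
  have := contraction_transition hwc htd Ω
    (isRealLinear_mixedCovector (σ := adaptedForm h η x) (basePoint h x) w' z).squareForm
    (σ := squareForm (liftCovector h Ω η w (fibreParam h x z))) (by
      intro u v
      simp only [squareForm, liftCovector_fibreParam hΩ hη hz hw, fderiv_transition_smul htd])
  rw [ht] at this
  exact this

lemma mixedNorm_laplacian (hΩ : IsRelativelyKahler EB π Ω) {η : Form EX X 2}
    (hη : VanishesVertically EB π η) (hcl : η.IsClosed) (h11 : η.IsOneOne)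
    (hric : ∀ y u v, (ricciForm (fibreForm h Ω y)).at₂ (fibrePoint h y) u v
      = (fibreForm h Ω y).at₂ (fibrePoint h y) u v) (b : B) (w : EB) :
    SmoothOnFibre h b (mixedNorm h Ω η w) ∧
      ∀ x, π x = b → verticalLaplacian h Ω (mixedNorm h Ω η w) x ≤ -mixedNorm h Ω η w x := by
  have key : ∀ x, ContDiffOn ℝ ∞ (mixedNorm h Ω η w ∘ fibreParam h x) (fibreDomain h x) ∧
      localLaplacian (fibreForm h Ω x) (mixedNorm h Ω η w ∘ fibreParam h x) (fibrePoint h x)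
        ≤ -(mixedNorm h Ω η w ∘ fibreParam h x) (fibrePoint h x) := by
    intro x
    have hb : basePoint h x ∈ (h x).codChart.target :=
      fst_mem_codChart_target (adaptedCoord_mem (mem_adaptedSource h x))
    obtain ⟨w', hw'⟩ := exists_tangentMapAt_codChart_symm hb w
    have hD := isOpen_adaptedDomain h x
    have hs := contDiffOn_adaptedForm (h := h) hcl.1 x
    have hcl' : ∀ p ∈ adaptedDomain h x, extDeriv (adaptedForm h η x) p = 0 := fun p hp => by
      rw [extDeriv_adaptedForm hcl.1 hcl.2 hp]
      rfl
    have hwirt := fun (z : Fin m → ℂ) (hz : (basePoint h x, z) ∈ adaptedDomain h x) j k =>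
      wirt_mixedCoeff hD hs hcl' (fun p hp => adaptedForm_oneOne h11 hp)
        (fun p hp => hη.adaptedForm hp) hz w' j k
    refine (hΩ.fibreForm (h := h) x).localLaplacian_normSq_le
      (β := mixedCoeff (adaptedForm h η x) (basePoint h x) w')
      (fun k => contDiffOn_mixedCoeff hs _ _ k) (fun j k y hy => (hwirt y hy j k).1)
      (fun j k y hy => (hwirt y hy j k).2) (fibrePoint_mem h x) (hric x) fun z hz => ?_
    rw [Function.comp_apply, mixedNorm_fibreParam hΩ hη hz hw',
      contraction_squareForm (hΩ.fibreForm (h := h) x) hz (isRealLinear_mixedCovector _ _ _)]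
    rfl
  refine ⟨fun x _ => (key x).1, fun x _ => ?_⟩
  have := (key x).2
  rw [Function.comp_apply, fibreParam_fibrePoint] at this
  exact this

lemma isVertical_sub_horizontalLift (h : IsHolSubmersion EX EB m π)
    (hΩ : IsRelativelyKahler EB π Ω) (y : X) (u : EX) :
    IsVertical (EB := EB) π y
      (u - horizontalLift π Ω y (tangentMapAt (E := EX) (E' := EB) π y u)) := by
  rw [IsVertical, map_sub, (horizontalLift_spec h hΩ y _).1, sub_self]

lemma exists_tangentMapAt_fibreParam (h : IsHolSubmersion EX EB m π) {y : X} {v : EX}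
    (hv : IsVertical (EB := EB) π y v) :
    ∃ u, v = tangentMapAt (E := Fin m → ℂ) (E' := EX) (fibreParam h y) (fibrePoint h y) u := by
  have hp := adaptedCoord_mem (mem_adaptedSource h y)
  have h1 : IsVertical (EB := EB) π (adaptedParam h y (adaptedCoord h y y)) v := by
    rwa [adaptedParam_adaptedCoord (mem_adaptedSource h y)]
  obtain ⟨u, hu⟩ := exists_paramDeriv_of_isVertical hp h1
  exact ⟨u, hu.trans (tangentMapAt_slice (fibrePoint_mem h y) u).symm⟩

variable [T2Space X] [CompactSpace X] [MeasurableSpace X] [BorelSpace X] [T2Space B]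

lemma ricciDefect_vanishesVertically (hΩ : IsRelativelyCscK h Ω)
    (hclass : InRelativeAnticanonicalClass h Ω) :
    VanishesVertically EB π (ricciDefect h Ω) := by
  intro y u v hu hv
  obtain ⟨u', rfl⟩ := exists_tangentMapAt_fibreParam h hu
  obtain ⟨v', rfl⟩ := exists_tangentMapAt_fibreParam h hv
  have := fibreForm_ricciDefect hΩ hclass y u' v'
  rw [fibreForm, Form.pull_at₂, fibreParam_fibrePoint] at this
  exact this

/-- The relative Ricci form and `Ω` agree on all pairs of vectors one of which is vertical. -/
lemma ricciDefect_eq_zero_of_isVertical (hΩ : IsRelativelyCscK h Ω)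
    (hclass : InRelativeAnticanonicalClass h Ω) (y : X) (u v : EX)
    (hv : IsVertical (EB := EB) π y v) : (ricciDefect h Ω).at₂ y u v = 0 := by
  have hK := hΩ.relKahler
  have hη := ricciDefect_vanishesVertically hΩ hclass
  set w := tangentMapAt (E := EX) (E' := EB) π y u with hw
  obtain ⟨hs, hΔ⟩ := mixedNorm_laplacian hK hη (ricciDefect_isClosed hclass)
    (ricciDefect_isOneOne hK) (ricciForm_fibreForm_eq hΩ hclass) (π y) w
  set N := mixedNorm h Ω (ricciDefect h Ω) w with hN
  have hnn : ∀ x, 0 ≤ N x ∧ (N x = 0 → ∀ u, liftCovector h Ω (ricciDefect h Ω) w x u = 0) :=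
    fun x => contraction_squareForm_nonneg (hK.fibreForm (h := h) x) (fibrePoint_mem h x)
      (isRealLinear_liftCovector _ _ _)
  -- Integrate N ≤ -ΔN: the right-hand side has integral zero, and N is nonnegative.
  have hInt : ∫ x, N x ∂(fibreMeasure h Ω (π y)) = 0 := by
    apply le_antisymm
    · have h1 : ∫ x, N x ∂(fibreMeasure h Ω (π y))
          ≤ ∫ x, -verticalLaplacian h Ω N x ∂(fibreMeasure h Ω (π y)) := by
        refine integral_mono_ae (hs.integrable hK)
          ((smoothOnFibre_verticalLaplacian hK hs).integrable hK).neg ?_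
        filter_upwards [ae_mem_fibre h Ω (π y)] with x hx
        linarith [hΔ x hx]
      rwa [integral_neg, integral_verticalLaplacian hK hs, neg_zero] at h1
    · exact integral_nonneg fun x => (hnn x).1
  have h0 := eq_zero_of_integral_eq_zero hK hs.continuousOn (fun x _ => (hnn x).1) hInt rfl
  obtain ⟨v', rfl⟩ := exists_tangentMapAt_fibreParam h hv
  have h1 := (hnn y).2 h0 v'
  rw [liftCovector] at h1
  have hsplit : u = horizontalLift π Ω y w + (u - horizontalLift π Ω y w) := by abel
  rw [hsplit, (Form.isRealBilin _ _).add_left, h1,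
    hη y _ _ (isVertical_sub_horizontalLift h hK y u) hv, add_zero]

end MixedPart

/-! ### Cartan's formula for two-forms on vector fields. -/

section VectorFields

variable {E₀ E : Type*} [NormedAddCommGroup E₀] [NormedSpace ℝ E₀]
  [NormedAddCommGroup E] [NormedSpace ℝ E]

/-- σ(u, v) is the value on the standard basis of ℝ² of the pullback of σ along the linear map with
columns u and v, which reduces the claim to smoothness of pullbacks. -/
lemma contDiffOn_form_apply_fields {O : Set E₀} {σ : E₀ → E [⋀^Fin 2]→L[ℝ] ℝ} {u v : E₀ → E}
    (hσ : ContDiffOn ℝ ∞ σ O) (hu : ContDiffOn ℝ ∞ u O) (hv : ContDiffOn ℝ ∞ v O) :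
    ContDiffOn ℝ ∞ (fun p => σ p ![u p, v p]) O := by
  set L : E₀ → (ℝ × ℝ) →L[ℝ] E := fun p =>
    (ContinuousLinearMap.fst ℝ ℝ ℝ).smulRight (u p)
      + (ContinuousLinearMap.snd ℝ ℝ ℝ).smulRight (v p) with hL
  have hLs : ContDiffOn ℝ ∞ L O :=
    (contDiffOn_const.smulRight hu).add (contDiffOn_const.smulRight hv)
  have h1 := contDiffOn_compContinuousLinearMap hσ hLs
  have h2 := (ContinuousAlternatingMap.apply ℝ (ℝ × ℝ) ℝ
    ![((1 : ℝ), (0 : ℝ)), (0, 1)]).contDiff.comp_contDiffOn (n := ∞) h1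
  refine h2.congr fun p _ => ?_
  simp only [Function.comp_apply, ContinuousAlternatingMap.apply_apply,
    ContinuousAlternatingMap.compContinuousLinearMap_apply]
  congr 1
  ext i
  fin_cases i <;> simp [hL]

lemma extDeriv_two_vectorField {σ : Form E E 2} {p : E} (hσ : DifferentiableAt ℝ σ p)
    {U V W : E → E} (hU : DifferentiableAt ℝ U p) (hV : DifferentiableAt ℝ V p)
    (hW : DifferentiableAt ℝ W p) :
    extDeriv σ p ![U p, V p, W p]
      = fderiv ℝ (fun q => σ.at₂ q (V q) (W q)) p (U p)
        - fderiv ℝ (fun q => σ.at₂ q (U q) (W q)) p (V p)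
        + fderiv ℝ (fun q => σ.at₂ q (U q) (V q)) p (W p)
        - σ.at₂ p (VectorField.lieBracket ℝ U V p) (W p)
        + σ.at₂ p (VectorField.lieBracket ℝ U W p) (V p)
        - σ.at₂ p (VectorField.lieBracket ℝ V W p) (U p) := by
  have h1 := extDeriv_apply_vectorField (V := ![U, V, W]) (x := p) hσ
    (by intro i; fin_cases i <;> assumption)
  have hv : (fun i => (![U, V, W] : Fin 3 → E → E) i p) = ![U p, V p, W p] := by
    ext i; fin_cases i <;> rfl
  rw [hv] at h1
  rw [h1, Fin.sum_univ_three, Fin.sum_univ_two]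
  have e0 : ∀ q, (0 : Fin 3).removeNth (fun i => (![U, V, W] : Fin 3 → E → E) i q) = ![V q, W q] := by
    intro q; ext i; fin_cases i <;> rfl
  have e1 : ∀ q, (1 : Fin 3).removeNth (fun i => (![U, V, W] : Fin 3 → E → E) i q) = ![U q, W q] := by
    intro q; ext i; fin_cases i <;> rfl
  have e2 : ∀ q, (2 : Fin 3).removeNth (fun i => (![U, V, W] : Fin 3 → E → E) i q) = ![U q, V q] := by
    intro q; ext i; fin_cases i <;> rfl
  have hI0 : Finset.Ici (0 : Fin 2) = {0, 1} := by decide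
  have hI1 : Finset.Ici (1 : Fin 2) = {1} := by decide
  have f01 : (1 : Fin 2).removeNth ![V p, W p] = ![V p] := by
    ext i; fin_cases i; rfl
  have f11 : (1 : Fin 2).removeNth ((1 : Fin 3).removeNth ![U p, V p, W p]) = ![U p] := by
    ext i; fin_cases i; rfl
  simp only [e0, e1, e2, hI0, hI1]
  rw [Finset.sum_pair (by decide), Finset.sum_singleton]
  have c0 : (0 : Fin 2).castSucc = (0 : Fin 3) := rfl
  have c1 : (1 : Fin 2).castSucc = (1 : Fin 3) := rfl
  have s0 : (0 : Fin 2).succ = (1 : Fin 3) := rfl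
  have s1 : (1 : Fin 2).succ = (2 : Fin 3) := rfl
  simp only [c0, c1, s0, s1]
  simp only [Form.at₂, Fin.removeNth_zero, Fin.val_zero, Fin.val_one, Fin.val_two, pow_zero, pow_one,
    one_smul, neg_smul, even_two, Even.neg_pow, one_pow, add_zero, zero_add, Nat.reduceAdd,
    Matrix.cons_val_zero, Matrix.cons_val_one, Matrix.cons_val_two]
  have g01 := congrArg (fun t => σ p (Matrix.vecCons (VectorField.lieBracket ℝ U W p) t)) f01
  have g11 := congrArg (fun t => σ p (Matrix.vecCons (VectorField.lieBracket ℝ V W p) t)) f11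
  have ht : ∀ {n : ℕ} (a : E) (b : Fin n → E), Fin.tail (Matrix.vecCons a b) = b := fun a b => rfl
  simp only [ht]
  erw [g01, g11]
  simp
  ring

/-- For a closed two-form `σ` on a product, the vertical derivative of `σ(U, V)` for projectable
fields `U`, `V` which are `σ`-orthogonal to the vertical directions. -/
lemma fderiv_at₂_of_orthogonal {E' F : Type*} [NormedAddCommGroup E'] [NormedSpace ℝ E']
    [NormedAddCommGroup F] [NormedSpace ℝ F] {σ : Form (E' × F) (E' × F) 2} {D : Set (E' × F)}
    (hD : IsOpen D) {p : E' × F} (hp : p ∈ D) (hσ : DifferentiableAt ℝ σ p)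
    (hcl : extDeriv σ p = 0) {U V : E' × F → E' × F} (hU : DifferentiableAt ℝ U p)
    (hV : DifferentiableAt ℝ V p) (hUv : ∀ q ∈ D, ∀ v, σ.at₂ q (U q) (0, v) = 0)
    (hVv : ∀ q ∈ D, ∀ v, σ.at₂ q (V q) (0, v) = 0)
    {U₀ V₀ : E' → E'} (hU₀ : ∀ q, (U q).1 = U₀ q.1) (hV₀ : ∀ q, (V q).1 = V₀ q.1) (v : F) :
    fderiv ℝ (fun q => σ.at₂ q (U q) (V q)) p (0, v)
      = σ.at₂ p (VectorField.lieBracket ℝ U V p) (0, v) := by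
  -- The third field is the constant vertical field (0, v). Orthogonality kills two of the
  -- derivative terms. Since U and V are projectable, their brackets with the vertical field are
  -- vertical, so orthogonality kills two of the bracket terms as well.
  have h1 := extDeriv_two_vectorField hσ hU hV (differentiableAt_const ((0 : E'), v))
  rw [hcl] at h1
  have hz : ∀ {T : E' × F → E' × F}, (∀ q ∈ D, ∀ v, σ.at₂ q (T q) (0, v) = 0) →
      fderiv ℝ (fun q => σ.at₂ q (T q) (0, v)) p = 0 := fun hT => by
    rw [(Filter.eventuallyEq_of_mem (hD.mem_nhds hp) fun q hq => hT q hq v :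
      (fun q => σ.at₂ q _ (0, v)) =ᶠ[nhds p] fun _ => (0 : ℝ)).fderiv_eq, fderiv_fun_const]
    rfl
  have hbr : ∀ {T : E' × F → E' × F} {T₀ : E' → E'}, DifferentiableAt ℝ T p →
      (∀ q, (T q).1 = T₀ q.1) →
      (VectorField.lieBracket ℝ T (fun _ => ((0 : E'), v)) p).1 = 0 := fun {T T₀} hT hT₀ => by
    have h2 : (fun t : ℝ => (T (p + t • ((0 : E'), v))).1) = fun _ => T₀ p.1 := by
      ext t
      rw [hT₀]
      simp
    have h3 : HasDerivAt (fun t : ℝ => (T (p + t • ((0 : E'), v))).1)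
        (fderiv ℝ T p ((0 : E'), v)).1 0 :=
      ((ContinuousLinearMap.fst ℝ E' F).hasFDerivAt.comp_hasDerivAt (0 : ℝ)
        (hT.hasFDerivAt.hasLineDerivAt ((0 : E'), v)) :)
    rw [h2] at h3
    have h4 := h3.unique (hasDerivAt_const _ _)
    simp [VectorField.lieBracket, h4]
  have hsw : ∀ a b, σ.at₂ p a b = -σ.at₂ p b a := fun a b => Form.at₂_antisymm σ p b a
  have hor : ∀ {T : E' × F → E' × F}, (∀ q ∈ D, ∀ v, σ.at₂ q (T q) (0, v) = 0) →
      ∀ a : E' × F, a.1 = 0 → σ.at₂ p a (T p) = 0 := fun {T} hT a ha => by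
    rw [hsw, show a = (0, a.2) from Prod.ext ha rfl, hT p hp, neg_zero]
  rw [hz hUv, hz hVv, hor hVv _ (hbr hU hU₀), hor hUv _ (hbr hV hV₀)] at h1
  have h0 : (0 : (E' × F) [⋀^Fin 3]→L[ℝ] ℝ) ![U p, V p, (0, v)] = 0 := rfl
  rw [h0] at h1
  simp only [_root_.zero_apply] at h1
  linarith

end VectorFields

/-! ### The horizontal component of a form and its derivative along the fibres. -/

section LiftedForm

variable {EX EB X B : Type*}
  [NormedAddCommGroup EX] [NormedSpace ℂ EX] [FiniteDimensional ℂ EX]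
  [NormedAddCommGroup EB] [NormedSpace ℂ EB] [FiniteDimensional ℂ EB]
  [TopologicalSpace X] [ChartedSpace EX X] [IsManifold 𝓘(ℂ, EX) ω X]
  [TopologicalSpace B] [ChartedSpace EB B] [IsManifold 𝓘(ℂ, EB) ω B]
  {m : ℕ} {π : X → B} {h : IsHolSubmersion EX EB m π} {Ω η : Form EX X 2}

/-- The horizontal component of `η`, as a family of two-forms on the tangent spaces of `B`. -/
def liftedForm (π : X → B) (Ω η : Form EX X 2) (y : X) (w₁ w₂ : EB) : ℝ :=
  η.at₂ y (horizontalLift π Ω y w₁) (horizontalLift π Ω y w₂)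

lemma isRealBilin_liftedForm (h : IsHolSubmersion EX EB m π) (hΩ : IsRelativelyKahler EB π Ω)
    (η : Form EX X 2) (y : X) : IsRealBilin (liftedForm (EB := EB) π Ω η y) where
  add_left u u' v := by
    simp only [liftedForm, horizontalLift_add h hΩ, (η.isRealBilin y).add_left]
  add_right u v v' := by
    simp only [liftedForm, horizontalLift_add h hΩ, (η.isRealBilin y).add_right]
  smul_left r u v := by
    simp only [liftedForm, horizontalLift_smul h hΩ, (η.isRealBilin y).smul_left]
  smul_right r u v := by
    simp only [liftedForm, horizontalLift_smul h hΩ, (η.isRealBilin y).smul_right]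

lemma liftedForm_adaptedParam (hΩ : IsRelativelyKahler EB π Ω) (η : Form EX X 2) {x : X}
    {p : EB × (Fin m → ℂ)} (hp : p ∈ adaptedDomain h x) (w₁ w₂ : EB) :
    liftedForm π Ω η (adaptedParam h x p)
        (tangentMapAt (E := EB) (E' := EB) (h x).codChart.symm p.1 w₁)
        (tangentMapAt (E := EB) (E' := EB) (h x).codChart.symm p.1 w₂)
      = (adaptedForm h η x).at₂ p (coordLift h Ω x w₁ p) (coordLift h Ω x w₂ p) := by
  rw [liftedForm, horizontalLift_adaptedParam hΩ hp, horizontalLift_adaptedParam hΩ hp,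
    adaptedForm_at₂]

lemma contDiffOn_adaptedForm_coordLift (hΩ : IsRelativelyKahler EB π Ω) (hη : η.IsSmooth) (x : X)
    (w₁ w₂ : EB) : ContDiffOn ℝ ∞ (fun p => (adaptedForm h η x).at₂ p (coordLift h Ω x w₁ p)
      (coordLift h Ω x w₂ p)) (adaptedDomain h x) :=
  contDiffOn_form_apply_fields (contDiffOn_adaptedForm hη x) (contDiffOn_coordLift hΩ x w₁)
    (contDiffOn_coordLift hΩ x w₂)

lemma basePoint_mem (h : IsHolSubmersion EX EB m π) (x : X) :
    basePoint h x ∈ (h x).codChart.target :=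
  fst_mem_codChart_target (adaptedCoord_mem (mem_adaptedSource h x))

lemma smoothOnFibre_liftedForm (hΩ : IsRelativelyKahler EB π Ω) (hη : η.IsSmooth) (b : B)
    (w₁ w₂ : EB) : SmoothOnFibre h b (fun y => liftedForm π Ω η y w₁ w₂) := by
  intro x hx
  obtain ⟨w₁', rfl⟩ := exists_tangentMapAt_codChart_symm (basePoint_mem h x) w₁
  obtain ⟨w₂', rfl⟩ := exists_tangentMapAt_codChart_symm (basePoint_mem h x) w₂
  refine ((contDiffOn_adaptedForm_coordLift hΩ hη x w₁' w₂').comp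
    (contDiff_prodMk_right (basePoint h x)).contDiffOn fun z hz => hz).congr fun z hz => ?_
  exact liftedForm_adaptedParam hΩ η (p := (basePoint h x, z)) hz w₁' w₂'

lemma contDiffOn_coordLift_field (hΩ : IsRelativelyKahler EB π Ω) (x : X) {W : EB → EB} {O : Set EB}
    (hW : ContDiffOn ℝ ∞ W O) :
    ContDiffOn ℝ ∞ (fun p => coordLift h Ω x (W p.1) p) (adaptedDomain h x ∩ Prod.fst ⁻¹' O) := by
  have hs := (contDiffOn_adaptedForm (h := h) hΩ.closed.1 x).mono
    (Set.inter_subset_left (t := Prod.fst ⁻¹' O))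
  have hW' : ContDiffOn ℝ ∞ (fun p : EB × (Fin m → ℂ) => W p.1)
      (adaptedDomain h x ∩ Prod.fst ⁻¹' O) :=
    hW.comp contDiff_fst.contDiffOn fun p hp => hp.2
  refine hW'.prodMk (contDiffOn_pi.2 fun l => (ContDiffOn.sum fun k _ => ?_).neg)
  refine (contDiffOn_inv (fun i j => contDiffOn_hermCoeff hs _ _)
    (fun p hp => (isUnit_det_vertVec hΩ hp.1).ne_zero) k l).mul ?_
  have hc : ContDiffOn ℝ ∞ (fun p : EB × (Fin m → ℂ) => (W p.1, (0 : Fin m → ℂ)))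
      (adaptedDomain h x ∩ Prod.fst ⁻¹' O) := hW'.prodMk contDiffOn_const
  have hI := hc.const_smul Complex.I
  have h1 : ∀ {u v : EB × (Fin m → ℂ) → EB × (Fin m → ℂ)},
      ContDiffOn ℝ ∞ u (adaptedDomain h x ∩ Prod.fst ⁻¹' O) →
      ContDiffOn ℝ ∞ v (adaptedDomain h x ∩ Prod.fst ⁻¹' O) →
      ContDiffOn ℝ ∞ (fun p => (((adaptedForm h Ω x).at₂ p (u p) (v p) : ℝ) : ℂ))
        (adaptedDomain h x ∩ Prod.fst ⁻¹' O) := fun hu hv =>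
    Complex.ofRealCLM.contDiff.comp_contDiffOn (contDiffOn_form_apply_fields hs hu hv)
  simp only [hermCoeff]
  push_cast
  exact (((h1 hc contDiffOn_const).sub (h1 hI contDiffOn_const)).sub
    (contDiffOn_const.mul ((h1 hc contDiffOn_const).add (h1 hI contDiffOn_const)))).div_const 4

/-- The derivative of the horizontal component along the fibres, for a closed form whose mixed
component vanishes. -/
lemma fderiv_liftedForm (hΩ : IsRelativelyKahler EB π Ω) (hη : η.IsClosed)
    (hor : ∀ y w v, IsVertical (EB := EB) π y v → η.at₂ y (horizontalLift π Ω y (w : EB)) v = 0)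
    {x : X} {O : Set EB} (hO : IsOpen O) (hxO : basePoint h x ∈ O) {W₁ W₂ : EB → EB}
    (hW₁ : ContDiffOn ℝ ∞ W₁ O) (hW₂ : ContDiffOn ℝ ∞ W₂ O) {z : Fin m → ℂ}
    (hz : z ∈ fibreDomain h x) (u : Fin m → ℂ) {w₁ w₂ : EB}
    (hw₁ : tangentMapAt (E := EB) (E' := EB) (h x).codChart.symm (basePoint h x)
      (W₁ (basePoint h x)) = w₁)
    (hw₂ : tangentMapAt (E := EB) (E' := EB) (h x).codChart.symm (basePoint h x)
      (W₂ (basePoint h x)) = w₂) :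
    fderiv ℝ ((fun y => liftedForm π Ω η y w₁ w₂) ∘ fibreParam h x) z u
      = (adaptedForm h η x).at₂ (basePoint h x, z)
        (VectorField.lieBracket ℝ (fun p => coordLift h Ω x (W₁ p.1) p)
          (fun p => coordLift h Ω x (W₂ p.1) p) (basePoint h x, z)) (0, u) := by
  set D := adaptedDomain h x ∩ Prod.fst ⁻¹' O with hDdef
  have hD : IsOpen D := (isOpen_adaptedDomain h x).inter (hO.preimage continuous_fst)
  have hp : (basePoint h x, z) ∈ D := ⟨hz, hxO⟩
  have hs := (contDiffOn_adaptedForm (h := h) hη.1 x).mono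
    (Set.inter_subset_left : D ⊆ adaptedDomain h x)
  have hU₁ := contDiffOn_coordLift_field (h := h) hΩ x hW₁
  have hU₂ := contDiffOn_coordLift_field (h := h) hΩ x hW₂
  have horth : ∀ q ∈ D, ∀ w v, (adaptedForm h η x).at₂ q (coordLift h Ω x w q) (0, v) = 0 := by
    intro q hq w v
    rw [adaptedForm_at₂, ← horizontalLift_adaptedParam hΩ hq.1]
    exact hor _ _ _ ((isVertical_paramDeriv_iff hq.1 _).2 rfl)
  rw [← fderiv_at₂_of_orthogonal hD hp (ContDiffOn.differentiableAt_of_isOpen hs hD hp)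
    ((extDeriv_adaptedForm hη.1 hη.2 hz).trans rfl)
    (ContDiffOn.differentiableAt_of_isOpen hU₁ hD hp)
    (ContDiffOn.differentiableAt_of_isOpen hU₂ hD hp)
    (fun q hq v => horth q hq _ v) (fun q hq v => horth q hq _ v) (fun q => rfl) (fun q => rfl) u]
  have h1 : ((fun y => liftedForm π Ω η y w₁ w₂) ∘ fibreParam h x) =ᶠ[nhds z]
      (fun q => (adaptedForm h η x).at₂ q (coordLift h Ω x (W₁ q.1) q)
        (coordLift h Ω x (W₂ q.1) q)) ∘ fun z => (basePoint h x, z) := by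
    filter_upwards [(isOpen_fibreDomain h x).mem_nhds hz] with z' hz'
    rw [← hw₁, ← hw₂]
    exact liftedForm_adaptedParam hΩ η (p := (basePoint h x, z')) hz' _ _
  have h2 : ContDiffOn ℝ ∞ (fun q => (adaptedForm h η x).at₂ q (coordLift h Ω x (W₁ q.1) q)
      (coordLift h Ω x (W₂ q.1) q)) D := contDiffOn_form_apply_fields hs hU₁ hU₂
  rw [h1.fderiv_eq, fderiv_comp z (ContDiffOn.differentiableAt_of_isOpen h2 hD hp) (by fun_prop)]
  rw [ContinuousLinearMap.comp_apply, fderiv_prodMk_const]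

/-- The horizontal component of a closed form which vanishes on vertical vectors is constant along
connected fibres. -/
lemma liftedForm_eq_of_closed (hΩ : IsRelativelyKahler EB π Ω) (hη : η.IsClosed)
    (hor : ∀ y u v, IsVertical (EB := EB) π y v → η.at₂ y u v = 0)
    (h : IsHolSubmersion EX EB m π) {b : B} (hconn : IsConnected (π ⁻¹' {b})) (w₁ w₂ : EB) {x y : X}
    (hx : π x = b) (hy : π y = b) :
    liftedForm π Ω η x w₁ w₂ = liftedForm π Ω η y w₁ w₂ := by
  refine eq_of_fibreDeriv_eq_zero (h := h) hconn (smoothOnFibre_liftedForm hΩ hη.1 b w₁ w₂)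
    (fun y _ => ?_) hx hy
  obtain ⟨w₁', hw₁⟩ := exists_tangentMapAt_codChart_symm (basePoint_mem h y) w₁
  obtain ⟨w₂', hw₂⟩ := exists_tangentMapAt_codChart_symm (basePoint_mem h y) w₂
  ext u
  -- Constant base fields suffice: whatever the bracket of their lifts is, η pairs it to zero with a
  -- vertical vector.
  rw [fibreDeriv, fderiv_liftedForm hΩ hη (fun y w v hv => hor y _ v hv) isOpen_univ trivial
    (W₁ := fun _ => w₁') (W₂ := fun _ => w₂') contDiffOn_const contDiffOn_const
    (fibrePoint_mem h y) u hw₁ hw₂, adaptedForm_at₂]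
  exact hor _ _ _ ((isVertical_paramDeriv_iff (fibrePoint_mem h y) _).2 rfl)

end LiftedForm

/-! ### The curvature of the connection and its fibrewise Hamiltonians. -/

section Curvature

variable {EX EB X B : Type*}
  [NormedAddCommGroup EX] [NormedSpace ℂ EX] [FiniteDimensional ℂ EX]
  [NormedAddCommGroup EB] [NormedSpace ℂ EB] [FiniteDimensional ℂ EB]
  [TopologicalSpace X] [ChartedSpace EX X] [IsManifold 𝓘(ℂ, EX) ω X]
  [TopologicalSpace B] [ChartedSpace EB B] [IsManifold 𝓘(ℂ, EB) ω B]
  {m : ℕ} {π : X → B} {h : IsHolSubmersion EX EB m π} {Ω η : Form EX X 2}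

lemma coordinateField_self (b : B) (w : EB) : coordinateField b w b = w := by
  have : IsManifold 𝓘(ℝ, EB) ∞ B := isManifold_real
  have : IsManifold 𝓘(ℝ, EB) 1 B := IsManifold.of_le (n := ∞) (by simp)
  set c := chartAt EB b with hc
  have hb : b ∈ c.source := mem_chart_source EB b
  have h1 : MDifferentiableAt 𝓘(ℝ, EB) 𝓘(ℝ, EB) c b :=
    mdifferentiableAt_atlas (I := 𝓘(ℝ, EB)) (chart_mem_atlas EB b) hb
  have h2 : MDifferentiableAt 𝓘(ℝ, EB) 𝓘(ℝ, EB) c.symm (c b) :=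
    mdifferentiableAt_atlas_symm (I := 𝓘(ℝ, EB)) (chart_mem_atlas EB b) (c.map_source hb)
  have h3 : tangentMapAt (E := EB) (E' := EB) c b w = w := by
    have := mfderiv_chartAt_eq_tangentCoordChange (I := 𝓘(ℝ, EB)) (x := b) (y := b) hb
    rw [tangentMapAt, this]
    exact tangentCoordChange_self (I := 𝓘(ℝ, EB)) (by simp)
  have h4 := tangentMapAt_comp h2 h1
  have h5 : tangentMapAt (E := EB) (E' := EB) (c.symm ∘ c) b w = w := by
    rw [tangentMapAt_congr (g := id) (by
      filter_upwards [c.open_source.mem_nhds hb] with y hy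
      exact c.left_inv hy), tangentMapAt, mfderiv_id]
    rfl
  rw [h4, ContinuousLinearMap.comp_apply, h3] at h5
  exact h5

lemma contDiffOn_chart_transition {M E : Type*} [NormedAddCommGroup E] [NormedSpace ℝ E]
    [TopologicalSpace M] [ChartedSpace E M] [IsManifold 𝓘(ℝ, E) ∞ M]
    {e e' : OpenPartialHomeomorph M E} (he : e ∈ IsManifold.maximalAtlas 𝓘(ℝ, E) ∞ M)
    (he' : e' ∈ IsManifold.maximalAtlas 𝓘(ℝ, E) ∞ M) :
    ContDiffOn ℝ ∞ (e' ∘ e.symm) (e.target ∩ e.symm ⁻¹' e'.source) :=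
  (((contMDiffOn_of_mem_maximalAtlas he').comp
    ((contMDiffOn_symm_of_mem_maximalAtlas he).mono Set.inter_subset_left) fun _ hx => hx.2 :
    ContMDiffOn 𝓘(ℝ, E) 𝓘(ℝ, E) ∞ (e' ∘ e.symm) (e.target ∩ e.symm ⁻¹' e'.source))).contDiffOn

lemma codChart_mem_real (h : IsHolSubmersion EX EB m π) (x : X) :
    (h x).codChart ∈ IsManifold.maximalAtlas 𝓘(ℝ, EB) ∞ B :=
  maximalAtlas_complex_le_real (h x).codChart_mem_maximalAtlas

/-- The coordinates of `coordinateField b w` in the adapted chart of `B` around `π x`. -/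
def baseField (h : IsHolSubmersion EX EB m π) (x : X) (b : B) (w : EB) (q : EB) : EB :=
  fderiv ℝ ((h x).codChart ∘ (chartAt EB b).symm) (chartAt EB b ((h x).codChart.symm q)) w

/-- The domain of `baseField`. -/
def baseFieldDomain (h : IsHolSubmersion EX EB m π) (x : X) (b : B) : Set EB :=
  (h x).codChart.target ∩ (h x).codChart.symm ⁻¹' (chartAt EB b).source

lemma isOpen_baseFieldDomain (x : X) (b : B) : IsOpen (baseFieldDomain h x b) :=
  (h x).codChart.symm.isOpen_inter_preimage (chartAt EB b).open_source

lemma basePoint_mem_baseFieldDomain (x : X) : basePoint h x ∈ baseFieldDomain h x (π x) :=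
  ⟨basePoint_mem h x, by
    rw [Set.mem_preimage, codChart_symm_basePoint]
    exact mem_chart_source EB (π x)⟩

lemma contDiffOn_baseField (x : X) (b : B) (w : EB) :
    ContDiffOn ℝ ∞ (baseField h x b w) (baseFieldDomain h x b) := by
  have : IsManifold 𝓘(ℝ, EB) ∞ B := isManifold_real
  have hc : chartAt EB b ∈ IsManifold.maximalAtlas 𝓘(ℝ, EB) ∞ B :=
    IsManifold.chart_mem_maximalAtlas b
  have h1 := contDiffOn_chart_transition hc (codChart_mem_real h x)
  have h2 := contDiffOn_chart_transition (codChart_mem_real h x) hc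
  have h3 := h1.fderiv_of_isOpen (m := ∞)
    ((chartAt EB b).symm.isOpen_inter_preimage (h x).codChart.open_source) (by simp)
  refine (h3.comp h2 fun q hq => ?_).clm_apply contDiffOn_const
  refine ⟨(chartAt EB b).map_source hq.2, ?_⟩
  simp only [Set.mem_preimage, Function.comp_apply]
  rw [(chartAt EB b).left_inv hq.2]
  exact (h x).codChart.map_target hq.1

/-- The extension of a base vector used to define F_H is constant in the preferred chart of B, not
in the base chart of the adapted coordinates. Hence base fields with variable coefficients occur
here. -/
lemma tangentMapAt_baseField {x : X} {b : B} {q : EB} (hq : q ∈ baseFieldDomain h x b) (w : EB) :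
    tangentMapAt (E := EB) (E' := EB) (h x).codChart.symm q (baseField h x b w q)
      = coordinateField b w ((h x).codChart.symm q) := by
  have : IsManifold 𝓘(ℝ, EB) ∞ B := isManifold_real
  have hc : chartAt EB b ∈ IsManifold.maximalAtlas 𝓘(ℝ, EB) ∞ B :=
    IsManifold.chart_mem_maximalAtlas b
  set c := chartAt EB b with hcdef
  set e := (h x).codChart with he
  set s := c (e.symm q) with hs
  have hst : s ∈ c.target := c.map_source hq.2
  have hcs : c.symm s = e.symm q := c.left_inv hq.2
  have hτ : (e ∘ c.symm) s = q := by
    rw [Function.comp_apply, hcs, e.right_inv hq.1]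
  have hO : IsOpen (c.target ∩ c.symm ⁻¹' e.source) := c.symm.isOpen_inter_preimage e.open_source
  have hsO : s ∈ c.target ∩ c.symm ⁻¹' e.source :=
    ⟨hst, by rw [Set.mem_preimage, hcs]; exact e.map_target hq.1⟩
  have h1 : MDifferentiableAt 𝓘(ℝ, EB) 𝓘(ℝ, EB) (e ∘ c.symm) s :=
    ((ContDiffOn.differentiableAt_of_isOpen
      (contDiffOn_chart_transition hc (codChart_mem_real h x)) hO hsO)).mdifferentiableAt
  have h2 : MDifferentiableAt 𝓘(ℝ, EB) 𝓘(ℝ, EB) e.symm ((e ∘ c.symm) s) := by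
    rw [hτ]
    exact ((contMDiffOn_symm_of_mem_maximalAtlas (codChart_mem_real h x)).contMDiffAt
      (e.open_target.mem_nhds hq.1)).mdifferentiableAt (by simp)
  have h3 := tangentMapAt_comp h2 h1
  rw [hτ, tangentMapAt_eq_fderiv (e ∘ c.symm)] at h3
  have h4 : tangentMapAt (E := EB) (E' := EB) (e.symm ∘ e ∘ c.symm) s
      = tangentMapAt (E := EB) (E' := EB) c.symm s := by
    refine tangentMapAt_congr ?_
    filter_upwards [hO.mem_nhds hsO] with y hy
    exact e.left_inv hy.2
  rw [coordinateField, ← hcdef, ← hs, ← h4, h3]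
  rfl

lemma coordDeriv_inverse {x y : X} (hy : y ∈ adaptedSource h x) :
    (coordDeriv h x y).inverse = paramDeriv h x (adaptedCoord h x y) := by
  refine ContinuousLinearMap.inverse_eq ?_ ?_
  · refine ContinuousLinearMap.ext fun v => ?_
    have := coordDeriv_paramDeriv (adaptedCoord_mem hy) v
    rw [adaptedParam_adaptedCoord hy] at this
    exact this
  · refine ContinuousLinearMap.ext fun v => ?_
    exact paramDeriv_coordDeriv hy v

/-- The bracket of vector fields which are given in adapted coordinates. -/
lemma mlieBracket_of_paramDeriv {x y : X} (hy : y ∈ adaptedSource h x) {V₁ V₂ : X → EX}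
    {U₁ U₂ : EB × (Fin m → ℂ) → EB × (Fin m → ℂ)} {D : Set (EB × (Fin m → ℂ))} (hD : IsOpen D)
    (hyD : adaptedCoord h x y ∈ D) (hU₁ : ContDiffOn ℝ ∞ U₁ D) (hU₂ : ContDiffOn ℝ ∞ U₂ D)
    (hV₁ : ∀ᶠ y' in nhds y, V₁ y' = paramDeriv h x (adaptedCoord h x y')
      (U₁ (adaptedCoord h x y')))
    (hV₂ : ∀ᶠ y' in nhds y, V₂ y' = paramDeriv h x (adaptedCoord h x y')
      (U₂ (adaptedCoord h x y'))) :
    VectorField.mlieBracket 𝓘(ℝ, EX) V₁ V₂ y = paramDeriv h x (adaptedCoord h x y)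
      (VectorField.lieBracket ℝ U₁ U₂ (adaptedCoord h x y)) := by
  have : IsManifold 𝓘(ℝ, EX) ∞ X := isManifold_real
  have : IsManifold 𝓘(ℝ, EX) (minSmoothness ℝ 2) X := by
    rw [minSmoothness_of_isRCLikeNormedField]
    exact IsManifold.of_le (n := ∞) two_le_infty
  have : CompleteSpace EX := FiniteDimensional.complete ℂ EX
  have hev : ∀ {V : X → EX} {U : EB × (Fin m → ℂ) → EB × (Fin m → ℂ)},
      (∀ᶠ y' in nhds y, V y' = paramDeriv h x (adaptedCoord h x y') (U (adaptedCoord h x y'))) →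
      V =ᶠ[nhds y] VectorField.mpullback 𝓘(ℝ, EX) 𝓘(ℝ, EB × (Fin m → ℂ)) (adaptedCoord h x) U := by
    intro V U hV
    filter_upwards [hV, (isOpen_adaptedSource h x).mem_nhds hy] with y' hy' hys
    rw [hy', ← coordDeriv_inverse hys]
    rfl
  have hmd : ∀ {U : EB × (Fin m → ℂ) → EB × (Fin m → ℂ)}, ContDiffOn ℝ ∞ U D →
      MDifferentiableAt 𝓘(ℝ, EB × (Fin m → ℂ)) 𝓘(ℝ, EB × (Fin m → ℂ)).tangent
        (fun p => (⟨p, U p⟩ : TangentBundle 𝓘(ℝ, EB × (Fin m → ℂ)) (EB × (Fin m → ℂ))))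
        (adaptedCoord h x y) := fun hU =>
    (contMDiffAt_vectorSpace_iff_contDiffAt.2
      (hU.contDiffAt (hD.mem_nhds hyD))).mdifferentiableAt (by simp)
  have h1 := VectorField.mpullback_mlieBracket (I := 𝓘(ℝ, EX)) (n := ∞) (x₀ := y) (f := adaptedCoord h x)
    (hmd hU₁) (hmd hU₂) (ContMDiffAt.real (contMDiffAt_adaptedCoord hy))
    (by rw [minSmoothness_of_isRCLikeNormedField]; exact two_le_infty)
  rw [(hev hV₁).mlieBracket_vectorField_eq (hev hV₂)]
  have h2 : VectorField.mlieBracket 𝓘(ℝ, EB × (Fin m → ℂ)) U₁ U₂ (adaptedCoord h x y)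
      = VectorField.lieBracket ℝ U₁ U₂ (adaptedCoord h x y) := by
    rw [← VectorField.lieBracketWithin_univ]
    exact congrFun (VectorField.mlieBracketWithin_eq_lieBracketWithin (𝕜 := ℝ) (V := U₁) (W := U₂)
      (s := Set.univ)) _
  rw [← coordDeriv_inverse hy]
  exact h1.symm.trans (congrArg (coordDeriv h x y).inverse h2)

lemma isHorizontal_horizontalLift (h : IsHolSubmersion EX EB m π) (hΩ : IsRelativelyKahler EB π Ω)
    (y : X) (w : EB) : IsHorizontal EB π Ω y (horizontalLift π Ω y w) :=
  (horizontalLift_spec h hΩ y w).2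

/-- Taking the vertical part subtracts a horizontal vector, which Ω pairs to zero with vertical
ones, so the full bracket may be used. Along a fibre the base point is fixed, so the same extended
fields serve at all its points. -/
lemma at₂_connectionCurvature (hΩ : IsRelativelyKahler EB π Ω) {x : X} {z : Fin m → ℂ}
    (hz : z ∈ fibreDomain h x) (w₁ w₂ : EB) (u : Fin m → ℂ) :
    Ω.at₂ (fibreParam h x z) (connectionCurvature π Ω (fibreParam h x z) w₁ w₂)
        (tangentMapAt (E := Fin m → ℂ) (E' := EX) (fibreParam h x) z u)
      = (adaptedForm h Ω x).at₂ (basePoint h x, z)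
        (VectorField.lieBracket ℝ (fun p => coordLift h Ω x (baseField h x (π x) w₁ p.1) p)
          (fun p => coordLift h Ω x (baseField h x (π x) w₂ p.1) p) (basePoint h x, z)) (0, u) := by
  set y := fibreParam h x z with hy
  have hys : y ∈ adaptedSource h x := fibreParam_mem_adaptedSource hz
  have hyc : adaptedCoord h x y = (basePoint h x, z) := adaptedCoord_fibreParam hz
  have hπ : π y = π x := proj_fibreParam hz
  set D := adaptedDomain h x ∩ Prod.fst ⁻¹' baseFieldDomain h x (π x) with hDdef
  have hD : IsOpen D := (isOpen_adaptedDomain h x).inter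
    ((isOpen_baseFieldDomain x (π x)).preimage continuous_fst)
  have hyD : adaptedCoord h x y ∈ D := by
    rw [hyc]
    exact ⟨hz, basePoint_mem_baseFieldDomain x⟩
  have hev : ∀ w : EB, ∀ᶠ y' in nhds y, horizontalLift π Ω y' (coordinateField (π y) w (π y'))
      = paramDeriv h x (adaptedCoord h x y') (coordLift h Ω x
        (baseField h x (π x) w (adaptedCoord h x y').1) (adaptedCoord h x y')) := by
    intro w
    have hcont : ContinuousAt (adaptedCoord h x) y :=
      (contMDiffAt_adaptedCoord hys).continuousAt
    filter_upwards [(isOpen_adaptedSource h x).mem_nhds hys,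
      hcont.preimage_mem_nhds (hD.mem_nhds hyD)] with y' hy' hyD'
    have h1 := horizontalLift_adaptedParam hΩ hyD'.1
      (baseField h x (π x) w (adaptedCoord h x y').1)
    rw [tangentMapAt_baseField hyD'.2, adaptedParam_adaptedCoord hy',
      ← proj_eq_codChart_symm hy', ← hπ] at h1
    rw [h1, hπ]
  have hbr := mlieBracket_of_paramDeriv hys hD hyD
    (contDiffOn_coordLift_field hΩ x (contDiffOn_baseField x (π x) w₁))
    (contDiffOn_coordLift_field hΩ x (contDiffOn_baseField x (π x) w₂)) (hev w₁) (hev w₂)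
  have hv : tangentMapAt (E := Fin m → ℂ) (E' := EX) (fibreParam h x) z u
      = paramDeriv h x (basePoint h x, z) (0, u) := tangentMapAt_slice (w := basePoint h x) hz u
  have hvert : IsVertical (EB := EB) π y (paramDeriv h x (basePoint h x, z) (0, u)) :=
    (isVertical_paramDeriv_iff (p := (basePoint h x, z)) hz _).2 rfl
  rw [hyc] at hbr
  have hcc := congrArg (verticalPart EB π Ω y) hbr
  rw [verticalPart] at hcc
  rw [adaptedForm_at₂, hv]
  refine (congrArg (fun a => Ω.at₂ y a (paramDeriv h x (basePoint h x, z) (0, u))) hcc).trans ?_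
  simp only [sub_eq_add_neg]
  rw [(Ω.isRealBilin _).add_left, (Ω.isRealBilin _).neg_left,
    isHorizontal_horizontalLift h hΩ y _ _ hvert, neg_zero, add_zero]
  rfl

variable [T2Space X] [CompactSpace X] [MeasurableSpace X] [BorelSpace X] [T2Space B]

/-- The fibrewise comoment map of the curvature is, up to a constant on each fibre, the horizontal
component of `Ω`. -/
lemma isHamiltonian_liftedForm (hΩ : IsRelativelyKahler EB π Ω) {b : B} (hb : (π ⁻¹' {b}).Nonempty)
    (w₁ w₂ : EB) : ∃ c, IsHamiltonian h Ω b (fun y => connectionCurvature π Ω y w₁ w₂)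
      (fun y => liftedForm π Ω Ω y w₁ w₂ - c) := by
  have hs := smoothOnFibre_liftedForm (h := h) hΩ hΩ.closed.1 b w₁ w₂
  have hfin := isFiniteMeasure_fibreMeasure (h := h) hΩ b
  set μ := fibreMeasure h Ω b with hμ
  -- If the total mass were zero, the constant function 1 would have integral zero and hence vanish
  -- on the nonempty fibre.
  have hpos : μ.real Set.univ ≠ 0 := by
    intro h0
    obtain ⟨x, hx⟩ := hb
    have := eq_zero_of_const_of_integral (h := h) hΩ (f := fun _ => 1) (b := b)
      (fun _ _ _ _ => rfl) (by simp [← hμ, h0]) hx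
    exact one_ne_zero this
  -- The normalizing constant is the mean value over the fibre.
  refine ⟨(∫ y, liftedForm π Ω Ω y w₁ w₂ ∂μ) / μ.real Set.univ, hs.sub (SmoothOnFibre.const _),
    ?_, ?_⟩
  · intro x hx z hz u
    subst hx
    rw [at₂_connectionCurvature hΩ hz, ← fderiv_liftedForm hΩ hΩ.closed
      (fun y w v hv => isHorizontal_horizontalLift h hΩ y w v hv) (isOpen_baseFieldDomain x (π x))
      (basePoint_mem_baseFieldDomain x) (contDiffOn_baseField x (π x) w₁)
      (contDiffOn_baseField x (π x) w₂) hz u (w₁ := w₁) (w₂ := w₂)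
      (by rw [tangentMapAt_baseField (basePoint_mem_baseFieldDomain x), codChart_symm_basePoint,
        coordinateField_self])
      (by rw [tangentMapAt_baseField (basePoint_mem_baseFieldDomain x), codChart_symm_basePoint,
        coordinateField_self])]
    have : ((fun y => liftedForm π Ω Ω y w₁ w₂
        - (∫ y, liftedForm π Ω Ω y w₁ w₂ ∂μ) / μ.real Set.univ) ∘ fibreParam h x)
        = fun z => ((fun y => liftedForm π Ω Ω y w₁ w₂) ∘ fibreParam h x) z
          - (∫ y, liftedForm π Ω Ω y w₁ w₂ ∂μ) / μ.real Set.univ := rfl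
    rw [this, fderiv_sub_const]
  · rw [integral_sub (hs.integrable hΩ) (integrable_const _), integral_const, smul_eq_mul,
      mul_div_cancel₀ _ hpos, sub_self]

lemma IsHamiltonian.sub_eq {b : B} (hconn : IsConnected (π ⁻¹' {b})) {ξ : X → EX} {f g : X → ℝ}
    (hf : IsHamiltonian h Ω b ξ f) (hg : IsHamiltonian h Ω b ξ g) {x y : X} (hx : π x = b)
    (hy : π y = b) : f x - g x = f y - g y := by
  refine eq_of_fibreDeriv_eq_zero (h := h) (f := fun x => f x - g x) hconn (hf.1.sub hg.1)
    (fun y hy => ?_) hx hy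
  have hz := fibrePoint_mem h y
  have h1 := fderiv_fun_sub (hf.1.differentiableAt hy hz) (hg.1.differentiableAt hy hz)
  rw [fibreDeriv]
  refine h1.trans ?_
  ext u
  rw [sub_apply, hf.2.1 y hy _ hz, hg.2.1 y hy _ hz, sub_self]
  rfl

/-- On each fibre, `μ^* F_H` is the horizontal component of `Ω` normalized to have integral zero. -/
lemma comomentCurvature_eq (hΩ : IsRelativelyKahler EB π Ω) {b : B}
    (hconn : IsConnected (π ⁻¹' {b})) (w₁ w₂ : EB) :
    ∃ c, (∀ y, π y = b → comomentCurvature h Ω y w₁ w₂ = liftedForm π Ω Ω y w₁ w₂ - c) ∧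
      ∫ y, comomentCurvature h Ω y w₁ w₂ ∂(fibreMeasure h Ω b) = 0 := by
  obtain ⟨c, hc⟩ := isHamiltonian_liftedForm (h := h) hΩ hconn.nonempty w₁ w₂
  have hspec : IsHamiltonian h Ω b (fun y => connectionCurvature π Ω y w₁ w₂)
      (comoment h Ω b (fun y => connectionCurvature π Ω y w₁ w₂)) :=
    Classical.epsilon_spec (p := fun f => IsHamiltonian h Ω b
      (fun y => connectionCurvature π Ω y w₁ w₂) f) ⟨_, hc⟩
  obtain ⟨x, hx⟩ := hconn.nonempty
  have heq : ∀ y, π y = b → comomentCurvature h Ω y w₁ w₂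
      = comoment h Ω b (fun y => connectionCurvature π Ω y w₁ w₂) y := by
    rintro y rfl
    rfl
  -- Two Hamiltonians of the same field differ by a constant on a connected fibre, so that constant
  -- is read off at the chosen point x.
  refine ⟨c - (comoment h Ω b (fun y => connectionCurvature π Ω y w₁ w₂) x
    - (liftedForm π Ω Ω x w₁ w₂ - c)), fun y hy => ?_, ?_⟩
  · have := hspec.sub_eq hconn hc hx hy
    rw [heq y hy]
    linarith
  · rw [← hspec.2.2]
    refine integral_congr_ae ?_
    filter_upwards [ae_mem_fibre h Ω b] with y hy
    exact heq y hy

end Curvature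

/-! ### Frame changes and integration of contractions. -/

section ContractionLemmas

variable {V : Type*} [AddCommGroup V] [Module ℂ V] {ι : Type*} [Fintype ι] [DecidableEq ι]

lemma contraction_linearMap (e : Module.Basis ι ℂ V) {L : V →ₗ[ℂ] V} (hL : Function.Injective L)
    {θ σ : V → V → ℝ} (hθ : IsRealBilin θ) (hσ : IsRealBilin σ) :
    contraction (fun j => L (e j)) θ σ = contraction e θ σ := by
  obtain ⟨A, hA⟩ := exists_matrix_of_linearMap e L
  have h1 : LinearIndependent ℂ (fun j => L (e j)) :=
    e.linearIndependent.map' L (LinearMap.ker_eq_bot.2 hL)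
  have h2 : LinearIndependent ℂ A.row := by
    refine LinearIndependent.of_comp e.equivFun.symm.toLinearMap ?_
    convert h1 using 1
    ext j
    rw [hA]
    exact Module.Basis.equivFun_symm_apply e (A j)
  have h3 : IsUnit A.det :=
    (Matrix.isUnit_iff_isUnit_det A).1 (Matrix.linearIndependent_rows_iff_isUnit.1 h2)
  rw [← contraction_change hθ hσ h3 e]
  simp only [hA]

lemma contraction_eq_sum (e : ι → V) (θ σ : V → V → ℝ) :
    contraction e θ σ = ∑ j, ∑ k,
      (((hermMatrix e θ)⁻¹ j k).re * (σ (e k) (Complex.I • e j) - σ (Complex.I • e k) (e j))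
        + ((hermMatrix e θ)⁻¹ j k).im
          * (σ (e k) (e j) + σ (Complex.I • e k) (Complex.I • e j))) / 4 := by
  simp only [contraction, Matrix.trace, Matrix.diag, Matrix.mul_apply, Complex.re_sum]
  refine Finset.sum_congr rfl fun j _ => Finset.sum_congr rfl fun k _ => ?_
  have h4 : (4 : ℂ) = ((4 : ℝ) : ℂ) := by norm_num
  have h5 : hermMatrix e σ k j = hermCoeff σ (e k) (e j) := rfl
  rw [h5, hermCoeff, h4, ← mul_div_assoc, Complex.div_ofReal_re]
  simp [Complex.mul_re]
  ring

/-- With θ fixed, the contraction is a finite real linear combination of values of σ, so it commutes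
with the integral. -/
lemma integral_contraction_eq_zero {α : Type*} [MeasurableSpace α] {μ : Measure α} (e : ι → V)
    (θ : V → V → ℝ) {σ : α → V → V → ℝ} (hσ : ∀ u v, Integrable (fun y => σ y u v) μ)
    (h0 : ∀ u v, ∫ y, σ y u v ∂μ = 0) : ∫ y, contraction e θ (σ y) ∂μ = 0 := by
  simp only [contraction_eq_sum]
  have hi : ∀ j k, Integrable (fun y => (((hermMatrix e θ)⁻¹ j k).re
      * (σ y (e k) (Complex.I • e j) - σ y (Complex.I • e k) (e j))
        + ((hermMatrix e θ)⁻¹ j k).im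
          * (σ y (e k) (e j) + σ y (Complex.I • e k) (Complex.I • e j))) / 4) μ := fun j k =>
    ((((hσ _ _).sub (hσ _ _)).const_mul _).add (((hσ _ _).add (hσ _ _)).const_mul _)).div_const 4
  rw [integral_finsetSum _ fun j _ => integrable_finsetSum _ fun k _ => hi j k]
  refine Finset.sum_eq_zero fun j _ => ?_
  rw [integral_finsetSum _ fun k _ => hi j k]
  refine Finset.sum_eq_zero fun k _ => ?_
  have h1 : ∀ u v u' v', Integrable (fun y => σ y u v - σ y u' v') μ :=
    fun _ _ _ _ => (hσ _ _).sub (hσ _ _)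
  have h2 : ∀ u v u' v', Integrable (fun y => σ y u v + σ y u' v') μ :=
    fun _ _ _ _ => (hσ _ _).add (hσ _ _)
  rw [integral_div, integral_add ((h1 _ _ _ _).const_mul _) ((h2 _ _ _ _).const_mul _),
    integral_const_mul, integral_const_mul,
    integral_sub (hσ _ _) (hσ _ _), integral_add (hσ _ _) (hσ _ _)]
  simp [h0]

end ContractionLemmas

/-! ### Smoothness of the global functions on X and descent to B. -/

section Smoothness

variable {EX EB X B : Type*}
  [NormedAddCommGroup EX] [NormedSpace ℂ EX] [FiniteDimensional ℂ EX]
  [NormedAddCommGroup EB] [NormedSpace ℂ EB] [FiniteDimensional ℂ EB]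
  [TopologicalSpace X] [ChartedSpace EX X] [IsManifold 𝓘(ℂ, EX) ω X]
  [TopologicalSpace B] [ChartedSpace EB B] [IsManifold 𝓘(ℂ, EB) ω B]
  {m : ℕ} {π : X → B} {h : IsHolSubmersion EX EB m π} {Ω η : Form EX X 2} {ΩB : Form EB B 2}

/-- The contraction of the horizontal component of `η`. -/
def contractedLift (π : X → B) (Ω : Form EX X 2) (ΩB : Form EB B 2) (η : Form EX X 2) (y : X) : ℝ :=
  contraction (Module.finBasis ℂ EB) (ΩB.at₂ (π y)) (liftedForm π Ω η y)

lemma tangentMapAt_codChart_symm_smul {x : X} {q : EB} (hq : q ∈ (h x).codChart.target) (c : ℂ)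
    (v : EB) : tangentMapAt (E := EB) (E' := EB) (h x).codChart.symm q (c • v)
      = c • tangentMapAt (E := EB) (E' := EB) (h x).codChart.symm q v :=
  tangentMapAt_smul ((contMDiffOn_symm_of_mem_maximalAtlas
    (h x).codChart_mem_maximalAtlas).contMDiffAt ((h x).codChart.open_target.mem_nhds hq)) c v

/-- The definition uses the tangent coordinates of preferred charts, which vary with the point.
Invariance of the contraction under complex changes of frame replaces them by one fixed base chart,
in which everything depends smoothly on p. -/
lemma contractedLift_adaptedParam (hΩ : IsRelativelyKahler EB π Ω) (η : Form EX X 2) {x : X}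
    {p : EB × (Fin m → ℂ)} (hp : p ∈ adaptedDomain h x) :
    contractedLift π Ω ΩB η (adaptedParam h x p)
      = contraction (Module.finBasis ℂ EB)
        ((Form.pull (E := EB) (E' := EB) (h x).codChart.symm ΩB).at₂ p.1)
        (fun u v => (adaptedForm h η x).at₂ p (coordLift h Ω x u p) (coordLift h Ω x v p)) := by
  have hq := fst_mem_codChart_target hp
  set L : EB →ₗ[ℂ] EB :=
    { toFun := tangentMapAt (E := EB) (E' := EB) (h x).codChart.symm p.1
      map_add' := fun u v => map_add _ u v
      map_smul' := fun c v => tangentMapAt_codChart_symm_smul hq c v } with hL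
  have hinj : Function.Injective L := tangentMapAt_codChart_symm_injective hq
  rw [contractedLift, ← contraction_linearMap _ hinj (Form.isRealBilin _ _)
    (isRealBilin_liftedForm h hΩ _ _)]
  symm
  refine contraction_comp (L := L) (fun v => L.map_smul _ v) (fun u v => ?_) (fun u v => ?_) _
  · rw [Form.pull_at₂, ← proj_adaptedParam hp]
    rfl
  · exact (liftedForm_adaptedParam hΩ η hp u v).symm

lemma hermMatrix_det_ne_zero_base (hΩB : IsKahlerForm ΩB) {x : X} {q : EB}
    (hq : q ∈ (h x).codChart.target) :
    (hermMatrix (Module.finBasis ℂ EB)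
      ((Form.pull (E := EB) (E' := EB) (h x).codChart.symm ΩB).at₂ q)).det ≠ 0 := by
  refine (hermMatrix_posDef (Form.isRealBilin _ _) (fun u v => ?_)
    (fun u v => Form.at₂_antisymm _ _ _ _) (Module.finBasis ℂ EB).linearIndependent
    (fun v _ hv => ?_)).det_pos.ne'
  · simp only [Form.pull_at₂, tangentMapAt_codChart_symm_smul hq]
    exact hΩB.oneOne _ _ _
  · simp only [Form.pull_at₂, tangentMapAt_codChart_symm_smul hq]
    exact hΩB.pos _ _ fun h0 => hv (tangentMapAt_codChart_symm_injective hq (h0.trans (map_zero _).symm))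

lemma contMDiff_contractedLift (h : IsHolSubmersion EX EB m π) (hΩ : IsRelativelyKahler EB π Ω)
    (hΩB : IsKahlerForm ΩB) (hη : η.IsSmooth) :
    ContMDiff 𝓘(ℝ, EX) 𝓘(ℝ, ℝ) ∞ (contractedLift π Ω ΩB η) := by
  have : FiniteDimensional ℝ EB := FiniteDimensional.complexToReal EB
  refine contMDiff_of_adaptedParam (h := h) fun x => ?_
  have hpull : ContDiffOn ℝ ∞ (Form.pull (E := EB) (E' := EB) (h x).codChart.symm ΩB)
      (h x).codChart.target := by
    have : IsManifold 𝓘(ℝ, EB) ∞ B := isManifold_real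
    exact Form.contDiffOn_pull (h x).codChart.open_target
      (contMDiffOn_symm_of_mem_maximalAtlas (codChart_mem_real h x)) hΩB.closed.1
  have h1 : ∀ u v, ContDiffOn ℝ ∞ (fun p => (((adaptedForm h η x).at₂ p (coordLift h Ω x u p)
      (coordLift h Ω x v p) : ℝ) : ℂ)) (adaptedDomain h x) := fun u v =>
    Complex.ofRealCLM.contDiff.comp_contDiffOn (contDiffOn_adaptedForm_coordLift hΩ hη x u v)
  have hc := contDiffOn_contraction (O := adaptedDomain h x) (e := Module.finBasis ℂ EB)
    (θ := fun p : EB × (Fin m → ℂ) =>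
      (Form.pull (E := EB) (E' := EB) (h x).codChart.symm ΩB).at₂ p.1)
    (σ := fun p u v => (adaptedForm h η x).at₂ p (coordLift h Ω x u p) (coordLift h Ω x v p))
    (fun i j => (contDiffOn_hermCoeff hpull _ _).comp contDiff_fst.contDiffOn
      fun p hp => fst_mem_codChart_target hp)
    (fun p hp => hermMatrix_det_ne_zero_base hΩB (fst_mem_codChart_target hp))
    (fun i j => by
      simp only [hermMatrix, Matrix.of_apply, hermCoeff]
      push_cast
      exact (((h1 _ _).sub (h1 _ _)).sub
        (contDiffOn_const.mul ((h1 _ _).add (h1 _ _)))).div_const 4)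
  exact (hc.congr fun p hp => contractedLift_adaptedParam hΩ η hp).contDiffAt
    ((isOpen_adaptedDomain h x).mem_nhds (adaptedCoord_mem (mem_adaptedSource h x)))

lemma verticalLaplacian_adaptedParam (Ω : Form EX X 2) {f : X → ℝ}
    (hf : ContMDiff 𝓘(ℝ, EX) 𝓘(ℝ, ℝ) ∞ f) {x : X} {p : EB × (Fin m → ℂ)}
    (hp : p ∈ adaptedDomain h x) :
    verticalLaplacian h Ω f (adaptedParam h x p)
      = -contraction (vertVec EB m) ((adaptedForm h Ω x).at₂ p)
        ((iddbar (f ∘ adaptedParam h x)).at₂ p) := by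
  have hF : ContDiffAt ℝ 2 (f ∘ adaptedParam h x) p :=
    ((ContMDiff.contDiffOn_adaptedParam hf x).contDiffAt
      ((isOpen_adaptedDomain h x).mem_nhds hp)).of_le two_le_infty
  have hz : p.2 ∈ sliceDomain h x p.1 := hp
  have hι : ContDiff ℂ 2 (fun z : Fin m → ℂ => (p.1, z)) := contDiff_prodMk_right p.1
  have hιR : ContDiff ℝ 2 (fun z : Fin m → ℂ => (p.1, z)) := contDiff_prodMk_right p.1
  have h1 := verticalLaplacian_slice Ω (f := f) hz 
    (ContDiffAt.comp (g := f ∘ adaptedParam h x) p.2 hF hιR.contDiffAt)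
  refine h1.trans ?_
  rw [localLaplacian]
  congr 1
  refine contraction_comp (L := fun u : Fin m → ℂ => ((0 : EB), u)) (fun v => by simp)
    (fun u v => sliceForm_at₂ Ω hz u v) (fun u v => ?_) _
  have h2 := iddbar_comp (f := f ∘ adaptedParam h x) (τ := fun z : Fin m → ℂ => (p.1, z))
    (z := p.2) hF hι.contDiffAt u v
  rw [fderiv_prodMk_const, fderiv_prodMk_const] at h2
  exact h2

lemma contDiffOn_iddbar_apply {E : Type*} [NormedAddCommGroup E] [NormedSpace ℂ E] {f : E → ℝ}
    {O : Set E} (hO : IsOpen O) (hf : ContDiffOn ℝ ∞ f O) (u v : E) :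
    ContDiffOn ℝ ∞ (fun y => (iddbar f).at₂ y u v) O := by
  have h1 : ContDiffOn ℝ ∞ (fderiv ℝ (fderiv ℝ f)) O :=
    (hf.fderiv_of_isOpen (m := ∞) hO (by simp)).fderiv_of_isOpen (m := ∞) hO (by simp)
  have h2 : ∀ a b, ContDiffOn ℝ ∞ (fun y => fderiv ℝ (fderiv ℝ f) y a b) O := fun a b =>
    (h1.clm_apply contDiffOn_const).clm_apply contDiffOn_const
  refine (((h2 v (Complex.I • u)).sub (h2 u (Complex.I • v))).div_const 2).congr fun y hy => ?_
  exact iddbar_apply ((hf.contDiffAt (hO.mem_nhds hy)).of_le two_le_infty) u v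

lemma contMDiff_verticalLaplacian (hΩ : IsRelativelyKahler EB π Ω) {f : X → ℝ}
    (hf : ContMDiff 𝓘(ℝ, EX) 𝓘(ℝ, ℝ) ∞ f) :
    ContMDiff 𝓘(ℝ, EX) 𝓘(ℝ, ℝ) ∞ (verticalLaplacian h Ω f) := by
  refine contMDiff_of_adaptedParam (h := h) fun x => ?_
  have hF := ContMDiff.contDiffOn_adaptedParam (h := h) hf x
  have hD := isOpen_adaptedDomain h x
  have h1 : ∀ u v, ContDiffOn ℝ ∞ (fun p => (((iddbar (f ∘ adaptedParam h x)).at₂ p u v : ℝ) : ℂ))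
      (adaptedDomain h x) := fun u v =>
    Complex.ofRealCLM.contDiff.comp_contDiffOn (contDiffOn_iddbar_apply hD hF u v)
  have hc := contDiffOn_contraction (O := adaptedDomain h x) (e := vertVec EB m)
    (θ := fun p => (adaptedForm h Ω x).at₂ p)
    (σ := fun p => (iddbar (f ∘ adaptedParam h x)).at₂ p)
    (fun i j => contDiffOn_hermCoeff (contDiffOn_adaptedForm hΩ.closed.1 x) _ _)
    (fun p hp => (isUnit_det_vertVec hΩ hp).ne_zero)
    (fun i j => by
      simp only [hermMatrix, Matrix.of_apply, hermCoeff]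
      push_cast
      exact (((h1 _ _).sub (h1 _ _)).sub
        (contDiffOn_const.mul ((h1 _ _).add (h1 _ _)))).div_const 4)
  exact (hc.neg.congr fun p hp => verticalLaplacian_adaptedParam Ω hf hp).contDiffAt
    (hD.mem_nhds (adaptedCoord_mem (mem_adaptedSource h x)))

/-- A function on the base is smooth if its pullback is. -/
lemma contMDiff_of_comp_proj (h : IsHolSubmersion EX EB m π) (hsurj : Function.Surjective π)
    {c : B → ℝ} (hc : ContMDiff 𝓘(ℝ, EX) 𝓘(ℝ, ℝ) ∞ (c ∘ π)) : ContMDiff 𝓘(ℝ, EB) 𝓘(ℝ, ℝ) ∞ c := by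
  have : IsManifold 𝓘(ℝ, EB) ∞ B := isManifold_real
  intro b
  obtain ⟨x, rfl⟩ := hsurj b
  set e := (h x).codChart with he
  have hsrc : π x ∈ e.source := proj_mem_codChart (mem_adaptedSource h x)
  have hex : e (π x) = basePoint h x := (adaptedCoord_fst (mem_adaptedSource h x)).symm
  have h1 : ContMDiffAt 𝓘(ℝ, EB) 𝓘(ℝ, EB) ∞ e (π x) :=
    (contMDiffOn_of_mem_maximalAtlas (codChart_mem_real h x)).contMDiffAt
      (e.open_source.mem_nhds hsrc)
  have h2 : ContMDiffAt 𝓘(ℝ, EB) 𝓘(ℝ, EB × (Fin m → ℂ)) ∞ (fun q : EB => (q, fibrePoint h x))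
      (e (π x)) := (contDiff_prodMk_left (fibrePoint h x)).contMDiff.contMDiffAt
  have hmem : (e (π x), fibrePoint h x) ∈ adaptedDomain h x := by
    rw [hex]
    exact adaptedCoord_mem (mem_adaptedSource h x)
  have h3 : ContMDiffAt 𝓘(ℝ, EB × (Fin m → ℂ)) 𝓘(ℝ, EX) ∞ (adaptedParam h x)
      (e (π x), fibrePoint h x) := ContMDiffAt.real (contMDiffAt_adaptedParam hmem)
  -- Compose with the local section of π obtained by freezing the fibre coordinates.
  have h4 : ContMDiffAt 𝓘(ℝ, EB) 𝓘(ℝ, ℝ) ∞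
      ((c ∘ π) ∘ adaptedParam h x ∘ (fun q : EB => (q, fibrePoint h x)) ∘ e) (π x) :=
    ContMDiffAt.comp _ hc.contMDiffAt (ContMDiffAt.comp _ h3 (ContMDiffAt.comp _ h2 h1))
  refine h4.congr_of_eventuallyEq ?_
  have hcont : ContinuousAt (fun b' => (e b', fibrePoint h x)) (π x) :=
    (h2.comp _ h1).continuousAt
  filter_upwards [hcont.preimage_mem_nhds ((isOpen_adaptedDomain h x).mem_nhds hmem),
    e.open_source.mem_nhds hsrc] with b' hb' hs'
  simp only [Function.comp_apply]
  rw [proj_adaptedParam hb', e.left_inv hs']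

end Smoothness

/-! ### Comparison of the two projection conditions. -/

section Projection

variable {EX EB X B : Type*}
  [NormedAddCommGroup EX] [NormedSpace ℂ EX] [FiniteDimensional ℂ EX]
  [NormedAddCommGroup EB] [NormedSpace ℂ EB] [FiniteDimensional ℂ EB]
  [TopologicalSpace X] [ChartedSpace EX X] [IsManifold 𝓘(ℂ, EX) ω X]
  [T2Space X] [CompactSpace X] [MeasurableSpace X] [BorelSpace X]
  [TopologicalSpace B] [ChartedSpace EB B] [IsManifold 𝓘(ℂ, EB) ω B] [T2Space B]
  {m : ℕ} {π : X → B} {h : IsHolSubmersion EX EB m π} {Ω : Form EX X 2} {ΩB : Form EB B 2}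

lemma contractedHorizontalRicci_eq_add (x : X) :
    contractedHorizontalRicci h Ω ΩB x
      = contractedLift π Ω ΩB (ricciDefect h Ω) x + contractedLift π Ω ΩB Ω x := by
  have h1 : (fun w₁ w₂ : EB => (relativeRicci h Ω).at₂ x (horizontalLift π Ω x w₁)
      (horizontalLift π Ω x w₂))
      = fun w₁ w₂ => liftedForm π Ω (ricciDefect h Ω) x w₁ w₂ + liftedForm π Ω Ω x w₁ w₂ := by
    ext w₁ w₂
    simp only [liftedForm, ricciDefect_at₂, sub_add_cancel]
  rw [contractedHorizontalRicci, h1, contraction_add]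
  rfl

/-- Obtained through ρ = η + Ω, a sum of two forms known to be smooth. -/
lemma contMDiff_contractedHorizontalRicci (hΩ : IsRelativelyKahler EB π Ω) (hΩB : IsKahlerForm ΩB)
    (hclass : InRelativeAnticanonicalClass h Ω) :
    ContMDiff 𝓘(ℝ, EX) 𝓘(ℝ, ℝ) ∞ (contractedHorizontalRicci h Ω ΩB) := by
  have := (contMDiff_contractedLift h hΩ hΩB (ricciDefect_isClosed hclass).1).add
    (contMDiff_contractedLift h hΩ hΩB hΩ.closed.1)
  exact this.congr fun x => contractedHorizontalRicci_eq_add x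

/-- In the anticanonical class, `Λ ρ_H` and `Λ μ^* F_H` differ by a function on the base. -/
lemma exists_contractedHorizontalRicci_eq (hfib : ∀ b, IsConnected (π ⁻¹' {b}))
    (hΩ : IsRelativelyCscK h Ω) (hclass : InRelativeAnticanonicalClass h Ω) (ΩB : Form EB B 2) :
    ∃ c : B → ℝ, ∀ x, contractedHorizontalRicci h Ω ΩB x
      = contractedComomentCurvature h Ω ΩB x + c (π x) := by
  have hK := hΩ.relKahler
  suffices H : ∀ b, ∃ c, ∀ x, π x = b → contractedHorizontalRicci h Ω ΩB x
      = contractedComomentCurvature h Ω ΩB x + c by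
    choose c hc using H
    exact ⟨c, fun x => hc _ x rfl⟩
  intro b
  choose c₀ hc₀ _ using fun w₁ w₂ => comomentCurvature_eq (h := h) hK (hfib b) w₁ w₂
  obtain ⟨x₀, hx₀⟩ := (hfib b).nonempty
  -- The constant has two sources: the horizontal part of η, constant along the fibre and read off
  -- at x₀, and the constants by which Ω(w₁^#, w₂^#) exceeds its normalized Hamiltonian.
  refine ⟨contraction (Module.finBasis ℂ EB) (ΩB.at₂ b) (liftedForm π Ω (ricciDefect h Ω) x₀)
    + contraction (Module.finBasis ℂ EB) (ΩB.at₂ b) c₀, fun x hx => ?_⟩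
  have h1 : comomentCurvature h Ω x = fun w₁ w₂ => liftedForm π Ω Ω x w₁ w₂ - c₀ w₁ w₂ := by
    ext w₁ w₂
    exact hc₀ w₁ w₂ x hx
  have h2 : liftedForm (EB := EB) π Ω (ricciDefect h Ω) x
      = liftedForm π Ω (ricciDefect h Ω) x₀ := by
    ext w₁ w₂
    exact liftedForm_eq_of_closed hK (ricciDefect_isClosed hclass)
      (ricciDefect_eq_zero_of_isVertical hΩ hclass) h (hfib b) w₁ w₂ hx hx₀
  rw [contractedHorizontalRicci_eq_add, contractedComomentCurvature, contractedLift, contractedLift,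
    h1, h2, hx, contraction_sub]
  ring

lemma integral_contractedComomentCurvature (hfib : ∀ b, IsConnected (π ⁻¹' {b}))
    (hΩ : IsRelativelyKahler EB π Ω) (ΩB : Form EB B 2) (b : B) :
    ∫ x, contractedComomentCurvature h Ω ΩB x ∂(fibreMeasure h Ω b) = 0 := by
  choose c₀ hc₀ hInt using fun w₁ w₂ => comomentCurvature_eq (h := h) hΩ (hfib b) w₁ w₂
  rw [← integral_contraction_eq_zero (μ := fibreMeasure h Ω b) (Module.finBasis ℂ EB) (ΩB.at₂ b)
    (σ := fun y => comomentCurvature h Ω y) (fun w₁ w₂ => ?_) hInt]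
  · refine integral_congr_ae ?_
    filter_upwards [ae_mem_fibre h Ω b] with y hy
    rw [contractedComomentCurvature, hy]
  · have hs := (smoothOnFibre_liftedForm (h := h) hΩ hΩ.closed.1 b w₁ w₂).sub
      (SmoothOnFibre.const (c₀ w₁ w₂))
    exact (hs.congr (g := fun y => comomentCurvature h Ω y w₁ w₂) (hc₀ w₁ w₂)).integrable hΩ

lemma memCE_zero : MemCE h Ω 0 := by
  refine ⟨contMDiff_const, fun b => ⟨fun x _ => contDiffOn_const, fun x _ => ?_, by simp⟩⟩
  have h1 : grad10 (fibreForm h Ω x) ((0 : X → ℝ) ∘ fibreParam h x) = fun _ => 0 := by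
    ext z : 1
    have h2 : dbarCoeff ((0 : X → ℝ) ∘ fibreParam h x) z = 0 := by
      ext k
      have h3 : ((0 : X → ℝ) ∘ fibreParam h x) = fun _ => 0 := rfl
      simp [dbarCoeff, h3]
    rw [grad10, h2, Matrix.mulVec_zero]
  rw [h1]
  exact differentiableOn_const _

lemma contMDiff_proj (h : IsHolSubmersion EX EB m π) : ContMDiff 𝓘(ℝ, EX) 𝓘(ℝ, EB) ∞ π :=
  fun x => ContMDiffAt.real (h x).contMDiffAt

/-- Holomorphy potentials lie in the eigenspace of the Laplacian with eigenvalue one. -/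
lemma integral_laplacian_add_mul (hfib : ∀ b, IsConnected (π ⁻¹' {b})) (hΩ : IsRelativelyCscK h Ω)
    (hclass : InRelativeAnticanonicalClass h Ω) {b : B} {f g : X → ℝ} (hf : SmoothOnFibre h b f)
    (hg : IsFibrePotential h Ω b g) :
    ∫ y, (verticalLaplacian h Ω f y + f y) * g y ∂(fibreMeasure h Ω b)
      = 2 * ∫ y, f y * g y ∂(fibreMeasure h Ω b) := by
  have hK := hΩ.relKahler
  have h1 := integral_mul_laplacian_symm hK hf hg.1
  have h2 : ∫ y, f y * verticalLaplacian h Ω g y ∂(fibreMeasure h Ω b)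
      = ∫ y, f y * g y ∂(fibreMeasure h Ω b) := by
    refine integral_congr_ae ?_
    filter_upwards [ae_mem_fibre h Ω b] with y hy
    rw [hg.verticalLaplacian_eq hΩ hclass (hfib b) hy]
  have h3 : ∫ y, (verticalLaplacian h Ω f y + f y) * g y ∂(fibreMeasure h Ω b)
      = ∫ y, (g y * verticalLaplacian h Ω f y + f y * g y) ∂(fibreMeasure h Ω b) :=
    integral_congr_ae (Filter.Eventually.of_forall fun y => by ring)
  rw [h3, integral_add ((hg.1.mul (smoothOnFibre_verticalLaplacian hK hf)).integrable hK)
    ((hf.mul hg.1).integrable hK), ← h1, h2]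
  ring

lemma eq_zero_of_integral_comp_proj (hΩ : IsRelativelyKahler EB π Ω)
    (hfib : ∀ b, IsConnected (π ⁻¹' {b})) {c : B → ℝ} {b : B}
    (hInt : ∫ y, c (π y) ∂(fibreMeasure h Ω b) = 0) : c b = 0 := by
  obtain ⟨x, hx⟩ := (hfib b).nonempty
  have := eq_zero_of_const_of_integral (h := h) hΩ (f := fun y => c (π y)) (b := b)
    (fun x y hx hy => by rw [hx, hy]) hInt hx
  rwa [show π x = b from hx] at this

lemma smoothOnFibre_comp_proj (c : B → ℝ) (b : B) : SmoothOnFibre h b (fun y => c (π y)) :=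
  (SmoothOnFibre.const (c b)).congr fun y hy => by rw [hy]

/-- A function of mean zero on the fibres has vanishing `E`-component if and only if it lies in
`C^∞_R(X)`. -/
lemma projE_zero_iff (hΩ : IsRelativelyKahler EB π Ω) (hfib : ∀ b, IsConnected (π ⁻¹' {b}))
    {φ : X → ℝ} (hInt : ∀ b, ∫ y, φ y ∂(fibreMeasure h Ω b) = 0) :
    ProjE h Ω φ 0 ↔ MemCR h Ω φ := by
  constructor
  · rintro ⟨-, φB, φR, hB, hR, heq⟩
    -- On the fibre over b the components φ and φ_R have integral zero, so the constant φ_B(b) does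
    -- too and must vanish.
    have hφB : ∀ b, φB b = 0 := fun b => by
      refine eq_zero_of_integral_comp_proj (h := h) hΩ hfib ?_
      have h1 := hInt b
      simp only [heq, Pi.zero_apply, add_zero] at h1
      rwa [integral_add ((smoothOnFibre_comp_proj φB b).integrable hΩ)
        ((ContMDiff.smoothOnFibre hR.1 b).integrable hΩ), (hR.2 b).1, add_zero] at h1
    have : φ = φR := by
      ext x
      rw [heq, hφB]
      simp
    rwa [this]
  · exact fun hφ => ⟨memCE_zero, fun _ => 0, φ, contMDiff_const, hφ, fun x => by simp⟩

/-- If `ρ` agrees with `φ` up to a function on the base, then the `E`-component of `Δ_V φ + ρ`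
vanishes if and only if `φ` lies in `C^∞_R(X)`. -/
lemma projE_laplacian_add_zero_iff (hfib : ∀ b, IsConnected (π ⁻¹' {b}))
    (hΩ : IsRelativelyCscK h Ω) (hclass : InRelativeAnticanonicalClass h Ω) {φ ρ : X → ℝ}
    (hInt : ∀ b, ∫ y, φ y ∂(fibreMeasure h Ω b) = 0) (hρ : ContMDiff 𝓘(ℝ, EX) 𝓘(ℝ, ℝ) ∞ ρ)
    {c : B → ℝ} (hc : ∀ x, ρ x = φ x + c (π x)) :
    ProjE h Ω (fun x => verticalLaplacian h Ω φ x + ρ x) 0 ↔ MemCR h Ω φ := by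
  have hK := hΩ.relKahler
  have hφ : ∀ b, SmoothOnFibre h b φ := fun b =>
    ((ContMDiff.smoothOnFibre hρ b).sub (smoothOnFibre_comp_proj c b)).congr fun y _ => by
      rw [hc]
      ring
  have hΔ := fun b => smoothOnFibre_verticalLaplacian hK (hφ b)
  have hsum : ∀ b, ∫ y, (verticalLaplacian h Ω φ y + φ y) ∂(fibreMeasure h Ω b) = 0 := fun b => by
    rw [integral_add ((hΔ b).integrable hK) ((hφ b).integrable hK),
      integral_verticalLaplacian hK (hφ b), hInt, add_zero]
  constructor
  · rintro ⟨-, φB, φR, hB, hR, heq⟩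
    have hφR : ∀ y, φR y = (verticalLaplacian h Ω φ y + φ y) + (c (π y) - φB (π y)) := fun y => by
      have := heq y
      simp only [hc, Pi.zero_apply, add_zero] at this
      linarith
    -- Fibre integration forces φ_B = c. This also shows that c is smooth, and with it φ = ρ - c∘π.
    have hcB : ∀ b, c b - φB b = 0 := fun b => by
      refine eq_zero_of_integral_comp_proj (h := h) (c := fun b => c b - φB b) hK hfib ?_
      have h1 := (hR.2 b).1
      simp only [hφR] at h1
      rwa [integral_add (((hΔ b).add (hφ b)).integrable hK)
        ((smoothOnFibre_comp_proj (fun b => c b - φB b) b).integrable hK), hsum, zero_add] at h1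
    refine ⟨?_, fun b => ⟨hInt b, fun g hg => ?_⟩⟩
    · refine (hρ.sub (hB.comp (contMDiff_proj h))).congr fun x => ?_
      have := hcB (π x)
      rw [Function.comp_apply, hc]
      linarith
    -- Now φ_R = Δφ + φ, whose pairing with a potential is twice that of φ; the factor is nonzero,
    -- so φ itself is orthogonal to E_b.
    · have h1 := (hR.2 b).2 g hg
      simp only [hφR, hcB, add_zero] at h1
      rw [integral_laplacian_add_mul hfib hΩ hclass (hφ b) hg] at h1
      linarith
  · intro hR
    -- Conversely φ is smooth, so c∘π = ρ - φ is smooth, and smoothness descends along the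
    -- surjective submersion.
    have hcs : ContMDiff 𝓘(ℝ, EB) 𝓘(ℝ, ℝ) ∞ c := by
      refine contMDiff_of_comp_proj h (fun b => (hfib b).nonempty)
        ((hρ.sub hR.1).congr fun x => ?_)
      rw [Function.comp_apply, hc]
      ring
    refine ⟨memCE_zero, c, fun x => verticalLaplacian h Ω φ x + φ x, hcs,
      ⟨(contMDiff_verticalLaplacian hK hR.1).add hR.1, fun b => ⟨hsum b, fun g hg => ?_⟩⟩,
      fun x => ?_⟩
    · rw [integral_laplacian_add_mul hfib hΩ hclass (hφ b) hg, (hR.2 b).2 g hg, mul_zero]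
    · simp only [hc, Pi.zero_apply]
      ring

end Projection

end

end FibrationGeometry

theorem mainTheorem6 {EX EB X B : Type*}
    [NormedAddCommGroup EX] [NormedSpace ℂ EX] [FiniteDimensional ℂ EX]
    [NormedAddCommGroup EB] [NormedSpace ℂ EB] [FiniteDimensional ℂ EB]
    [TopologicalSpace X] [ChartedSpace EX X] [IsManifold 𝓘(ℂ, EX) ω X]
    [T2Space X] [CompactSpace X] [MeasurableSpace X] [BorelSpace X]
    [TopologicalSpace B] [ChartedSpace EB B] [IsManifold 𝓘(ℂ, EB) ω B]
    [T2Space B] [CompactSpace B]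
    (m : ℕ) (π : X → B) (hπ : IsHolSubmersion EX EB m π)
    (hfib : ∀ b, IsConnected (π ⁻¹' {b}))
    (ΩB : Form EB B 2) (hΩB : IsKahlerForm ΩB)
    (Ω : Form EX X 2) (hΩ : IsRelativelyCscK hπ Ω)
    (hclass : InRelativeAnticanonicalClass hπ Ω) :
    IsOptimalSymplecticConnection hπ Ω ΩB ↔
      ProjE hπ Ω (contractedComomentCurvature hπ Ω ΩB) 0 := by
  obtain ⟨c, hc⟩ := exists_contractedHorizontalRicci_eq hfib hΩ hclass ΩB
  have hInt := integral_contractedComomentCurvature (h := hπ) hfib hΩ.relKahler ΩB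
  -- Both conditions are brought to the statement that Λμ^*F_H lies in C^∞_R(X).
  rw [projE_zero_iff hΩ.relKahler hfib hInt, ← projE_laplacian_add_zero_iff hfib hΩ hclass hInt
    (contMDiff_contractedHorizontalRicci hΩ.relKahler hΩB hclass) hc]
  exact and_iff_right hΩ
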